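/- Let $G$ be a connected reductive complex linear algebraic group, $P\subset G$ a parabolic subgroup with unipotent radical $P^u$, $L$ a Levi subgroup of $P$, $\sigma$ an involution of the algebraic group $L$, and $H\subset G$ a closed subgroup with $P^u\subset H\subset P$ such that $L\cap H$ contains the neutral component $(L^\sigma)^0$ with finite index. Let $n=\dim_{\mathbb C}G/H$. Let $T$ be a maximally split torus of $L$, that is, a $\sigma$-stable maximal torus containing a torus on which $\sigma(t)=t^{-1}$ of maximal dimension among such tori of $L$, and let $T_s$ be its maximal split subtorus. Let $\theta$ be a Cartan involution of $G$ preserving $L$ and $T$ and commuting with $\sigma$ on $L$, let $K=G^\theta$, $\mathfrak a_s=\mathfrak t_s\cap i\mathfrak k$, and let $(l_1,\dots,l_r)$ be a basis of the real vector space $\mathfrak a_s$. Let $Q$ be the parabolic subgroup opposite to $P$ with respect to $L$, and $\Phi_{Q^u}$ the set of roots (with respect to $T$) of its unipotent radical. Let $\Phi_L$ be the set of roots of $L$ and $\Phi_s=\{\beta\in\Phi_L:\sigma(\beta)\neq\beta\}$. Fix a positive system $\Phi^+$ of the roots of $G$ that contains $\Phi_{Q^u}$ and is such that for every $\alpha\in\Phi^+\cap\Phi_L$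 either $\sigma(\alpha)=\alpha$ or $-\sigma(\alpha)\in\Phi^+\cap\Phi_L$; put $\Phi_s^+=\Phi_s\cap\Phi^+$. Write $\alpha^\vee$ for coroots, and choose root vectors $e_\alpha$ with $[\theta(e_\alpha),e_\alpha]=\alpha^\vee$. The vectors $l_j$, $e_\alpha$ ($\alpha\in\Phi_{Q^u}$) and $\tau_\beta=e_\beta-\sigma(e_\beta)$ ($\beta\in\Phi_s^+$) form a basis $(f_\diamondsuit)$ of a complement of $\mathfrak h$ in $\mathfrak g$, and for $g\in G$ let $\gamma^g_\diamondsuit=dz_\diamondsuit$ be the $(1,0)$-forms at $gH$ given by the coordinates $z\mapsto g\exp(\sum_\diamondsuit z_\diamondsuit f_\diamondsuit)H$. Let $dV_H$ be the $K$-invariant volume form on $G/H$ given at $gH$ by $i^{n^2}|\xi|_{q_H}^{-2}\,\xi\wedge\bar\xi$ with $\xi=\bigwedge_\diamondsuit\gamma^g_\diamondsuit$. Here $q_H=q_f\otimes f^*q_P$, where $f:G/H\to G/P$ is the projection, $q_f$ is the smooth $K$-invariant metric on the relative canonical bundle of $f$ for which all $L$-translates of $\bigwedge_j\gamma^e_j\wedge\bigwedge_\beta\gamma^e_\beta$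 have norm one, and $q_P$ is the smooth $K$-invariant metric on $K_{G/P}$ for which $\bigwedge_\alpha\gamma^e_\alpha$ has norm one. Put $J_H(x)=\prod_{\beta\in\Phi_s^+}|\sinh(2\beta(x))|$ for $x\in\mathfrak a_s$. Let $\mathcal L$ be the $G$-linearized line bundle on $G/H$ attached to an algebraic character $\chi$ of $H$ (so that $h\in H$ acts on the fiber at $eH$ by $\chi(h)$), and let $q$ be a smooth $K$-invariant hermitian metric on $\mathcal L$ with curvature form $\omega$ (locally $\omega=-i\partial\bar\partial\ln|s|_q^2$ for a local holomorphic trivialization $s$). Let $s$ be the $G$-equivariant trivialization of the pullback of $\mathcal L$ to $G$ and let $u:\mathfrak a_s\to\mathbb R$, $u(x)=-2\ln|s(\exp x)|_q$, be the toric potential. For $x\in\mathfrak t\cap i\mathfrak k$ put $d_au(x)=d_au\big(\tfrac{x-\sigma(x)}2\big)$ and $\chi(x)=\chi\big(\tfrac{x+\sigma(x)}2\big)$, where $\chi$ also denotes the differential of $\chi$. Assume that the restriction of $\mathcal L$ to the symmetric fiber $L/L\cap H$ is trivial, and let $a\in\mathfrak a_s$ be such that $\beta(a)\neq0$ for all $\beta\in\Phi_s$.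 Then, at $\exp(a)H$, \[ \frac{\omega^n}{dV_H}=\frac{n!}{2^{2r+|\Phi_{Q^u}|}}\,\frac{\det\big((d_a^2u(l_j,l_k))_{j,k}\big)}{J_H(a)}\prod_{\alpha\in\Phi_{Q^u}}(2\chi-d_au)(\alpha^\vee)\prod_{\beta\in\Phi_s^+}\operatorname{sgn}(\beta(a))\,d_au(\beta^\vee). \] In particular, if $\omega$ is non-negative at $\exp(a)H$, then \[ \frac{\omega^n}{dV_H}=\frac{n!}{2^{2r+|\Phi_{Q^u}|}}\,\frac{\det\big((d_a^2u(l_j,l_k))_{j,k}\big)}{J_H(a)}\prod_{\alpha\in\Phi_{Q^u}}(2\chi-d_au)(\alpha^\vee)\prod_{\beta\in\Phi_s^+}|d_au(\beta^\vee)|. \] -/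

import Mathlib

open scoped ContDiff

noncomputable section

namespace Horosymmetric

/-- Complex `N × N` matrices. -/
abbrev Mat (N : ℕ) : Type := Matrix (Fin N) (Fin N) ℂ

/-- The invertible matrices `GL_N(ℂ)`. -/
abbrev GLN (N : ℕ) : Type := GL (Fin N) ℂ

/-- The commutator bracket of matrices. -/
instance matLieRing (N : ℕ) : LieRing (Mat N) := LieRing.ofAssociativeRing

/-- The commutator bracket is bilinear over the complex numbers. -/
instance matLieAlgebra (N : ℕ) : LieAlgebra ℂ (Mat N) := LieAlgebra.ofAssociativeAlgebra

/-- Polynomials in the `N²` matrix entries. -/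
abbrev MatPoly (N : ℕ) : Type := MvPolynomial (Fin N × Fin N) ℂ

/-- The value of a polynomial in the entries at a matrix. -/
def evalAt {N : ℕ} (A : Mat N) (p : MatPoly N) : ℂ :=
  MvPolynomial.eval (fun ij => A ij.1 ij.2) p

/-- A subgroup of `GL_N(ℂ)` that is the zero locus in `GL_N(ℂ)` of a set of polynomials, that is,
a linear algebraic group. -/
def IsZariskiClosed {N : ℕ} (A : Subgroup (GLN N)) : Prop :=
  ∃ S : Set (MatPoly N), ∀ g : GLN N, g ∈ A ↔ ∀ p ∈ S, evalAt (g : Mat N) p = 0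

/-- A polynomial that vanishes on the group. -/
def VanishesOn {N : ℕ} (A : Subgroup (GLN N)) (p : MatPoly N) : Prop :=
  ∀ g ∈ A, evalAt (g : Mat N) p = 0

/-- The differential at the identity of a polynomial function, in the direction `X`. -/
def diffAtOne {N : ℕ} (X : Mat N) (p : MatPoly N) : ℂ :=
  ∑ ij, evalAt 1 (MvPolynomial.pderiv ij p) * X ij.1 ij.2

section LieAlgebra

variable {N : ℕ}

theorem hasDerivAt_evalAt (p : MatPoly N) {c : ℂ → Mat N} {c' : Mat N} {s : ℂ}
    (hc : ∀ i j, HasDerivAt (fun z => c z i j) (c' i j) s) :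
    HasDerivAt (fun z => evalAt (c z) p)
      (∑ ij, evalAt (c s) (MvPolynomial.pderiv ij p) * c' ij.1 ij.2) s := by
  induction p using MvPolynomial.induction_on with
  | C a => simpa [evalAt] using hasDerivAt_const s a
  | add p q hp hq =>
    have h := hp.add hq
    have e : (fun z => evalAt (c z) (p + q)) =
        (fun z => evalAt (c z) p) + fun z => evalAt (c z) q := by
      funext z; simp [evalAt]
    rw [e]
    refine h.congr_deriv ?_
    simp only [evalAt, map_add, add_mul, Finset.sum_add_distrib]
  | mul_X p kl hp =>
    have h := hp.mul (hc kl.1 kl.2)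
    have e : (fun z => evalAt (c z) (p * MvPolynomial.X kl)) =
        (fun z => evalAt (c z) p) * fun z => c z kl.1 kl.2 := by
      funext z; simp [evalAt]
    rw [e]
    refine h.congr_deriv ?_
    simp only [evalAt, Derivation.leibniz, smul_eq_mul, MvPolynomial.pderiv_X, map_add, map_mul,
      MvPolynomial.eval_X, add_mul, Finset.sum_add_distrib, Finset.sum_mul]
    rw [add_comm]
    congr 1
    · rw [Finset.sum_eq_single kl]
      · simp
      · intro b _ hb; simp [hb.symm]
      · simp
    · exact Finset.sum_congr rfl fun x _ => by ring

theorem hasDerivAt_line (A B : Mat N) (i j : Fin N) :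
    HasDerivAt (fun z : ℂ => (A + z • B) i j) (B i j) 0 := by
  simpa using ((hasDerivAt_id (0 : ℂ)).mul_const (B i j)).const_add (A i j)

/-- Substitution `x ↦ A x B` (auxiliary). -/
def sandwich (A B : Mat N) (p : MatPoly N) : MatPoly N :=
  MvPolynomial.bind₁ (fun ij : Fin N × Fin N =>
    ∑ k, ∑ l, MvPolynomial.C (A ij.1 k * B l ij.2) * MvPolynomial.X (k, l)) p

theorem evalAt_sandwich (A B C : Mat N) (p : MatPoly N) :
    evalAt C (sandwich A B p) = evalAt (A * C * B) p := by
  simp only [evalAt, sandwich, MvPolynomial.eval₂Hom_bind₁, MvPolynomial.eval]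
  congr 2
  funext ij
  simp only [MvPolynomial.coe_eval₂Hom, MvPolynomial.eval₂_sum, MvPolynomial.eval₂_mul,
    MvPolynomial.eval₂_C, MvPolynomial.eval₂_X, RingHom.id_apply, Matrix.mul_apply, Finset.sum_mul]
  rw [Finset.sum_comm]
  exact Finset.sum_congr rfl fun l _ => Finset.sum_congr rfl fun k _ => by ring

theorem sum_pderiv_sandwich (A B X : Mat N) (p : MatPoly N) :
    diffAtOne X (sandwich A B p) =
      ∑ ij, evalAt (A * B) (MvPolynomial.pderiv ij p) * (A * X * B) ij.1 ij.2 := by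
  have h1 := hasDerivAt_evalAt (sandwich A B p) (hasDerivAt_line 1 X)
  have h2 := hasDerivAt_evalAt p (hasDerivAt_line (A * B) (A * X * B))
  simp only [evalAt_sandwich, zero_smul, add_zero] at h1 h2
  have e : ∀ z : ℂ, A * (1 + z • X) * B = A * B + z • (A * X * B) := by
    intro z; simp [mul_add, add_mul]
  simp only [e] at h1
  exact h1.unique h2

theorem VanishesOn.sandwich {A : Subgroup (GLN N)} {p : MatPoly N} (hp : VanishesOn A p)
    {a b : GLN N} (ha : a ∈ A) (hb : b ∈ A) : VanishesOn A (sandwich (a : Mat N) (b : Mat N) p) := by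
  intro g hg
  rw [evalAt_sandwich]
  exact hp (a * g * b) (A.mul_mem (A.mul_mem ha hg) hb)

/-- The left-invariant derivation attached to `X` (auxiliary). -/
def leftDer (X : Mat N) : Derivation ℂ (MatPoly N) (MatPoly N) :=
  MvPolynomial.mkDerivation ℂ fun ij => ∑ k, MvPolynomial.C (X k ij.2) * MvPolynomial.X (ij.1, k)

theorem evalAt_leftDer (A X : Mat N) (p : MatPoly N) :
    evalAt A (leftDer X p) = ∑ ij, evalAt A (MvPolynomial.pderiv ij p) * (A * X) ij.1 ij.2 := by
  induction p using MvPolynomial.induction_on with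
  | C a => simp [evalAt]
  | add p q hp hq =>
    simp only [evalAt, map_add, add_mul, Finset.sum_add_distrib] at hp hq ⊢
    rw [hp, hq]
  | mul_X p kl hp =>
    simp only [evalAt, Derivation.leibniz, smul_eq_mul, MvPolynomial.pderiv_X, map_add, map_mul,
      MvPolynomial.eval_X, add_mul, Finset.sum_add_distrib] at hp ⊢
    rw [hp]
    congr 1
    · rw [Finset.sum_eq_single kl]
      · simp [leftDer, MvPolynomial.mkDerivation_X, Matrix.mul_apply, mul_comm]
      · intro b _ hb; simp [hb.symm]
      · simp
    · rw [Finset.mul_sum]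
      exact Finset.sum_congr rfl fun x _ => by ring

theorem evalAt_one_leftDer (X : Mat N) (p : MatPoly N) :
    evalAt 1 (leftDer X p) = diffAtOne X p := by
  rw [evalAt_leftDer, one_mul]; rfl

theorem leftDer_bracket (X Y : Mat N) (p : MatPoly N) :
    leftDer X (leftDer Y p) - leftDer Y (leftDer X p) = leftDer ⁅X, Y⁆ p := by
  have h : ⁅leftDer X, leftDer Y⁆ = leftDer ⁅X, Y⁆ := by
    apply MvPolynomial.derivation_ext
    intro ij
    have hC : ∀ (X : Mat N) (a : ℂ) (f : MatPoly N),
        leftDer X (MvPolynomial.C a * f) = MvPolynomial.C a * leftDer X f := by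
      intro X a f
      rw [← MvPolynomial.smul_eq_C_mul, Derivation.map_smul, MvPolynomial.smul_eq_C_mul]
    have hX : ∀ (X : Mat N) (i j : Fin N), leftDer X (MvPolynomial.X (i, j)) =
        ∑ k, MvPolynomial.C (X k j) * MvPolynomial.X (i, k) := by
      intro X i j
      simp [leftDer, MvPolynomial.mkDerivation_X]
    obtain ⟨i, j⟩ := ij
    have hXY : ∀ X Y : Mat N, leftDer X (leftDer Y (MvPolynomial.X (i, j))) =
        ∑ k, MvPolynomial.C ((X * Y) k j) * MvPolynomial.X (i, k) := by
      intro X Y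
      rw [hX, map_sum]
      simp only [hC, hX, Matrix.mul_apply, map_sum, map_mul, Finset.sum_mul, Finset.mul_sum]
      rw [Finset.sum_comm]
      exact Finset.sum_congr rfl fun l _ => Finset.sum_congr rfl fun k _ => by ring
    rw [Derivation.commutator_apply, hXY, hXY, hX, ← Finset.sum_sub_distrib]
    refine Finset.sum_congr rfl fun k _ => ?_
    rw [Ring.lie_def, Matrix.sub_apply, map_sub, sub_mul]
  rw [← h, Derivation.commutator_apply]

theorem VanishesOn.leftDer {A : Subgroup (GLN N)} {X : Mat N}
    (hX : ∀ p, VanishesOn A p → diffAtOne X p = 0) {p : MatPoly N} (hp : VanishesOn A p) :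
    VanishesOn A (leftDer X p) := by
  intro g hg
  have h := hX _ (hp.sandwich hg A.one_mem)
  rw [sum_pderiv_sandwich] at h
  rw [evalAt_leftDer]
  simpa using h

/-- The Lie algebra of a linear algebraic group `A ⊆ GL_N(ℂ)`: the tangent space at the identity,
the matrices annihilated by the differentials of all polynomials that vanish on `A`. -/
def lie (A : Subgroup (GLN N)) : LieSubalgebra ℂ (Mat N) where
  carrier := {X | ∀ p, VanishesOn A p → diffAtOne X p = 0}
  zero_mem' := fun p _ => by simp [diffAtOne]
  add_mem' := fun {X Y} hX hY p hp => by
    have := congrArg₂ (· + ·) (hX p hp) (hY p hp)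
    simpa [diffAtOne, mul_add, Finset.sum_add_distrib] using this
  smul_mem' := fun c X hX p hp => by
    have := congrArg (c * ·) (hX p hp)
    simp only [diffAtOne, Finset.mul_sum, mul_zero] at this
    rw [← this]
    exact Finset.sum_congr rfl fun ij _ => by simp; ring
  lie_mem' := fun {X Y} hX hY p hp => by
    have h1 := hX _ (VanishesOn.leftDer hY hp)
    have h2 := hY _ (VanishesOn.leftDer hX hp)
    rw [← evalAt_one_leftDer] at h1 h2 ⊢
    rw [← leftDer_bracket]
    simp only [evalAt, map_sub] at h1 h2 ⊢
    rw [h1, h2, sub_zero]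

theorem mem_lie {A : Subgroup (GLN N)} {X : Mat N} :
    X ∈ lie A ↔ ∀ p, VanishesOn A p → diffAtOne X p = 0 := Iff.rfl

theorem lie_mono {A B : Subgroup (GLN N)} (h : A ≤ B) : lie A ≤ lie B :=
  fun _ hX p hp => hX p fun g hg => hp g (h hg)

theorem conj_mem_lie {A : Subgroup (GLN N)} {a : GLN N} (ha : a ∈ A) {X : Mat N}
    (hX : X ∈ lie A) : (a : Mat N) * X * ((a⁻¹ : GLN N) : Mat N) ∈ lie A := by
  intro p hp
  have h := hX _ (hp.sandwich ha (A.inv_mem ha))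
  rw [sum_pderiv_sandwich] at h
  simpa [diffAtOne, ← Units.val_mul] using h

/-- The matrix exponential as an element of `GL_N(ℂ)`. -/
def expGL (X : Mat N) : GLN N where
  val := NormedSpace.exp X
  inv := NormedSpace.exp (-X)
  val_inv := by
    rw [← Matrix.exp_add_of_commute _ _ (Commute.neg_right (Commute.refl X)), add_neg_cancel,
      NormedSpace.exp_zero]
  inv_val := by
    rw [← Matrix.exp_add_of_commute _ _ (Commute.neg_left (Commute.refl X)), neg_add_cancel,
      NormedSpace.exp_zero]

theorem coe_expGL (X : Mat N) : ((expGL X : GLN N) : Mat N) = NormedSpace.exp X := rfl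

section Exp

open scoped Matrix.Norms.Operator

theorem hasDerivAt_entry {c : ℂ → Mat N} {c' : Mat N} {s : ℂ} (hc : HasDerivAt c c' s)
    (i j : Fin N) : HasDerivAt (fun z => c z i j) (c' i j) s := by
  let f : Mat N →ₗ[ℂ] ℂ := Matrix.entryLinearMap ℂ ℂ i j
  have := (LinearMap.toContinuousLinearMap f).hasFDerivAt.comp_hasDerivAt s hc
  exact this

theorem hasDerivAt_evalAt_exp (p : MatPoly N) (X : Mat N) (s : ℂ) :
    HasDerivAt (fun z : ℂ => evalAt (NormedSpace.exp (z • X)) p)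
      (evalAt (NormedSpace.exp (s • X)) (leftDer X p)) s := by
  rw [evalAt_leftDer]
  exact hasDerivAt_evalAt p (hasDerivAt_entry (hasDerivAt_exp_smul_const X s))

theorem exp_mem {A : Subgroup (GLN N)} (hA : IsZariskiClosed A) {X : Mat N} (hX : X ∈ lie A) :
    expGL X ∈ A := by
  obtain ⟨S, hS⟩ := hA
  rw [hS]
  intro p hp
  have hpA : VanishesOn A p := fun g hg => (hS g).1 hg p hp
  have hd : Differentiable ℂ fun z : ℂ => evalAt (NormedSpace.exp (z • X)) p :=
    fun s => (hasDerivAt_evalAt_exp p X s).differentiableAt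
  have hder : ∀ (n : ℕ) (q : MatPoly N), VanishesOn A q →
      iteratedDeriv n (fun z : ℂ => evalAt (NormedSpace.exp (z • X)) q) 0 = 0 := by
    intro n
    induction n with
    | zero =>
      intro q hq
      simpa using hq 1 A.one_mem
    | succ n ih =>
      intro q hq
      rw [iteratedDeriv_succ']
      have : deriv (fun z : ℂ => evalAt (NormedSpace.exp (z • X)) q) =
          fun z : ℂ => evalAt (NormedSpace.exp (z • X)) (leftDer X q) := by
        funext s; exact (hasDerivAt_evalAt_exp q X s).deriv
      rw [this]
      exact ih _ (VanishesOn.leftDer hX hq)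
  have := Complex.taylorSeries_eq_of_entire' 0 1 hd
  simp only [hder _ p hpA, mul_zero, zero_mul, tsum_zero] at this
  simpa [coe_expGL] using this.symm

theorem mem_lie_of_exp {A : Subgroup (GLN N)} {X : Mat N} (h : ∀ s : ℝ, expGL (s • X) ∈ A) :
    X ∈ lie A := by
  intro p hp
  have h1 := (hasDerivAt_evalAt_exp p X 0).comp_ofReal
  rw [zero_smul, NormedSpace.exp_zero, evalAt_one_leftDer] at h1
  have e : (fun y : ℝ => evalAt (NormedSpace.exp ((y : ℂ) • X)) p) = fun _ => 0 := by
    funext y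
    simpa [coe_expGL] using hp _ (h y)
  rw [e] at h1
  exact h1.unique (hasDerivAt_const _ _)

theorem eq_of_exp {X Y : Mat N} (h : ∀ s : ℝ, expGL (s • X) = expGL (s • Y)) : X = Y := by
  have hX := hasDerivAt_exp_smul_const X (0 : ℝ)
  have hY := hasDerivAt_exp_smul_const Y (0 : ℝ)
  have hX' : HasDerivAt (fun s : ℝ => NormedSpace.exp (s • Y))
      (NormedSpace.exp ((0 : ℝ) • X) * X) 0 :=
    hX.congr_of_eventuallyEq (Filter.Eventually.of_forall fun s => (congrArg Units.val (h s)).symm)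
  simpa using hX'.unique hY

theorem continuous_expGL (X : Mat N) : Continuous fun s : ℝ => expGL (s • X) := by
  rw [Units.continuous_iff]
  constructor
  · exact continuous_iff_continuousAt.2 fun s => (hasDerivAt_exp_smul_const X s).continuousAt
  · have : Continuous fun s : ℝ => NormedSpace.exp (s • (-X)) :=
      continuous_iff_continuousAt.2 fun s => (hasDerivAt_exp_smul_const (-X) s).continuousAt
    simpa [Function.comp_def, expGL] using this

theorem hasDerivAt_conj (X Y : Mat N) :
    HasDerivAt (fun s : ℝ => NormedSpace.exp (s • X) * Y * NormedSpace.exp (-(s • X)))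
      ⁅X, Y⁆ 0 := by
  have h1 := hasDerivAt_exp_smul_const X (0 : ℝ)
  have h2 := hasDerivAt_exp_smul_const (-X) (0 : ℝ)
  have := (h1.mul_const Y).mul h2
  simp only [smul_neg] at this
  convert! this using 1
  simp [Ring.lie_def, sub_eq_add_neg]

end Exp

end LieAlgebra

section AlgebraicGroups

variable {N : ℕ}

/-- The exponential map of a linear algebraic group. -/
def expIn {A : Subgroup (GLN N)} (hA : IsZariskiClosed A) (X : lie A) : A :=
  ⟨expGL (X : Mat N), exp_mem hA X.2⟩

/-- The adjoint action of an algebraic group on its Lie algebra. -/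
def Ad {A : Subgroup (GLN N)} (a : A) : lie A →ₗ[ℂ] lie A where
  toFun X := ⟨((a : GLN N) : Mat N) * (X : Mat N) * (((a : GLN N)⁻¹ : GLN N) : Mat N),
    conj_mem_lie a.2 X.2⟩
  map_add' X Y := by ext1; simp [mul_add, add_mul]
  map_smul' c X := by ext1; simp

/-- A regular function on a linear algebraic group: the restriction of a polynomial in the entries
and the inverse of the determinant. -/
def IsRegular (A : Subgroup (GLN N)) (f : A → ℂ) : Prop :=
  ∃ (p : MatPoly N) (k : ℕ), ∀ g : A,
    f g * Matrix.det ((g : GLN N) : Mat N) ^ k = evalAt ((g : GLN N) : Mat N) p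

/-- A morphism of algebraic groups into `GL_M(ℂ)`. -/
def IsAlgebraicHom (A : Subgroup (GLN N)) {M : ℕ} (ρ : A →* GLN M) : Prop :=
  ∀ i j, IsRegular A fun g => ((ρ g : GLN M) : Mat M) i j

/-- The neutral connected component. -/
def neutralComponent (A : Subgroup (GLN N)) : Subgroup (GLN N) :=
  (Subgroup.connectedComponentOfOne A).map A.subtype

/-- The subgroup of the elements fixed by an endomorphism. -/
def fixedSubgroup (A : Subgroup (GLN N)) (τ : A →* A) : Subgroup (GLN N) :=
  (τ.eqLocus (MonoidHom.id A)).map A.subtype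

/-- The closed connected normal unipotent subgroups of `A`. -/
def IsNormalUnipotent (A U : Subgroup (GLN N)) : Prop :=
  U ≤ A ∧ (U.subgroupOf A).Normal ∧ IsZariskiClosed U ∧ IsConnected (U : Set (GLN N)) ∧
    ∀ u ∈ U, IsNilpotent ((u : Mat N) - 1)

/-- The unipotent radical: the largest closed connected normal unipotent subgroup. -/
def IsUnipotentRadical (A U : Subgroup (GLN N)) : Prop :=
  IsGreatest {V | IsNormalUnipotent A V} U

/-- Reductive: the unipotent radical is trivial. -/
def IsReductive (A : Subgroup (GLN N)) : Prop := IsUnipotentRadical A ⊥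

/-- `L` is a Levi subgroup of `P`, whose unipotent radical is `Pu`: a reductive subgroup such that
`P` is the semidirect product of `Pu` and `L`. -/
structure IsLevi (P Pu L : Subgroup (GLN N)) : Prop where
  closed : IsZariskiClosed L
  reductive : IsReductive L
  le : L ≤ P
  inf_eq_bot : Pu ⊓ L = ⊥
  sup_eq : Pu ⊔ L = P

/-- A parabolic subgroup: a closed subgroup `P` such that `G/P` is projective. In terms of an
algebraic representation of `G` on `ℂ^M`, the subgroup `P` is the stabilizer of a point `[v]` of the
projective space whose orbit is closed; closedness is expressed on the cone over the orbit. -/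
def IsParabolic (G P : Subgroup (GLN N)) : Prop :=
  P ≤ G ∧ IsZariskiClosed P ∧
    ∃ (M : ℕ) (ρ : G →* GLN M) (v : Fin M → ℂ), IsAlgebraicHom G ρ ∧ v ≠ 0 ∧
      (∀ g : G, (g : GLN N) ∈ P ↔ ∃ c : ℂ, ((ρ g : GLN M) : Mat M).mulVec v = c • v) ∧
      IsClosed {w : Fin M → ℂ | ∃ (c : ℂ) (g : G), w = c • ((ρ g : GLN M) : Mat M).mulVec v}

/-- An algebraic torus: a closed connected simultaneously diagonalizable subgroup. -/
def IsTorus (T : Subgroup (GLN N)) : Prop :=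
  IsZariskiClosed T ∧ IsConnected (T : Set (GLN N)) ∧
    ∃ g : GLN N, ∀ t ∈ T, ((g * t * g⁻¹ : GLN N) : Mat N).IsDiag

theorem mem_neutralComponent {A : Subgroup (GLN N)} {X : Mat N}
    (h : ∀ s : ℝ, expGL (s • X) ∈ A) : expGL X ∈ neutralComponent A := by
  let c : ℝ → A := fun s => ⟨expGL (s • X), h s⟩
  have hc : Continuous c := (continuous_expGL X).subtype_mk h
  have hpre : IsPreconnected (Set.range c) := isPreconnected_range hc
  have h0 : (1 : A) ∈ Set.range c := by
    refine ⟨0, Subtype.ext (Units.ext ?_)⟩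
    simp [c, coe_expGL]
  have h1 : c 1 ∈ connectedComponent (1 : A) := hpre.subset_connectedComponent h0 ⟨1, rfl⟩
  refine ⟨c 1, h1, ?_⟩
  simp [c]

end AlgebraicGroups

section Spaces

/-- A horosymmetric homogeneous space `G/H` of a connected reductive complex linear algebraic group
`G`: a parabolic subgroup `P` with unipotent radical `Pu`, a Levi subgroup `L` of `P`, an involution
`σ` of the algebraic group `L` (with differential `dσ`), and a closed subgroup `H` with
`Pu ⊆ H ⊆ P` such that `L ∩ H` contains the neutral component of `L^σ` with finite index. -/
structure HorosymmetricSpace (N : ℕ) where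
  G : Subgroup (GLN N)
  P : Subgroup (GLN N)
  Pu : Subgroup (GLN N)
  L : Subgroup (GLN N)
  H : Subgroup (GLN N)
  G_closed : IsZariskiClosed G
  G_connected : IsConnected (G : Set (GLN N))
  G_reductive : IsReductive G
  P_parabolic : IsParabolic G P
  Pu_radical : IsUnipotentRadical P Pu
  L_levi : IsLevi P Pu L
  σ : L →* L
  σ_algebraic : IsAlgebraicHom L (L.subtype.comp σ)
  σ_involutive : ∀ g, σ (σ g) = g
  dσ : lie L →ₗ[ℂ] lie L
  σ_exp : ∀ X : lie L, σ (expIn L_levi.closed X) = expIn L_levi.closed (dσ X)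
  H_closed : IsZariskiClosed H
  Pu_le_H : Pu ≤ H
  H_le_P : H ≤ P
  neutral_le : neutralComponent (fixedSubgroup L σ) ≤ L ⊓ H
  finite_index : (neutralComponent (fixedSubgroup L σ)).relIndex (L ⊓ H) ≠ 0

namespace HorosymmetricSpace

variable {N : ℕ} (X : HorosymmetricSpace N)

theorem P_le_G : X.P ≤ X.G := X.P_parabolic.1

theorem H_le_G : X.H ≤ X.G := X.H_le_P.trans X.P_le_G

theorem L_le_G : X.L ≤ X.G := X.L_levi.le.trans X.P_le_G

theorem σ_expGL (x : lie X.L) (hx : expGL (x : Mat N) ∈ X.L) :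
    ((X.σ ⟨expGL (x : Mat N), hx⟩ : X.L) : GLN N) = expGL (X.dσ x : Mat N) :=
  congrArg Subtype.val (X.σ_exp x)

theorem dσ_dσ (x : lie X.L) : X.dσ (X.dσ x) = x := by
  apply Subtype.ext
  apply eq_of_exp
  intro s
  have h1 := X.σ_exp ((s : ℂ) • x)
  have h2 := X.σ_exp (X.dσ ((s : ℂ) • x))
  rw [← h1, X.σ_involutive] at h2
  have := congrArg Subtype.val h2
  simp only [map_smul, expIn] at this
  simpa using this.symm

/-- `𝓗(x) = (x + σ(x))/2` on the Lie algebra of `L`. -/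
def hPart : lie X.L →ₗ[ℂ] lie X.L := (1 / 2 : ℂ) • (LinearMap.id + X.dσ)

/-- `𝓟(x) = (x - σ(x))/2` on the Lie algebra of `L`. -/
def pPart : lie X.L →ₗ[ℂ] lie X.L := (1 / 2 : ℂ) • (LinearMap.id - X.dσ)

theorem dσ_hPart (x : lie X.L) : X.dσ (X.hPart x) = X.hPart x := by
  simp [hPart, X.dσ_dσ, add_comm]

theorem dσ_pPart (x : lie X.L) : X.dσ (X.pPart x) = -X.pPart x := by
  simp [pPart, X.dσ_dσ, ← smul_neg]

theorem fixed_mem_lie_H {x : lie X.L} (hx : X.dσ x = x) : (x : Mat N) ∈ lie X.H := by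
  have hfix : ∀ s : ℝ, expGL (s • (x : Mat N)) ∈ fixedSubgroup X.L X.σ := by
    intro s
    refine ⟨expIn X.L_levi.closed ((s : ℂ) • x), ?_, ?_⟩
    · change X.σ _ = _
      rw [X.σ_exp, map_smul, hx]
      rfl
    · simp [expIn]
  refine mem_lie_of_exp fun s => ?_
  have : expGL (s • (x : Mat N)) ∈ neutralComponent (fixedSubgroup X.L X.σ) := by
    apply mem_neutralComponent
    intro t
    rw [smul_smul]
    exact hfix _
  exact (X.neutral_le this).2

theorem hPart_mem (x : lie X.L) : (X.hPart x : Mat N) ∈ lie X.H :=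
  X.fixed_mem_lie_H (X.dσ_hPart x)

/-- For a subgroup `T` of `L`, the neutral component of the group of elements of `T` inverted by
`σ`. When `T` is a `σ`-stable torus the inverted elements already form a group, and this is the
maximal split subtorus of `T`. -/
def splitPart (T : Subgroup (GLN N)) : Subgroup (GLN N) :=
  neutralComponent (Subgroup.closure {t | ∃ h : t ∈ X.L, t ∈ T ∧ X.σ ⟨t, h⟩ = (⟨t, h⟩ : X.L)⁻¹})

end HorosymmetricSpace

/-- The complex dimension of the homogeneous space `A/B`, that is, of the quotient of the Lie
algebras. -/
def quotientDim {N : ℕ} (A B : Subgroup (GLN N)) : ℕ :=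
  Module.finrank ℂ (lie A ⧸ (lie B).toSubmodule.comap (lie A).toSubmodule.subtype)

/-- The action of an element of `B` on the tangent space of `A/B` at the base point. -/
def isotropy {N : ℕ} {A B : Subgroup (GLN N)} (hBA : B ≤ A) (b : B) :
    (lie A ⧸ (lie B).toSubmodule.comap (lie A).toSubmodule.subtype) →ₗ[ℂ]
      (lie A ⧸ (lie B).toSubmodule.comap (lie A).toSubmodule.subtype) :=
  Submodule.mapQ _ _ (Ad (⟨b, hBA b.2⟩ : A)) fun _ hx => conj_mem_lie b.2 hx

/-- The character by which `B` acts on the fiber of the canonical bundle of `A/B` at the base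
point. -/
def canonicalCharacter {N : ℕ} {A B : Subgroup (GLN N)} (hBA : B ≤ A) (b : B) : ℂ :=
  (LinearMap.det (isotropy hBA b))⁻¹

/-- The total space `G ×_H ℂ_χ` of the `G`-linearized line bundle on `G/H` attached to `χ`:
`(g h, z)` is identified with `(g, χ(h) z)`. -/
def LineBundle {N : ℕ} (G H : Subgroup (GLN N)) (χ : H → ℂ) : Type :=
  Quot fun x y : G × ℂ => ∃ h : H, (x.1 : GLN N) = y.1 * h ∧ y.2 = χ h * x.2

/-- The class of `(g, z)`; for `z = 1` this is the `G`-equivariant section `s(g)` of the pullback of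
the line bundle to `G`. -/
def LineBundle.mk {N : ℕ} {G H : Subgroup (GLN N)} {χ : H → ℂ} (g : G) (z : ℂ) :
    LineBundle G H χ := Quot.mk _ (g, z)

/-- A smooth `K`-invariant hermitian metric on `G ×_H ℂ_χ`, given by its norm. Smoothness is tested
in the exponential coordinates around the points of `G`. -/
structure HermitianMetric {N : ℕ} {G : Subgroup (GLN N)} (hG : IsZariskiClosed G)
    (K H : Subgroup (GLN N)) (χ : H → ℂ) where
  norm : LineBundle G H χ → ℝ
  norm_pos : ∀ (g : G) (z : ℂ), z ≠ 0 → 0 < norm (LineBundle.mk g z)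
  norm_smul : ∀ (g : G) (c z : ℂ), norm (LineBundle.mk g (c * z)) = ‖c‖ * norm (LineBundle.mk g z)
  smooth : ∀ (g : G) (m : ℕ) (b : Fin m → lie G),
    ContDiff ℝ ∞ fun z : Fin m → ℂ => norm (LineBundle.mk (g * expIn hG (∑ i, z i • b i)) 1)
  invariant : ∀ (k g : G) (z : ℂ), (k : GLN N) ∈ K →
    norm (LineBundle.mk (k * g) z) = norm (LineBundle.mk g z)

/-- The quasipotential `φ(g) = -2 ln |s(g)|` of a metric. -/
def HermitianMetric.quasipotential {N : ℕ} {G : Subgroup (GLN N)} {hG : IsZariskiClosed G}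
    {K H : Subgroup (GLN N)} {χ : H → ℂ} (q : HermitianMetric hG K H χ) (g : G) : ℝ :=
  -2 * Real.log (q.norm (LineBundle.mk g 1))

/-- An algebraic character of `A`, with its differential. -/
structure AlgebraicCharacter {N : ℕ} {A : Subgroup (GLN N)} (hA : IsZariskiClosed A) where
  χ : A →* ℂˣ
  regular : IsRegular A fun a => (χ a : ℂ)
  dχ : lie A →ₗ[ℂ] ℂ
  χ_exp : ∀ x : lie A, (χ (expIn hA x) : ℂ) = Complex.exp (dχ x)

/-- The line bundle attached to `χ` is trivial on the symmetric fiber `L/(L ∩ H)`: it has a nowhere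
vanishing algebraic section there. -/
def HorosymmetricSpace.TrivialOnFiber {N : ℕ} (X : HorosymmetricSpace N) (χ : X.H → ℂ) : Prop :=
  ∃ f : X.L → ℂ, IsRegular X.L f ∧ (∀ l, f l ≠ 0) ∧
    ∀ l l' : X.L, ((l⁻¹ * l' : X.L) : GLN N) ∈ X.H →
      (LineBundle.mk ⟨l, X.L_le_G l.2⟩ (f l) : LineBundle X.G X.H χ) =
        LineBundle.mk ⟨l', X.L_le_G l'.2⟩ (f l')

end Spaces

section Roots

variable {N : ℕ}

/-- The root space of `α` in the Lie algebra of `G`, with respect to the Lie algebra of `T`. -/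
def rootSpace (G T : Subgroup (GLN N)) (α : Module.Dual ℂ (lie T)) : Submodule ℂ (Mat N) where
  carrier := {x | x ∈ lie G ∧ ∀ h : lie T, ⁅(h : Mat N), x⁆ = α h • x}
  zero_mem' := ⟨(lie G).zero_mem, by simp⟩
  add_mem' := fun hx hy => ⟨(lie G).add_mem hx.1 hy.1, fun h => by
    rw [lie_add, hx.2, hy.2, smul_add]⟩
  smul_mem' := fun c _ hx => ⟨(lie G).smul_mem c hx.1, fun h => by
    rw [lie_smul, hx.2, smul_comm]⟩

/-- The roots of `G` with respect to `T` (as linear functionals on the Lie algebra of `T`). -/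
def roots (G T : Subgroup (GLN N)) : Set (Module.Dual ℂ (lie T)) :=
  {α | α ≠ 0 ∧ rootSpace G T α ≠ ⊥}

/-- The roots of the subgroup `A`: those whose root space is in the Lie algebra of `A`. -/
def rootsIn (G T A : Subgroup (GLN N)) : Set (Module.Dual ℂ (lie T)) :=
  {α | α ∈ roots G T ∧ ∀ x ∈ rootSpace G T α, x ∈ lie A}

theorem roots_finite (G T : Subgroup (GLN N)) : (roots G T).Finite := by
  by_contra hinf
  have hinf : (roots G T).Infinite := hinf
  obtain ⟨s, hs, hcard⟩ := hinf.exists_subset_card_eq (Module.finrank ℂ (Mat N) + 1)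
  have hsep : ∃ h : lie T, ∀ αβ ∈ s.offDiag, (αβ.1 - αβ.2) h ≠ 0 := by
    obtain ⟨h, -, hh⟩ := Module.Dual.exists_forall_mem_ne_zero_of_forall_exists
      (⊤ : Submodule ℂ (lie T)) (fun αβ : s.offDiag => (αβ.1.1 - αβ.1.2 : Module.Dual ℂ (lie T)))
      (by
        rintro ⟨⟨α, β⟩, hαβ⟩
        rw [Finset.mem_offDiag] at hαβ
        obtain ⟨h, hh⟩ := DFunLike.ne_iff.1 (sub_ne_zero.2 hαβ.2.2)
        exact ⟨h, trivial, hh⟩)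
    exact ⟨h, fun αβ hαβ => hh ⟨αβ, hαβ⟩⟩
  obtain ⟨h, hh⟩ := hsep
  have hv : ∀ α : s, ∃ x : Mat N, x ≠ 0 ∧ x ∈ rootSpace G T α.1 := fun α => by
    obtain ⟨x, hx, hx0⟩ := (Submodule.ne_bot_iff _).1 (hs α.2).2
    exact ⟨x, hx0, hx⟩
  choose v hv0 hv using hv
  let f : Module.End ℂ (Mat N) :=
    LinearMap.mulLeft ℂ (h : Mat N) - LinearMap.mulRight ℂ (h : Mat N)
  have hli : LinearIndependent ℂ v := by
    refine Module.End.eigenvectors_linearIndependent' f (fun α : s => α.1 h) ?_ v ?_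
    · intro α β hαβ
      by_contra hne
      refine hh (α.1, β.1) (Finset.mem_offDiag.2 ⟨α.2, β.2, fun e => hne (Subtype.ext e)⟩) ?_
      simpa [sub_eq_zero] using hαβ
    · intro α
      refine ⟨Module.End.mem_eigenspace_iff.2 ?_, hv0 α⟩
      have := (hv α).2 h
      rw [Ring.lie_def] at this
      simpa [f] using this
  have := hli.fintype_card_le_finrank
  simp only [Fintype.card_coe, hcard] at this
  omega

instance (G T A : Subgroup (GLN N)) : Finite (rootsIn G T A) :=
  ((roots_finite G T).subset fun _ h => h.1).to_subtype

/-- `h` is the coroot of `α`: the element of `[𝔤, 𝔤] ∩ 𝔱` with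
`α(x) = 2 κ(x, h) / κ(h, h)` for all `x` in `𝔱`, where `κ` is the Killing form of `𝔤`. -/
def IsCoroot {G T : Subgroup (GLN N)} (hTG : T ≤ G) (α : Module.Dual ℂ (lie T)) (h : lie T) :
    Prop :=
  (h : Mat N) ∈ Submodule.span ℂ {z : Mat N | ∃ x ∈ lie G, ∃ y ∈ lie G, z = ⁅x, y⁆} ∧
    ∀ x : lie T, α x =
      2 * killingForm ℂ (lie G) ⟨x, lie_mono hTG x.2⟩ ⟨h, lie_mono hTG h.2⟩ /
        killingForm ℂ (lie G) ⟨h, lie_mono hTG h.2⟩ ⟨h, lie_mono hTG h.2⟩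

/-- A positive system in a root system `R`. -/
structure IsPositiveSystem {V : Type*} [AddCommGroup V] (R pos : Set V) : Prop where
  subset : pos ⊆ R
  trichotomy : ∀ α ∈ R, Xor (α ∈ pos) (-α ∈ pos)
  add_mem : ∀ α ∈ pos, ∀ β ∈ pos, α + β ∈ R → α + β ∈ pos

end Roots

section Choices

variable {N : ℕ}

/-- A maximally split torus: a `σ`-stable maximal torus of `L` that contains a split torus (one
whose elements are inverted by `σ`) of maximal dimension among the split tori of `L`. -/
structure MaximallySplitTorus (X : HorosymmetricSpace N) where
  T : Subgroup (GLN N)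
  torus : IsTorus T
  le_L : T ≤ X.L
  maximal : ∀ S : Subgroup (GLN N), IsTorus S → S ≤ X.L → T ≤ S → S = T
  stable : ∀ t : X.L, (t : GLN N) ∈ T → (X.σ t : GLN N) ∈ T
  split : ∀ S : Subgroup (GLN N), IsTorus S → S ≤ X.L →
    (∀ s : X.L, (s : GLN N) ∈ S → X.σ s = s⁻¹) →
      Module.finrank ℂ (lie S) ≤ Module.finrank ℂ (lie (X.splitPart T))

namespace MaximallySplitTorus

variable {X : HorosymmetricSpace N} (S : MaximallySplitTorus X)

theorem le_G : S.T ≤ X.G := S.le_L.trans X.L_le_G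

/-- The inclusion of the Lie algebra of `T` into that of `L`. -/
def toL : lie S.T →ₗ[ℂ] lie X.L :=
  Submodule.inclusion (p := (lie S.T).toSubmodule) (p' := (lie X.L).toSubmodule) (lie_mono S.le_L)

theorem coe_toL (x : lie S.T) : (S.toL x : Mat N) = x := rfl

theorem dσ_mem (x : lie S.T) : (X.dσ (S.toL x) : Mat N) ∈ lie S.T := by
  refine mem_lie_of_exp fun s => ?_
  have h := X.σ_exp ((s : ℂ) • S.toL x)
  have h2 := S.stable (expIn X.L_levi.closed ((s : ℂ) • S.toL x))
    (exp_mem S.torus.1 ((lie S.T).smul_mem (s : ℂ) x.2))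
  rw [h, map_smul] at h2
  simpa [expIn] using h2

/-- The involution of the Lie algebra of `T` induced by `σ`. -/
def dσT : lie S.T →ₗ[ℂ] lie S.T where
  toFun x := ⟨X.dσ (S.toL x), S.dσ_mem x⟩
  map_add' x y := by ext1; simp
  map_smul' c x := by ext1; simp

/-- The action of `σ` on the functionals on the Lie algebra of `T`. -/
def σRoot (α : Module.Dual ℂ (lie S.T)) : Module.Dual ℂ (lie S.T) := α ∘ₗ S.dσT

/-- The maximal split subtorus of `T`. -/
def Ts : Subgroup (GLN N) := X.splitPart S.T

theorem Ts_le : S.Ts ≤ S.T := by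
  rintro _ ⟨⟨t, ht⟩, -, rfl⟩
  exact (Subgroup.closure_le S.T).2 (fun t ht => ht.2.1) ht

theorem antifixed_mem {x : lie X.L} (hT : (x : Mat N) ∈ lie S.T) (hx : X.dσ x = -x) :
    (x : Mat N) ∈ lie S.Ts := by
  refine mem_lie_of_exp fun s => ?_
  apply mem_neutralComponent
  intro t
  apply Subgroup.subset_closure
  rw [smul_smul]
  have hmem : ((t * s) • (x : Mat N)) ∈ lie S.T := by
    have := (lie S.T).smul_mem ((t * s : ℝ) : ℂ) hT
    rwa [Complex.coe_smul] at this
  refine ⟨S.le_L (exp_mem S.torus.1 hmem), exp_mem S.torus.1 hmem, ?_⟩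
  have h := X.σ_exp (((t * s : ℝ) : ℂ) • x)
  rw [map_smul, hx] at h
  have e1 : expIn X.L_levi.closed (((t * s : ℝ) : ℂ) • x) =
      ⟨expGL ((t * s) • (x : Mat N)), S.le_L (exp_mem S.torus.1 hmem)⟩ := by
    apply Subtype.ext
    change expGL (((t * s : ℝ) : ℂ) • (x : Mat N)) = _
    rw [Complex.coe_smul]
  rw [← e1, h]
  apply Subtype.ext
  apply Units.ext
  simp only [expIn, Subgroup.coe_inv]
  change NormedSpace.exp _ = NormedSpace.exp _
  simp

theorem pPart_mem (x : lie S.T) : (X.pPart (S.toL x) : Mat N) ∈ lie S.Ts := by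
  refine S.antifixed_mem ?_ (X.dσ_pPart _)
  have : (X.pPart (S.toL x) : Mat N) = (1 / 2 : ℂ) • ((x : Mat N) - (S.dσT x : Mat N)) := by
    simp [HorosymmetricSpace.pPart, dσT, coe_toL]
  rw [this]
  exact (lie S.T).smul_mem _ ((lie S.T).sub_mem x.2 (S.dσT x).2)

end MaximallySplitTorus

/-- A Cartan involution `θ` of `G`: an antiholomorphic involution (its differential `dθ` is
conjugate-linear) whose fixed group `K` is compact. It is required to preserve `L` and to commute
with `σ` there. -/
structure CartanInvolution (X : HorosymmetricSpace N) where
  θ : X.G →* X.G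
  involutive : ∀ g, θ (θ g) = g
  dθ : lie X.G →ₛₗ[starRingEnd ℂ] lie X.G
  θ_exp : ∀ x : lie X.G, θ (expIn X.G_closed x) = expIn X.G_closed (dθ x)
  compact : IsCompact (fixedSubgroup X.G θ : Set (GLN N))
  map_L : ∀ g : X.L, (θ ⟨g, X.L_le_G g.2⟩ : GLN N) ∈ X.L
  comm_σ : ∀ g : X.L, (θ ⟨X.σ g, X.L_le_G (X.σ g).2⟩ : GLN N) =
    X.σ ⟨θ ⟨g, X.L_le_G g.2⟩, map_L g⟩

namespace CartanInvolution

variable {X : HorosymmetricSpace N} (C : CartanInvolution X)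

/-- The maximal compact subgroup `K = G^θ`. -/
def K : Subgroup (GLN N) := fixedSubgroup X.G C.θ

theorem expIn_smul {A : Subgroup (GLN N)} (hA : IsZariskiClosed A) (s : ℝ) (x : lie A) :
    (expIn hA ((s : ℂ) • x) : GLN N) = expGL (s • (x : Mat N)) := by
  simp [expIn]

theorem dθ_smul (s : ℝ) (x : lie X.G) : C.dθ ((s : ℂ) • x) = (s : ℂ) • C.dθ x := by
  rw [LinearMap.map_smulₛₗ, Complex.conj_ofReal]

theorem dθ_dθ (x : lie X.G) : C.dθ (C.dθ x) = x := by
  apply Subtype.ext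
  apply eq_of_exp
  intro s
  rw [← expIn_smul X.G_closed, ← expIn_smul X.G_closed]
  have h1 := C.θ_exp ((s : ℂ) • x)
  have h2 := C.θ_exp (C.dθ ((s : ℂ) • x))
  rw [← h1, C.involutive, dθ_smul, dθ_smul] at h2
  rw [h2]

theorem dθ_Ad (g : X.G) (y : lie X.G) : C.dθ (Ad g y) = Ad (C.θ g) (C.dθ y) := by
  apply Subtype.ext
  apply eq_of_exp
  intro s
  have key : ∀ (g : X.G) (y : lie X.G), expIn X.G_closed (Ad g y) =
      g * expIn X.G_closed y * g⁻¹ := by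
    intro g y
    apply Subtype.ext
    apply Units.ext
    simpa [expIn, coe_expGL, Ad] using Matrix.exp_units_conj (g : GLN N) (y : Mat N)
  rw [← expIn_smul X.G_closed, ← expIn_smul X.G_closed]
  have h1 : C.dθ (Ad g ((s : ℂ) • y)) = (s : ℂ) • C.dθ (Ad g y) := by
    rw [map_smul, dθ_smul]
  rw [← h1, ← C.θ_exp, key, map_mul, map_mul, map_inv, C.θ_exp, ← key, dθ_smul, map_smul]

open scoped Matrix.Norms.Operator in
theorem dθ_lie (x y : lie X.G) : C.dθ ⁅x, y⁆ = ⁅C.dθ x, C.dθ y⁆ := by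
  let f : lie X.G →ₗ[ℝ] Mat N :=
    { toFun := fun z => (C.dθ z : Mat N)
      map_add' := fun a b => by simp
      map_smul' := fun c a => by
        rw [← algebraMap_smul ℂ c a, LinearMap.map_smulₛₗ]
        simp }
  obtain ⟨F, hF⟩ := LinearMap.exists_extend (p := (lie X.G).toSubmodule.restrictScalars ℝ) f
  have hF' : ∀ z : lie X.G, F (z : Mat N) = C.dθ z := fun z => LinearMap.congr_fun hF z
  have h1 := (LinearMap.toContinuousLinearMap F).hasFDerivAt.comp_hasDerivAt 0
    (hasDerivAt_conj (x : Mat N) (y : Mat N))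
  have h2 := hasDerivAt_conj (C.dθ x : Mat N) (C.dθ y : Mat N)
  have e : ∀ s : ℝ, F (NormedSpace.exp (s • (x : Mat N)) * (y : Mat N) *
      NormedSpace.exp (-(s • (x : Mat N)))) =
      NormedSpace.exp (s • (C.dθ x : Mat N)) * (C.dθ y : Mat N) *
      NormedSpace.exp (-(s • (C.dθ x : Mat N))) := by
    intro s
    have h3 := congrArg Subtype.val (C.dθ_Ad (expIn X.G_closed ((s : ℂ) • x)) y)
    rw [← hF', C.θ_exp] at h3
    have h4 : C.dθ ((s : ℂ) • x) = (s : ℂ) • C.dθ x := C.dθ_smul s x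
    rw [h4] at h3
    simpa [Ad, expIn, expGL] using h3
  have h5 := h1.congr_of_eventuallyEq (Filter.Eventually.of_forall fun s => (e s).symm)
  have h6 := h5.unique h2
  apply Subtype.ext
  rw [← hF']
  exact h6

/-- The inclusion of the Lie algebra of `L` into that of `G`. -/
def _root_.Horosymmetric.HorosymmetricSpace.toG (X : HorosymmetricSpace N) :
    lie X.L →ₗ[ℂ] lie X.G :=
  Submodule.inclusion (p := (lie X.L).toSubmodule) (p' := (lie X.G).toSubmodule)
    (lie_mono X.L_le_G)

theorem dθ_mem_L (x : lie X.L) : (C.dθ (X.toG x) : Mat N) ∈ lie X.L := by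
  refine mem_lie_of_exp fun s => ?_
  have h := C.map_L (expIn X.L_levi.closed ((s : ℂ) • x))
  have h2 := C.θ_exp ((s : ℂ) • X.toG x)
  have h3 : C.dθ ((s : ℂ) • X.toG x) = (s : ℂ) • C.dθ (X.toG x) := C.dθ_smul s _
  rw [h3] at h2
  rw [← expIn_smul X.G_closed, ← h2]
  exact h

theorem dθ_dσ (x : lie X.L) :
    (C.dθ (X.toG (X.dσ x)) : Mat N) = X.dσ ⟨C.dθ (X.toG x), C.dθ_mem_L x⟩ := by
  apply eq_of_exp
  intro s
  have h := C.comm_σ (expIn X.L_levi.closed ((s : ℂ) • x))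
  have h1 := C.θ_exp ((s : ℂ) • X.toG (X.dσ x))
  have h2 := C.θ_exp ((s : ℂ) • X.toG x)
  have e1 : C.dθ ((s : ℂ) • X.toG (X.dσ x)) = (s : ℂ) • C.dθ (X.toG (X.dσ x)) :=
    C.dθ_smul s _
  have e2 : C.dθ ((s : ℂ) • X.toG x) = (s : ℂ) • C.dθ (X.toG x) := C.dθ_smul s _
  rw [e1] at h1
  rw [e2] at h2
  have h3 := X.σ_exp ((s : ℂ) • ⟨C.dθ (X.toG x), C.dθ_mem_L x⟩)
  rw [map_smul] at h3
  rw [← expIn_smul X.G_closed, ← expIn_smul X.L_levi.closed, ← h1, ← h3]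
  have h4 : (⟨X.σ (expIn X.L_levi.closed ((s : ℂ) • x)),
      X.L_le_G (X.σ (expIn X.L_levi.closed ((s : ℂ) • x))).2⟩ : X.G) =
      expIn X.G_closed ((s : ℂ) • X.toG (X.dσ x)) := by
    apply Subtype.ext
    rw [X.σ_exp, map_smul]
    rfl
  have h5 : (⟨C.θ ⟨expIn X.L_levi.closed ((s : ℂ) • x), X.L_le_G (Subtype.prop _)⟩,
      C.map_L _⟩ : X.L) =
      expIn X.L_levi.closed ((s : ℂ) • ⟨C.dθ (X.toG x), C.dθ_mem_L x⟩) := by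
    apply Subtype.ext
    exact congrArg (fun z : X.G => (z : GLN N)) h2
  rw [h4, h5] at h
  exact h

end CartanInvolution

/-- The choices attached to a horosymmetric space: a maximally split torus `T` of `L`; a Cartan
involution `θ` of `G`, commuting with `σ` and preserving `T`; the parabolic subgroup `Q` opposite to
`P` with respect to `L`, with unipotent radical `Qu`; a positive root system `pos` of `G`, containing
the roots of `Qu`, such that every positive root of `L` is either fixed by `σ` or mapped by `-σ` to a
positive root of `L`; the coroots; and root vectors `e α` with `[θ(e α), e α] = α^∨`. -/
structure Frame (X : HorosymmetricSpace N) where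
  S : MaximallySplitTorus X
  C : CartanInvolution X
  T_stable : ∀ t : X.G, (t : GLN N) ∈ S.T → (C.θ t : GLN N) ∈ S.T
  Q : Subgroup (GLN N)
  Qu : Subgroup (GLN N)
  Q_parabolic : IsParabolic X.G Q
  Qu_radical : IsUnipotentRadical Q Qu
  L_levi_Q : IsLevi Q Qu X.L
  Q_inf_P : Q ⊓ X.P = X.L
  pos : Set (Module.Dual ℂ (lie S.T))
  pos_system : IsPositiveSystem (roots X.G S.T) pos
  Qu_pos : rootsIn X.G S.T Qu ⊆ pos
  σ_pos : ∀ α ∈ pos, α ∈ rootsIn X.G S.T X.L →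
    S.σRoot α = α ∨ -S.σRoot α ∈ pos ∩ rootsIn X.G S.T X.L
  coroot : Module.Dual ℂ (lie S.T) → lie S.T
  coroot_spec : ∀ α ∈ roots X.G S.T, IsCoroot S.le_G α (coroot α)
  e : Module.Dual ℂ (lie S.T) → lie X.G
  e_ne_zero : ∀ α ∈ roots X.G S.T, e α ≠ 0
  e_mem : ∀ α ∈ roots X.G S.T, (e α : Mat N) ∈ rootSpace X.G S.T α
  e_normalized : ∀ α ∈ roots X.G S.T, ((⁅C.dθ (e α), e α⁆ : lie X.G) : Mat N) = coroot α

namespace Frame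

variable {X : HorosymmetricSpace N} (F : Frame X)

/-- The roots of the unipotent radical of `Q`. -/
def rootsQu : Set (Module.Dual ℂ (lie F.S.T)) := rootsIn X.G F.S.T F.Qu

/-- The roots of `L` that are not fixed by `σ`. -/
def rootsS : Set (Module.Dual ℂ (lie F.S.T)) := {β | β ∈ rootsIn X.G F.S.T X.L ∧ F.S.σRoot β ≠ β}

/-- The positive roots of `L` that are not fixed by `σ`. -/
def posRootsS : Set (Module.Dual ℂ (lie F.S.T)) := {β | β ∈ F.rootsS ∧ β ∈ F.pos}

instance : Fintype F.rootsQu :=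
  @Fintype.ofFinite _ (inferInstanceAs (Finite (rootsIn X.G F.S.T F.Qu)))

instance : Fintype F.posRootsS :=
  @Fintype.ofFinite _ (((roots_finite X.G F.S.T).subset fun _ h => h.1.1.1).to_subtype)

theorem lie_Ts_le : lie F.S.Ts ≤ lie X.G := lie_mono (F.S.Ts_le.trans F.S.le_G)

/-- The real vector space `𝔞_s = 𝔱_s ∩ i𝔨`, where `i𝔨` is the `-1`-eigenspace of `θ`. -/
def aSplit : Submodule ℝ (Mat N) where
  carrier := {x | ∃ h : x ∈ lie F.S.Ts, F.C.dθ ⟨x, F.lie_Ts_le h⟩ = -⟨x, F.lie_Ts_le h⟩}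
  zero_mem' := ⟨(lie F.S.Ts).zero_mem, by
    have : (⟨0, F.lie_Ts_le (lie F.S.Ts).zero_mem⟩ : lie X.G) = 0 := rfl
    rw [this, map_zero, neg_zero]⟩
  add_mem' := by
    rintro x y ⟨hx, hx'⟩ ⟨hy, hy'⟩
    refine ⟨(lie F.S.Ts).add_mem hx hy, ?_⟩
    have : (⟨x + y, F.lie_Ts_le ((lie F.S.Ts).add_mem hx hy)⟩ : lie X.G) =
      ⟨x, F.lie_Ts_le hx⟩ + ⟨y, F.lie_Ts_le hy⟩ := rfl
    rw [this, map_add, hx', hy', neg_add]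
  smul_mem' := by
    rintro c x ⟨hx, hx'⟩
    have hc : c • x ∈ lie F.S.Ts := by
      have := (lie F.S.Ts).smul_mem (c : ℂ) hx
      rwa [Complex.coe_smul] at this
    refine ⟨hc, ?_⟩
    have : (⟨c • x, F.lie_Ts_le hc⟩ : lie X.G) = (c : ℂ) • ⟨x, F.lie_Ts_le hx⟩ := by
      apply Subtype.ext
      change c • x = (c : ℂ) • x
      rw [Complex.coe_smul]
    rw [this, CartanInvolution.dθ_smul, hx', smul_neg]

/-- An element of `𝔞_s` as an element of the Lie algebra of `G`. -/
def asToG (x : F.aSplit) : lie X.G := ⟨x, F.lie_Ts_le x.2.1⟩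

/-- The value of a functional on the Lie algebra of `T` at an element of `𝔞_s`. -/
def rootAt (α : Module.Dual ℂ (lie F.S.T)) (x : F.aSplit) : ℂ :=
  α ⟨x, lie_mono F.S.Ts_le x.2.1⟩

theorem dθ_coroot {α : Module.Dual ℂ (lie F.S.T)} (hα : α ∈ roots X.G F.S.T) :
    F.C.dθ (X.toG (F.S.toL (F.coroot α))) = -X.toG (F.S.toL (F.coroot α)) := by
  have h : X.toG (F.S.toL (F.coroot α)) = ⁅F.C.dθ (F.e α), F.e α⁆ :=
    Subtype.ext (F.e_normalized α hα).symm
  rw [h, F.C.dθ_lie, F.C.dθ_dθ, lie_skew]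

theorem pPart_coroot_mem {α : Module.Dual ℂ (lie F.S.T)} (hα : α ∈ roots X.G F.S.T) :
    (X.pPart (F.S.toL (F.coroot α)) : Mat N) ∈ F.aSplit := by
  refine ⟨F.S.pPart_mem _, ?_⟩
  set x := F.S.toL (F.coroot α) with hx
  have h1 : (⟨X.pPart x, F.lie_Ts_le (F.S.pPart_mem (F.coroot α))⟩ : lie X.G) =
      ((1 / 2 : ℝ) : ℂ) • (X.toG x - X.toG (X.dσ x)) := by
    apply Subtype.ext
    simp [HorosymmetricSpace.pPart, HorosymmetricSpace.toG]
    rfl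
  have h2 : F.C.dθ (X.toG (X.dσ x)) = -X.toG (X.dσ x) := by
    apply Subtype.ext
    rw [F.C.dθ_dσ]
    have h3 : (⟨F.C.dθ (X.toG x), F.C.dθ_mem_L x⟩ : lie X.L) = -x := by
      apply Subtype.ext
      exact congrArg (fun z : lie X.G => (z : Mat N)) (F.dθ_coroot hα)
    rw [h3, map_neg]
    rfl
  rw [h1, CartanInvolution.dθ_smul, map_sub, h2, F.dθ_coroot hα, ← smul_neg]
  congr 1
  abel

/-- `𝓟(α^∨)`, an element of `𝔞_s`. -/
def pCoroot (α : Module.Dual ℂ (lie F.S.T)) (hα : α ∈ roots X.G F.S.T) : F.aSplit :=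
  ⟨X.pPart (F.S.toL (F.coroot α)), F.pPart_coroot_mem hα⟩

/-- `𝓗(α^∨)`, an element of the Lie algebra of `H`. -/
def hCoroot (α : Module.Dual ℂ (lie F.S.T)) : lie X.H :=
  ⟨X.hPart (F.S.toL (F.coroot α)), X.hPart_mem _⟩

/-- `τ_β = e_β - σ(e_β)` for a root `β` of `L`. -/
def tau (β : Module.Dual ℂ (lie F.S.T)) (hβ : β ∈ rootsIn X.G F.S.T X.L) : lie X.G :=
  X.toG ((⟨F.e β, hβ.2 _ (F.e_mem β hβ.1)⟩ : lie X.L) -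
    X.dσ ⟨F.e β, hβ.2 _ (F.e_mem β hβ.1)⟩)

/-- The indices of the local coordinates of `G/H`. -/
abbrev Index (r : ℕ) : Type := Fin r ⊕ F.rootsQu ⊕ F.posRootsS

/-- The vectors `l_j`, `e_α` and `τ_β`, which span a complement of the Lie algebra of `H`. -/
def frameVector {r : ℕ} (l : Module.Basis (Fin r) ℝ F.aSplit) : F.Index r → lie X.G
  | Sum.inl j => F.asToG (l j)
  | Sum.inr (Sum.inl α) => F.e α
  | Sum.inr (Sum.inr β) => F.tau β β.2.1.1

/-- `J_H(x) = ∏ |sinh(2 β(x))|` over the positive roots `β` of `L` not fixed by `σ`; the roots are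
real on `𝔞_s`. -/
def J (x : F.aSplit) : ℝ := ∏ β : F.posRootsS, |Real.sinh (2 * (F.rootAt β x).re)|

end Frame

end Choices

section Forms

variable {ι : Type*} [Fintype ι] [DecidableEq ι]

/-- The complexified real cotangent space of `ℂ^ι`. -/
abbrev Cotangent (ι : Type*) : Type _ := (ι → ℂ) →ₗ[ℝ] ℂ

/-- The form `dz_i`. -/
def dz (i : ι) : Cotangent ι := LinearMap.proj i

/-- The form `dz̄_i`. -/
def dzbar (i : ι) : Cotangent ι := Complex.conjAe.toLinearMap ∘ₗ LinearMap.proj i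

/-- The derivative `∂f/∂z_i`. -/
def wirtinger (i : ι) (f : (ι → ℂ) → ℂ) (z : ι → ℂ) : ℂ :=
  (lineDeriv ℝ f z (Pi.single i 1) - Complex.I * lineDeriv ℝ f z (Pi.single i Complex.I)) / 2

/-- The derivative `∂f/∂z̄_i`. -/
def wirtingerBar (i : ι) (f : (ι → ℂ) → ℂ) (z : ι → ℂ) : ℂ :=
  (lineDeriv ℝ f z (Pi.single i 1) + Complex.I * lineDeriv ℝ f z (Pi.single i Complex.I)) / 2

/-- The matrix of the derivatives `∂²f/∂z_i∂z̄_j` at the origin. -/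
def complexHessian (f : (ι → ℂ) → ℂ) : Matrix ι ι ℂ :=
  Matrix.of fun i j => wirtinger i (wirtingerBar j f) 0

/-- The form `i ∂∂̄ f` at the origin, in the exterior algebra of the cotangent space. -/
def ddbar (f : (ι → ℂ) → ℂ) : ExteriorAlgebra ℂ (Cotangent ι) :=
  Complex.I • ∑ i, ∑ j, complexHessian f i j •
    (ExteriorAlgebra.ι ℂ (dz i) * ExteriorAlgebra.ι ℂ (dzbar j))

/-- The form `i^{m²} ξ ∧ ξ̄`, where `m` is the number of coordinates and `ξ` is the exterior product
of all the `dz_i` (it does not depend on their order). -/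
def standardVolume (ι : Type*) [Fintype ι] : ExteriorAlgebra ℂ (Cotangent ι) :=
  Complex.I ^ (Fintype.card ι ^ 2) •
    (ExteriorAlgebra.ιMulti ℂ (Fintype.card ι) (fun k => dz ((Fintype.equivFin ι).symm k)) *
      ExteriorAlgebra.ιMulti ℂ (Fintype.card ι) (fun k => dzbar ((Fintype.equivFin ι).symm k)))

end Forms

section MongeAmpere

variable {N r : ℕ} {X : HorosymmetricSpace N}

/-- The metrics that define the reference volume form. The relative canonical bundle of
`G/H → G/P` and the canonical bundle of `G/P` are the homogeneous line bundles attached to the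
characters of `H` and `P` on their fibers at the base points, and `[g, 1]` stands for the translate
by `g` of the exterior product of the dual frame `γ_j, γ_β` (respectively `γ_α`) at the base point.
The first metric is `K`-invariant and gives norm one to the `L`-translates of this element; the
second one is `K`-invariant and gives it norm one at the base point. -/
structure ReferenceMetrics (F : Frame X) where
  qf : HermitianMetric X.G_closed F.C.K X.H (canonicalCharacter X.H_le_P)
  qf_L : ∀ g : X.L, qf.norm (LineBundle.mk ⟨g, X.L_le_G g.2⟩ 1) = 1
  qP : HermitianMetric X.G_closed F.C.K X.P (canonicalCharacter X.P_le_G)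
  qP_one : qP.norm (LineBundle.mk 1 1) = 1

namespace Frame

variable (F : Frame X) (l : Module.Basis (Fin r) ℝ F.aSplit)

/-- The point `g exp(∑ z_i f_i)` of `G`; modulo `H` this gives the local holomorphic coordinates `z`
of `G/H` around `gH`. -/
def coordinates (g : X.G) (z : F.Index r → ℂ) : X.G :=
  g * expIn X.G_closed (∑ i, z i • F.frameVector l i)

/-- The local potential `-ln |s|²` in these coordinates, where `s` is the local holomorphic
trivialization `z ↦ [g exp(∑ z_i f_i), 1]` of the line bundle. -/
def localPotential {χ : X.H → ℂ} (q : HermitianMetric X.G_closed F.C.K X.H χ) (g : X.G)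
    (z : F.Index r → ℂ) : ℂ :=
  ((-Real.log (q.norm (LineBundle.mk (F.coordinates l g z) 1) ^ 2) : ℝ) : ℂ)

open Classical in
/-- The curvature form of `q` at `gH`: `i ∂∂̄` of the local potential. -/
def curvatureForm {χ : X.H → ℂ} (q : HermitianMetric X.G_closed F.C.K X.H χ) (g : X.G) :
    ExteriorAlgebra ℂ (Cotangent (F.Index r)) :=
  ddbar (F.localPotential l q g)

open Classical in
/-- The curvature form of `q` is non-negative at `gH`: its hermitian form is positive
semidefinite. -/
def CurvatureNonneg {χ : X.H → ℂ} (q : HermitianMetric X.G_closed F.C.K X.H χ) (g : X.G) : Prop :=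
  ∀ v : F.Index r → ℂ, 0 ≤ (∑ i, ∑ j,
    complexHessian (F.localPotential l q g) i j * v i * (starRingEnd ℂ) (v j)).re

/-- The reference volume form `dV_H` at `gH`: `i^{n²} |ξ|^{-2} ξ ∧ ξ̄`, where `ξ` is the exterior
product of the coordinate forms at `gH`, and where the norm is that of the metric
`q_H = q_f ⊗ f^* q_P` on the canonical bundle of `G/H`. -/
def referenceVolume (R : ReferenceMetrics F) (g : X.G) :
    ExteriorAlgebra ℂ (Cotangent (F.Index r)) :=
  ((((R.qf.norm (LineBundle.mk g 1) * R.qP.norm (LineBundle.mk g 1)) ^ 2)⁻¹ : ℝ) : ℂ) •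
    standardVolume (F.Index r)

/-- The point `exp(a)` of `G`, for `a` in `𝔞_s`. -/
def point (a : F.aSplit) : X.G := expIn X.G_closed (F.asToG a)

/-- The toric potential `u(x) = φ(exp x)` on `𝔞_s`. -/
def toricPotential {χ : X.H → ℂ} (q : HermitianMetric X.G_closed F.C.K X.H χ) (x : F.aSplit) : ℝ :=
  q.quasipotential (F.point x)

/-- `d_a u(α^∨)`, where `d_a u` is extended by `d_a u(x) = d_a u(𝓟(x))`. -/
def diffAtCoroot (u : F.aSplit → ℝ) (a : F.aSplit) (α : Module.Dual ℂ (lie F.S.T))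
    (hα : α ∈ roots X.G F.S.T) : ℝ :=
  lineDeriv ℝ u a (F.pCoroot α hα)

/-- The matrix of `d²_a u` in the basis `l`. -/
def realHessian (u : F.aSplit → ℝ) (a : F.aSplit) : Matrix (Fin r) (Fin r) ℝ :=
  Matrix.of fun j k => lineDeriv ℝ (fun x => lineDeriv ℝ u x (l k)) a (l j)

/-- `χ(α^∨)`, where `χ` is extended by `χ(x) = χ(𝓗(x))`. -/
def charAtCoroot (χ : AlgebraicCharacter X.H_closed) (α : Module.Dual ℂ (lie F.S.T)) : ℂ :=
  χ.dχ (F.hCoroot α)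

end Frame

end MongeAmpere

end Horosymmetric

end

open Horosymmetric

noncomputable section

namespace Horosymmetric

open Filter Topology

/-! ### Exponential coordinates and the closed subgroup theorem -/

section NormedAlgebra

/-! Write φ(g) = -2 ln |s(g)|. The form ω at exp(a)H is the complex Hessian of φ in the coordinates
exp(∑ z_i f_i). The commutator terms cancel in its (1,1)-part, so this Hessian is a form `hess` in
the left-invariant second derivatives of φ at exp(a) (`complexHessian_exp`,
`nonempty_potentialJet`). Let λ (`lam`) be the (1,0)-part of the first derivative and `bil` the
complex bilinear part of the second, so that bil(v,w) - bil(w,v) = λ([v,w]).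

Equivariance under H gives λ = -χ on 𝔥, and hess(v,y) = 0, bil(y,v) = λ([y,v]) for y in 𝔥. Put x† =
-θ(x), and let x be an eigenvector of ad(a) with real eigenvalue ρ. Then x - x† lies in 𝔨, and
Ad(exp(-a)) turns it into e^{-ρ}x - e^{ρ}x†. Invariance under K therefore gives λ(x) = e^{2ρ} times
the conjugate of λ(x†), and hess(v,x) = e^{2ρ} bil(x†,v). For x = e_α the adjoint lies in 𝔭^u ⊂ 𝔥,
whence hess(v,e_α) = e^{2α(a)} λ([e_α†,v]) (`hess_e`). For e_β and σ(e_β), with eigenvalues ±β(a)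
and with sum in 𝔥, one solves a linear system and finds hess(v,τ_β) = -λ([(e_β+σ(e_β))†,v]) /
sinh(2β(a)) (`hess_tau`).

The form λ kills every root vector (`lam_e_eq_zero`). A character kills the nilpotent elements of 𝔥.
For β in Φ_s, triviality on the symmetric fiber gives λ(σ(e_β)) = -λ(e_β), and the two relations
from K then force λ(e_β) = 0 because β(a) ≠ 0. Hence the columns of e_α and τ_β in the Hessian
matrix vanish off the diagonal. Their diagonal entries follow from [e_α,e_α†] = α^∨ and λ(α^∨) =
d_au(α^∨)/2 - χ(α^∨). They are e^{2α(a)}(2χ-d_au)(α^∨)/2 and d_au(β^∨)/sinh(2β(a)), and the block of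
𝔞_s is d_a²u/4. The top power of ω is n! times the determinant (`ddbar_pow`). The factors e^{2α(a)}
are cancelled by the norm of ξ in dV_H. When ω ≥ 0, the diagonal entries at τ_β are non-negative,
which identifies the signs.

The structure theory behind this is derived from positivity. Averaging over the compact group K
yields a hermitian inner product on ℂ^N for which x† is the adjoint, so tr(xy†) is positive definite
(`exists_dag`). Closedness of the cone over the orbit G/P yields 𝔤 = 𝔭^u + 𝔩 + (𝔭^u)†. Maximality of
T then shows that 𝔱 is its own centralizer, from which root spaces are lines, and maximality of T_s
shows that σ is the identity on the root spaces of σ-fixed roots. Consequently the frame is a basis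
of a complement of 𝔥, and n is the number of its vectors. -/

theorem exists_seq_of_frequently_nhds_zero {E : Type*} [SeminormedAddCommGroup E] {p : E → Prop}
    (h : ∃ᶠ b in 𝓝 (0 : E), p b) : ∃ b : ℕ → E, Tendsto b atTop (𝓝 0) ∧ ∀ n, p (b n) :=
  exists_seq_forall_of_frequently h

variable {𝔸 : Type*} [NormedRing 𝔸] [NormedAlgebra ℝ 𝔸] [CompleteSpace 𝔸]

/-- The map `x ↦ exp(π x) exp(x - π x)` is a local homeomorphism at the origin. -/
theorem map_nhds_exp_mul_exp (π : 𝔸 →L[ℝ] 𝔸) :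
    map (fun x => NormedSpace.exp (π x) * NormedSpace.exp (x - π x)) (𝓝 (0 : 𝔸)) = 𝓝 1 := by
  have hexp : HasStrictFDerivAt (NormedSpace.exp : 𝔸 → 𝔸) (1 : 𝔸 →L[ℝ] 𝔸) 0 :=
    hasStrictFDerivAt_exp_zero
  have hid : HasStrictFDerivAt (fun x : 𝔸 => x - π x) (ContinuousLinearMap.id ℝ _ - π) 0 :=
    (hasStrictFDerivAt_id (𝕜 := ℝ) (0 : 𝔸)).sub π.hasStrictFDerivAt
  have e1 := HasStrictFDerivAt.comp (g := (NormedSpace.exp : 𝔸 → 𝔸)) (f := fun x => π x)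
    (0 : 𝔸) (g' := 1) (by rw [map_zero]; exact hexp) π.hasStrictFDerivAt
  have e2 := HasStrictFDerivAt.comp (g := (NormedSpace.exp : 𝔸 → 𝔸)) (f := fun x => x - π x)
    (0 : 𝔸) (g' := 1) (by rw [map_zero, sub_zero]; exact hexp) hid
  have h := e1.mul' e2
  have h' : HasStrictFDerivAt (fun x => NormedSpace.exp (π x) * NormedSpace.exp (x - π x))
      ((ContinuousLinearEquiv.refl ℝ 𝔸 : 𝔸 ≃L[ℝ] 𝔸) : 𝔸 →L[ℝ] 𝔸) 0 := by
    refine h.congr_fderiv ?_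
    ext x : 1
    simp
  simpa using h'.map_nhds_eq_of_equiv

end NormedAlgebra

section ClosedSubgroup

open scoped Matrix.Norms.Operator

variable {N : ℕ}

theorem continuous_evalAt (p : MatPoly N) : Continuous fun A : Mat N => evalAt A p :=
  (MvPolynomial.continuous_eval p).comp
    (continuous_pi fun ij => (continuous_apply ij.2).comp (continuous_apply ij.1))

theorem IsZariskiClosed.mem_of_tendsto {A : Subgroup (GLN N)} (hA : IsZariskiClosed A)
    {ι : Type*} {l : Filter ι} [l.NeBot] {g : ι → GLN N} {g₀ : GLN N} (hg : ∀ᶠ i in l, g i ∈ A)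
    (h : Tendsto (fun i => (g i : Mat N)) l (𝓝 (g₀ : Mat N))) : g₀ ∈ A := by
  obtain ⟨S, hS⟩ := hA
  rw [hS]
  intro p hp
  have h1 := ((continuous_evalAt p).tendsto _).comp h
  refine tendsto_nhds_unique (h1.congr' ?_) tendsto_const_nhds
  filter_upwards [hg] with i hi
  exact (hS _).1 hi p hp

/-- The derivative at the identity of a curve in an algebraic group is in its Lie algebra. -/
theorem mem_lie_of_hasDerivAt {A : Subgroup (GLN N)} {c : ℂ → Mat N} {c' : Mat N}
    (hc : HasDerivAt c c' 0) (h0 : c 0 = 1) (hA : ∀ z, ∃ g ∈ A, (g : Mat N) = c z) :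
    c' ∈ lie A := by
  intro p hp
  have h1 := hasDerivAt_evalAt p (hasDerivAt_entry hc)
  rw [h0] at h1
  have e : (fun z => evalAt (c z) p) = fun _ => 0 := by
    funext z
    obtain ⟨g, hg, e⟩ := hA z
    rw [← e]
    exact hp g hg
  rw [e] at h1
  exact h1.unique (hasDerivAt_const _ _)

theorem expGL_zpow (X : Mat N) (k : ℤ) : expGL X ^ k = expGL ((k : ℝ) • X) := by
  have key : ∀ m : ℕ, ∀ Y : Mat N, expGL Y ^ m = expGL ((m : ℝ) • Y) := by
    intro m Y
    apply Units.ext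
    rw [Units.val_pow_eq_pow_val, coe_expGL, coe_expGL, ← Matrix.exp_nsmul]
    congr 1
    rw [Nat.cast_smul_eq_nsmul]
  have hinv : ∀ Y : Mat N, (expGL Y)⁻¹ = expGL (-Y) := by
    intro Y
    apply Units.ext
    rfl
  cases k with
  | ofNat m => simpa using key m X
  | negSucc m =>
    rw [zpow_negSucc, key, hinv]
    congr 1
    rw [← neg_smul]
    congr 1
    push_cast
    ring

/-- The heart of the closed subgroup theorem. Small nonzero counterexamples, rescaled to the unit
sphere, accumulate at a direction v in W. Suitable integer powers of their exponentials converge to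
exp(tv) for every t, so v also lies in the Lie algebra of A and must vanish. -/
theorem eventually_eq_zero_of_expGL_mem {A : Subgroup (GLN N)} (hA : IsZariskiClosed A)
    {W : Submodule ℂ (Mat N)} (hW : Disjoint (lie A).toSubmodule W) :
    ∀ᶠ b in 𝓝 (0 : Mat N), b ∈ W → expGL b ∈ A → b = 0 := by
  by_contra hcon
  rw [not_eventually] at hcon
  obtain ⟨b, hb, hb'⟩ := exists_seq_of_frequently_nhds_zero (E := Mat N) hcon
  simp only [Classical.not_imp] at hb'
  have hpos : ∀ n, 0 < ‖b n‖ := fun n => norm_pos_iff.2 (hb' n).2.2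
  let u : ℕ → Mat N := fun n => ‖b n‖⁻¹ • b n
  have hu : ∀ n, u n ∈ Metric.sphere (0 : Mat N) 1 := by
    intro n
    simp [u, norm_smul, (hpos n).ne']
  have : FiniteDimensional ℂ (Mat N) := inferInstance
  have : ProperSpace (Mat N) := FiniteDimensional.proper ℂ (Mat N)
  obtain ⟨v, hv, φ, hφ, hlim⟩ := (isCompact_sphere (0 : Mat N) 1).tendsto_subseq hu
  have hvW : v ∈ W := by
    refine (Submodule.closed_of_finiteDimensional W).mem_of_tendsto hlim ?_
    refine Eventually.of_forall fun n => ?_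
    have := W.smul_mem ((‖b (φ n)‖⁻¹ : ℝ) : ℂ) (hb' (φ n)).1
    rwa [Complex.coe_smul] at this
  have hvA : v ∈ lie A := by
    refine mem_lie_of_exp fun t => ?_
    -- The integer part makes k_n ‖b_n‖ tend to t, so that exp(b_n)^{k_n} = exp(k_n b_n) tends to
    -- exp(tv).
    let k : ℕ → ℤ := fun n => ⌊t / ‖b (φ n)‖⌋
    have hb0 : Tendsto (fun n => ‖b (φ n)‖) atTop (𝓝 0) := by
      simpa using (hb.comp hφ.tendsto_atTop).norm
    have hk : Tendsto (fun n => (k n : ℝ) * ‖b (φ n)‖) atTop (𝓝 t) := by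
      rw [tendsto_iff_norm_sub_tendsto_zero]
      refine squeeze_zero (fun n => norm_nonneg _) (fun n => ?_) hb0
      have hp := hpos (φ n)
      have h1 := Int.floor_le (t / ‖b (φ n)‖)
      have h2 := Int.lt_floor_add_one (t / ‖b (φ n)‖)
      rw [le_div_iff₀ hp] at h1
      rw [div_lt_iff₀ hp] at h2
      rw [Real.norm_eq_abs, abs_le]
      constructor
      · simp only [k]; linarith
      · simp only [k]; linarith
    have hconv : Tendsto (fun n => (k n : ℝ) • b (φ n)) atTop (𝓝 (t • v)) := by
      refine (hk.smul hlim).congr fun n => ?_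
      simp only [u, Function.comp, smul_smul, mul_assoc, mul_inv_cancel₀ (hpos (φ n)).ne', mul_one]
    refine hA.mem_of_tendsto (l := atTop) (g := fun n => expGL (b (φ n)) ^ k n) (Eventually.of_forall fun n =>
      A.zpow_mem (hb' (φ n)).2.1 _) ?_
    simp only [expGL_zpow, coe_expGL]
    exact ((NormedSpace.exp_continuous).tendsto _).comp hconv
  have hv0 : v = 0 := (Submodule.disjoint_def.1 hW) v hvA hvW
  simp [hv0] at hv

theorem hasStrictFDerivAt_exp_mat :
    HasStrictFDerivAt (NormedSpace.exp : Mat N → Mat N)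
      ((ContinuousLinearEquiv.refl ℝ (Mat N) : Mat N ≃L[ℝ] Mat N) : Mat N →L[ℝ] Mat N) 0 :=
  hasStrictFDerivAt_exp_zero

/-- The local inverse of the matrix exponential at the identity. -/
def logMat : Mat N → Mat N :=
  HasStrictFDerivAt.localInverse (NormedSpace.exp : Mat N → Mat N) (ContinuousLinearEquiv.refl ℝ (Mat N)) 0
    hasStrictFDerivAt_exp_mat

theorem logMat_exp : ∀ᶠ x in 𝓝 (0 : Mat N), logMat (NormedSpace.exp x) = x :=
  HasStrictFDerivAt.eventually_left_inverse hasStrictFDerivAt_exp_mat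

theorem contDiff_exp_mat : ContDiff ℝ ∞ (NormedSpace.exp : Mat N → Mat N) :=
  contDiff_iff_contDiffAt.2 fun x => (NormedSpace.exp_analytic (𝕂 := ℝ) x).contDiffAt

theorem contDiffAt_logMat : ContDiffAt ℝ ∞ (logMat : Mat N → Mat N) 1 := by
  have h := ContDiffAt.to_localInverse (f' := ContinuousLinearEquiv.refl ℝ (Mat N))
    (contDiff_exp_mat.contDiffAt (x := (0 : Mat N))) hasStrictFDerivAt_exp_mat.hasFDerivAt (by simp)
  rw [NormedSpace.exp_zero] at h
  exact h

/-- Near the identity, the elements of an algebraic group are exponentials of small elements of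
its Lie algebra. -/
theorem eventually_exists_exp_eq {A : Subgroup (GLN N)} (hA : IsZariskiClosed A)
    {U : Set (Mat N)} (hU : U ∈ 𝓝 (0 : Mat N)) :
    ∀ᶠ m in 𝓝 (1 : Mat N), ∀ g ∈ A, (g : Mat N) = m → ∃ x ∈ lie A, x ∈ U ∧ NormedSpace.exp x = m := by
  obtain ⟨W, hW⟩ := Submodule.exists_isCompl (lie A).toSubmodule
  let π : Mat N →L[ℝ] Mat N :=
    (LinearMap.toContinuousLinearMap (Submodule.projection _ _ hW)).restrictScalars ℝ
  have hπ : ∀ x, π x ∈ lie A := fun x => Submodule.projection_apply_mem hW x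
  have hπ' : ∀ x, x - π x ∈ W := fun x => Submodule.sub_projection_mem hW x
  -- A local homeomorphism at the origin, so points near 1 are of the form Φ(x) with x small. If
  -- Φ(x) lies in A, then so does exp(x - πx), and the previous lemma forces x = πx.
  let Φ : Mat N → Mat N := fun x => NormedSpace.exp (π x) * NormedSpace.exp (x - π x)
  have hmap : map Φ (𝓝 0) = 𝓝 1 := map_nhds_exp_mul_exp π
  suffices ∀ᶠ m in map Φ (𝓝 0), ∀ g ∈ A, (g : Mat N) = m →
      ∃ x ∈ lie A, x ∈ U ∧ NormedSpace.exp x = m by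
    rw [hmap] at this
    exact this
  rw [eventually_map]
  have hc1 : Tendsto (fun x : Mat N => x - π x) (𝓝 0) (𝓝 0) := by
    have : Continuous fun x : Mat N => x - π x := continuous_id.sub π.continuous
    simpa using this.tendsto 0
  have hc2 : Tendsto (fun x : Mat N => π x) (𝓝 0) (𝓝 0) := by
    simpa using π.continuous.tendsto 0
  filter_upwards [hc1.eventually (eventually_eq_zero_of_expGL_mem hA hW.disjoint), hc2 hU]
    with x hx hxU g hg hgx
  have hmem : expGL (x - π x) ∈ A := by
    have h1 : expGL (x - π x) = (expGL (π x))⁻¹ * g := by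
      rw [eq_inv_mul_iff_mul_eq]
      apply Units.ext
      rw [hgx, Units.val_mul]
      rfl
    rw [h1]
    exact A.mul_mem (A.inv_mem (exp_mem hA (hπ x))) hg
  have h0 := hx (hπ' x) hmem
  refine ⟨π x, hπ x, hxU, ?_⟩
  simp [Φ, h0]

/-- This makes the smooth matrix logarithm a chart of the group near 1, which later serves to extend
potentials off the group. -/
theorem eventually_logMat_mem {A : Subgroup (GLN N)} (hA : IsZariskiClosed A) :
    ∀ᶠ m in 𝓝 (1 : Mat N), ∀ g ∈ A, (g : Mat N) = m →
      logMat m ∈ lie A ∧ NormedSpace.exp (logMat m) = m := by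
  filter_upwards [eventually_exists_exp_eq hA logMat_exp] with m hm g hg hgm
  obtain ⟨x, hx, hxU, rfl⟩ := hm g hg hgm
  have : logMat (NormedSpace.exp x) = x := hxU
  rw [this]
  exact ⟨hx, rfl⟩

/-- A connected algebraic group is generated by the exponentials of its Lie algebra. -/
theorem le_of_forall_expGL_mem {A B : Subgroup (GLN N)} (hA : IsZariskiClosed A)
    (hconn : IsConnected (A : Set (GLN N))) (h : ∀ x ∈ lie A, expGL x ∈ B) : A ≤ B := by
  have hcs : ConnectedSpace A := isConnected_iff_connectedSpace.1 hconn
  let C : Subgroup A := B.subgroupOf A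
  -- A subgroup containing a neighborhood of the identity is open and closed, hence everything in a
  -- connected group.
  have hC : (C : Set A) ∈ 𝓝 (1 : A) := by
    have h1 := eventually_exists_exp_eq hA (univ_mem : Set.univ ∈ 𝓝 (0 : Mat N))
    have hcont : Tendsto (fun a : A => ((a : GLN N) : Mat N)) (𝓝 1) (𝓝 1) :=
      (Units.continuous_val.comp continuous_subtype_val).tendsto' _ _ rfl
    filter_upwards [hcont.eventually h1] with a ha
    obtain ⟨x, hx, -, e⟩ := ha a a.2 rfl
    have : (a : GLN N) = expGL x := Units.ext e.symm
    change (a : GLN N) ∈ B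
    rw [this]
    exact h x hx
  have hopen : IsOpen (C : Set A) := Subgroup.isOpen_of_mem_nhds C hC
  have hclosed : IsClosed (C : Set A) := Subgroup.isClosed_of_isOpen C hopen
  have huniv : (C : Set A) = Set.univ := IsClopen.eq_univ ⟨hclosed, hopen⟩ ⟨1, C.one_mem⟩
  intro g hg
  have : (⟨g, hg⟩ : A) ∈ (C : Set A) := by rw [huniv]; trivial
  exact this

/-- A linear subspace that contains a one-parameter group contains its generator. -/
theorem mem_of_forall_exp_mem {V : Submodule ℂ (Mat N)} {x : Mat N}
    (h : ∀ s : ℂ, NormedSpace.exp (s • x) ∈ V) : x ∈ V := by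
  by_contra hx
  obtain ⟨f, hfx, hf⟩ := Submodule.exists_le_ker_of_notMem hx
  have h1 := (LinearMap.toContinuousLinearMap f).hasFDerivAt.comp_hasDerivAt 0
    (hasDerivAt_exp_smul_const x (0 : ℂ))
  have h3 := h1.congr_of_eventuallyEq (f₁ := fun _ => 0)
    (Eventually.of_forall fun s => (hf (h s)).symm)
  have h2 := h3.unique (hasDerivAt_const _ _)
  simp at h2
  exact hfx h2

end ClosedSubgroup

/-! ### Adjoints for a hermitian inner product and positivity of the trace form -/

section Adjoint

open Matrix
open scoped ComplexOrder

variable {N : ℕ}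

/-- The adjoint of a matrix with respect to the hermitian inner product with Gram matrix `Sᴴ S`. -/
def dag (S : GLN N) : Mat N →ₛₗ[starRingEnd ℂ] Mat N where
  toFun x := ((S⁻¹ : GLN N) : Mat N) * ((S : Mat N) * x * ((S⁻¹ : GLN N) : Mat N))ᴴ * (S : Mat N)
  map_add' x y := by simp [mul_add, add_mul]
  map_smul' c x := by simp

theorem dag_apply (S : GLN N) (x : Mat N) :
    dag S x = ((S⁻¹ : GLN N) : Mat N) * ((S : Mat N) * x * ((S⁻¹ : GLN N) : Mat N))ᴴ * (S : Mat N) :=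
  rfl

variable (S : GLN N)

theorem GL_inv_mul_cancel (x : Mat N) : ((S⁻¹ : GLN N) : Mat N) * ((S : Mat N) * x) = x := by
  rw [← mul_assoc, ← Units.val_mul, inv_mul_cancel, Units.val_one, one_mul]

theorem GL_mul_inv_cancel (x : Mat N) : (S : Mat N) * (((S⁻¹ : GLN N) : Mat N) * x) = x := by
  rw [← mul_assoc, ← Units.val_mul, mul_inv_cancel, Units.val_one, one_mul]

theorem conj_dag (x : Mat N) :
    (S : Mat N) * dag S x * ((S⁻¹ : GLN N) : Mat N) = ((S : Mat N) * x * ((S⁻¹ : GLN N) : Mat N))ᴴ := by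
  have h : (S : Mat N) * ((S⁻¹ : GLN N) : Mat N) = 1 := by
    rw [← Units.val_mul, mul_inv_cancel, Units.val_one]
  rw [dag_apply]
  simp only [mul_assoc, GL_mul_inv_cancel]
  rw [h, mul_one]

theorem conj_injective {x y : Mat N}
    (h : (S : Mat N) * x * ((S⁻¹ : GLN N) : Mat N) = (S : Mat N) * y * ((S⁻¹ : GLN N) : Mat N)) : x = y := by
  have := congrArg (fun z => ((S⁻¹ : GLN N) : Mat N) * (z * (S : Mat N))) h
  have h' : ((S⁻¹ : GLN N) : Mat N) * (S : Mat N) = 1 := by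
    rw [← Units.val_mul, inv_mul_cancel, Units.val_one]
  simpa only [mul_assoc, GL_inv_mul_cancel, h', mul_one] using this

theorem conj_mul (x y : Mat N) :
    (S : Mat N) * (x * y) * ((S⁻¹ : GLN N) : Mat N) =
      ((S : Mat N) * x * ((S⁻¹ : GLN N) : Mat N)) * ((S : Mat N) * y * ((S⁻¹ : GLN N) : Mat N)) := by
  simp only [mul_assoc, GL_inv_mul_cancel]

theorem trace_conj (x : Mat N) :
    trace ((S : Mat N) * x * ((S⁻¹ : GLN N) : Mat N)) = trace x := by
  rw [Matrix.trace_mul_comm, GL_inv_mul_cancel]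

theorem dag_dag (x : Mat N) : dag S (dag S x) = x := by
  apply conj_injective S
  rw [conj_dag, conj_dag, conjTranspose_conjTranspose]

theorem dag_mul (x y : Mat N) : dag S (x * y) = dag S y * dag S x := by
  apply conj_injective S
  rw [conj_dag, conj_mul, conj_mul, conj_dag, conj_dag, conjTranspose_mul]

theorem dag_one : dag S 1 = 1 := by
  apply conj_injective S
  rw [conj_dag]
  simp

theorem dag_lie (x y : Mat N) : dag S ⁅x, y⁆ = ⁅dag S y, dag S x⁆ := by
  simp [Ring.lie_def, dag_mul]

theorem trace_dag (x : Mat N) : trace (dag S x) = (starRingEnd ℂ) (trace x) := by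
  rw [← trace_conj S, conj_dag, Matrix.trace_conjTranspose, trace_conj]
  rfl

theorem trace_mul_dag_symm (x y : Mat N) :
    trace (x * dag S y) = (starRingEnd ℂ) (trace (y * dag S x)) := by
  rw [← trace_dag S, dag_mul, dag_dag]

theorem trace_mul_dag_eq (x : Mat N) :
    trace (x * dag S x) = ((∑ i, ∑ j, ‖((S : Mat N) * x * ((S⁻¹ : GLN N) : Mat N)) i j‖ ^ 2 : ℝ) : ℂ) := by
  rw [← trace_conj S, conj_mul, conj_dag]
  generalize (S : Mat N) * x * ((S⁻¹ : GLN N) : Mat N) = A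
  simp only [Matrix.trace, Matrix.diag, Matrix.mul_apply, Matrix.conjTranspose_apply]
  push_cast
  refine Finset.sum_congr rfl fun i _ => Finset.sum_congr rfl fun j _ => ?_
  rw [← Complex.mul_conj']
  rfl

theorem trace_mul_dag_self_eq_zero {x : Mat N} (h : trace (x * dag S x) = 0) : x = 0 := by
  rw [← trace_conj S, conj_mul, conj_dag, Matrix.trace_mul_conjTranspose_self_eq_zero_iff] at h
  apply conj_injective S
  simpa using h

theorem trace_mul_dag_self_re_nonneg (x : Mat N) : 0 ≤ (trace (x * dag S x)).re := by
  rw [trace_mul_dag_eq, Complex.ofReal_re]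
  positivity

theorem trace_mul_dag_self_re_pos {x : Mat N} (hx : x ≠ 0) : 0 < (trace (x * dag S x)).re := by
  refine lt_of_le_of_ne (trace_mul_dag_self_re_nonneg S x) fun h => hx ?_
  apply trace_mul_dag_self_eq_zero S
  rw [trace_mul_dag_eq] at h ⊢
  rw [Complex.ofReal_re] at h
  rw [← h, Complex.ofReal_zero]

variable {S}

/-- Since x commutes with its adjoint x†, the product xx† is nilpotent. Its trace, the squared norm
of x, is then zero. -/
theorem eq_zero_of_normal_of_isNilpotent {x : Mat N} (h : ⁅x, dag S x⁆ = 0) (hx : IsNilpotent x) :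
    x = 0 := by
  apply trace_mul_dag_self_eq_zero S
  have hc : Commute x (dag S x) := by
    rw [Ring.lie_def, sub_eq_zero] at h
    exact h
  exact (Matrix.isNilpotent_trace_of_isNilpotent (hc.isNilpotent_mul_right hx)).eq_zero

theorem exists_diagonal_of_isHermitian {A : Mat N} (hA : A.IsHermitian) :
    ∃ (u : GLN N) (d : Fin N → ℝ),
      (u : Mat N) * A * ((u⁻¹ : GLN N) : Mat N) = diagonal fun i => (d i : ℂ) := by
  obtain ⟨V, hV⟩ : ∃ V : Mat N, V = (hA.eigenvectorUnitary : Mat N) := ⟨_, rfl⟩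
  have h1 : star V * V = 1 := by rw [hV]; exact Unitary.coe_star_mul_self _
  have h2 : V * star V = 1 := by rw [hV]; exact Unitary.coe_mul_star_self _
  have h3 : star V * A * V = diagonal (RCLike.ofReal ∘ hA.eigenvalues) := by
    have := hA.conjStarAlgAut_star_eigenvectorUnitary
    rw [Unitary.conjStarAlgAut_apply] at this
    simpa [hV] using this
  exact ⟨⟨star V, V, h1, h2⟩, hA.eigenvalues, h3⟩

/-- A self-adjoint matrix is diagonalizable with real eigenvalues. -/
theorem exists_diagonal_of_dag_eq {x : Mat N} (h : dag S x = x) :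
    ∃ (g : GLN N) (d : Fin N → ℝ),
      (g : Mat N) * x * ((g⁻¹ : GLN N) : Mat N) = diagonal fun i => (d i : ℂ) := by
  have hA : ((S : Mat N) * x * ((S⁻¹ : GLN N) : Mat N)).IsHermitian := by
    rw [Matrix.IsHermitian, ← conj_dag, h]
  obtain ⟨u, d, hu⟩ := exists_diagonal_of_isHermitian hA
  refine ⟨u * S, d, ?_⟩
  rw [← hu, _root_.mul_inv_rev, Units.val_mul, Units.val_mul]
  simp only [mul_assoc]

variable (S)

theorem dag_exp (x : Mat N) : dag S (NormedSpace.exp x) = NormedSpace.exp (dag S x) := by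
  have h1 := Matrix.exp_units_conj S x
  have h2 := Matrix.exp_units_conj S⁻¹ ((S : Mat N) * x * ((S⁻¹ : GLN N) : Mat N))ᴴ
  rw [inv_inv] at h2
  rw [dag_apply, dag_apply, h2, Matrix.exp_conjTranspose]
  congr 3
  exact h1.symm

end Adjoint

/-! ### Weyl's averaging and the Cartan involution as minus an adjoint -/

section Average

open Matrix MeasureTheory
open scoped ComplexOrder

variable {N : ℕ}

/-- A compact subgroup of `GL_N(ℂ)` is unitary for some hermitian inner product. -/
theorem exists_unitary_of_isCompact {K : Subgroup (GLN N)} (hK : IsCompact (K : Set (GLN N))) :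
    ∃ S : GLN N, ∀ k ∈ K, dag S (k : Mat N) * (k : Mat N) = 1 := by
  have : CompactSpace K := isCompact_iff_compactSpace.1 hK
  let _ : MeasurableSpace K := borel K
  have : BorelSpace K := ⟨rfl⟩
  let μ : Measure K := Measure.haar
  let c : K → Mat N := fun k => (((k : GLN N)⁻¹ : GLN N) : Mat N)
  have hc : Continuous c := Units.continuous_val.comp (continuous_inv.comp continuous_subtype_val)
  -- The inverses make f(k₀⁻¹k) = k₀ᴴ f(k) k₀, so left invariance of Haar measure yields an
  -- invariant Gram matrix.
  let f : K → Mat N := fun k => (c k)ᴴ * c k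
  have hf : Continuous f := hc.matrix_conjTranspose.matrix_mul hc
  have hfij : ∀ i j, Continuous fun k => f k i j := fun i j => hf.matrix_elem i j
  have hintegral : ∀ g : K → ℂ, Continuous g → Integrable g μ := fun g hg =>
    hg.integrable_of_hasCompactSupport (HasCompactSupport.of_compactSpace g)
  let H : Mat N := Matrix.of fun i j => ∫ k, f k i j ∂μ
  have hsand : ∀ A B : Mat N, ∀ i j, (A * H * B) i j = ∫ k, (A * f k * B) i j ∂μ := by
    intro A B i j
    simp only [Matrix.mul_apply, H, Matrix.of_apply]
    rw [integral_finsetSum]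
    · refine Finset.sum_congr rfl fun l _ => ?_
      rw [integral_mul_const, integral_finsetSum]
      · congr 1
        exact Finset.sum_congr rfl fun m _ => (integral_const_mul _ _).symm
      · exact fun m _ => hintegral _ (continuous_const.mul (hfij _ _))
    · exact fun l _ => hintegral _ ((continuous_finsetSum _ fun m _ =>
        continuous_const.mul (hfij _ _)).mul continuous_const)
  have hinv : ∀ k₀ : K, ((k₀ : GLN N) : Mat N)ᴴ * H * ((k₀ : GLN N) : Mat N) = H := by
    intro k₀
    ext i j
    rw [hsand]
    have e : ∀ k, ((k₀ : GLN N) : Mat N)ᴴ * f k * ((k₀ : GLN N) : Mat N) = f (k₀⁻¹ * k) := by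
      intro k
      simp only [f, c, Subgroup.coe_mul, Subgroup.coe_inv, _root_.mul_inv_rev, inv_inv, Units.val_mul,
        Matrix.conjTranspose_mul, mul_assoc]
    simp only [e]
    exact integral_mul_left_eq_self (fun k => f k i j) k₀⁻¹
  have hpos : H.PosDef := by
    refine PosDef.of_dotProduct_mulVec_pos ?_ ?_
    · ext i j
      simp only [H, Matrix.conjTranspose_apply, Matrix.of_apply]
      have h1 : ∀ k, f k i j = (starRingEnd ℂ) (f k j i) := by
        intro k
        have : (f k)ᴴ = f k := by simp [f]
        exact (congrFun (congrFun this i) j).symm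
      simp only [h1, integral_conj]
      rfl
    · intro v hv
      let w : K → Fin N → ℂ := fun k => c k *ᵥ v
      have hw : Continuous w := hc.matrix_mulVec continuous_const
      have e1 : star v ⬝ᵥ (H *ᵥ v) = ∫ k, (star (w k) ⬝ᵥ w k) ∂μ := by
        have h2 : ∀ k, star (w k) ⬝ᵥ w k = star v ⬝ᵥ (f k *ᵥ v) := by
          intro k
          simp only [w, f, Matrix.star_mulVec, Matrix.dotProduct_mulVec, Matrix.vecMul_vecMul]
        simp only [h2]
        simp only [dotProduct, Matrix.mulVec, H, Matrix.of_apply]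
        rw [integral_finsetSum]
        · refine Finset.sum_congr rfl fun l _ => ?_
          rw [integral_const_mul, integral_finsetSum]
          · congr 1
            exact Finset.sum_congr rfl fun m _ => (integral_mul_const _ _).symm
          · exact fun m _ => hintegral _ ((hfij _ _).mul continuous_const)
        · exact fun l _ => hintegral _ (continuous_const.mul (continuous_finsetSum _ fun m _ =>
            (hfij _ _).mul continuous_const))
      have e2 : ∀ k, star (w k) ⬝ᵥ w k = ((∑ i, ‖w k i‖ ^ 2 : ℝ) : ℂ) := by
        intro k
        simp only [dotProduct, Pi.star_apply]
        push_cast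
        refine Finset.sum_congr rfl fun i _ => ?_
        rw [← Complex.conj_mul']
        rfl
      rw [e1]
      simp only [e2]
      rw [integral_complex_ofReal]
      have h3 : 0 < ∫ k, (∑ i, ‖w k i‖ ^ 2 : ℝ) ∂μ := by
        refine Continuous.integral_pos_of_hasCompactSupport_nonneg_nonzero (x := 1) ?_
          (HasCompactSupport.of_compactSpace _) (fun k => by positivity) ?_
        · exact continuous_finsetSum _ fun i _ => (((continuous_apply i).comp hw).norm).pow 2
        · intro h0
          apply hv
          have hw1 : w 1 = v := by simp [w, c]
          rw [hw1] at h0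
          funext i
          have := (Finset.sum_eq_zero_iff_of_nonneg (fun i _ => by positivity)).1 h0 i (Finset.mem_univ i)
          simpa using this
      exact_mod_cast h3
  -- A factorization H = yᴴy of the averaged Gram matrix; y is the required change of coordinates,
  -- in which K becomes unitary.
  obtain ⟨y, hy⟩ : ∃ y : Mat N, H = yᴴ * y := by
    open scoped MatrixOrder Matrix.Norms.L2Operator in
    exact CStarAlgebra.nonneg_iff_eq_star_mul_self.mp hpos.posSemidef.nonneg
  have hyu : IsUnit y := by
    have := hpos.isUnit
    rw [hy] at this
    rw [Matrix.isUnit_iff_isUnit_det] at this ⊢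
    rw [Matrix.det_mul] at this
    exact isUnit_of_mul_isUnit_right this
  obtain ⟨S, rfl⟩ := hyu
  refine ⟨S, fun k hk => ?_⟩
  have h := hinv ⟨k, hk⟩
  rw [hy] at h
  have h' : (((S : GLN N) : Mat N) * (k : Mat N) * ((S⁻¹ : GLN N) : Mat N))ᴴ *
      (((S : GLN N) : Mat N) * (k : Mat N) * ((S⁻¹ : GLN N) : Mat N)) = 1 := by
    have e : (((S⁻¹ : GLN N) : Mat N))ᴴ * ((S : Mat N))ᴴ = 1 := by
      rw [← Matrix.conjTranspose_mul, ← Units.val_mul, mul_inv_cancel, Units.val_one,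
        Matrix.conjTranspose_one]
    have e' : (S : Mat N) * ((S⁻¹ : GLN N) : Mat N) = 1 := by
      rw [← Units.val_mul, mul_inv_cancel, Units.val_one]
    have h2 := congrArg (fun z => (((S⁻¹ : GLN N) : Mat N))ᴴ * z * ((S⁻¹ : GLN N) : Mat N)) h
    simp only [Matrix.conjTranspose_mul, mul_assoc] at h2 ⊢
    rw [h2, e', mul_one, e]
  apply conj_injective S
  rw [conj_mul, conj_dag, h']
  simp

end Average

namespace CartanInvolution

variable {N : ℕ} {X : HorosymmetricSpace N} (C : CartanInvolution X)

/-- On 𝔨, the fixed points of dθ, one-parameter groups lie in K and are unitary, so the adjoint is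
-1 there. Both dθ and minus the adjoint are conjugate-linear and 𝔤 = 𝔨 + i𝔨, so they agree
everywhere. -/
theorem exists_dag : ∃ S : GLN N, ∀ x : lie X.G, (C.dθ x : Mat N) = -dag S x := by
  obtain ⟨S, hS⟩ := exists_unitary_of_isCompact C.compact
  refine ⟨S, ?_⟩
  have key : ∀ x : lie X.G, C.dθ x = x → dag S (x : Mat N) = -x := by
    intro x hx
    apply eq_of_exp
    intro s
    have hmem : expGL (s • (x : Mat N)) ∈ fixedSubgroup X.G C.θ := by
      refine ⟨expIn X.G_closed ((s : ℂ) • x), ?_, expIn_smul X.G_closed s x⟩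
      change C.θ _ = _
      rw [C.θ_exp, dθ_smul, hx]
      rfl
    have h := hS _ hmem
    apply Units.ext
    rw [coe_expGL, dag_exp] at h
    have h2 : dag S (s • (x : Mat N)) = s • dag S (x : Mat N) := by
      have := (dag S).map_smulₛₗ (s : ℂ) (x : Mat N)
      simpa using this
    rw [h2] at h
    have h3 := congrArg (fun z => z * NormedSpace.exp (-(s • (x : Mat N)))) h
    simp only [mul_assoc, one_mul] at h3
    have h4 : NormedSpace.exp (s • (x : Mat N)) * NormedSpace.exp (-(s • (x : Mat N))) = 1 :=
      (expGL (s • (x : Mat N))).val_inv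
    rw [h4, mul_one] at h3
    rw [coe_expGL, coe_expGL, h3, smul_neg]
  intro x
  let y : lie X.G := (1 / 2 : ℂ) • (x + C.dθ x)
  let z : lie X.G := (-Complex.I / 2) • (x - C.dθ x)
  have hy : C.dθ y = y := by
    simp only [y, LinearMap.map_smulₛₗ, map_add, C.dθ_dθ]
    rw [add_comm]
    congr 1
    rw [map_div₀, map_one, map_ofNat]
  have hz : C.dθ z = z := by
    simp only [z, LinearMap.map_smulₛₗ, map_sub, C.dθ_dθ]
    rw [← neg_sub, smul_neg, ← neg_smul]
    congr 1
    rw [map_div₀, map_neg, Complex.conj_I, map_ofNat, neg_neg, neg_div]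
  have hx : x = y + Complex.I • z := by
    simp only [y, z, smul_smul]
    have : Complex.I * (-Complex.I / 2) = 1 / 2 := by
      rw [mul_div_assoc', mul_neg, Complex.I_mul_I, neg_neg]
    rw [this, ← smul_add]
    have e : x + C.dθ x + (x - C.dθ x) = (2 : ℂ) • x := by
      rw [two_smul]; abel
    rw [e, smul_smul]
    norm_num
  clear_value y z
  have h1 : C.dθ x = y - Complex.I • z := by
    conv_lhs => rw [hx]
    rw [map_add, LinearMap.map_smulₛₗ, hy, hz]
    simp [sub_eq_add_neg]
  have h2 : dag S (x : Mat N) = -(y : Mat N) + Complex.I • (z : Mat N) := by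
    conv_lhs => rw [hx]
    have : ((y + Complex.I • z : lie X.G) : Mat N) = (y : Mat N) + Complex.I • (z : Mat N) := rfl
    rw [this, map_add, LinearMap.map_smulₛₗ, key y hy, key z hz]
    simp
  rw [h1, h2]
  have : ((y - Complex.I • z : lie X.G) : Mat N) = (y : Mat N) - Complex.I • (z : Mat N) := rfl
  rw [this]
  abel

/-- The group version θ(g) = (g†)⁻¹. Both sides are homomorphisms that agree on exponentials, and
these generate the connected group G. It is needed to see that L itself, not only its Lie algebra,
is stable under the adjoint. -/
theorem θ_mul_dag {S : GLN N} (hS : ∀ x : lie X.G, (C.dθ x : Mat N) = -dag S x) (g : X.G) :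
    ((C.θ g : GLN N) : Mat N) * dag S ((g : GLN N) : Mat N) = 1 := by
  let B : Subgroup (GLN N) :=
    { carrier := {g | ∃ h : g ∈ X.G, ((C.θ ⟨g, h⟩ : GLN N) : Mat N) * dag S (g : Mat N) = 1}
      one_mem' := ⟨X.G.one_mem, by
        have : (⟨1, X.G.one_mem⟩ : X.G) = 1 := rfl
        rw [this, map_one]
        simp [dag_one]⟩
      mul_mem' := by
        rintro a b ⟨ha, ha'⟩ ⟨hb, hb'⟩
        refine ⟨X.G.mul_mem ha hb, ?_⟩
        have : (⟨a * b, X.G.mul_mem ha hb⟩ : X.G) = ⟨a, ha⟩ * ⟨b, hb⟩ := rfl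
        rw [this, map_mul, Subgroup.coe_mul, Units.val_mul, Units.val_mul, dag_mul, mul_assoc,
          ← mul_assoc (((C.θ ⟨b, hb⟩ : X.G) : GLN N) : Mat N), hb', one_mul, ha']
      inv_mem' := by
        rintro a ⟨ha, ha'⟩
        refine ⟨X.G.inv_mem ha, ?_⟩
        have : (⟨a⁻¹, X.G.inv_mem ha⟩ : X.G) = (⟨a, ha⟩)⁻¹ := rfl
        rw [this, map_inv, Subgroup.coe_inv]
        have h1 : dag S (a : Mat N) * dag S ((a⁻¹ : GLN N) : Mat N) = 1 := by
          rw [← dag_mul, ← Units.val_mul, inv_mul_cancel, Units.val_one, dag_one]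
        have h2 : (((C.θ ⟨a, ha⟩ : X.G) : GLN N)⁻¹ : GLN N) * (1 : Mat N) = dag S (a : Mat N) := by
          rw [← ha', GL_inv_mul_cancel]
        rw [mul_one] at h2
        rw [h2, h1] }
  have hle : X.G ≤ B := by
    refine le_of_forall_expGL_mem X.G_closed X.G_connected fun x hx => ?_
    refine ⟨exp_mem X.G_closed hx, ?_⟩
    have h1 : C.θ ⟨expGL x, exp_mem X.G_closed hx⟩ = expIn X.G_closed (C.dθ ⟨x, hx⟩) :=
      C.θ_exp ⟨x, hx⟩
    rw [h1]
    simp only [expIn, coe_expGL, hS, dag_exp]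
    exact (expGL (dag S x)).inv_val
  obtain ⟨h, h'⟩ := hle g.2
  exact h'

end CartanInvolution

/-! ### Derivatives at the identity of products of curves -/

section Exponential

variable {𝔸 : Type*} [NormedRing 𝔸] [NormedAlgebra ℂ 𝔸]

theorem hasDerivAt_mul_of_one {f g : ℂ → 𝔸} {f' g' : 𝔸} (hf : HasDerivAt f f' 0)
    (hg : HasDerivAt g g' 0) (hf1 : f 0 = 1) (hg1 : g 0 = 1) :
    HasDerivAt (fun s => f s * g s) (f' + g') 0 := by
  have := hf.mul hg
  rw [hf1, hg1, mul_one, one_mul] at this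
  exact this

variable [CompleteSpace 𝔸]

theorem hasDerivAt_exp_smul_zero (x : 𝔸) :
    HasDerivAt (fun s : ℂ => NormedSpace.exp (s • x)) x 0 := by
  simpa using hasDerivAt_exp_smul_const x (0 : ℂ)

end Exponential

/-! ### Unipotent groups and the filtration of ℂ^N that they shift -/

section Nilpotent

open Matrix

variable {N : ℕ}

/-- All roots of the characteristic polynomial vanish, so it is X^N, and Cayley–Hamilton applies. -/
theorem isNilpotent_of_forall_eigenvalue {x : Mat N}
    (h : ∀ (μ : ℂ) (v : Fin N → ℂ), v ≠ 0 → x *ᵥ v = μ • v → μ = 0) : IsNilpotent x := by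
  have hroots : x.charpoly.roots = Multiset.replicate N 0 := by
    have hsplit : x.charpoly.Splits := IsAlgClosed.splits _
    have hcard := hsplit.natDegree_eq_card_roots
    rw [Matrix.charpoly_natDegree_eq_dim, Fintype.card_fin] at hcard
    rw [Multiset.eq_replicate]
    refine ⟨hcard.symm, fun μ hμ => ?_⟩
    rw [Polynomial.mem_roots x.charpoly_monic.ne_zero, ← Matrix.charpoly_toLin',
      ← Module.End.hasEigenvalue_iff_isRoot_charpoly] at hμ
    obtain ⟨v, hv⟩ := hμ.exists_hasEigenvector
    exact h μ v hv.2 (by simpa using hv.apply_eq_smul)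
  have hp : x.charpoly = Polynomial.X ^ N := by
    have := (IsAlgClosed.splits x.charpoly).eq_prod_roots_of_monic x.charpoly_monic
    rw [hroots] at this
    simpa using this
  refine ⟨N, ?_⟩
  have := x.aeval_self_charpoly
  rwa [hp, map_pow, Polynomial.aeval_X] at this

open scoped Matrix.Norms.Operator in
theorem exp_mulVec_of_eigenvector {x : Mat N} {μ : ℂ} {v : Fin N → ℂ} (h : x *ᵥ v = μ • v) :
    NormedSpace.exp x *ᵥ v = Complex.exp μ • v := by
  have h1 := NormedSpace.exp_series_hasSum_exp' (𝕂 := ℂ) x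
  have h2 := NormedSpace.exp_series_hasSum_exp' (𝕂 := ℂ) μ
  have hpow : ∀ n : ℕ, x ^ n *ᵥ v = μ ^ n • v := by
    intro n
    induction n with
    | zero => simp
    | succ n ih => rw [pow_succ, ← Matrix.mulVec_mulVec, h, Matrix.mulVec_smul, ih, smul_smul, pow_succ']
  let f : Mat N →ₗ[ℂ] (Fin N → ℂ) := (Matrix.mulVecBilin ℂ ℂ).flip v
  have h3 := (LinearMap.toContinuousLinearMap f).hasSum h1
  have h4 := h2.smul_const v
  have e : (⇑(LinearMap.toContinuousLinearMap f) ∘ fun n : ℕ => ((n.factorial : ℂ)⁻¹) • x ^ n) =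
      fun n : ℕ => (((n.factorial : ℂ)⁻¹) • μ ^ n) • v := by
    funext n
    change ((n.factorial : ℂ)⁻¹ • x ^ n) *ᵥ v = _
    rw [Matrix.smul_mulVec, hpow, smul_assoc]
  have h5 := h3.unique (e ▸ h4)
  rw [Complex.exp_eq_exp_ℂ]
  exact h5

/-- The Lie algebra of a unipotent group consists of nilpotent matrices. -/
theorem isNilpotent_of_mem_lie_of_unipotent {U : Subgroup (GLN N)} (hU : IsZariskiClosed U)
    (hu : ∀ u ∈ U, IsNilpotent ((u : Mat N) - 1)) {x : Mat N} (hx : x ∈ lie U) : IsNilpotent x := by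
  apply isNilpotent_of_forall_eigenvalue
  intro μ v hv hμ
  by_contra hne
  -- Scaling by 1/μ turns the eigenvalue into 1; the unipotent element exp(x/μ) would then have the
  -- eigenvalue e ≠ 1.
  have h1 := hu _ (exp_mem hU ((lie U).smul_mem (1 / μ) hx))
  rw [coe_expGL] at h1
  obtain ⟨n, hn⟩ := h1
  have h2 : (NormedSpace.exp ((1 / μ) • x)) *ᵥ v = Complex.exp 1 • v := by
    apply exp_mulVec_of_eigenvector
    rw [Matrix.smul_mulVec, hμ, smul_smul, one_div_mul_cancel hne]
  have h3 : (NormedSpace.exp ((1 / μ) • x) - 1) *ᵥ v = (Complex.exp 1 - 1) • v := by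
    rw [Matrix.sub_mulVec, h2, Matrix.one_mulVec, sub_smul, one_smul]
  have h4 : ∀ k : ℕ, (NormedSpace.exp ((1 / μ) • x) - 1) ^ k *ᵥ v = (Complex.exp 1 - 1) ^ k • v := by
    intro k
    induction k with
    | zero => simp
    | succ k ih => rw [pow_succ, ← Matrix.mulVec_mulVec, h3, Matrix.mulVec_smul, ih, smul_smul, pow_succ']
  have h5 := h4 n
  rw [hn, Matrix.zero_mulVec] at h5
  have h6 : (Complex.exp 1 - 1) ^ n ≠ 0 := by
    apply pow_ne_zero
    rw [sub_ne_zero, ← Complex.ofReal_one, ← Complex.ofReal_exp]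
    norm_cast
    have := Real.add_one_lt_exp (one_ne_zero)
    linarith
  exact hv ((smul_eq_zero.1 h5.symm).resolve_left h6)

/-- The descending filtration of `ℂ^N` by the products of elements of a Lie algebra of matrices. -/
def lowerFiltration (n : LieSubalgebra ℂ (Mat N)) : ℕ → Submodule ℂ (Fin N → ℂ)
  | 0 => ⊤
  | k + 1 => Submodule.span ℂ {w | ∃ x ∈ n, ∃ v ∈ lowerFiltration n k, w = x *ᵥ v}

/-- Engel's theorem for the tautological module ℂ^N, whose lower central series is this filtration.
-/
theorem exists_lowerFiltration_eq_bot {n : LieSubalgebra ℂ (Mat N)}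
    (hn : ∀ x ∈ n, IsNilpotent x) : ∃ k, lowerFiltration n k = ⊥ := by
  let _ : LieRingModule n (Fin N → ℂ) :=
    { bracket := fun x v => (x : Mat N) *ᵥ v
      add_lie := fun x y v => Matrix.add_mulVec _ _ _
      lie_add := fun x v w => Matrix.mulVec_add _ _ _
      leibniz_lie := fun x y v => by
        change (x : Mat N) *ᵥ ((y : Mat N) *ᵥ v) =
          (⁅(x : Mat N), (y : Mat N)⁆) *ᵥ v + (y : Mat N) *ᵥ ((x : Mat N) *ᵥ v)
        rw [Ring.lie_def, Matrix.sub_mulVec, Matrix.mulVec_mulVec, Matrix.mulVec_mulVec]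
        abel }
  have hbr : ∀ (x : n) (v : Fin N → ℂ), ⁅x, v⁆ = (x : Mat N) *ᵥ v := fun x v => rfl
  have : LieModule ℂ n (Fin N → ℂ) :=
    { smul_lie := fun c x v => by rw [hbr, hbr]; exact Matrix.smul_mulVec _ _ _
      lie_smul := fun c x v => by rw [hbr, hbr]; exact Matrix.mulVec_smul _ _ _ }
  have hnil : LieModule.IsNilpotent n (Fin N → ℂ) := by
    rw [LieModule.isNilpotent_iff_forall (R := ℂ)]
    intro x
    obtain ⟨k, hk⟩ := hn x x.2
    refine ⟨k, ?_⟩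
    have : LieModule.toEnd ℂ n (Fin N → ℂ) x = Matrix.toLin' (x : Mat N) := by
      ext1 i
      ext1
      simp [hbr]
    rw [this, ← Matrix.toLin'_pow, hk, map_zero]
  have hlcs : ∀ k, (LieModule.lowerCentralSeries ℂ n (Fin N → ℂ) k).toSubmodule = lowerFiltration n k := by
    intro k
    induction k with
    | zero => simp [lowerFiltration]
    | succ k ih =>
      rw [LieModule.lowerCentralSeries_succ, LieSubmodule.lieIdeal_oper_eq_linear_span', lowerFiltration]
      congr 1
      ext w
      constructor
      · rintro ⟨x, -, v, hv, rfl⟩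
        exact ⟨x, x.2, v, ih ▸ hv, hbr x v⟩
      · rintro ⟨x, hx, v, hv, rfl⟩
        refine ⟨⟨x, hx⟩, trivial, v, ?_, hbr _ _⟩
        rw [← ih] at hv
        exact hv
  obtain ⟨k, hk⟩ := (LieModule.isNilpotent_iff ℂ n (Fin N → ℂ)).1 hnil
  exact ⟨k, by rw [← hlcs, hk]; simp⟩

theorem mulVec_mem_lowerFiltration_succ {n : LieSubalgebra ℂ (Mat N)} {x : Mat N} (hx : x ∈ n) {k : ℕ}
    {v : Fin N → ℂ} (hv : v ∈ lowerFiltration n k) : x *ᵥ v ∈ lowerFiltration n (k + 1) :=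
  Submodule.subset_span ⟨x, hx, v, hv, rfl⟩

theorem lowerFiltration_succ_le (n : LieSubalgebra ℂ (Mat N)) (k : ℕ) :
    lowerFiltration n (k + 1) ≤ lowerFiltration n k := by
  induction k with
  | zero => exact le_top
  | succ k ih =>
    rw [lowerFiltration, Submodule.span_le]
    rintro _ ⟨x, hx, v, hv, rfl⟩
    exact mulVec_mem_lowerFiltration_succ hx (ih hv)

/-- The matrices that shift a filtration by `d`. -/
def shifting (W : ℕ → Submodule ℂ (Fin N → ℂ)) (d : ℕ) : Submodule ℂ (Mat N) where
  carrier := {m | ∀ k, ∀ v ∈ W k, m *ᵥ v ∈ W (k + d)}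
  zero_mem' := fun k v _ => by simp
  add_mem' := fun ha hb k v hv => by
    rw [Matrix.add_mulVec]; exact (W _).add_mem (ha k v hv) (hb k v hv)
  smul_mem' := fun c m hm k v hv => by
    rw [Matrix.smul_mulVec]; exact (W _).smul_mem c (hm k v hv)

theorem mul_mem_shifting {W : ℕ → Submodule ℂ (Fin N → ℂ)} {d d' : ℕ} {a b : Mat N}
    (ha : a ∈ shifting W d) (hb : b ∈ shifting W d') : a * b ∈ shifting W (d' + d) := by
  intro k v hv
  rw [← Matrix.mulVec_mulVec, ← add_assoc]
  exact ha _ _ (hb k v hv)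

theorem trace_eq_zero_of_mem_shifting {W : ℕ → Submodule ℂ (Fin N → ℂ)} (h0 : W 0 = ⊤) {K : ℕ}
    (hK : W K = ⊥) {m : Mat N} (hm : m ∈ shifting W 1) : trace m = 0 := by
  refine (Matrix.isNilpotent_trace_of_isNilpotent ⟨K, ?_⟩).eq_zero
  have h : ∀ k (v : Fin N → ℂ), m ^ k *ᵥ v ∈ W k := by
    intro k
    induction k with
    | zero => intro v; rw [h0]; trivial
    | succ k ih => intro v; rw [pow_succ', ← Matrix.mulVec_mulVec]; exact hm k _ (ih v)
  apply Matrix.ext_of_mulVec_single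
  intro i
  have := h K (Pi.single i 1)
  rw [hK, Submodule.mem_bot] at this
  rw [this, Matrix.zero_mulVec]

/-- Because g(xv) = (gxg⁻¹)(gv), an element that normalizes 𝔫 preserves each step of the filtration
of 𝔫. -/
theorem mem_shifting_zero_of_normalizes {n : LieSubalgebra ℂ (Mat N)} {g : GLN N}
    (hg : ∀ x ∈ n, (g : Mat N) * x * ((g⁻¹ : GLN N) : Mat N) ∈ n) :
    (g : Mat N) ∈ shifting (lowerFiltration n) 0 := by
  intro k
  induction k with
  | zero => intro v _; trivial
  | succ k ih =>
    intro v hv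
    rw [lowerFiltration] at hv
    induction hv using Submodule.span_induction with
    | mem w hw =>
      obtain ⟨x, hx, v, hv, rfl⟩ := hw
      have e : (g : Mat N) *ᵥ (x *ᵥ v) =
          ((g : Mat N) * x * ((g⁻¹ : GLN N) : Mat N)) *ᵥ ((g : Mat N) *ᵥ v) := by
        rw [Matrix.mulVec_mulVec, Matrix.mulVec_mulVec]
        congr 1
        rw [mul_assoc, ← Units.val_mul, inv_mul_cancel, Units.val_one, mul_one]
      rw [e]
      exact mulVec_mem_lowerFiltration_succ (hg x hx) (ih v hv)
    | zero => simp
    | add a b _ _ ha hb => rw [Matrix.mulVec_add]; exact Submodule.add_mem _ ha hb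
    | smul c a _ ha => rw [Matrix.mulVec_smul]; exact Submodule.smul_mem _ c ha

open scoped Matrix.Norms.Operator in
theorem exp_sub_one_mem_shifting {n : LieSubalgebra ℂ (Mat N)} {y : Mat N} (hy : y ∈ n) :
    NormedSpace.exp y - 1 ∈ shifting (lowerFiltration n) 1 := by
  have hpow : ∀ j : ℕ, y ^ (j + 1) ∈ shifting (lowerFiltration n) 1 := by
    intro j
    induction j with
    | zero => rw [zero_add, pow_one]; exact fun k v hv => mulVec_mem_lowerFiltration_succ hy hv
    | succ j ih =>
      intro k v hv
      rw [pow_succ', ← Matrix.mulVec_mulVec]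
      exact lowerFiltration_succ_le _ _ (mulVec_mem_lowerFiltration_succ hy (ih k v hv))
  have h1 := (hasSum_nat_add_iff' 1).2 (NormedSpace.exp_series_hasSum_exp' (𝕂 := ℂ) y)
  simp only [Finset.range_one, Finset.sum_singleton, Nat.factorial_zero, Nat.cast_one, inv_one,
    pow_zero, one_smul] at h1
  refine (Submodule.closed_of_finiteDimensional (shifting (lowerFiltration n) 1)).mem_of_tendsto h1
    (Eventually.of_forall fun s => ?_)
  exact Submodule.sum_mem _ fun j _ => Submodule.smul_mem _ _ (hpow j)

end Nilpotent

/-! ### The Lie algebra of a Levi decomposition -/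

section Levi

open Matrix

variable {N : ℕ} {P U L : Subgroup (GLN N)}

theorem conj_mem_lie_of_normal {A B : Subgroup (GLN N)}
    (hn : (B.subgroupOf A).Normal) (hBA : B ≤ A) {a : GLN N} (ha : a ∈ A) {x : Mat N} (hx : x ∈ lie B) :
    (a : Mat N) * x * ((a⁻¹ : GLN N) : Mat N) ∈ lie B := by
  intro p hp
  have hp' : VanishesOn B (sandwich (a : Mat N) ((a⁻¹ : GLN N) : Mat N) p) := by
    intro g hg
    rw [evalAt_sandwich]
    have := hn.conj_mem ⟨g, hBA hg⟩ hg ⟨a, ha⟩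
    exact hp (a * g * a⁻¹) this
  have h := hx _ hp'
  rw [sum_pderiv_sandwich] at h
  simpa [diffAtOne, ← Units.val_mul] using h

/-- The elements of the unipotent radical minus one, and its Lie algebra, shift the filtration. -/
theorem IsNormalUnipotent.sub_one_mem_shifting (hU : IsNormalUnipotent P U) {u : GLN N} (hu : u ∈ U) :
    (u : Mat N) - 1 ∈ shifting (lowerFiltration (lie U)) 1 := by
  obtain ⟨hUP, hn, hcl, hconn, -⟩ := hU
  have hzero : ∀ g ∈ U, (g : Mat N) ∈ shifting (lowerFiltration (lie U)) 0 := fun g hg =>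
    mem_shifting_zero_of_normalizes fun x hx => conj_mem_lie hg hx
  let B : Subgroup (GLN N) :=
    { carrier := {g | g ∈ U ∧ (g : Mat N) - 1 ∈ shifting (lowerFiltration (lie U)) 1}
      one_mem' := ⟨U.one_mem, by simp⟩
      mul_mem' := by
        rintro a b ⟨ha, ha'⟩ ⟨hb, hb'⟩
        refine ⟨U.mul_mem ha hb, ?_⟩
        have e : ((a * b : GLN N) : Mat N) - 1 = ((a : Mat N) - 1) * (b : Mat N) + ((b : Mat N) - 1) := by
          rw [Units.val_mul, sub_mul, one_mul]; abel
        rw [e]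
        exact Submodule.add_mem _ (by simpa using mul_mem_shifting ha' (hzero b hb)) hb'
      inv_mem' := by
        rintro a ⟨ha, ha'⟩
        refine ⟨U.inv_mem ha, ?_⟩
        have e : ((a⁻¹ : GLN N) : Mat N) - 1 = -(((a : Mat N) - 1) * ((a⁻¹ : GLN N) : Mat N)) := by
          rw [sub_mul, ← Units.val_mul, mul_inv_cancel, Units.val_one, one_mul]; abel
        rw [e]
        exact Submodule.neg_mem _ (by simpa using mul_mem_shifting ha' (hzero _ (U.inv_mem ha))) }
  have hle : U ≤ B := le_of_forall_expGL_mem hcl hconn fun x hx =>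
    ⟨exp_mem hcl hx, exp_sub_one_mem_shifting hx⟩
  exact (hle hu).2

theorem IsNormalUnipotent.mem_shifting_zero (hU : IsNormalUnipotent P U) {g : GLN N} (hg : g ∈ P) :
    (g : Mat N) ∈ shifting (lowerFiltration (lie U)) 0 :=
  mem_shifting_zero_of_normalizes fun _ hx => conj_mem_lie_of_normal hU.2.1 hU.1 hg hx

/-- The factor u - 1 lowers the filtration by one step and g preserves it, so the product is
nilpotent. This is the source of all orthogonality between the unipotent radical and P. -/
theorem IsNormalUnipotent.trace_sub_one_mul (hU : IsNormalUnipotent P U) {u g : GLN N} (hu : u ∈ U)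
    (hg : g ∈ P) : trace (((u : Mat N) - 1) * (g : Mat N)) = 0 := by
  obtain ⟨K, hK⟩ := exists_lowerFiltration_eq_bot fun x hx =>
    isNilpotent_of_mem_lie_of_unipotent hU.2.2.1 hU.2.2.2.2 hx
  refine trace_eq_zero_of_mem_shifting rfl hK ?_
  simpa using mul_mem_shifting (hU.sub_one_mem_shifting hu) (hU.mem_shifting_zero hg)

/-- The infinitesimal form of the same fact: 𝔲 is orthogonal to 𝔭 for the trace form. -/
theorem IsNormalUnipotent.trace_mul (hU : IsNormalUnipotent P U) (hP : IsZariskiClosed P) {u x : Mat N}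
    (hu : u ∈ lie U) (hx : x ∈ lie P) : trace (u * x) = 0 := by
  obtain ⟨K, hK⟩ := exists_lowerFiltration_eq_bot fun x hx =>
    isNilpotent_of_mem_lie_of_unipotent hU.2.2.1 hU.2.2.2.2 hx
  refine trace_eq_zero_of_mem_shifting rfl hK ?_
  have h1 : u ∈ shifting (lowerFiltration (lie U)) 1 := fun k v hv =>
    mulVec_mem_lowerFiltration_succ hu hv
  have h2 : x ∈ shifting (lowerFiltration (lie U)) 0 :=
    mem_of_forall_exp_mem fun s => hU.mem_shifting_zero (exp_mem hP ((lie P).smul_mem s hx))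
  simpa using mul_mem_shifting h1 h2

theorem IsNormalUnipotent.isNilpotent (hU : IsNormalUnipotent P U) {u : Mat N} (hu : u ∈ lie U) :
    IsNilpotent u := isNilpotent_of_mem_lie_of_unipotent hU.2.2.1 hU.2.2.2.2 hu

/-- The trace form is nondegenerate on a subspace stable under an adjoint. -/
theorem exists_traceProjection {S : GLN N} {V : Submodule ℂ (Mat N)} (hV : ∀ x ∈ V, dag S x ∈ V) :
    ∃ D : Mat N →ₗ[ℂ] Mat N, (∀ b, D b ∈ V) ∧ ∀ b, ∀ x ∈ V, (∀ c ∈ V, trace (b * c) = trace (x * c)) → D b = x := by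
  let τ : Mat N →ₗ[ℂ] Module.Dual ℂ V :=
    { toFun := fun b =>
        { toFun := fun c => trace (b * (c : Mat N))
          map_add' := fun c d => by simp [mul_add]
          map_smul' := fun r c => by simp }
      map_add' := fun b c => by ext d; simp [add_mul]
      map_smul' := fun r c => by ext d; simp }
  have hinj : Function.Injective (τ ∘ₗ V.subtype) := by
    rw [← LinearMap.ker_eq_bot, LinearMap.ker_eq_bot']
    intro c hc
    have h := LinearMap.congr_fun hc ⟨dag S c, hV c c.2⟩
    exact Subtype.ext (trace_mul_dag_self_eq_zero S h)
  let E : V ≃ₗ[ℂ] Module.Dual ℂ V :=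
    LinearEquiv.ofInjectiveOfFinrankEq (τ ∘ₗ V.subtype) hinj Subspace.dual_finrank_eq.symm
  refine ⟨V.subtype ∘ₗ E.symm.toLinearMap ∘ₗ τ, fun b => (E.symm (τ b)).2, fun b x hx h => ?_⟩
  have : τ b = E ⟨x, hx⟩ := by
    ext c
    exact h c c.2
  change ((E.symm (τ b) : V) : Mat N) = x
  rw [this, LinearEquiv.symm_apply_apply]

theorem dag_mem_span {S : GLN N} (hd : ∀ g ∈ L, ∃ g' ∈ L, dag S (g : Mat N) = (g' : Mat N)) {x : Mat N}
    (hx : x ∈ Submodule.span ℂ {m : Mat N | ∃ g ∈ L, (g : Mat N) = m}) :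
    dag S x ∈ Submodule.span ℂ {m : Mat N | ∃ g ∈ L, (g : Mat N) = m} := by
  induction hx using Submodule.span_induction with
  | mem m hm =>
    obtain ⟨g, hg, rfl⟩ := hm
    obtain ⟨g', hg', e⟩ := hd g hg
    exact Submodule.subset_span ⟨g', hg', e.symm⟩
  | zero => simp
  | add a b _ _ ha hb => rw [map_add]; exact Submodule.add_mem _ ha hb
  | smul c a _ ha => rw [LinearMap.map_smulₛₗ]; exact Submodule.smul_mem _ _ ha

open scoped Matrix.Norms.Operator in
/-- The Lie algebra of a semidirect product with a unipotent group is the sum of the Lie algebras. -/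
theorem IsLevi.exists_lie_add {S : GLN N} (hP : IsZariskiClosed P) (hU : IsNormalUnipotent P U)
    (hL : IsLevi P U L) (hd : ∀ g ∈ L, ∃ g' ∈ L, dag S (g : Mat N) = (g' : Mat N)) {x : Mat N}
    (hx : x ∈ lie P) : ∃ u ∈ lie U, ∃ y ∈ lie L, x = u + y := by
  let V : Submodule ℂ (Mat N) := Submodule.span ℂ {m : Mat N | ∃ g ∈ L, (g : Mat N) = m}
  -- The trace projection onto the span of L. Since tr((u-1)yc) = 0 for c in L, it sends uy to y.
  -- The Levi projection of the group thus extends to a linear map, which can be differentiated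
  -- without knowing that P is a product of manifolds.
  obtain ⟨D, hDV, hD⟩ := exists_traceProjection (V := V) fun x hx => dag_mem_span hd hx
  have hnorm : U ≤ P := hU.1
  have hdec : ∀ g ∈ P, ∃ u ∈ U, ∃ y ∈ L, g = u * y := by
    intro g hg
    rw [← hL.sup_eq] at hg
    have hle : L ≤ Subgroup.normalizer (U : Set (GLN N)) :=
      hL.le.trans (Subgroup.normal_subgroupOf_iff_le_normalizer hnorm |>.1 hU.2.1)
    have h := Subgroup.coe_mul_of_right_le_normalizer_left U L hle
    have hg' : g ∈ ((U ⊔ L : Subgroup (GLN N)) : Set (GLN N)) := hg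
    rw [h] at hg'
    obtain ⟨u, hu, y, hy, e⟩ := hg'
    exact ⟨u, hu, y, hy, e.symm⟩
  have hDg : ∀ u ∈ U, ∀ y ∈ L, D ((u * y : GLN N) : Mat N) = (y : Mat N) := by
    intro u hu y hy
    refine hD _ _ (Submodule.subset_span ⟨y, hy, rfl⟩) fun c hc => ?_
    induction hc using Submodule.span_induction with
    | mem m hm =>
      obtain ⟨g, hg, rfl⟩ := hm
      have := hU.trace_sub_one_mul hu (hL.le (L.mul_mem hy hg))
      rw [sub_mul, one_mul, Matrix.trace_sub, sub_eq_zero] at this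
      rw [Units.val_mul, mul_assoc, ← Units.val_mul, this]
    | zero => simp
    | add a b _ _ ha hb => rw [mul_add, mul_add, Matrix.trace_add, Matrix.trace_add, ha, hb]
    | smul c a _ ha => rw [mul_smul_comm, mul_smul_comm, Matrix.trace_smul, Matrix.trace_smul, ha]
  have hexp : ∀ s : ℂ, expGL (s • x) ∈ P := fun s => exp_mem hP ((lie P).smul_mem s hx)
  have hder : HasDerivAt (fun s : ℂ => NormedSpace.exp (s • x)) x 0 :=
    hasDerivAt_exp_smul_zero x
  have hder' : HasDerivAt (fun s : ℂ => NormedSpace.exp (s • (-x))) (-x) 0 :=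
    hasDerivAt_exp_smul_zero (-x)
  have hDder : HasDerivAt (fun s : ℂ => D (NormedSpace.exp (s • x))) (D x) 0 :=
    (LinearMap.toContinuousLinearMap D).hasFDerivAt.comp_hasDerivAt 0 hder
  have hDder' : HasDerivAt (fun s : ℂ => D (NormedSpace.exp (s • (-x)))) (D (-x)) 0 :=
    (LinearMap.toContinuousLinearMap D).hasFDerivAt.comp_hasDerivAt 0 hder'
  have hD1 : D 1 = 1 := by simpa using hDg 1 U.one_mem 1 L.one_mem
  have hDL : ∀ s : ℂ, ∃ g ∈ L, (g : Mat N) = D (NormedSpace.exp (s • x)) := by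
    intro s
    obtain ⟨u, hu, y, hy, e⟩ := hdec _ (hexp s)
    refine ⟨y, hy, ?_⟩
    rw [← hDg u hu y hy, ← e, coe_expGL]
  have hy : D x ∈ lie L := mem_lie_of_hasDerivAt hDder (by simp [hD1]) hDL
  -- If exp(sx) = uy, then exp(-sx) = (y⁻¹u⁻¹y)y⁻¹ is mapped by D to y⁻¹. The product is u, so this
  -- is a curve in U with derivative x - D(x).
  have hmul : HasDerivAt (fun s : ℂ => NormedSpace.exp (s • x) * D (NormedSpace.exp (s • (-x)))) (x - D x) 0 := by
    have := hasDerivAt_mul_of_one hder hDder' (by simp) (by simp [hD1])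
    rwa [map_neg, ← sub_eq_add_neg] at this
  have hu : x - D x ∈ lie U := by
    refine mem_lie_of_hasDerivAt hmul (by simp [hD1]) fun s => ?_
    obtain ⟨u, hu, y, hy, e⟩ := hdec _ (hexp s)
    refine ⟨u, hu, ?_⟩
    have e2 : expGL (s • (-x)) = (y⁻¹ * u⁻¹ * y) * y⁻¹ := by
      have : expGL (s • (-x)) = (expGL (s • x))⁻¹ := by
        apply Units.ext
        rw [smul_neg]
        rfl
      rw [this, e]
      group
    have hmem : y⁻¹ * u⁻¹ * y ∈ U := by
      have := hU.2.1.conj_mem ⟨u⁻¹, hnorm (U.inv_mem hu)⟩ (U.inv_mem hu) ⟨y⁻¹, hL.le (L.inv_mem hy)⟩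
      simpa [Subgroup.mem_subgroupOf] using this
    have h3 := hDg _ hmem _ (L.inv_mem hy)
    rw [← e2, coe_expGL] at h3
    rw [h3, ← coe_expGL, e, ← Units.val_mul, mul_inv_cancel_right]
  exact ⟨x - D x, hu, D x, hy, by abel⟩

end Levi

/-! ### Sums of real exponentials and their leading terms -/

section ExponentialSums

open Matrix

/-- The functions `s ↦ e^{μ s}`. -/
def realExponential : Multiplicative ℝ →* (ℝ → ℂ) where
  toFun μ s := Complex.exp ((μ.toAdd * s : ℝ) : ℂ)
  map_one' := by funext s; simp
  map_mul' μ ν := by funext s; simp [add_mul, Complex.exp_add]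

/-- The finite sums of real exponentials. -/
def exponentialSums : Subalgebra ℂ (ℝ → ℂ) := (AddMonoidAlgebra.lift ℂ (ℝ → ℂ) ℝ realExponential).range

theorem realExponential_mem (μ : ℝ) : (fun s : ℝ => Complex.exp ((μ * s : ℝ) : ℂ)) ∈ exponentialSums :=
  ⟨AddMonoidAlgebra.of ℂ ℝ (Multiplicative.ofAdd μ), by
    rw [AlgHom.toRingHom_eq_coe, RingHom.coe_coe, AddMonoidAlgebra.lift_of]; rfl⟩

theorem exists_sum_of_mem_exponentialSums {f : ℝ → ℂ} (hf : f ∈ exponentialSums) :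
    ∃ c : ℝ →₀ ℂ, ∀ s, f s = ∑ μ ∈ c.support, c μ * Complex.exp ((μ * s : ℝ) : ℂ) := by
  obtain ⟨p, rfl⟩ := hf
  refine ⟨p.coeff, fun s => ?_⟩
  change (AddMonoidAlgebra.lift ℂ (ℝ → ℂ) ℝ realExponential p) s = _
  rw [AddMonoidAlgebra.lift_apply, Finsupp.sum, Finset.sum_apply]
  rfl

variable {N : ℕ}

theorem evalAt_mem_exponentialSums {c : ℝ → Mat N} (hc : ∀ i j, (fun s => c s i j) ∈ exponentialSums)
    (p : MatPoly N) : (fun s => evalAt (c s) p) ∈ exponentialSums := by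
  induction p using MvPolynomial.induction_on with
  | C a =>
    have : (fun s => evalAt (c s) (MvPolynomial.C a)) = algebraMap ℂ (ℝ → ℂ) a := by
      funext s; simp [evalAt]
    rw [this]
    exact exponentialSums.algebraMap_mem a
  | add p q hp hq =>
    have : (fun s => evalAt (c s) (p + q)) = (fun s => evalAt (c s) p) + fun s => evalAt (c s) q := by
      funext s; simp [evalAt]
    rw [this]
    exact exponentialSums.add_mem hp hq
  | mul_X p ij hp =>
    have : (fun s => evalAt (c s) (p * MvPolynomial.X ij)) =
        (fun s => evalAt (c s) p) * fun s => c s ij.1 ij.2 := by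
      funext s; simp [evalAt]
    rw [this]
    exact exponentialSums.mul_mem hp (hc _ _)

theorem det_mem_exponentialSums {c : ℝ → Mat N} (hc : ∀ i j, (fun s => c s i j) ∈ exponentialSums) :
    (fun s => (c s).det) ∈ exponentialSums := by
  have : (fun s => (c s).det) =
      ∑ σ : Equiv.Perm (Fin N), Equiv.Perm.sign σ • ∏ i, fun s => c s (σ i) i := by
    funext s
    rw [Matrix.det_apply, Finset.sum_apply]
    refine Finset.sum_congr rfl fun σ _ => ?_
    rw [Pi.smul_apply, Finset.prod_apply]
  rw [this]
  refine Subalgebra.sum_mem _ fun σ _ => ?_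
  have h : (∏ i, fun s => c s (σ i) i) ∈ exponentialSums := Subalgebra.prod_mem _ fun i _ => hc _ _
  rw [Units.smul_def]
  exact zsmul_mem h _

/-- The eigenvalues of a self-adjoint matrix are real, so no oscillating terms appear. This is what
makes the rescaled limits below exist. -/
theorem exp_real_smul_mem_exponentialSums {S : GLN N} {x : Mat N} (hx : dag S x = x) (i j : Fin N) :
    (fun s : ℝ => NormedSpace.exp (s • x) i j) ∈ exponentialSums := by
  obtain ⟨g, d, hg⟩ := exists_diagonal_of_dag_eq hx
  have hx' : ∀ s : ℝ, s • x = ((g⁻¹ : GLN N) : Mat N) * (diagonal fun k => ((d k * s : ℝ) : ℂ)) * (g : Mat N) := by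
    intro s
    have e : (diagonal fun k => ((d k * s : ℝ) : ℂ)) = s • ((g : Mat N) * x * ((g⁻¹ : GLN N) : Mat N)) := by
      rw [hg]
      ext a b
      by_cases h : a = b
      · subst h; simp [mul_comm]
      · simp [h]
    rw [e, mul_smul_comm, smul_mul_assoc, mul_assoc, mul_assoc, mul_assoc, GL_inv_mul_cancel,
      ← Units.val_mul, inv_mul_cancel, Units.val_one, mul_one]
  have hexp : ∀ s : ℝ, NormedSpace.exp (s • x) i j =
      ∑ k, (((g⁻¹ : GLN N) : Mat N) i k * (g : Mat N) k j) * Complex.exp ((d k * s : ℝ) : ℂ) := by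
    intro s
    have h := Matrix.exp_units_conj g⁻¹ (diagonal fun k => ((d k * s : ℝ) : ℂ))
    rw [inv_inv] at h
    rw [hx', h, Matrix.exp_diagonal, Matrix.mul_apply]
    refine Finset.sum_congr rfl fun k _ => ?_
    rw [Matrix.mul_diagonal, Pi.coe_exp, ← Complex.exp_eq_exp_ℂ]
    ring
  have : (fun s : ℝ => NormedSpace.exp (s • x) i j) =
      ∑ k, (((g⁻¹ : GLN N) : Mat N) i k * (g : Mat N) k j) • fun s : ℝ => Complex.exp ((d k * s : ℝ) : ℂ) := by
    funext s
    rw [hexp, Finset.sum_apply]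
    rfl
  rw [this]
  exact Subalgebra.sum_mem _ fun k _ => Subalgebra.smul_mem _ (realExponential_mem (d k)) _

/-- The leading term of a vector-valued exponential sum. -/
theorem exists_leading_term {M : ℕ} {f : ℝ → Fin M → ℂ} (hf : ∀ i, (fun s => f s i) ∈ exponentialSums)
    (h0 : f 0 ≠ 0) : ∃ (μ : ℝ) (w : Fin M → ℂ), w ≠ 0 ∧
      Tendsto (fun s : ℝ => Complex.exp ((-(μ * s) : ℝ) : ℂ) • f s) atTop (𝓝 w) := by
  classical
  choose c hc using fun i => exists_sum_of_mem_exponentialSums (hf i)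
  let T : Finset ℝ := Finset.univ.biUnion fun i => (c i).support
  have hT : T.Nonempty := by
    rw [Finset.nonempty_iff_ne_empty]
    intro hT
    apply h0
    funext i
    have h1 : (c i).support = ∅ := by
      rw [← Finset.subset_empty, ← hT]
      exact Finset.subset_biUnion_of_mem (fun i => (c i).support) (Finset.mem_univ i)
    have := hc i 0
    rw [h1, Finset.sum_empty] at this
    exact this
  -- The largest exponent occurring in any coordinate; after multiplication by e^{-μs} every other
  -- term decays.
  let μ := T.max' hT
  refine ⟨μ, fun i => c i μ, ?_, ?_⟩
  · intro h
    obtain ⟨i, -, hi⟩ := Finset.mem_biUnion.1 (T.max'_mem hT)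
    exact (Finsupp.mem_support_iff.1 hi) (congrFun h i)
  · rw [tendsto_pi_nhds]
    intro i
    have e : ∀ s : ℝ, (Complex.exp ((-(μ * s) : ℝ) : ℂ) • f s) i =
        ∑ ν ∈ (c i).support, c i ν * Complex.exp (((ν - μ) * s : ℝ) : ℂ) := by
      intro s
      rw [Pi.smul_apply, hc i s, Finset.smul_sum]
      refine Finset.sum_congr rfl fun ν _ => ?_
      rw [smul_eq_mul, mul_left_comm, ← Complex.exp_add]
      congr 2
      push_cast
      ring
    simp only [e]
    have e2 : c i μ = ∑ ν ∈ (c i).support, if ν = μ then c i ν else 0 := by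
      rw [Finset.sum_ite_eq']
      split_ifs with h
      · rfl
      · exact Finsupp.notMem_support_iff.1 h
    rw [e2]
    refine tendsto_finsetSum _ fun ν hν => ?_
    split_ifs with h
    · simp [h]
    · have hlt : ν < μ := lt_of_le_of_ne
        (T.le_max' ν (Finset.mem_biUnion.2 ⟨i, Finset.mem_univ i, hν⟩)) h
      have h1 : Tendsto (fun s : ℝ => Real.exp ((ν - μ) * s)) atTop (𝓝 0) :=
        Real.tendsto_exp_atBot.comp ((tendsto_const_mul_atBot_of_neg (sub_neg.2 hlt)).2 tendsto_id)
      have h2 : Tendsto (fun s : ℝ => ((Real.exp ((ν - μ) * s) : ℝ) : ℂ)) atTop (𝓝 ((0 : ℝ) : ℂ)) :=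
        (Complex.continuous_ofReal.tendsto _).comp h1
      simpa only [Complex.ofReal_exp, Complex.ofReal_zero, mul_zero] using h2.const_mul (c i ν)

end ExponentialSums

/-! ### Limits of a self-adjoint flow on a projective orbit -/

section Parabolic

open Matrix

variable {N : ℕ} {G P : Subgroup (GLN N)}

theorem IsAlgebraicHom.entry_eq {M : ℕ} {ρ : G →* GLN M} (hρ : IsAlgebraicHom G ρ) (i j : Fin M) :
    ∃ (p : MatPoly N) (k : ℕ), ∀ g : G, ((ρ g : GLN M) : Mat M) i j =
      evalAt ((g : GLN N) : Mat N) p * Matrix.det (((g : GLN N)⁻¹ : GLN N) : Mat N) ^ k := by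
  obtain ⟨p, k, h⟩ := hρ i j
  refine ⟨p, k, fun g => ?_⟩
  rw [← h g, mul_assoc, ← mul_pow, ← Matrix.det_mul, ← Units.val_mul, mul_inv_cancel, Units.val_one,
    Matrix.det_one, one_pow, mul_one]

theorem IsAlgebraicHom.continuous_val {M : ℕ} {ρ : G →* GLN M} (hρ : IsAlgebraicHom G ρ) :
    Continuous fun g : G => ((ρ g : GLN M) : Mat M) := by
  refine continuous_matrix fun i j => ?_
  obtain ⟨p, k, h⟩ := hρ.entry_eq i j
  simp only [h]
  refine ((continuous_evalAt p).comp (Units.continuous_val.comp continuous_subtype_val)).mul ?_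
  exact ((Units.continuous_val.comp (continuous_inv.comp continuous_subtype_val)).matrix_det).pow k

theorem expGL_add_smul (x : Mat N) (s t : ℝ) : expGL ((s + t) • x) = expGL (s • x) * expGL (t • x) := by
  apply Units.ext
  rw [Units.val_mul, coe_expGL, coe_expGL, coe_expGL, add_smul]
  exact Matrix.exp_add_of_commute _ _ (((Commute.refl x).smul_left s).smul_right t)

theorem expGL_neg (x : Mat N) : expGL (-x) = (expGL x)⁻¹ := Units.ext rfl

theorem conj_expGL (g : GLN N) (x : Mat N) :
    g * expGL x * g⁻¹ = expGL ((g : Mat N) * x * ((g⁻¹ : GLN N) : Mat N)) := by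
  apply Units.ext
  rw [Units.val_mul, Units.val_mul, coe_expGL, coe_expGL]
  exact (Matrix.exp_units_conj g x).symm

/-- Conjugation by an invertible matrix. -/
def conjEquiv (g : GLN N) : Mat N ≃ₗ[ℂ] Mat N where
  toFun z := (g : Mat N) * z * ((g⁻¹ : GLN N) : Mat N)
  map_add' a b := by simp [mul_add, add_mul]
  map_smul' r a := by simp
  invFun z := ((g⁻¹ : GLN N) : Mat N) * z * (g : Mat N)
  left_inv z := by
    simp only [mul_assoc, GL_inv_mul_cancel]
    rw [← Units.val_mul, inv_mul_cancel, Units.val_one, mul_one]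
  right_inv z := by
    simp only [mul_assoc, GL_mul_inv_cancel]
    rw [← Units.val_mul, mul_inv_cancel, Units.val_one, mul_one]

theorem conjEquiv_apply (g : GLN N) (z : Mat N) :
    conjEquiv g z = (g : Mat N) * z * ((g⁻¹ : GLN N) : Mat N) := rfl

theorem tendsto_mulVec {M : ℕ} {ι : Type*} {l : Filter ι} {A : ι → Mat M} {B : ι → Fin M → ℂ} {a : Mat M}
    {b : Fin M → ℂ} (hA : Tendsto A l (𝓝 a)) (hB : Tendsto B l (𝓝 b)) :
    Tendsto (fun i => A i *ᵥ B i) l (𝓝 (a *ᵥ b)) := by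
  rw [tendsto_pi_nhds]
  intro i
  have hij : ∀ j, Tendsto (fun k => A k i j) l (𝓝 (a i j)) := fun j =>
    ((continuous_id.matrix_elem i j).tendsto a).comp hA
  simp only [Matrix.mulVec, dotProduct]
  exact tendsto_finsetSum Finset.univ fun j _ => (hij j).mul (tendsto_pi_nhds.1 hB j)

theorem smul_conj_eq (a b x : Mat N) (t : ℝ) : a * (t • x) * b = t • (a * x * b) := by
  rw [mul_smul_comm, smul_mul_assoc]

open scoped Matrix.Norms.Operator in
theorem continuous_expGL_all : Continuous (expGL : Mat N → GLN N) := by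
  rw [Units.continuous_iff]
  constructor
  · exact NormedSpace.exp_continuous
  · exact NormedSpace.exp_continuous.comp continuous_neg

open scoped Matrix.Norms.Operator in
/-- There is a unit vector in the kernel of a linear map that decreases the dimension. -/
theorem exists_norm_eq_one_of_finrank_lt {V W : Submodule ℂ (Mat N)} (h : Module.finrank ℂ W < Module.finrank ℂ V)
    (f : Mat N →ₗ[ℂ] W) : ∃ z ∈ V, ‖z‖ = 1 ∧ f z = 0 := by
  have hk := LinearMap.ker_ne_bot_of_finrank_lt (f := f ∘ₗ V.subtype) h
  obtain ⟨y, hy, hy0⟩ := (Submodule.ne_bot_iff _).1 hk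
  have hn : ‖(y : Mat N)‖ ≠ 0 := by
    rw [norm_ne_zero_iff]
    exact fun e => hy0 (Subtype.ext e)
  refine ⟨((‖(y : Mat N)‖⁻¹ : ℝ) : ℂ) • (y : Mat N), V.smul_mem _ y.2, ?_, ?_⟩
  · rw [norm_smul]; simp [hn]
  · rw [map_smul]
    have : f (y : Mat N) = 0 := hy
    rw [this, smul_zero]

set_option maxHeartbeats 400000 in
open scoped Matrix.Norms.Operator in
/-- A self-adjoint element of the Lie algebra of `G` that is orthogonal for the trace form to the Lie
algebra of a parabolic subgroup is zero. -/
theorem IsParabolic.eq_zero_of_trace_eq_zero (hG : IsZariskiClosed G) (hP : IsParabolic G P) {S : GLN N}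
    {x : Mat N} (hx : x ∈ lie G) (hd : dag S x = x) (hxP : ∀ y ∈ lie P, trace (x * y) = 0) : x = 0 := by
  obtain ⟨hPG, hPc, M, ρ, v, hρ, hv, hstab, hcone⟩ := hP
  have hmemG : ∀ y ∈ lie G, ∀ s : ℝ, expGL (s • y) ∈ G := fun y hy s =>
    exp_mem hG (by simpa using (lie G).smul_mem (s : ℂ) hy)
  let ex : ℝ → G := fun s => ⟨expGL (s • x), hmemG x hx s⟩
  let f : ℝ → Fin M → ℂ := fun s => ((ρ (ex s) : GLN M) : Mat M) *ᵥ v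
  have hex : ∀ s t, ex (s + t) = ex s * ex t := fun s t => Subtype.ext (expGL_add_smul x s t)
  have hex0 : ex 0 = 1 := by
    apply Subtype.ext; apply Units.ext
    simp [ex, coe_expGL]
  have hf : ∀ i, (fun s => f s i) ∈ exponentialSums := by
    intro i
    have : (fun s => f s i) = ∑ j, (v j) • fun s => ((ρ (ex s) : GLN M) : Mat M) i j := by
      funext s
      rw [Finset.sum_apply]
      simp [f, Matrix.mulVec, dotProduct, mul_comm]
    rw [this]
    refine Subalgebra.sum_mem _ fun j _ => Subalgebra.smul_mem _ ?_ _
    obtain ⟨p, k, h⟩ := hρ.entry_eq i j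
    simp only [h]
    refine exponentialSums.mul_mem (evalAt_mem_exponentialSums (fun a b => exp_real_smul_mem_exponentialSums hd a b) p)
      (exponentialSums.pow_mem (det_mem_exponentialSums fun a b => ?_) k)
    have hneg : dag S (-x) = -x := by rw [map_neg, hd]
    have := exp_real_smul_mem_exponentialSums hneg a b
    simp only [smul_neg] at this
    exact this
  have hf0 : f 0 = v := by simp [f, hex0]
  -- The limit of [exp(sx)v] as s → ∞. Closedness of the cone puts [w] in the orbit, and [w] is
  -- fixed by exp(tx), so x lies in Ad(g)𝔭, the stabilizer algebra of [w].
  obtain ⟨μ, w, hw, hlim⟩ := exists_leading_term hf (by rw [hf0]; exact hv)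
  have hwcone := hcone.mem_of_tendsto hlim (Eventually.of_forall fun s => ⟨_, ex s, rfl⟩)
  obtain ⟨c, g, hwg⟩ := hwcone
  have hc : c ≠ 0 := by
    rintro rfl
    exact hw (by rw [hwg, zero_smul])
  have hgv : ((ρ g : GLN M) : Mat M) *ᵥ v = c⁻¹ • w := by
    rw [hwg, smul_smul, inv_mul_cancel₀ hc, one_smul]
  have hstabw : ∀ k : G, (∃ b : ℂ, ((ρ k : GLN M) : Mat M) *ᵥ w = b • w) →
      ((g⁻¹ * k * g : G) : GLN N) ∈ P := by
    rintro k ⟨b, hb⟩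
    rw [hstab]
    refine ⟨b, ?_⟩
    rw [map_mul, map_mul, map_inv, Units.val_mul, Units.val_mul, ← Matrix.mulVec_mulVec, hgv,
      ← Matrix.mulVec_mulVec, Matrix.mulVec_smul, hb, smul_comm, Matrix.mulVec_smul, ← hgv,
      Matrix.mulVec_mulVec, ← Units.val_mul, inv_mul_cancel, Units.val_one, Matrix.one_mulVec]
  let conj : Mat N ≃ₗ[ℂ] Mat N := conjEquiv (g : GLN N)⁻¹
  have hconj : ∀ z : lie G, (∀ t : ℝ, ∃ b : ℂ, ((ρ ⟨expGL (t • (z : Mat N)), hmemG z z.2 t⟩ : GLN M) : Mat M) *ᵥ w = b • w) →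
      conj (z : Mat N) ∈ lie P := by
    intro z hz
    refine mem_lie_of_exp fun t => ?_
    have h1 := hstabw _ (hz t)
    have h2 : expGL (t • conj (z : Mat N)) = (g : GLN N)⁻¹ * expGL (t • (z : Mat N)) * (g : GLN N) := by
      have := conj_expGL (g : GLN N)⁻¹ (t • (z : Mat N))
      rw [smul_conj_eq, ← conjEquiv_apply] at this
      rw [← this, inv_inv]
    rw [h2]
    exact h1
  have hxw : conj x ∈ lie P := by
    refine hconj ⟨x, hx⟩ fun t => ⟨Complex.exp ((μ * t : ℝ) : ℂ), ?_⟩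
    have h1 : Tendsto (fun s : ℝ => ((ρ (ex t) : GLN M) : Mat M) *ᵥ (Complex.exp ((-(μ * s) : ℝ) : ℂ) • f s)) atTop
        (𝓝 (((ρ (ex t) : GLN M) : Mat M) *ᵥ w)) :=
      ((continuous_const.matrix_mulVec continuous_id).tendsto w).comp hlim
    have h2 : Tendsto (fun s : ℝ => Complex.exp ((μ * t : ℝ) : ℂ) •
        (Complex.exp ((-(μ * (t + s)) : ℝ) : ℂ) • f (t + s))) atTop (𝓝 (Complex.exp ((μ * t : ℝ) : ℂ) • w)) :=
      (hlim.comp (tendsto_atTop_add_const_left atTop t tendsto_id)).const_smul _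
    refine tendsto_nhds_unique h1 (h2.congr fun s => ?_)
    rw [smul_smul, ← Complex.exp_add, Matrix.mulVec_smul]
    simp only [f, hex, map_mul, Units.val_mul, Matrix.mulVec_mulVec]
    congr 2
    push_cast
    ring
  by_contra hne
  let V : Submodule ℂ (Mat N) := (lie P).toSubmodule
  -- The part of Ad(g)𝔭 orthogonal to x. It is a proper subspace because x itself lies in Ad(g)𝔭 and
  -- tr(x²) ≠ 0 for a nonzero self-adjoint x.
  let κ : Submodule ℂ (Mat N) := V.map conj.symm.toLinearMap ⊓ LinearMap.ker (Matrix.traceLinearMap (Fin N) ℂ ℂ ∘ₗ LinearMap.mulLeft ℂ x)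
  have hVdim : Module.finrank ℂ (V.map conj.symm.toLinearMap) = Module.finrank ℂ V :=
    LinearEquiv.finrank_map_eq conj.symm V
  have hκ : Module.finrank ℂ κ < Module.finrank ℂ V := by
    rw [← hVdim]
    refine Submodule.finrank_lt_finrank_of_lt (lt_of_le_of_ne inf_le_left fun e => hne ?_)
    have hxm : x ∈ κ := by
      rw [e]
      exact ⟨conj x, hxw, conj.symm_apply_apply x⟩
    have h0 : trace (x * x) = 0 := hxm.2
    apply trace_mul_dag_self_eq_zero S
    rw [hd, h0]
  obtain ⟨pr, hpr⟩ := κ.subtype.exists_leftInverse_of_injective κ.ker_subtype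
  let Ads : ℝ → Mat N ≃ₗ[ℂ] Mat N := fun s => conjEquiv (expGL (s • x))
  -- The spaces Ad(exp(nx))𝔭 have the full dimension of 𝔭, stabilize the lines [exp(nx)v], and
  -- remain orthogonal to x because exp(nx) commutes with x. Each contains a unit vector killed by a
  -- projection onto κ. A limit of these vectors would lie in κ and be killed by the projection,
  -- hence vanish, which is impossible for a unit vector.
  have hz : ∀ n : ℕ, ∃ z ∈ V.map (Ads n).toLinearMap, ‖z‖ = 1 ∧ pr z = 0 := by
    intro n
    refine exists_norm_eq_one_of_finrank_lt ?_ pr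
    rw [LinearEquiv.finrank_map_eq (Ads n) V]
    exact hκ
  choose z hzV hz1 hz0 using hz
  have hzG : ∀ n, z n ∈ lie G := by
    intro n
    obtain ⟨y, hy, e⟩ := hzV n
    rw [← e]
    exact conj_mem_lie (hmemG x hx n) (lie_mono hPG hy)
  have hztr : ∀ n, trace (x * z n) = 0 := by
    intro n
    obtain ⟨y, hy, e⟩ := hzV n
    rw [← e]
    change trace (x * ((expGL ((n : ℝ) • x) : Mat N) * y * (((expGL ((n : ℝ) • x))⁻¹ : GLN N) : Mat N))) = 0
    have hcomm : x * (expGL ((n : ℝ) • x) : Mat N) = (expGL ((n : ℝ) • x) : Mat N) * x := by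
      rw [coe_expGL]
      exact ((Commute.refl x).smul_right (n : ℝ)).exp_right
    rw [← mul_assoc, ← mul_assoc, hcomm, mul_assoc _ x y, trace_conj, hxP y hy]
  have hzstab : ∀ n (t : ℝ), ∃ b : ℂ, ((ρ ⟨expGL (t • z n), hmemG _ (hzG n) t⟩ : GLN M) : Mat M) *ᵥ f n = b • f n := by
    intro n t
    obtain ⟨y, hy, e⟩ := hzV n
    have hyP : expGL (t • y) ∈ P := exp_mem hPc (by simpa using (lie P).smul_mem (t : ℂ) hy)
    obtain ⟨b, hb⟩ := (hstab ⟨expGL (t • y), hPG hyP⟩).1 hyP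
    refine ⟨b, ?_⟩
    have e2 : (⟨expGL (t • z n), hmemG _ (hzG n) t⟩ : G) = ex n * ⟨expGL (t • y), hPG hyP⟩ * (ex n)⁻¹ := by
      apply Subtype.ext
      have h3 := conj_expGL (expGL ((n : ℝ) • x)) (t • y)
      rw [smul_conj_eq, ← conjEquiv_apply] at h3
      have h4 : z n = conjEquiv (expGL ((n : ℝ) • x)) y := e.symm
      change expGL (t • z n) = expGL ((n : ℝ) • x) * expGL (t • y) * (expGL ((n : ℝ) • x))⁻¹
      rw [h4, h3]
    have hval : ∀ a b : GLN M, (a : Mat M) *ᵥ ((b : Mat M) *ᵥ v) = ((a * b : GLN M) : Mat M) *ᵥ v := by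
      intro a b; rw [Matrix.mulVec_mulVec, Units.val_mul]
    simp only [f]
    rw [e2, hval, ← map_mul, inv_mul_cancel_right, map_mul, ← hval, hb, Matrix.mulVec_smul]
  have : ProperSpace (Mat N) := FiniteDimensional.proper ℂ (Mat N)
  obtain ⟨z₀, hz₀, φ, hφ, hφlim⟩ := (isCompact_sphere (0 : Mat N) 1).tendsto_subseq
    (x := z) (fun n => by simpa using hz1 n)
  have hz₀G : z₀ ∈ lie G := (Submodule.closed_of_finiteDimensional (lie G).toSubmodule).mem_of_tendsto hφlim
    (Eventually.of_forall fun n => hzG _)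
  have hz₀tr : trace (x * z₀) = 0 := by
    have h1 : Tendsto (fun n => trace (x * z (φ n))) atTop (𝓝 (trace (x * z₀))) :=
      ((continuous_const.matrix_mul continuous_id).matrix_trace.tendsto z₀).comp hφlim
    exact tendsto_nhds_unique h1 (by simp [hztr])
  have hprc : Continuous pr := LinearMap.continuous_of_finiteDimensional pr
  have hz₀pr : pr z₀ = 0 :=
    tendsto_nhds_unique ((hprc.tendsto z₀).comp hφlim) (by simp [Function.comp_def, hz0])
  have hz₀P : conj z₀ ∈ lie P := by
    refine hconj ⟨z₀, hz₀G⟩ fun t => ?_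
    have hA : Tendsto (fun n => ((ρ ⟨expGL (t • z (φ n)), hmemG _ (hzG (φ n)) t⟩ : GLN M) : Mat M)) atTop
        (𝓝 ((ρ ⟨expGL (t • z₀), hmemG z₀ hz₀G t⟩ : GLN M) : Mat M)) := by
      refine (hρ.continuous_val.tendsto _).comp ?_
      rw [tendsto_subtype_rng]
      exact (continuous_expGL_all.tendsto _).comp (hφlim.const_smul t)
    have hB : Tendsto (fun n => Complex.exp ((-(μ * (φ n : ℝ)) : ℝ) : ℂ) • f (φ n)) atTop (𝓝 w) :=
      hlim.comp (tendsto_natCast_atTop_atTop.comp hφ.tendsto_atTop)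
    have hAB : Tendsto (fun n => ((ρ ⟨expGL (t • z (φ n)), hmemG _ (hzG (φ n)) t⟩ : GLN M) : Mat M) *ᵥ
        (Complex.exp ((-(μ * (φ n : ℝ)) : ℝ) : ℂ) • f (φ n))) atTop
        (𝓝 (((ρ ⟨expGL (t • z₀), hmemG z₀ hz₀G t⟩ : GLN M) : Mat M) *ᵥ w)) :=
      tendsto_mulVec hA hB
    set A₀ := ((ρ ⟨expGL (t • z₀), hmemG z₀ hz₀G t⟩ : GLN M) : Mat M) *ᵥ w with hA₀
    -- Proportionality of vectors, written by 2 × 2 minors, is a closed condition and passes to the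
    -- limit although the factors b may not converge a priori.
    have hdep : ∀ i j, A₀ i * w j = A₀ j * w i := by
      intro i j
      have h1 := ((tendsto_pi_nhds.1 hAB i).mul (tendsto_pi_nhds.1 hB j))
      have h2 := ((tendsto_pi_nhds.1 hAB j).mul (tendsto_pi_nhds.1 hB i))
      refine tendsto_nhds_unique h1 (h2.congr fun n => ?_)
      obtain ⟨b, hb⟩ := hzstab (φ n) t
      rw [Matrix.mulVec_smul, hb]
      simp only [Pi.smul_apply, smul_eq_mul]
      ring
    obtain ⟨j, hj⟩ := Function.ne_iff.1 hw
    refine ⟨A₀ j / w j, ?_⟩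
    funext i
    rw [Pi.smul_apply, smul_eq_mul, div_mul_eq_mul_div, eq_div_iff hj]
    exact hdep i j
  have hz₀κ : z₀ ∈ κ := ⟨⟨conj z₀, hz₀P, conj.symm_apply_apply z₀⟩, hz₀tr⟩
  have h0 : z₀ = 0 := by
    have := LinearMap.congr_fun hpr ⟨z₀, hz₀κ⟩
    have h2 : pr z₀ = ⟨z₀, hz₀κ⟩ := this
    rw [hz₀pr] at h2
    exact (congrArg Subtype.val h2).symm
  rw [h0] at hz₀
  simp at hz₀

end Parabolic

/-! ### The smallest algebraic torus whose Lie algebra contains given commuting matrices -/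

section TorusHull

open Matrix

variable {N : ℕ}

/-- The pairing of integral weights and complex vectors. -/
def weightPairing (y : Fin N → ℂ) : (Fin N → ℤ) →+ ℂ where
  toFun m := ∑ i, (m i : ℂ) * y i
  map_zero' := by simp
  map_add' m m' := by simp [add_mul, Finset.sum_add_distrib]

theorem weightPairing_apply (y : Fin N → ℂ) (m : Fin N → ℤ) :
    weightPairing y m = ∑ i, (m i : ℂ) * y i := rfl

/-- The weights that vanish on a subspace. -/
def annihilatingWeights (E : Submodule ℂ (Fin N → ℂ)) : Submodule ℤ (Fin N → ℤ) where
  carrier := {m | ∀ y ∈ E, weightPairing y m = 0}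
  zero_mem' := fun y _ => map_zero _
  add_mem' := fun ha hb y hy => by rw [map_add, ha y hy, hb y hy, add_zero]
  smul_mem' := fun c m hm y hy => by rw [map_zsmul, hm y hy, smul_zero]

/-- The rational hull of a subspace: the common zeros of the weights that vanish on it. -/
def rationalHull (E : Submodule ℂ (Fin N → ℂ)) : Submodule ℂ (Fin N → ℂ) where
  carrier := {y | ∀ m ∈ annihilatingWeights E, weightPairing y m = 0}
  zero_mem' := fun m _ => by simp [weightPairing_apply]
  add_mem' := fun {a b} ha hb m hm => by
    have := congrArg₂ (· + ·) (ha m hm) (hb m hm)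
    simpa [weightPairing_apply, mul_add, Finset.sum_add_distrib] using this
  smul_mem' := fun c y hy m hm => by
    have := congrArg (c * ·) (hy m hm)
    simpa [weightPairing_apply, Finset.mul_sum, mul_left_comm] using this

theorem le_rationalHull (E : Submodule ℂ (Fin N → ℂ)) : E ≤ rationalHull E :=
  fun y hy _ hm => hm y hy

/-- The annihilating weights are a direct summand of the weight lattice. -/
theorem exists_retraction_annihilatingWeights (E : Submodule ℂ (Fin N → ℂ)) :
    ∃ f : (Fin N → ℤ) →ₗ[ℤ] annihilatingWeights E, ∀ m : annihilatingWeights E, f m = m := by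
  have htf : Module.IsTorsionFree ℤ ((Fin N → ℤ) ⧸ annihilatingWeights E) := by
    refine Module.IsTorsionFree.of_smul_eq_zero fun c x => ?_
    induction x using Submodule.Quotient.induction_on with
    | _ m =>
      intro h
      rw [or_iff_not_imp_left]
      intro hc
      rw [← Submodule.Quotient.mk_smul, Submodule.Quotient.mk_eq_zero] at h
      rw [Submodule.Quotient.mk_eq_zero]
      intro y hy
      have := h y hy
      rw [map_zsmul, zsmul_eq_mul] at this
      exact (mul_eq_zero.1 this).resolve_left (by exact_mod_cast hc)
  have hfree : Module.Free ℤ ((Fin N → ℤ) ⧸ annihilatingWeights E) := inferInstance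
  obtain ⟨g, hg⟩ := LinearMap.exists_rightInverse_of_surjective
    (annihilatingWeights E).mkQ (Submodule.range_mkQ _)
  refine ⟨(LinearMap.id - g ∘ₗ (annihilatingWeights E).mkQ).codRestrict _ fun m => ?_, fun m => ?_⟩
  · apply Subtype.ext
    have : (annihilatingWeights E).mkQ (m : Fin N → ℤ) = 0 := by simp
    rw [LinearMap.codRestrict_apply, LinearMap.sub_apply, LinearMap.comp_apply, this, map_zero, sub_zero]
    rfl
  · rw [← Submodule.Quotient.mk_eq_zero, ← Submodule.mkQ_apply, LinearMap.sub_apply, map_sub]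
    have := LinearMap.congr_fun hg ((annihilatingWeights E).mkQ m)
    simp only [LinearMap.comp_apply, LinearMap.id_apply] at this ⊢
    rw [this, sub_self]

/-- Every exponential of the rational hull satisfies the polynomial equations of the exponentials of
the subspace. -/
theorem eval_exp_eq_zero_of_rationalHull {E : Submodule ℂ (Fin N → ℂ)} {P : MvPolynomial (Fin N) ℂ}
    (hP : ∀ y ∈ E, MvPolynomial.eval (fun i => Complex.exp (y i)) P = 0) {y : Fin N → ℂ}
    (hy : y ∈ rationalHull E) : MvPolynomial.eval (fun i => Complex.exp (y i)) P = 0 := by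
  let ψ : (Fin N →₀ ℕ) → (Multiplicative E →* ℂ) := fun m =>
    { toFun := fun y => Complex.exp (weightPairing (y.toAdd : Fin N → ℂ) fun i => (m i : ℤ))
      map_one' := by simp [weightPairing_apply]
      map_mul' := fun a b => by
        rw [← Complex.exp_add]
        congr 1
        simp [weightPairing_apply, mul_add, Finset.sum_add_distrib] }
  let c : (Fin N →₀ ℕ) →₀ ℂ :=
    Finsupp.onFinset P.support (fun d => P.coeff d) fun d hd => MvPolynomial.mem_support_iff.2 hd
  have heval : ∀ y : Fin N → ℂ, MvPolynomial.eval (fun i => Complex.exp (y i)) P =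
      Finsupp.linearCombination ℂ (fun m : Fin N →₀ ℕ => Complex.exp (weightPairing y fun i => (m i : ℤ))) c := by
    intro y
    rw [MvPolynomial.eval_eq', Finsupp.linearCombination_apply, Finsupp.onFinset_sum _ (by simp)]
    refine Finset.sum_congr rfl fun d _ => ?_
    rw [smul_eq_mul, weightPairing_apply, Complex.exp_sum]
    congr 1
    refine Finset.prod_congr rfl fun i _ => ?_
    rw [← Complex.exp_nat_mul]
    simp
  -- Monomials restrict to characters of the additive group E. By Dedekind's independence of
  -- characters, the coefficients of the monomials with equal restriction sum to zero.
  have hzero : Finsupp.mapDomain ψ c = 0 := by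
    refine (linearIndependent_iff.1 (linearIndependent_monoidHom (Multiplicative E) ℂ)) _ ?_
    rw [Finsupp.linearCombination_mapDomain]
    funext z
    have h1 := heval (z.toAdd : Fin N → ℂ)
    rw [hP _ z.toAdd.2] at h1
    rw [Pi.zero_apply, h1, Finsupp.linearCombination_apply, Finsupp.linearCombination_apply, Finsupp.sum,
      Finsupp.sum, Finset.sum_apply]
    rfl
  -- Two monomials with equal restriction to exp(E) differ by a weight that annihilates E (scaling
  -- in E rules out values in 2πiℤ), hence agree on the rational hull too.
  have hfac : (fun m : Fin N →₀ ℕ => Complex.exp (weightPairing y fun i => (m i : ℤ))).FactorsThrough ψ := by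
    intro m m' hmm
    have hmem : (fun i => (m i : ℤ) - (m' i : ℤ)) ∈ annihilatingWeights E := by
      intro z hz
      by_contra hne
      set w := weightPairing z fun i => (m i : ℤ) - (m' i : ℤ) with hw
      have h1 : ∀ s : ℂ, Complex.exp (s * w) = 1 := by
        intro s
        have h2 := DFunLike.congr_fun hmm (Multiplicative.ofAdd (⟨s • z, E.smul_mem s hz⟩ : E))
        have h3 : Complex.exp (weightPairing (s • z) fun i => (m i : ℤ)) =
          Complex.exp (weightPairing (s • z) fun i => (m' i : ℤ)) := h2
        have h4 : s * w = weightPairing (s • z) (fun i => (m i : ℤ)) - weightPairing (s • z) fun i => (m' i : ℤ) := by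
          simp only [hw, weightPairing_apply, Finset.mul_sum, ← Finset.sum_sub_distrib]
          refine Finset.sum_congr rfl fun i _ => ?_
          simp
          ring
        rw [h4, Complex.exp_sub, h3, div_self (Complex.exp_ne_zero _)]
      have h5 := h1 (1 / w)
      rw [one_div_mul_cancel hne] at h5
      have h6 : Real.exp 1 = 1 := by
        rw [← Complex.ofReal_inj, Complex.ofReal_exp]
        simpa using h5
      have := Real.add_one_lt_exp (one_ne_zero)
      linarith
    have h7 := hy _ hmem
    have h8 : weightPairing y (fun i => (m i : ℤ)) = weightPairing y fun i => (m' i : ℤ) := by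
      rw [← sub_eq_zero, ← map_sub]
      exact h7
    exact congrArg Complex.exp h8
  rw [heval]
  have : (fun m : Fin N →₀ ℕ => Complex.exp (weightPairing y fun i => (m i : ℤ))) =
      (Function.extend ψ (fun m : Fin N →₀ ℕ => Complex.exp (weightPairing y fun i => (m i : ℤ))) 0) ∘ ψ := by
    funext m
    rw [Function.comp_apply, hfac.extend_apply]
  rw [this, ← Finsupp.linearCombination_mapDomain, hzero, map_zero]

/-- The diagonal matrix with entries `y`, in the coordinates given by `g`. -/
def diagIn (g : GLN N) : (Fin N → ℂ) →ₗ[ℂ] Mat N where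
  toFun y := ((g⁻¹ : GLN N) : Mat N) * diagonal y * (g : Mat N)
  map_add' y z := by
    rw [show diagonal (y + z) = diagonal y + diagonal z from (Matrix.diagonal_add y z).symm, mul_add,
      add_mul]
  map_smul' c y := by rw [Matrix.diagonal_smul, mul_smul_comm, smul_mul_assoc]; rfl

theorem diagIn_apply (g : GLN N) (y : Fin N → ℂ) :
    diagIn g y = ((g⁻¹ : GLN N) : Mat N) * diagonal y * (g : Mat N) := rfl

theorem diagIn_mul (g : GLN N) (y z : Fin N → ℂ) : diagIn g y * diagIn g z = diagIn g (y * z) := by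
  simp only [diagIn_apply, mul_assoc, GL_mul_inv_cancel]
  rw [← mul_assoc (diagonal y), Matrix.diagonal_mul_diagonal]
  rfl

theorem commute_diagIn (g : GLN N) (y z : Fin N → ℂ) : Commute (diagIn g y) (diagIn g z) := by
  rw [Commute, SemiconjBy, diagIn_mul, diagIn_mul, mul_comm]

theorem exp_diagIn (g : GLN N) (y : Fin N → ℂ) :
    NormedSpace.exp (diagIn g y) = diagIn g fun i => Complex.exp (y i) := by
  have h := Matrix.exp_units_conj g⁻¹ (diagonal y)
  rw [inv_inv] at h
  rw [diagIn_apply, h, Matrix.exp_diagonal, diagIn_apply]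
  congr 3
  funext i
  rw [Pi.coe_exp, ← Complex.exp_eq_exp_ℂ]

theorem conj_diagIn (g : GLN N) (y : Fin N → ℂ) :
    (g : Mat N) * diagIn g y * ((g⁻¹ : GLN N) : Mat N) = diagonal y := by
  simp only [diagIn_apply, mul_assoc, GL_mul_inv_cancel]
  rw [← Units.val_mul, mul_inv_cancel, Units.val_one, mul_one]

theorem eq_diagIn {g : GLN N} {x : Mat N} {y : Fin N → ℂ}
    (h : (g : Mat N) * x * ((g⁻¹ : GLN N) : Mat N) = diagonal y) : x = diagIn g y :=
  conj_injective g (h.trans (conj_diagIn g y).symm)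

theorem expGL_diagIn_add (g : GLN N) (y z : Fin N → ℂ) :
    expGL (diagIn g (y + z)) = expGL (diagIn g y) * expGL (diagIn g z) := by
  apply Units.ext
  rw [Units.val_mul, coe_expGL, coe_expGL, coe_expGL, map_add]
  exact Matrix.exp_add_of_commute _ _ (commute_diagIn g y z)

/-- The group of the exponentials of a space of diagonal matrices. -/
def expSubgroup (g : GLN N) (F : Submodule ℂ (Fin N → ℂ)) : Subgroup (GLN N) where
  carrier := {t | ∃ y ∈ F, t = expGL (diagIn g y)}
  one_mem' := ⟨0, F.zero_mem, by apply Units.ext; simp [coe_expGL]⟩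
  mul_mem' := by
    rintro _ _ ⟨y, hy, rfl⟩ ⟨z, hz, rfl⟩
    exact ⟨y + z, F.add_mem hy hz, (expGL_diagIn_add g y z).symm⟩
  inv_mem' := by
    rintro _ ⟨y, hy, rfl⟩
    exact ⟨-y, F.neg_mem hy, by rw [map_neg, expGL_neg]⟩

theorem isConnected_expSubgroup (g : GLN N) (F : Submodule ℂ (Fin N → ℂ)) :
    IsConnected (expSubgroup g F : Set (GLN N)) := by
  have hc : Continuous fun y : Fin N → ℂ => expGL (diagIn g y) :=
    continuous_expGL_all.comp (LinearMap.continuous_of_finiteDimensional (diagIn g))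
  have hF : IsConnected (F : Set (Fin N → ℂ)) := by
    refine ⟨⟨0, F.zero_mem⟩, ?_⟩
    exact (Submodule.convex (F.restrictScalars ℝ)).isPreconnected
  have := hF.image _ hc.continuousOn
  convert! this using 1
  ext t
  constructor
  · rintro ⟨y, hy, rfl⟩; exact ⟨y, hy, rfl⟩
  · rintro ⟨y, hy, rfl⟩; exact ⟨y, hy, rfl⟩

/-- The equations are diagonality and the monomial relations of the annihilating weights, with
negative exponents moved to the other side. Conversely, the logarithms of a solution pair with these
weights into 2πiℤ, and must be corrected by integral multiples of 2πi. -/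
theorem isZariskiClosed_expSubgroup_rationalHull (g : GLN N) (E : Submodule ℂ (Fin N → ℂ)) :
    IsZariskiClosed (expSubgroup g (rationalHull E)) := by
  let q : (Fin N → ℤ) → MatPoly N := fun m =>
    (∏ i, MvPolynomial.X (i, i) ^ (m i).toNat) - ∏ i, MvPolynomial.X (i, i) ^ (-m i).toNat
  refine ⟨{p | (∃ i j, i ≠ j ∧ p = sandwich (g : Mat N) ((g⁻¹ : GLN N) : Mat N) (MvPolynomial.X (i, j))) ∨
    ∃ m ∈ annihilatingWeights E, p = sandwich (g : Mat N) ((g⁻¹ : GLN N) : Mat N) (q m)}, fun t => ?_⟩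
  have hq : ∀ (m : Fin N → ℤ) (y : Fin N → ℂ), evalAt (diagonal fun i => Complex.exp (y i)) (q m) = 0 ↔
      Complex.exp (weightPairing y m) = 1 := by
    intro m y
    have h1 : ∀ k : Fin N → ℕ, evalAt (diagonal fun i => Complex.exp (y i)) (∏ i, MvPolynomial.X (i, i) ^ (k i)) =
        Complex.exp (∑ i, (k i : ℂ) * y i) := by
      intro k
      simp [evalAt, Complex.exp_sum, Complex.exp_nat_mul]
    have h2 : evalAt (diagonal fun i => Complex.exp (y i)) (q m) =
        Complex.exp (∑ i, (((m i).toNat : ℕ) : ℂ) * y i) - Complex.exp (∑ i, (((-m i).toNat : ℕ) : ℂ) * y i) := by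
      rw [← h1, ← h1]
      simp [q, evalAt]
    have h3 : weightPairing y m = ∑ i, (((m i).toNat : ℕ) : ℂ) * y i - ∑ i, (((-m i).toNat : ℕ) : ℂ) * y i := by
      rw [weightPairing_apply, ← Finset.sum_sub_distrib]
      refine Finset.sum_congr rfl fun i _ => ?_
      rw [← sub_mul]
      congr 1
      have := Int.toNat_sub_toNat_neg (m i)
      exact_mod_cast this.symm
    rw [h2, h3, Complex.exp_sub, sub_eq_zero, div_eq_one_iff_eq (Complex.exp_ne_zero _)]
  constructor
  · rintro ⟨y, hy, rfl⟩ p (⟨i, j, hij, rfl⟩ | ⟨m, hm, rfl⟩)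
    · rw [evalAt_sandwich, coe_expGL, exp_diagIn, conj_diagIn]
      simp [evalAt, hij]
    · rw [evalAt_sandwich, coe_expGL, exp_diagIn, conj_diagIn, hq, hy m hm, Complex.exp_zero]
  · intro h
    let τ : Fin N → ℂ := fun i => ((g : Mat N) * (t : Mat N) * ((g⁻¹ : GLN N) : Mat N)) i i
    have hdiag : (g : Mat N) * (t : Mat N) * ((g⁻¹ : GLN N) : Mat N) = diagonal τ := by
      ext i j
      by_cases hij : i = j
      · subst hij; simp [τ]
      · have := h _ (Or.inl ⟨i, j, hij, rfl⟩)
        rw [evalAt_sandwich] at this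
        simpa [evalAt, hij] using this
    have hτ : ∀ i, τ i ≠ 0 := by
      have h1 : IsUnit (diagonal τ) := by
        rw [← hdiag]
        exact ⟨g * t * g⁻¹, by simp⟩
      rw [Matrix.isUnit_iff_isUnit_det, Matrix.det_diagonal, isUnit_iff_ne_zero,
        Finset.prod_ne_zero_iff] at h1
      exact fun i => h1 i (Finset.mem_univ i)
    let y : Fin N → ℂ := fun i => Complex.log (τ i)
    have hy : τ = fun i => Complex.exp (y i) := funext fun i => (Complex.exp_log (hτ i)).symm
    have hintegral : ∀ m ∈ annihilatingWeights E, ∃ k : ℤ, weightPairing y m = k * (2 * Real.pi * Complex.I) := by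
      intro m hm
      have := h _ (Or.inr ⟨m, hm, rfl⟩)
      rw [evalAt_sandwich, hdiag, hy, hq] at this
      exact Complex.exp_eq_one_iff.1 this
    choose! k hk using hintegral
    obtain ⟨f, hf⟩ := exists_retraction_annihilatingWeights E
    -- The correction subtracts from y_i the pairing of y with the annihilating weight f(e_i), which
    -- is in 2πiℤ, so the exponential is unchanged. As f is a retraction, annihilating weights pair
    -- to zero with y'.
    let y' : Fin N → ℂ := fun i => y i - weightPairing y (f (Pi.single i 1) : Fin N → ℤ)
    have hy' : y' ∈ rationalHull E := by
      intro m hm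
      have h1 : weightPairing y' m = weightPairing y m - ∑ i, (m i : ℂ) * weightPairing y (f (Pi.single i 1) : Fin N → ℤ) := by
        simp only [weightPairing_apply y', weightPairing_apply y m, y', mul_sub, Finset.sum_sub_distrib]
      have h2 : ∑ i, (m i : ℂ) * weightPairing y (f (Pi.single i 1) : Fin N → ℤ) =
          weightPairing y (f m : Fin N → ℤ) := by
        have h3 : (m : Fin N → ℤ) = ∑ i, m i • (Pi.single i 1 : Fin N → ℤ) := by
          ext j
          simp [Finset.sum_apply, Pi.single_apply]
        conv_rhs => rw [h3, map_sum]
        rw [Submodule.coe_sum, map_sum]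
        refine Finset.sum_congr rfl fun i _ => ?_
        rw [map_smul, Submodule.coe_smul, map_zsmul, zsmul_eq_mul]
      rw [h1, h2, hf ⟨m, hm⟩, sub_self]
    refine ⟨y', hy', ?_⟩
    apply Units.ext
    rw [coe_expGL, exp_diagIn]
    apply eq_diagIn
    rw [hdiag, hy]
    congr 1
    funext i
    simp only [y', Complex.exp_sub]
    rw [hk _ (f (Pi.single i 1)).2, Complex.exp_int_mul_two_pi_mul_I, div_one]

/-- A space of simultaneously diagonalizable matrices is contained in the Lie algebra of a torus that
is contained in every algebraic group that contains its exponentials. -/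
theorem exists_torus_hull (g : GLN N) {D : Submodule ℂ (Mat N)}
    (hD : ∀ x ∈ D, ((g : Mat N) * x * ((g⁻¹ : GLN N) : Mat N)).IsDiag) :
    ∃ T : Subgroup (GLN N), IsTorus T ∧ (∀ x ∈ D, x ∈ lie T) ∧
      ∀ A : Subgroup (GLN N), IsZariskiClosed A → (∀ x ∈ D, expGL x ∈ A) → T ≤ A := by
  let E : Submodule ℂ (Fin N → ℂ) := D.comap (diagIn g)
  have hDE : ∀ x ∈ D, ∃ y ∈ E, x = diagIn g y := by
    intro x hx
    have h := eq_diagIn (hD x hx).diagonal_diag.symm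
    refine ⟨_, ?_, h⟩
    change diagIn g _ ∈ D
    rw [← h]
    exact hx
  refine ⟨expSubgroup g (rationalHull E), ⟨isZariskiClosed_expSubgroup_rationalHull g E,
    isConnected_expSubgroup g _, g, ?_⟩, ?_, ?_⟩
  · rintro _ ⟨y, -, rfl⟩
    rw [Units.val_mul, Units.val_mul, coe_expGL, exp_diagIn, conj_diagIn]
    exact Matrix.isDiag_diagonal _
  · intro x hx
    obtain ⟨y, hy, rfl⟩ := hDE x hx
    refine mem_lie_of_exp fun s => ⟨(s : ℂ) • y, (rationalHull E).smul_mem _ (le_rationalHull E hy), ?_⟩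
    rw [map_smul, Complex.coe_smul]
  · rintro A ⟨Q, hQ⟩ hA _ ⟨y, hy, rfl⟩
    rw [hQ]
    intro p hp
    -- The equation p restricted to the diagonal matrices in the coordinates g.
    let P : MvPolynomial (Fin N) ℂ := MvPolynomial.bind₁ (fun ij : Fin N × Fin N =>
      if ij.1 = ij.2 then MvPolynomial.X ij.1 else 0) (sandwich ((g⁻¹ : GLN N) : Mat N) (g : Mat N) p)
    have hP : ∀ τ : Fin N → ℂ, MvPolynomial.eval τ P = evalAt (diagIn g τ) p := by
      intro τ
      rw [diagIn_apply, ← evalAt_sandwich]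
      simp only [P, evalAt, MvPolynomial.eval, MvPolynomial.eval₂Hom_bind₁]
      congr 2
      funext ij
      by_cases h : ij.1 = ij.2
      · simp [h]
      · simp [h, Matrix.diagonal_apply_ne]
    have hmain : MvPolynomial.eval (fun i => Complex.exp (y i)) P = 0 := by
      refine eval_exp_eq_zero_of_rationalHull (E := E) (fun z hz => ?_) hy
      rw [hP, ← exp_diagIn, ← coe_expGL]
      exact (hQ _).1 (hA _ hz) p hp
    rw [coe_expGL, exp_diagIn, ← hP, hmain]

end TorusHull

/-! ### Simultaneous diagonalization and weight vectors -/

section Diagonalization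

open Matrix

variable {N : ℕ}

theorem exists_conj_isDiag_of_basis (B : Module.Basis (Fin N) ℂ (Fin N → ℂ)) :
    ∃ g : GLN N, ∀ M : Mat N, (∀ j, ∃ c : ℂ, M *ᵥ B j = c • B j) →
      ((g : Mat N) * M * ((g⁻¹ : GLN N) : Mat N)).IsDiag := by
  let V : Mat N := (Pi.basisFun ℂ (Fin N)).toMatrix B
  let W : Mat N := B.toMatrix (Pi.basisFun ℂ (Fin N))
  have hWV : W * V = 1 := Module.Basis.toMatrix_mul_toMatrix_flip _ _
  have hVW : V * W = 1 := Module.Basis.toMatrix_mul_toMatrix_flip _ _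
  refine ⟨⟨W, V, hWV, hVW⟩, fun M hM => ?_⟩
  choose c hc using hM
  have h1 : M * V = V * diagonal c := by
    ext i j
    rw [Matrix.mul_diagonal]
    have := congrFun (hc j) i
    simpa [V, Module.Basis.toMatrix_apply, Matrix.mul_apply, Matrix.mulVec, dotProduct, mul_comm] using this
  change (W * M * V).IsDiag
  rw [mul_assoc, h1, ← mul_assoc, hWV, one_mul]
  exact isDiag_diagonal c

/-- A commuting family of matrices stable under an adjoint is simultaneously diagonalizable. -/
theorem exists_conj_isDiag {S : GLN N} {D : Submodule ℂ (Mat N)} (hD : ∀ x ∈ D, dag S x ∈ D)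
    (hc : ∀ x ∈ D, ∀ y ∈ D, ⁅x, y⁆ = 0) :
    ∃ g : GLN N, ∀ x ∈ D, ((g : Mat N) * x * ((g⁻¹ : GLN N) : Mat N)).IsDiag := by
  -- The spectral theorem for commuting symmetric operators is applied to the self-adjoint members
  -- of D; these span D over ℂ because D is stable under the adjoint.
  let ι := {x : Mat N // x ∈ D ∧ dag S x = x}
  let f : ι → (EuclideanSpace ℂ (Fin N) →ₗ[ℂ] EuclideanSpace ℂ (Fin N)) := fun x =>
    Matrix.toEuclideanLin ((S : Mat N) * (x : Mat N) * ((S⁻¹ : GLN N) : Mat N))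
  have hsymm : ∀ i, (f i).IsSymmetric := by
    intro x
    apply Matrix.isSymmetric_toEuclideanLin_iff.2
    have := conj_dag S (x : Mat N)
    rw [x.2.2] at this
    exact this.symm
  have hcomm : Pairwise (Function.onFun Commute f) := by
    intro x y _
    have h1 := hc x x.2.1 y y.2.1
    rw [Ring.lie_def, sub_eq_zero] at h1
    have h2 : (f x) ∘ₗ (f y) = (f y) ∘ₗ (f x) := by
      simp only [f, Matrix.toEuclideanLin_eq_toLin_orthonormal]
      rw [← Matrix.toLin_mul, ← Matrix.toLin_mul, ← conj_mul, ← conj_mul, h1]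
    exact h2
  have htop := LinearMap.IsSymmetric.iSup_iInf_eq_top_of_commute hsymm hcomm
  let s : Set (Fin N → ℂ) := {v | ∀ i : ι, ∃ c : ℂ,
    ((S : Mat N) * (i : Mat N) * ((S⁻¹ : GLN N) : Mat N)) *ᵥ v = c • v}
  have hs : Submodule.span ℂ s = ⊤ := by
    rw [eq_top_iff]
    have h3 : (⊤ : Submodule ℂ (EuclideanSpace ℂ (Fin N))) ≤
        (Submodule.span ℂ s).comap (WithLp.linearEquiv 2 ℂ (Fin N → ℂ)).toLinearMap := by
      rw [← htop, iSup_le_iff]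
      intro χ v hv
      apply Submodule.subset_span
      intro i
      refine ⟨χ i, ?_⟩
      have := Module.End.mem_eigenspace_iff.1 ((Submodule.mem_iInf _).1 hv i)
      exact congrArg (WithLp.ofLp) this
    intro v _
    exact h3 (Submodule.mem_top (x := WithLp.toLp 2 v))
  obtain ⟨b, hbs, hb, hli⟩ := exists_linearIndependent ℂ s
  let B : Module.Basis b ℂ (Fin N → ℂ) := Module.Basis.mk hli (by
    rw [Subtype.range_coe, hb, hs])
  have : Fintype b := Module.Basis.fintypeIndexOfRankLtAleph0 B (Module.rank_lt_aleph0 ℂ _)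
  have hcard : Fintype.card b = N := by
    rw [← Module.finrank_eq_card_basis B]; simp
  let B' : Module.Basis (Fin N) ℂ (Fin N → ℂ) := B.reindex (Fintype.equivFinOfCardEq hcard)
  obtain ⟨g, hg⟩ := exists_conj_isDiag_of_basis B'
  have hherm : ∀ x ∈ D, dag S x = x →
      (((g * S : GLN N) : Mat N) * x * (((g * S)⁻¹ : GLN N) : Mat N)).IsDiag := by
    intro x hx hd
    have h4 := hg ((S : Mat N) * x * ((S⁻¹ : GLN N) : Mat N)) fun j => by
      have h5 : B' j ∈ s := hbs (by simp [B', B])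
      exact h5 ⟨x, hx, hd⟩
    rw [_root_.mul_inv_rev, Units.val_mul, Units.val_mul]
    simpa only [mul_assoc] using h4
  refine ⟨g * S, fun x hx => ?_⟩
  have h6 : x = (1 / 2 : ℂ) • (x + dag S x) + (-Complex.I / 2) • (Complex.I • (x - dag S x)) := by
    rw [smul_smul, show -Complex.I / 2 * Complex.I = 1 / 2 by
      rw [div_mul_eq_mul_div, neg_mul, Complex.I_mul_I, neg_neg], ← smul_add, add_add_sub_cancel,
      ← two_smul ℂ x, smul_smul]
    norm_num
  have h7 := hherm _ (D.add_mem hx (hD x hx)) (by rw [map_add, dag_dag, add_comm])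
  have h8 := hherm _ (D.smul_mem Complex.I (D.sub_mem hx (hD x hx))) (by
    rw [LinearMap.map_smulₛₗ, map_sub, dag_dag, Complex.conj_I, neg_smul, ← smul_neg, neg_sub])
  rw [h6, mul_add, add_mul, mul_smul_comm, smul_mul_assoc, mul_smul_comm (-Complex.I / 2), smul_mul_assoc]
  exact (h7.smul _).add (h8.smul _)

theorem conj_apply_eq_zero_of_vanishes {T : Subgroup (GLN N)} {g : GLN N} {i j : Fin N}
    (hg : ∀ t ∈ T, ((g * t * g⁻¹ : GLN N) : Mat N) i j = 0) {x : Mat N} (hx : x ∈ lie T) :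
    ((g : Mat N) * x * ((g⁻¹ : GLN N) : Mat N)) i j = 0 := by
  have h := hx (sandwich (g : Mat N) ((g⁻¹ : GLN N) : Mat N) (MvPolynomial.X (i, j))) fun t ht => by
    rw [evalAt_sandwich]
    simpa [evalAt] using hg t ht
  rw [sum_pderiv_sandwich, Finset.sum_eq_single (i, j)] at h
  · simpa [evalAt] using h
  · intro b _ hb
    rw [MvPolynomial.pderiv_X_of_ne hb.symm]
    simp [evalAt]
  · simp

theorem IsTorus.exists_lie_isDiag {T : Subgroup (GLN N)} (hT : IsTorus T) :
    ∃ g : GLN N, (∀ t ∈ T, ((g * t * g⁻¹ : GLN N) : Mat N).IsDiag) ∧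
      ∀ x ∈ lie T, ((g : Mat N) * x * ((g⁻¹ : GLN N) : Mat N)).IsDiag := by
  obtain ⟨-, -, g, hg⟩ := hT
  exact ⟨g, hg, fun x hx i j hij => conj_apply_eq_zero_of_vanishes (fun t ht => hg t ht hij) hx⟩

theorem IsTorus.lie_eq_zero {T : Subgroup (GLN N)} (hT : IsTorus T) {x y : Mat N} (hx : x ∈ lie T)
    (hy : y ∈ lie T) : ⁅x, y⁆ = 0 := by
  obtain ⟨g, -, hg⟩ := hT.exists_lie_isDiag
  have h1 := eq_diagIn (hg x hx).diagonal_diag.symm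
  have h2 := eq_diagIn (hg y hy).diagonal_diag.symm
  rw [Ring.lie_def, sub_eq_zero, h1, h2]
  exact commute_diagIn g _ _

/-- A subspace stable under a torus is spanned by its weight vectors. -/
theorem IsTorus.le_of_forall_weight {T : Subgroup (GLN N)} (hT : IsTorus T)
    {V W : Submodule ℂ (Mat N)} (hV : ∀ h ∈ lie T, ∀ x ∈ V, ⁅h, x⁆ ∈ V)
    (H : ∀ (γ : Module.Dual ℂ (lie T)), ∀ x ∈ V, (∀ h : lie T, ⁅(h : Mat N), x⁆ = γ h • x) → x ∈ W) :
    V ≤ W := by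
  obtain ⟨g, -, hg⟩ := hT.exists_lie_isDiag
  let ε : Fin N → Module.Dual ℂ (lie T) := fun i =>
    { toFun := fun h => ((g : Mat N) * (h : Mat N) * ((g⁻¹ : GLN N) : Mat N)) i i
      map_add' := fun a b => by simp [mul_add, add_mul]
      map_smul' := fun c a => by simp }
  have hε : ∀ h : lie T, (g : Mat N) * (h : Mat N) * ((g⁻¹ : GLN N) : Mat N) = diagonal fun i => ε i h :=
    fun h => (hg h h.2).diagonal_diag.symm
  have hbr : ∀ (h : lie T) (x : Mat N) (i j : Fin N),
      ((g : Mat N) * ⁅(h : Mat N), x⁆ * ((g⁻¹ : GLN N) : Mat N)) i j =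
        (ε i - ε j) h * ((g : Mat N) * x * ((g⁻¹ : GLN N) : Mat N)) i j := by
    intro h x i j
    rw [Ring.lie_def, mul_sub, sub_mul, conj_mul, conj_mul, hε, Matrix.sub_apply, Matrix.diagonal_mul,
      Matrix.mul_diagonal, LinearMap.sub_apply]
    ring
  -- A single element that separates all distinct weights ε_i - ε_j. The eigenspaces of its adjoint
  -- action are then simultaneous weight spaces for the whole torus.
  have hsep : ∃ h : lie T, ∀ i j k l, ε i - ε j ≠ ε k - ε l → (ε i - ε j) h ≠ (ε k - ε l) h := by
    obtain ⟨h, -, hh⟩ := Module.Dual.exists_forall_mem_ne_zero_of_forall_exists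
      (⊤ : Submodule ℂ (lie T)) (fun q : {q : Fin N × Fin N × Fin N × Fin N //
        ε q.1 - ε q.2.1 ≠ ε q.2.2.1 - ε q.2.2.2} =>
        ((ε q.1.1 - ε q.1.2.1) - (ε q.1.2.2.1 - ε q.1.2.2.2) : Module.Dual ℂ (lie T)))
      (by
        rintro ⟨q, hq⟩
        obtain ⟨h, hh⟩ := DFunLike.ne_iff.1 (sub_ne_zero.2 hq)
        exact ⟨h, trivial, hh⟩)
    refine ⟨h, fun i j k l hne => ?_⟩
    have := hh ⟨(i, j, k, l), hne⟩
    rw [LinearMap.sub_apply] at this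
    exact sub_ne_zero.1 this
  obtain ⟨h0, hh0⟩ := hsep
  let f : Module.End ℂ (Mat N) :=
    LinearMap.mulLeft ℂ (h0 : Mat N) - LinearMap.mulRight ℂ (h0 : Mat N)
  have hf : ∀ x, f x = ⁅(h0 : Mat N), x⁆ := fun x => rfl
  have htop : ⨆ μ, f.genEigenspace μ 1 = ⊤ := by
    rw [eq_top_iff]
    intro x _
    have hx : x = ∑ i, ∑ j, ((g⁻¹ : GLN N) : Mat N) *
        Matrix.single i j (((g : Mat N) * x * ((g⁻¹ : GLN N) : Mat N)) i j) * (g : Mat N) := by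
      simp only [← Finset.sum_mul, ← Finset.mul_sum]
      rw [← Matrix.matrix_eq_sum_single]
      simp only [mul_assoc, GL_inv_mul_cancel]
      rw [← Units.val_mul, inv_mul_cancel, Units.val_one, mul_one]
    rw [hx]
    refine Submodule.sum_mem _ fun i _ => Submodule.sum_mem _ fun j _ => ?_
    refine Submodule.mem_iSup_of_mem ((ε i - ε j) h0) ?_
    refine Module.End.mem_eigenspace_iff.2 ?_
    rw [hf]
    apply conj_injective g
    ext k l
    rw [hbr, mul_smul_comm, smul_mul_assoc, Matrix.smul_apply, smul_eq_mul]
    simp only [mul_assoc, GL_mul_inv_cancel]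
    rw [← Units.val_mul, mul_inv_cancel, Units.val_one, mul_one]
    by_cases hkl : i = k ∧ j = l
    · obtain ⟨rfl, rfl⟩ := hkl; rfl
    · rw [Matrix.single_apply_of_ne _ _ _ _ _ hkl, mul_zero, mul_zero]
  rw [Submodule.eq_iSup_inf_genEigenspace (p := V) (f := f) 1 (fun x hx => hV h0 h0.2 x hx) htop,
    iSup_le_iff]
  rintro μ x ⟨hxV, hxμ⟩
  have hxμ : ⁅(h0 : Mat N), x⁆ = μ • x := Module.End.mem_eigenspace_iff.1 hxμ
  by_cases hx0 : x = 0
  · rw [hx0]; exact W.zero_mem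
  have hx' : ∃ i j, ((g : Mat N) * x * ((g⁻¹ : GLN N) : Mat N)) i j ≠ 0 := by
    by_contra! hne
    apply hx0
    apply conj_injective g
    rw [mul_zero, zero_mul]
    ext i j
    exact hne i j
  have hμ : ∀ k l, ((g : Mat N) * x * ((g⁻¹ : GLN N) : Mat N)) k l ≠ 0 → (ε k - ε l) h0 = μ := by
    intro k l hkl
    have h1 := hbr h0 x k l
    rw [hxμ, mul_smul_comm, smul_mul_assoc, Matrix.smul_apply, smul_eq_mul] at h1
    exact (mul_right_cancel₀ hkl h1).symm
  obtain ⟨i, j, hij⟩ := hx'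
  refine H (ε i - ε j) x hxV fun h => ?_
  apply conj_injective g
  ext k l
  rw [hbr, mul_smul_comm, smul_mul_assoc, Matrix.smul_apply, smul_eq_mul]
  by_cases hkl : ((g : Mat N) * x * ((g⁻¹ : GLN N) : Mat N)) k l = 0
  · rw [hkl, mul_zero, mul_zero]
  · congr 1
    by_contra hne
    refine hh0 k l i j (fun e => hne (by rw [e])) ?_
    rw [hμ k l hkl, hμ i j hij]

theorem trace_lie_mul (x y z : Mat N) : trace (⁅x, y⁆ * z) = trace (x * ⁅y, z⁆) := by
  rw [Ring.lie_def, Ring.lie_def, sub_mul, mul_sub, Matrix.trace_sub, Matrix.trace_sub, mul_assoc,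
    mul_assoc y x z, Matrix.trace_mul_comm y (x * z), mul_assoc]

/-- The trace form gives projections onto subspaces stable under an adjoint. -/
theorem exists_mem_trace_eq {S : GLN N} {V : Submodule ℂ (Mat N)} (hV : ∀ x ∈ V, dag S x ∈ V)
    (b : Mat N) : ∃ x ∈ V, ∀ c ∈ V, trace ((b - x) * c) = 0 := by
  let τ : Mat N →ₗ[ℂ] Module.Dual ℂ V :=
    { toFun := fun b =>
        { toFun := fun c => trace (b * (c : Mat N))
          map_add' := fun c d => by simp [mul_add]
          map_smul' := fun r c => by simp }
      map_add' := fun b c => by ext d; simp [add_mul]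
      map_smul' := fun r c => by ext d; simp }
  have hinj : Function.Injective (τ ∘ₗ V.subtype) := by
    rw [← LinearMap.ker_eq_bot, LinearMap.ker_eq_bot']
    intro c hc
    have h := LinearMap.congr_fun hc ⟨dag S c, hV c c.2⟩
    exact Subtype.ext (trace_mul_dag_self_eq_zero S h)
  let E : V ≃ₗ[ℂ] Module.Dual ℂ V :=
    LinearEquiv.ofInjectiveOfFinrankEq (τ ∘ₗ V.subtype) hinj Subspace.dual_finrank_eq.symm
  refine ⟨E.symm (τ b), (E.symm (τ b)).2, fun c hc => ?_⟩
  have h1 : E (E.symm (τ b)) = τ b := E.apply_symm_apply _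
  have h2 := LinearMap.congr_fun h1 ⟨c, hc⟩
  rw [sub_mul, Matrix.trace_sub, sub_eq_zero]
  exact h2.symm

end Diagonalization

/-! ### The decomposition 𝔤 = 𝔲 + 𝔩 + 𝔲† -/

section ParabolicDecomposition

open Matrix

variable {N : ℕ}

-- The bracket is the derivative at 0 of a curve in V; a linear form that vanishes on V vanishes on
-- this derivative.
open scoped Matrix.Norms.Operator in
theorem lie_mem_of_forall_conj_mem {V : Submodule ℂ (Mat N)} {x y : Mat N}
    (h : ∀ s : ℝ, NormedSpace.exp (s • x) * y * NormedSpace.exp (-(s • x)) ∈ V) : ⁅x, y⁆ ∈ V := by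
  by_contra hne
  obtain ⟨f, hf, hVf⟩ := Submodule.exists_le_ker_of_notMem hne
  have h1 := (LinearMap.toContinuousLinearMap (f.restrictScalars ℝ)).hasFDerivAt.comp_hasDerivAt 0
    (hasDerivAt_conj x y)
  have h2 : (⇑(LinearMap.toContinuousLinearMap (f.restrictScalars ℝ)) ∘
      fun s : ℝ => NormedSpace.exp (s • x) * y * NormedSpace.exp (-(s • x))) = fun _ => 0 := by
    funext s
    exact hVf (h s)
  rw [h2] at h1
  exact hf (h1.unique (hasDerivAt_const _ _))

theorem lie_mem_of_normal {A B : Subgroup (GLN N)} (hA : IsZariskiClosed A)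
    (hn : (B.subgroupOf A).Normal) (hBA : B ≤ A) {x y : Mat N} (hx : x ∈ lie A) (hy : y ∈ lie B) :
    ⁅x, y⁆ ∈ lie B := by
  refine lie_mem_of_forall_conj_mem (V := (lie B).toSubmodule) fun s => ?_
  have hs : expGL (s • x) ∈ A := by
    have := exp_mem hA ((lie A).smul_mem (s : ℂ) hx)
    rwa [Complex.coe_smul] at this
  exact conj_mem_lie_of_normal hn hBA hs hy

theorem lie_inf {A B : Subgroup (GLN N)} (hA : IsZariskiClosed A) (hB : IsZariskiClosed B) {x : Mat N}
    (hx : x ∈ lie A) (hx' : x ∈ lie B) : x ∈ lie (A ⊓ B) := by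
  refine mem_lie_of_exp fun s => ?_
  have h1 := exp_mem hA ((lie A).smul_mem (s : ℂ) hx)
  have h2 := exp_mem hB ((lie B).smul_mem (s : ℂ) hx')
  rw [Complex.coe_smul] at h1 h2
  exact ⟨h1, h2⟩

variable {G P U L : Subgroup (GLN N)} {S : GLN N}

/-- The nilradical, the Levi subalgebra and the opposite nilradical are independent. -/
theorem IsLevi.eq_zero_of_add_eq_zero (hP : IsZariskiClosed P) (hU : IsNormalUnipotent P U)
    (hL : IsLevi P U L) (hdL : ∀ x ∈ lie L, dag S x ∈ lie L) {u y v : Mat N} (hu : u ∈ lie U)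
    (hy : y ∈ lie L) (hv : v ∈ lie U) (h : u + y + dag S v = 0) : u = 0 ∧ y = 0 ∧ v = 0 := by
  have hLP : lie L ≤ lie P := lie_mono hL.le
  have hUP : lie U ≤ lie P := lie_mono hU.1
  have hu0 : u = 0 := by
    apply trace_mul_dag_self_eq_zero S
    have h1 : u = -y - dag S v := by rw [← sub_eq_zero, ← h]; abel
    have h2 : dag S u = -dag S y - v := by rw [h1, map_sub, map_neg, dag_dag]
    rw [h2, mul_sub, mul_neg, Matrix.trace_sub, Matrix.trace_neg, hU.trace_mul hP hu (hLP (hdL y hy)),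
      hU.trace_mul hP hu (hUP hv), neg_zero, sub_zero]
  have hv0 : v = 0 := by
    apply trace_mul_dag_self_eq_zero S
    have h1 : dag S v = -y := by
      rw [hu0, zero_add] at h
      exact (neg_eq_of_add_eq_zero_right h).symm
    rw [h1, mul_neg, Matrix.trace_neg, hU.trace_mul hP hv (hLP hy), neg_zero]
  refine ⟨hu0, ?_, hv0⟩
  rw [hu0, hv0, map_zero, zero_add, add_zero] at h
  exact h

/-- The decomposition of a reductive Lie algebra defined by a parabolic subgroup and a Levi subgroup
stable under a Cartan involution. -/
theorem IsParabolic.exists_decomposition (hG : IsZariskiClosed G) (hP : IsParabolic G P)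
    (hU : IsNormalUnipotent P U) (hL : IsLevi P U L)
    (hd : ∀ g ∈ L, ∃ g' ∈ L, dag S (g : Mat N) = (g' : Mat N))
    (hdG : ∀ x ∈ lie G, dag S x ∈ lie G) (hdL : ∀ x ∈ lie L, dag S x ∈ lie L) {x : Mat N}
    (hx : x ∈ lie G) : ∃ u ∈ lie U, ∃ y ∈ lie L, ∃ v ∈ lie U, x = u + y + dag S v := by
  have hLG : lie L ≤ lie G := lie_mono (hL.le.trans hP.1)
  have hUG : lie U ≤ lie G := lie_mono (hU.1.trans hP.1)
  let W : Submodule ℂ (Mat N) :=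
    { carrier := {x | ∃ u ∈ lie U, ∃ y ∈ lie L, ∃ v ∈ lie U, x = u + y + dag S v}
      zero_mem' := ⟨0, (lie U).zero_mem, 0, (lie L).zero_mem, 0, (lie U).zero_mem, by simp⟩
      add_mem' := by
        rintro _ _ ⟨u, hu, y, hy, v, hv, rfl⟩ ⟨u', hu', y', hy', v', hv', rfl⟩
        refine ⟨u + u', (lie U).add_mem hu hu', y + y', (lie L).add_mem hy hy', v + v',
          (lie U).add_mem hv hv', ?_⟩
        rw [map_add]
        abel
      smul_mem' := by
        rintro c _ ⟨u, hu, y, hy, v, hv, rfl⟩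
        refine ⟨c • u, (lie U).smul_mem c hu, c • y, (lie L).smul_mem c hy, starRingEnd ℂ c • v,
          (lie U).smul_mem _ hv, ?_⟩
        rw [LinearMap.map_smulₛₗ, Complex.conj_conj, smul_add, smul_add] }
  have hWd : ∀ x ∈ W, dag S x ∈ W := by
    rintro _ ⟨u, hu, y, hy, v, hv, rfl⟩
    refine ⟨v, hv, dag S y, hdL y hy, u, hu, ?_⟩
    rw [map_add, map_add, dag_dag]
    abel
  have hWG : ∀ x ∈ W, x ∈ lie G := by
    rintro _ ⟨u, hu, y, hy, v, hv, rfl⟩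
    exact (lie G).add_mem ((lie G).add_mem (hUG hu) (hLG hy)) (hdG v (hUG hv))
  have hPW : ∀ y ∈ lie P, y ∈ W := by
    intro y hy
    obtain ⟨u, hu, z, hz, rfl⟩ := hL.exists_lie_add hP.2.1 hU hd hy
    exact ⟨u, hu, z, hz, 0, (lie U).zero_mem, by simp⟩
  obtain ⟨w, hw, hw'⟩ := exists_mem_trace_eq hWd x
  set z := x - w with hz
  have hzG : z ∈ lie G := (lie G).sub_mem hx (hWG w hw)
  have hz' : ∀ c ∈ W, trace (dag S z * c) = 0 := by
    intro c hc
    have h1 := hw' (dag S c) (hWd c hc)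
    rw [trace_mul_dag_symm, Matrix.trace_mul_comm] at h1
    simpa using h1
  -- The component z of x orthogonal to W has hermitian and anti-hermitian parts still orthogonal to
  -- 𝔭 ⊂ W, since W is stable under the adjoint. The criterion for self-adjoint elements kills both,
  -- the second after multiplication by i.
  have h1 : z + dag S z = 0 := by
    refine hP.eq_zero_of_trace_eq_zero (S := S) hG ((lie G).add_mem hzG (hdG z hzG)) ?_ fun y hy => ?_
    · rw [map_add, dag_dag, add_comm]
    · rw [add_mul, Matrix.trace_add, hw' y (hPW y hy), hz' y (hPW y hy), add_zero]
  have h2 : Complex.I • (z - dag S z) = 0 := by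
    refine hP.eq_zero_of_trace_eq_zero (S := S) hG ((lie G).smul_mem _ ((lie G).sub_mem hzG (hdG z hzG)))
      ?_ fun y hy => ?_
    · rw [LinearMap.map_smulₛₗ, map_sub, dag_dag, Complex.conj_I, neg_smul, ← smul_neg, neg_sub]
    · rw [smul_mul_assoc, sub_mul, Matrix.trace_smul, Matrix.trace_sub, hw' y (hPW y hy),
        hz' y (hPW y hy), sub_zero, smul_zero]
  have h3 : z - dag S z = 0 := (smul_eq_zero.1 h2).resolve_left Complex.I_ne_zero
  have h4 : z = 0 := by
    have h5 : (2 : ℂ) • z = (z + dag S z) + (z - dag S z) := by rw [two_smul]; abel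
    rw [h1, h3, add_zero] at h5
    exact (smul_eq_zero.1 h5).resolve_left two_ne_zero
  rw [sub_eq_zero.1 (hz.symm.trans h4)]
  exact hw

end ParabolicDecomposition

/-! ### The Lie algebra of the maximal torus is its own centralizer -/

namespace Frame

open Matrix

variable {N : ℕ} {X : HorosymmetricSpace N} (F : Frame X)

/-- A matrix whose Gram form is invariant under the maximal compact group, so that `θ` is minus the
corresponding adjoint. -/
def gram : GLN N := Classical.choose F.C.exists_dag

theorem dθ_eq (x : lie X.G) : (F.C.dθ x : Mat N) = -dag F.gram x :=
  Classical.choose_spec F.C.exists_dag x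

theorem dag_mem_G {x : Mat N} (hx : x ∈ lie X.G) : dag F.gram x ∈ lie X.G := by
  have := (lie X.G).neg_mem (F.C.dθ ⟨x, hx⟩).2
  rwa [F.dθ_eq, neg_neg] at this

theorem dag_mem_L {x : Mat N} (hx : x ∈ lie X.L) : dag F.gram x ∈ lie X.L := by
  have := (lie X.L).neg_mem (F.C.dθ_mem_L ⟨x, hx⟩)
  rwa [F.dθ_eq, neg_neg] at this

theorem dag_mem_T {x : Mat N} (hx : x ∈ lie F.S.T) : dag F.gram x ∈ lie F.S.T := by
  have hxG : x ∈ lie X.G := lie_mono F.S.le_G hx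
  have : (F.C.dθ ⟨x, hxG⟩ : Mat N) ∈ lie F.S.T := by
    refine mem_lie_of_exp fun s => ?_
    have hs : ((expIn X.G_closed ((s : ℂ) • ⟨x, hxG⟩) : X.G) : GLN N) ∈ F.S.T :=
      exp_mem F.S.torus.1 ((lie F.S.T).smul_mem (s : ℂ) hx)
    have h := F.T_stable _ hs
    have h3 : F.C.dθ ((s : ℂ) • ⟨x, hxG⟩) = (s : ℂ) • F.C.dθ ⟨x, hxG⟩ := F.C.dθ_smul s _
    rw [F.C.θ_exp, h3, CartanInvolution.expIn_smul] at h
    exact h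
  have := (lie F.S.T).neg_mem this
  rwa [F.dθ_eq, neg_neg] at this

theorem exists_dag_L : ∀ g ∈ X.L, ∃ g' ∈ X.L, dag F.gram (g : Mat N) = (g' : Mat N) := by
  intro g hg
  refine ⟨(F.C.θ ⟨g, X.L_le_G hg⟩ : GLN N)⁻¹, X.L.inv_mem (F.C.map_L ⟨g, hg⟩), ?_⟩
  have h := F.C.θ_mul_dag F.dθ_eq ⟨g, X.L_le_G hg⟩
  have h1 := congrArg (fun m => (((F.C.θ ⟨g, X.L_le_G hg⟩ : GLN N)⁻¹ : GLN N) : Mat N) * m) h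
  simpa only [GL_inv_mul_cancel, mul_one] using h1

theorem lie_T_le_L : lie F.S.T ≤ lie X.L := lie_mono F.S.le_L

theorem exists_decomposition_P {x : Mat N} (hx : x ∈ lie X.G) :
    ∃ u ∈ lie X.Pu, ∃ y ∈ lie X.L, ∃ v ∈ lie X.Pu, x = u + y + dag F.gram v :=
  X.P_parabolic.exists_decomposition X.G_closed X.Pu_radical.1 X.L_levi F.exists_dag_L
    (fun _ => F.dag_mem_G) (fun _ => F.dag_mem_L) hx

theorem exists_decomposition_Q {x : Mat N} (hx : x ∈ lie X.G) :
    ∃ u ∈ lie F.Qu, ∃ y ∈ lie X.L, ∃ v ∈ lie F.Qu, x = u + y + dag F.gram v :=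
  F.Q_parabolic.exists_decomposition X.G_closed F.Qu_radical.1 F.L_levi_Q F.exists_dag_L
    (fun _ => F.dag_mem_G) (fun _ => F.dag_mem_L) hx

/-- The torus hull of D lies in L and contains T, so it equals T by maximality; hence D cannot
exceed 𝔱. -/
theorem mem_lie_of_torus_hull {D : Submodule ℂ (Mat N)} (hDL : ∀ x ∈ D, x ∈ lie X.L)
    (hDd : ∀ x ∈ D, dag F.gram x ∈ D) (hDc : ∀ x ∈ D, ∀ y ∈ D, ⁅x, y⁆ = 0)
    (hTD : ∀ x ∈ lie F.S.T, x ∈ D) {x : Mat N} (hx : x ∈ D) : x ∈ lie F.S.T := by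
  obtain ⟨g, hg⟩ := exists_conj_isDiag hDd hDc
  obtain ⟨A, hA, hDA, hmin⟩ := exists_torus_hull g hg
  have hAL : A ≤ X.L := hmin _ X.L_levi.closed fun y hy => exp_mem X.L_levi.closed (hDL y hy)
  have hTA : F.S.T ≤ A := le_of_forall_expGL_mem F.S.torus.1 F.S.torus.2.1 fun y hy =>
    exp_mem hA.1 (hDA y (hTD y hy))
  rw [← F.S.maximal A hA hAL hTA]
  exact hDA x hx

/-- The Lie algebra of a maximal torus is its own centralizer in the Levi subalgebra. -/
theorem mem_lie_T_of_mem_L {x : Mat N} (hx : x ∈ lie X.L) (hc : ∀ h ∈ lie F.S.T, ⁅h, x⁆ = 0) :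
    x ∈ lie F.S.T := by
  have key : ∀ y ∈ lie X.L, dag F.gram y = y → (∀ h ∈ lie F.S.T, ⁅h, y⁆ = 0) → y ∈ lie F.S.T := by
    intro y hy hd hyc
    refine F.mem_lie_of_torus_hull (D := (lie F.S.T).toSubmodule ⊔ Submodule.span ℂ {y}) ?_ ?_ ?_ ?_
      (Submodule.mem_sup_right (Submodule.mem_span_singleton_self y))
    · intro z hz
      obtain ⟨h, hh, w, hw, rfl⟩ := Submodule.mem_sup.1 hz
      obtain ⟨c, rfl⟩ := Submodule.mem_span_singleton.1 hw
      exact (lie X.L).add_mem (F.lie_T_le_L hh) ((lie X.L).smul_mem c hy)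
    · intro z hz
      obtain ⟨h, hh, w, hw, rfl⟩ := Submodule.mem_sup.1 hz
      obtain ⟨c, rfl⟩ := Submodule.mem_span_singleton.1 hw
      rw [map_add, LinearMap.map_smulₛₗ, hd]
      exact Submodule.add_mem_sup (F.dag_mem_T hh) (Submodule.smul_mem _ _ (Submodule.mem_span_singleton_self y))
    · intro z hz z' hz'
      obtain ⟨h, hh, w, hw, rfl⟩ := Submodule.mem_sup.1 hz
      obtain ⟨c, rfl⟩ := Submodule.mem_span_singleton.1 hw
      obtain ⟨h', hh', w', hw', rfl⟩ := Submodule.mem_sup.1 hz'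
      obtain ⟨c', rfl⟩ := Submodule.mem_span_singleton.1 hw'
      rw [add_lie, lie_add, lie_add, smul_lie, smul_lie, lie_smul, lie_smul, lie_self,
        F.S.torus.lie_eq_zero hh hh', hyc h hh, ← lie_skew, hyc h' hh']
      simp
    · intro h hh
      exact Submodule.mem_sup_left hh
  have hc' : ∀ h ∈ lie F.S.T, ⁅h, dag F.gram x⁆ = 0 := by
    intro h hh
    have h1 := hc (dag F.gram h) (F.dag_mem_T hh)
    have h2 := congrArg (dag F.gram) h1
    rw [dag_lie, dag_dag, map_zero, ← lie_skew, neg_eq_zero] at h2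
    exact h2
  have h1 := key (x + dag F.gram x) ((lie X.L).add_mem hx (F.dag_mem_L hx))
    (by rw [map_add, dag_dag, add_comm]) fun h hh => by rw [lie_add, hc h hh, hc' h hh, add_zero]
  have h2 := key (Complex.I • (x - dag F.gram x))
    ((lie X.L).smul_mem _ ((lie X.L).sub_mem hx (F.dag_mem_L hx)))
    (by rw [LinearMap.map_smulₛₗ, map_sub, dag_dag, Complex.conj_I, neg_smul, ← smul_neg, neg_sub])
    fun h hh => by rw [lie_smul, lie_sub, hc h hh, hc' h hh, sub_zero, smul_zero]
  have h6 : x = (1 / 2 : ℂ) • (x + dag F.gram x) + (-Complex.I / 2) • (Complex.I • (x - dag F.gram x)) := by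
    rw [smul_smul, show -Complex.I / 2 * Complex.I = 1 / 2 by
      rw [div_mul_eq_mul_div, neg_mul, Complex.I_mul_I, neg_neg], ← smul_add, add_add_sub_cancel,
      ← two_smul ℂ x, smul_smul]
    norm_num
  rw [h6]
  exact (lie F.S.T).add_mem ((lie F.S.T).smul_mem _ h1) ((lie F.S.T).smul_mem _ h2)

theorem lie_mem_Pu {h u : Mat N} (hh : h ∈ lie F.S.T) (hu : u ∈ lie X.Pu) : ⁅h, u⁆ ∈ lie X.Pu :=
  lie_mem_of_normal X.P_parabolic.2.1 X.Pu_radical.1.2.1 X.Pu_radical.1.1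
    (lie_mono X.L_levi.le (F.lie_T_le_L hh)) hu

theorem lie_dag {h v : Mat N} : ⁅h, dag F.gram v⁆ = -dag F.gram ⁅dag F.gram h, v⁆ := by
  rw [dag_lie, dag_dag, lie_skew]

/-- The components of an element of the centralizer of the torus are in the centralizer. -/
theorem exists_decomposition_centralizer {x : Mat N} (hx : x ∈ lie X.G)
    (hc : ∀ h ∈ lie F.S.T, ⁅h, x⁆ = 0) : ∃ u ∈ lie X.Pu, ∃ y ∈ lie F.S.T, ∃ v ∈ lie X.Pu,
      (∀ h ∈ lie F.S.T, ⁅h, u⁆ = 0) ∧ (∀ h ∈ lie F.S.T, ⁅h, v⁆ = 0) ∧ x = u + y + dag F.gram v := by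
  obtain ⟨u, hu, y, hy, v, hv, rfl⟩ := F.exists_decomposition_P hx
  have h1 : ∀ h ∈ lie F.S.T, ⁅h, u⁆ = 0 ∧ ⁅h, y⁆ = 0 ∧ -⁅dag F.gram h, v⁆ = 0 := by
    intro h hh
    refine X.L_levi.eq_zero_of_add_eq_zero (S := F.gram) X.P_parabolic.2.1 X.Pu_radical.1
      (fun _ => F.dag_mem_L) (F.lie_mem_Pu hh hu) ((lie X.L).lie_mem (F.lie_T_le_L hh) hy)
      ((lie X.Pu).neg_mem (F.lie_mem_Pu (F.dag_mem_T hh) hv)) ?_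
    rw [map_neg, ← lie_dag, ← lie_add, ← lie_add]
    exact hc h hh
  refine ⟨u, hu, y, F.mem_lie_T_of_mem_L hy fun h hh => (h1 h hh).2.1, v, hv, fun h hh => (h1 h hh).1,
    fun h hh => ?_, rfl⟩
  have := (h1 (dag F.gram h) (F.dag_mem_T hh)).2.2
  rwa [dag_dag, neg_eq_zero] at this

/-- The aim is [u,u†] = 0, since a normal nilpotent matrix is zero. The self-adjoint element x =
[u,u†] centralizes 𝔱, so it decomposes as n + y + v† within the centralizer. By invariance, tr(nx)
and tr(yx) reduce to traces with [n,u] = 0 and [y,u] = 0, and tr(v†x) is the conjugate of tr(vx) =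
0. Thus tr(x²) = 0. -/
theorem eq_zero_of_mem_Pu_of_central {u : Mat N} (hu : u ∈ lie X.Pu) (hc : ∀ h ∈ lie F.S.T, ⁅h, u⁆ = 0)
    (hcen : ∀ n ∈ lie X.Pu, (∀ h ∈ lie F.S.T, ⁅h, n⁆ = 0) → ⁅u, n⁆ = 0) : u = 0 := by
  refine eq_zero_of_normal_of_isNilpotent (S := F.gram) ?_ (X.Pu_radical.1.isNilpotent hu)
  have huG : u ∈ lie X.G := lie_mono (X.Pu_radical.1.1.trans X.P_le_G) hu
  have hcd : ∀ h ∈ lie F.S.T, ⁅h, dag F.gram u⁆ = 0 := fun h hh => by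
    rw [lie_dag, hc _ (F.dag_mem_T hh), map_zero, neg_zero]
  set x := ⁅u, dag F.gram u⁆ with hx
  have hxd : dag F.gram x = x := by rw [hx, dag_lie, dag_dag]
  obtain ⟨n, hn, y, hy, v, hv, hnc, hvc, hdec⟩ := F.exists_decomposition_centralizer (x := x)
    ((lie X.G).lie_mem huG (F.dag_mem_G huG)) fun h hh => by
      rw [hx, leibniz_lie, hc h hh, hcd h hh, zero_lie, lie_zero, add_zero]
  have hxn : ∀ n ∈ lie X.Pu, (∀ h ∈ lie F.S.T, ⁅h, n⁆ = 0) → trace (n * x) = 0 := by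
    intro n hn hnc
    rw [hx, ← trace_lie_mul, ← lie_skew, hcen n hn hnc, neg_zero, zero_mul, Matrix.trace_zero]
  apply trace_mul_dag_self_eq_zero F.gram
  rw [hxd]
  nth_rewrite 1 [hdec]
  rw [add_mul, add_mul, Matrix.trace_add, Matrix.trace_add, hxn n hn hnc]
  have h1 : trace (y * x) = 0 := by
    rw [hx, ← trace_lie_mul, hc y hy, zero_mul, Matrix.trace_zero]
  have h2 : trace (dag F.gram v * x) = 0 := by
    rw [Matrix.trace_mul_comm, trace_mul_dag_symm, hxd, hxn v hv hvc, map_zero]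
  rw [h1, h2, add_zero, add_zero]

/-- Descending induction on the depth at which u shifts the filtration. Brackets with centralizing
elements of 𝔭^u are one step deeper, hence zero by induction, and the central case applies. -/
theorem eq_zero_of_mem_Pu_of_centralizes {u : Mat N} (hu : u ∈ lie X.Pu)
    (hc : ∀ h ∈ lie F.S.T, ⁅h, u⁆ = 0) : u = 0 := by
  obtain ⟨K, hK⟩ := exists_lowerFiltration_eq_bot fun x hx => X.Pu_radical.1.isNilpotent (u := x) hx
  have h1 : ∀ n ∈ lie X.Pu, n ∈ shifting (lowerFiltration (lie X.Pu)) 1 := fun n hn k v hv =>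
    mulVec_mem_lowerFiltration_succ hn hv
  have key : ∀ i j, j + i = K → ∀ u ∈ lie X.Pu, (∀ h ∈ lie F.S.T, ⁅h, u⁆ = 0) →
      u ∈ shifting (lowerFiltration (lie X.Pu)) j → u = 0 := by
    intro i
    induction i with
    | zero =>
      intro j hj u _ _ hs
      rw [add_zero] at hj
      subst hj
      apply Matrix.toLin'.injective
      apply LinearMap.ext
      intro v
      have := hs 0 v trivial
      rw [zero_add, hK, Submodule.mem_bot] at this
      simpa using this
    | succ i ih =>
      intro j hj u hu hc hs
      refine F.eq_zero_of_mem_Pu_of_central hu hc fun n hn hnc => ?_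
      refine ih (j + 1) (by omega) _ ((lie X.Pu).lie_mem hu hn) (fun h hh => ?_) ?_
      · rw [leibniz_lie, hc h hh, hnc h hh, zero_lie, lie_zero, add_zero]
      · rw [Ring.lie_def]
        refine Submodule.sub_mem _ ?_ (mul_mem_shifting (h1 n hn) hs)
        rw [add_comm]
        exact mul_mem_shifting hs (h1 n hn)
  exact key K 0 (zero_add K) u hu hc (by
    intro k v hv
    rw [add_zero]
    exact lowerFiltration_succ_le _ k (mulVec_mem_lowerFiltration_succ hu hv))

/-- The Lie algebra of a maximal torus is its own centralizer. -/
theorem mem_lie_T_of_mem_G {x : Mat N} (hx : x ∈ lie X.G) (hc : ∀ h ∈ lie F.S.T, ⁅h, x⁆ = 0) :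
    x ∈ lie F.S.T := by
  obtain ⟨u, hu, y, hy, v, hv, huc, hvc, rfl⟩ := F.exists_decomposition_centralizer hx hc
  rw [F.eq_zero_of_mem_Pu_of_centralizes hu huc, F.eq_zero_of_mem_Pu_of_centralizes hv hvc]
  simpa using hy

end Frame

/-! ### Root spaces and the trichotomy of roots -/

section RootSpaces

variable {N : ℕ} {G T : Subgroup (GLN N)}

theorem lie_mem_rootSpace {α β : Module.Dual ℂ (lie T)} {x y : Mat N} (hx : x ∈ rootSpace G T α)
    (hy : y ∈ rootSpace G T β) : ⁅x, y⁆ ∈ rootSpace G T (α + β) := by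
  refine ⟨(lie G).lie_mem hx.1 hy.1, fun h => ?_⟩
  rw [leibniz_lie, hx.2, hy.2, smul_lie, lie_smul, ← add_smul]
  rfl

theorem trace_mul_eq_zero_of_rootSpace {α β : Module.Dual ℂ (lie T)} {x y : Mat N}
    (hx : x ∈ rootSpace G T α) (hy : y ∈ rootSpace G T β) (hne : α + β ≠ 0) :
    Matrix.trace (x * y) = 0 := by
  obtain ⟨h, hh⟩ := DFunLike.ne_iff.1 hne
  have h1 := trace_lie_mul x (h : Mat N) y
  rw [← lie_skew, hx.2, hy.2, neg_mul, smul_mul_assoc, mul_smul_comm, Matrix.trace_neg, Matrix.trace_smul,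
    Matrix.trace_smul, smul_eq_mul, smul_eq_mul] at h1
  have h2 : (α + β) h * Matrix.trace (x * y) = 0 := by
    rw [LinearMap.add_apply]
    linear_combination -h1
  exact (mul_eq_zero.1 h2).resolve_left hh

end RootSpaces

namespace Frame

open Matrix

variable {N : ℕ} {X : HorosymmetricSpace N} (F : Frame X)

/-- The adjoint on the Lie algebra of the torus. -/
def dagT (h : lie F.S.T) : lie F.S.T := ⟨dag F.gram h, F.dag_mem_T h.2⟩

/-- Computing tr(x†[h,x]) in two ways. In particular roots take real values on self-adjoint elements
of 𝔱, and the adjoint exchanges the root spaces of α and -α. -/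
theorem conj_root {α : Module.Dual ℂ (lie F.S.T)} {x : Mat N} (hx : x ∈ rootSpace X.G F.S.T α)
    (hx0 : x ≠ 0) (h : lie F.S.T) : α (F.dagT h) = starRingEnd ℂ (α h) := by
  have h1 : ⁅(h : Mat N), x⁆ = α h • x := hx.2 h
  have h2 : ⁅dag F.gram (h : Mat N), x⁆ = α (F.dagT h) • x := hx.2 (F.dagT h)
  have h3 := trace_lie_mul (dag F.gram x) (h : Mat N) x
  rw [h1, ← lie_skew, lie_dag, neg_neg, h2, LinearMap.map_smulₛₗ, smul_mul_assoc, mul_smul_comm,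
    Matrix.trace_smul, Matrix.trace_smul, smul_eq_mul, smul_eq_mul, Matrix.trace_mul_comm] at h3
  have h4 : trace (x * dag F.gram x) ≠ 0 := fun h => hx0 (trace_mul_dag_self_eq_zero F.gram h)
  rw [← mul_right_cancel₀ h4 h3, Complex.conj_conj]

theorem dag_mem_rootSpace {α : Module.Dual ℂ (lie F.S.T)} {x : Mat N}
    (hx : x ∈ rootSpace X.G F.S.T α) : dag F.gram x ∈ rootSpace X.G F.S.T (-α) := by
  by_cases hx0 : x = 0
  · rw [hx0, map_zero]; exact Submodule.zero_mem _
  refine ⟨F.dag_mem_G hx.1, fun h => ?_⟩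
  have h1 : ⁅dag F.gram (h : Mat N), x⁆ = α (F.dagT h) • x := hx.2 (F.dagT h)
  rw [lie_dag, h1, LinearMap.map_smulₛₗ, F.conj_root hx hx0, Complex.conj_conj, LinearMap.neg_apply, neg_smul]

theorem trace_mul_dag_eq_zero {α β : Module.Dual ℂ (lie F.S.T)} {x y : Mat N}
    (hx : x ∈ rootSpace X.G F.S.T α) (hy : y ∈ rootSpace X.G F.S.T β) (hne : α ≠ β) :
    trace (x * dag F.gram y) = 0 :=
  trace_mul_eq_zero_of_rootSpace hx (F.dag_mem_rootSpace hy) (by rwa [← sub_eq_add_neg, sub_ne_zero])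

theorem mem_rootSpace_zero {x : Mat N} : x ∈ rootSpace X.G F.S.T 0 ↔ x ∈ lie F.S.T := by
  constructor
  · intro hx
    refine F.mem_lie_T_of_mem_G hx.1 fun h hh => ?_
    have := hx.2 ⟨h, hh⟩
    simpa using this
  · intro hx
    refine ⟨lie_mono F.S.le_G hx, fun h => ?_⟩
    rw [F.S.torus.lie_eq_zero h.2 hx]
    simp

variable {F}
variable {α : Module.Dual ℂ (lie F.S.T)}

theorem coroot_eq (hα : α ∈ roots X.G F.S.T) :
    (F.coroot α : Mat N) = ⁅(F.e α : Mat N), dag F.gram (F.e α : Mat N)⁆ := by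
  rw [← F.e_normalized α hα, LieSubalgebra.coe_bracket, F.dθ_eq, neg_lie, lie_skew]

theorem e_coe_ne_zero (hα : α ∈ roots X.G F.S.T) : (F.e α : Mat N) ≠ 0 := fun h =>
  F.e_ne_zero α hα (Subtype.ext h)

theorem root_coroot (hα : α ∈ roots X.G F.S.T) : α (F.coroot α) = 2 := by
  have h := (F.coroot_spec α hα).2
  set κ := killingForm ℂ (lie X.G) ⟨F.coroot α, lie_mono F.S.le_G (F.coroot α).2⟩
    ⟨F.coroot α, lie_mono F.S.le_G (F.coroot α).2⟩ with hκ
  -- With division by zero equal to zero, κ = 0 would make α vanish, which a root does not.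
  by_cases hk : κ = 0
  · exfalso
    apply hα.1
    ext x
    rw [h x, hk, div_zero]
    rfl
  · rw [h, ← hκ, mul_div_assoc, div_self hk, mul_one]

/-- The root spaces are one-dimensional. -/
theorem exists_eq_smul_e (hα : α ∈ roots X.G F.S.T) {x : Mat N} (hx : x ∈ rootSpace X.G F.S.T α) :
    ∃ c : ℂ, x = c • (F.e α : Mat N) := by
  set e : Mat N := (F.e α).1 with he
  have he0 : e ≠ 0 := e_coe_ne_zero hα
  have heα : e ∈ rootSpace X.G F.S.T α := F.e_mem α hα
  have htr : trace (e * dag F.gram e) ≠ 0 := fun h => he0 (trace_mul_dag_self_eq_zero F.gram h)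
  refine ⟨trace (x * dag F.gram e) / trace (e * dag F.gram e), ?_⟩
  rw [← sub_eq_zero]
  -- The component of x orthogonal to e = e_α for tr(xy†). Then [y,e†] lies in 𝔱 and has norm zero,
  -- since its pairing with h in 𝔱 is a multiple of tr(ye†).
  set y := x - (trace (x * dag F.gram e) / trace (e * dag F.gram e)) • e with hy
  have hyα : y ∈ rootSpace X.G F.S.T α := Submodule.sub_mem _ hx (Submodule.smul_mem _ _ heα)
  have hye : trace (y * dag F.gram e) = 0 := by
    rw [hy, sub_mul, smul_mul_assoc, Matrix.trace_sub, Matrix.trace_smul, smul_eq_mul,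
      div_mul_cancel₀ _ htr, sub_self]
  have hzT : ⁅y, dag F.gram e⁆ ∈ lie F.S.T := by
    rw [← mem_rootSpace_zero]
    have := lie_mem_rootSpace hyα (F.dag_mem_rootSpace heα)
    rwa [add_neg_cancel] at this
  have hz : ⁅y, dag F.gram e⁆ = 0 := by
    apply trace_mul_dag_self_eq_zero F.gram
    have h1 := (F.dag_mem_rootSpace heα).2 ⟨_, F.dag_mem_T hzT⟩
    rw [trace_lie_mul, ← lie_skew]
    have h2 : ⁅dag F.gram ⁅y, dag F.gram e⁆, dag F.gram e⁆ = (-α) ⟨_, F.dag_mem_T hzT⟩ • dag F.gram e := h1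
    rw [h2, mul_neg, mul_smul_comm, Matrix.trace_neg, Matrix.trace_smul, hye, smul_zero, neg_zero]
  -- With [y,e†] = 0 and α(α^∨) = 2, the squared norm of [e,y] equals -2 times that of y. Positivity
  -- forces y = 0.
  have h3 : trace (⁅e, y⁆ * dag F.gram ⁅e, y⁆) = -2 * trace (y * dag F.gram y) := by
    have h4 : ⁅y, ⁅dag F.gram y, dag F.gram e⁆⁆ = ⁅⁅y, dag F.gram y⁆, dag F.gram e⁆ := by
      rw [leibniz_lie, hz, lie_zero, add_zero]
    have h5 : ⁅(F.coroot α : Mat N), dag F.gram y⁆ = (-2 : ℂ) • dag F.gram y := by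
      rw [(F.dag_mem_rootSpace hyα).2 (F.coroot α), LinearMap.neg_apply, root_coroot hα]
    rw [dag_lie, trace_lie_mul, h4, Matrix.trace_mul_comm, trace_lie_mul, ← lie_skew (dag F.gram e) e,
      ← coroot_eq hα, mul_neg, Matrix.trace_neg, trace_lie_mul, ← lie_skew, h5, mul_neg,
      mul_smul_comm, Matrix.trace_neg, Matrix.trace_smul, smul_eq_mul]
    ring
  have h6 := congrArg Complex.re h3
  have h7 := trace_mul_dag_self_re_nonneg F.gram ⁅e, y⁆
  by_contra hne
  have h8 := trace_mul_dag_self_re_pos F.gram hne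
  rw [h6, show (-2 : ℂ) * trace (y * dag F.gram y) = ((-2 : ℝ) : ℂ) * trace (y * dag F.gram y) by norm_num,
    Complex.re_ofReal_mul] at h7
  linarith

theorem dag_e_mem (hα : α ∈ roots X.G F.S.T) :
    dag F.gram (F.e α : Mat N) ∈ rootSpace X.G F.S.T (-α) := F.dag_mem_rootSpace (F.e_mem α hα)

theorem neg_mem_roots (hα : α ∈ roots X.G F.S.T) : -α ∈ roots X.G F.S.T := by
  refine ⟨neg_ne_zero.2 hα.1, fun h => ?_⟩
  have h1 := dag_e_mem hα
  rw [h, Submodule.mem_bot] at h1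
  have h2 := congrArg (dag F.gram) h1
  rw [dag_dag, map_zero] at h2
  exact e_coe_ne_zero hα h2

theorem mem_of_exists_mem (hα : α ∈ roots X.G F.S.T) {V : Submodule ℂ (Mat N)} {x y : Mat N}
    (hx : x ∈ rootSpace X.G F.S.T α) (hxV : x ∈ V) (hx0 : x ≠ 0) (hy : y ∈ rootSpace X.G F.S.T α) :
    y ∈ V := by
  obtain ⟨c, rfl⟩ := exists_eq_smul_e hα hx
  obtain ⟨d, rfl⟩ := exists_eq_smul_e hα hy
  have hc : c ≠ 0 := fun h => hx0 (by rw [h, zero_smul])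
  have := V.smul_mem (d / c) hxV
  rwa [smul_smul, div_mul_cancel₀ _ hc] at this

/-- The three components of e_α relative to 𝔲 + 𝔩 + 𝔲† are again of weight α, by independence of the
sum. A nonzero one spans the line of the root α. -/
theorem root_trichotomy {P U : Subgroup (GLN N)} (hP : IsZariskiClosed P) (hU : IsNormalUnipotent P U)
    (hL : IsLevi P U X.L)
    (hdec : ∀ x ∈ lie X.G, ∃ u ∈ lie U, ∃ y ∈ lie X.L, ∃ v ∈ lie U, x = u + y + dag F.gram v)
    (hUG : lie U ≤ lie X.G) (hα : α ∈ roots X.G F.S.T) :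
    (F.e α : Mat N) ∈ lie U ∨ (F.e α : Mat N) ∈ lie X.L ∨ dag F.gram (F.e α : Mat N) ∈ lie U := by
  obtain ⟨u, hu, y, hy, v, hv, he⟩ := hdec _ (F.e α).2
  have hlU : ∀ h ∈ lie F.S.T, ∀ u ∈ lie U, ⁅h, u⁆ ∈ lie U := fun h hh u hu =>
    lie_mem_of_normal hP hU.2.1 hU.1 (lie_mono hL.le (F.lie_T_le_L hh)) hu
  have key : ∀ h : lie F.S.T, ⁅(h : Mat N), u⁆ - α h • u = 0 ∧ ⁅(h : Mat N), y⁆ - α h • y = 0 ∧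
      -⁅dag F.gram (h : Mat N), v⁆ - starRingEnd ℂ (α h) • v = 0 := by
    intro h
    refine hL.eq_zero_of_add_eq_zero (S := F.gram) hP hU (fun _ => F.dag_mem_L)
      ((lie U).sub_mem (hlU h h.2 u hu) ((lie U).smul_mem _ hu))
      ((lie X.L).sub_mem ((lie X.L).lie_mem (F.lie_T_le_L h.2) hy) ((lie X.L).smul_mem _ hy))
      ((lie U).sub_mem ((lie U).neg_mem (hlU _ (F.dag_mem_T h.2) v hv)) ((lie U).smul_mem _ hv)) ?_
    rw [map_sub, map_neg, ← lie_dag, LinearMap.map_smulₛₗ, Complex.conj_conj]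
    have h1 := (F.e_mem α hα).2 h
    rw [he, lie_add, lie_add, smul_add, smul_add] at h1
    rw [← sub_eq_zero] at h1
    rw [← h1]
    abel
  have hLG : lie X.L ≤ lie X.G := lie_mono X.L_le_G
  have hum : u ∈ rootSpace X.G F.S.T α := ⟨hUG hu, fun h => sub_eq_zero.1 (key h).1⟩
  have hym : y ∈ rootSpace X.G F.S.T α := ⟨hLG hy, fun h => sub_eq_zero.1 (key h).2.1⟩
  have hvm : dag F.gram v ∈ rootSpace X.G F.S.T α := by
    refine ⟨F.dag_mem_G (hUG hv), fun h => ?_⟩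
    have h2 := congrArg (dag F.gram) (sub_eq_zero.1 (key h).2.2)
    rw [map_neg, ← lie_dag, LinearMap.map_smulₛₗ, Complex.conj_conj] at h2
    exact h2
  by_cases hu0 : u = 0
  · by_cases hy0 : y = 0
    · right; right
      rw [he, hu0, hy0, zero_add, zero_add, dag_dag]
      exact hv
    · right; left
      exact mem_of_exists_mem hα (V := (lie X.L).toSubmodule) hym hy hy0 (F.e_mem α hα)
  · left
    exact mem_of_exists_mem hα (V := (lie U).toSubmodule) hum hu hu0 (F.e_mem α hα)

theorem lie_Pu_le : lie X.Pu ≤ lie X.G := lie_mono (X.Pu_radical.1.1.trans X.P_le_G)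

theorem lie_Qu_le : lie F.Qu ≤ lie X.G := lie_mono (F.Qu_radical.1.1.trans F.Q_parabolic.1)

theorem root_trichotomy_P (hα : α ∈ roots X.G F.S.T) :
    (F.e α : Mat N) ∈ lie X.Pu ∨ (F.e α : Mat N) ∈ lie X.L ∨ dag F.gram (F.e α : Mat N) ∈ lie X.Pu :=
  root_trichotomy X.P_parabolic.2.1 X.Pu_radical.1 X.L_levi (fun _ => F.exists_decomposition_P)
    lie_Pu_le hα

theorem root_trichotomy_Q (hα : α ∈ roots X.G F.S.T) :
    (F.e α : Mat N) ∈ lie F.Qu ∨ (F.e α : Mat N) ∈ lie X.L ∨ dag F.gram (F.e α : Mat N) ∈ lie F.Qu :=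
  root_trichotomy F.Q_parabolic.2.1 F.Qu_radical.1 F.L_levi_Q (fun _ => F.exists_decomposition_Q)
    lie_Qu_le hα

theorem eq_zero_of_mem_Qu_of_mem_L {x : Mat N} (hx : x ∈ lie F.Qu) (hx' : x ∈ lie X.L) : x = 0 :=
  (F.L_levi_Q.eq_zero_of_add_eq_zero (S := F.gram) F.Q_parabolic.2.1 F.Qu_radical.1
    (fun _ => F.dag_mem_L) hx ((lie X.L).neg_mem hx') (lie F.Qu).zero_mem (by simp)).1

theorem eq_zero_of_mem_Qu_of_mem_Pu {x : Mat N} (hx : x ∈ lie F.Qu) (hx' : x ∈ lie X.Pu) : x = 0 := by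
  have h := lie_inf F.Q_parabolic.2.1 X.P_parabolic.2.1 (lie_mono F.Qu_radical.1.1 hx)
    (lie_mono X.Pu_radical.1.1 hx')
  rw [F.Q_inf_P] at h
  exact eq_zero_of_mem_Qu_of_mem_L hx h

theorem dag_ne_zero {x : Mat N} (hx : x ≠ 0) : dag F.gram x ≠ 0 := fun h => hx (by
  have h2 := congrArg (dag F.gram) h
  rwa [dag_dag, map_zero] at h2)

theorem e_mem_Qu (hα : α ∈ F.rootsQu) : (F.e α : Mat N) ∈ lie F.Qu := hα.2 _ (F.e_mem α hα.1)

/-- The vector e_α is in 𝔮^u, which meets 𝔩 and 𝔭^u only in zero because P ∩ Q = L. The trichotomy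
for P leaves one case. -/
theorem dag_e_mem_Pu (hα : α ∈ F.rootsQu) : dag F.gram (F.e α : Mat N) ∈ lie X.Pu := by
  rcases root_trichotomy_P hα.1 with h | h | h
  · exact absurd (eq_zero_of_mem_Qu_of_mem_Pu (e_mem_Qu hα) h) (e_coe_ne_zero hα.1)
  · exact absurd (eq_zero_of_mem_Qu_of_mem_L (e_mem_Qu hα) h) (e_coe_ne_zero hα.1)
  · exact h

theorem mem_rootsIn_of_e_mem (hα : α ∈ roots X.G F.S.T) {A : Subgroup (GLN N)}
    (h : (F.e α : Mat N) ∈ lie A) : α ∈ rootsIn X.G F.S.T A :=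
  ⟨hα, fun _ hx => mem_of_exists_mem hα (V := (lie A).toSubmodule) (F.e_mem α hα) h (e_coe_ne_zero hα) hx⟩

/-- Every root is a root of the Levi subgroup or of one of the two opposite unipotent radicals. -/
theorem mem_rootsQu_or (hα : α ∈ roots X.G F.S.T) :
    α ∈ F.rootsQu ∨ α ∈ rootsIn X.G F.S.T X.L ∨ α ∈ rootsIn X.G F.S.T X.Pu := by
  rcases root_trichotomy_P hα with h | h | h
  · exact Or.inr (Or.inr (mem_rootsIn_of_e_mem hα h))
  · exact Or.inr (Or.inl (mem_rootsIn_of_e_mem hα h))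
  · rcases root_trichotomy_Q hα with h' | h' | h'
    · exact Or.inl (mem_rootsIn_of_e_mem hα h')
    · exact Or.inr (Or.inl (mem_rootsIn_of_e_mem hα h'))
    · exact absurd (eq_zero_of_mem_Qu_of_mem_Pu h' h) (dag_ne_zero (e_coe_ne_zero hα))

theorem notMem_rootsQu_of_mem_L (hα : α ∈ rootsIn X.G F.S.T X.L) : α ∉ F.rootsQu := fun h =>
  e_coe_ne_zero h.1 (eq_zero_of_mem_Qu_of_mem_L (e_mem_Qu h) (hα.2 _ (F.e_mem α hα.1)))

end Frame

/-! ### The differential of σ and the Lie algebra of L ∩ H -/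

namespace HorosymmetricSpace

open Matrix

variable {N : ℕ} (X : HorosymmetricSpace N)

theorem exists_sg : ∃ f : Mat N →ₗ[ℂ] Mat N, ∀ x : lie X.L, f x = X.dσ x := by
  obtain ⟨f, hf⟩ := LinearMap.exists_extend (p := (lie X.L).toSubmodule)
    ((lie X.L).toSubmodule.subtype ∘ₗ X.dσ)
  exact ⟨f, fun x => LinearMap.congr_fun hf x⟩

/-- A linear extension to all matrices of the differential of the involution. -/
def sg : Mat N →ₗ[ℂ] Mat N := Classical.choose X.exists_sg

theorem sg_coe (x : lie X.L) : X.sg x = X.dσ x := Classical.choose_spec X.exists_sg x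

variable {X}

theorem sg_apply {x : Mat N} (hx : x ∈ lie X.L) : X.sg x = X.dσ ⟨x, hx⟩ := X.sg_coe ⟨x, hx⟩

theorem sg_mem {x : Mat N} (hx : x ∈ lie X.L) : X.sg x ∈ lie X.L := by
  rw [sg_apply hx]; exact (X.dσ _).2

theorem sg_sg {x : Mat N} (hx : x ∈ lie X.L) : X.sg (X.sg x) = x := by
  rw [sg_apply hx, sg_coe, X.dσ_dσ]

theorem coe_σ_expGL {x : Mat N} (hx : x ∈ lie X.L) (h : expGL x ∈ X.L) :
    ((X.σ ⟨expGL x, h⟩ : X.L) : GLN N) = expGL (X.sg x) := by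
  rw [sg_apply hx]
  exact X.σ_expGL ⟨x, hx⟩ h

theorem expGL_real_smul_mem {A : Subgroup (GLN N)} (hA : IsZariskiClosed A) {x : Mat N}
    (hx : x ∈ lie A) (s : ℝ) : expGL (s • x) ∈ A := by
  have := exp_mem hA ((lie A).smul_mem (s : ℂ) hx)
  rwa [Complex.coe_smul] at this

theorem real_smul_mem {A : Subgroup (GLN N)} {x : Mat N} (hx : x ∈ lie A) (s : ℝ) : s • x ∈ lie A := by
  have := (lie A).smul_mem (s : ℂ) hx
  rwa [Complex.coe_smul] at this

theorem sg_real_smul (s : ℝ) (x : Mat N) : X.sg (s • x) = s • X.sg x := by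
  rw [← Complex.coe_smul, map_smul, Complex.coe_smul]

theorem sg_conj {x y : Mat N} (hx : x ∈ lie X.L) (hy : y ∈ lie X.L) :
    X.sg (NormedSpace.exp x * y * NormedSpace.exp (-x)) =
      NormedSpace.exp (X.sg x) * X.sg y * NormedSpace.exp (-X.sg x) := by
  have hex : expGL x ∈ X.L := exp_mem X.L_levi.closed hx
  have hc : (expGL x : Mat N) * y * ((expGL x)⁻¹ : GLN N) ∈ lie X.L := conj_mem_lie hex hy
  have hc' : (expGL (X.sg x) : Mat N) * X.sg y * ((expGL (X.sg x))⁻¹ : GLN N) ∈ lie X.L :=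
    conj_mem_lie (exp_mem X.L_levi.closed (sg_mem hx)) (sg_mem hy)
  change X.sg ((expGL x : Mat N) * y * ((expGL x)⁻¹ : GLN N)) =
    (expGL (X.sg x) : Mat N) * X.sg y * ((expGL (X.sg x))⁻¹ : GLN N)
  apply eq_of_exp
  intro s
  have h1 : (⟨expGL (s • ((expGL x : Mat N) * y * ((expGL x)⁻¹ : GLN N))),
      expGL_real_smul_mem X.L_levi.closed hc s⟩ : X.L) =
      ⟨expGL x, hex⟩ * ⟨expGL (s • y), expGL_real_smul_mem X.L_levi.closed hy s⟩ * (⟨expGL x, hex⟩)⁻¹ := by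
    apply Subtype.ext
    change expGL _ = expGL x * expGL (s • y) * (expGL x)⁻¹
    rw [conj_expGL, mul_smul_comm, smul_mul_assoc]
  rw [← sg_real_smul, ← coe_σ_expGL (real_smul_mem hc s) (expGL_real_smul_mem X.L_levi.closed hc s),
    h1, map_mul, map_mul, map_inv, Subgroup.coe_mul, Subgroup.coe_mul, Subgroup.coe_inv,
    coe_σ_expGL hx hex, coe_σ_expGL (real_smul_mem hy s), conj_expGL, sg_real_smul, mul_smul_comm,
    smul_mul_assoc]

-- The differential of a homomorphism respects brackets: differentiate its compatibility with
-- conjugation along a one-parameter group.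
open scoped Matrix.Norms.Operator in
theorem sg_lie {x y : Mat N} (hx : x ∈ lie X.L) (hy : y ∈ lie X.L) :
    X.sg ⁅x, y⁆ = ⁅X.sg x, X.sg y⁆ := by
  have h1 := (LinearMap.toContinuousLinearMap (X.sg.restrictScalars ℝ)).hasFDerivAt.comp_hasDerivAt 0
    (hasDerivAt_conj x y)
  have h2 := hasDerivAt_conj (X.sg x) (X.sg y)
  refine h1.unique (h2.congr_of_eventuallyEq (Eventually.of_forall fun s => ?_))
  have h3 := sg_conj (real_smul_mem hx s) hy
  rw [sg_real_smul] at h3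
  exact h3

theorem evalAt_det (A : Mat N) : evalAt A (Matrix.det (Matrix.mvPolynomialX (Fin N) (Fin N) ℂ)) = A.det := by
  rw [evalAt, RingHom.map_det]
  congr 1
  ext i j
  simp

/-- The elements of `L` that are diagonal in given coordinates and inverted by the involution form an
algebraic group. -/
theorem exists_isZariskiClosed_inverted (g : GLN N) : ∃ A : Subgroup (GLN N), IsZariskiClosed A ∧
    ∀ t, t ∈ A ↔ ∃ h : t ∈ X.L, ((g * t * g⁻¹ : GLN N) : Mat N).IsDiag ∧ X.σ ⟨t, h⟩ = (⟨t, h⟩ : X.L)⁻¹ := by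
  have hcomm : ∀ s t : GLN N, ((g * s * g⁻¹ : GLN N) : Mat N).IsDiag →
      ((g * t * g⁻¹ : GLN N) : Mat N).IsDiag → s * t = t * s := by
    intro s t hs ht
    have h1 := eq_diagIn (x := (s : Mat N)) (g := g) hs.diagonal_diag.symm
    have h2 := eq_diagIn (x := (t : Mat N)) (g := g) ht.diagonal_diag.symm
    apply Units.ext
    rw [Units.val_mul, Units.val_mul, h1, h2]
    exact commute_diagIn g _ _
  let A : Subgroup (GLN N) :=
    { carrier := {t | ∃ h : t ∈ X.L, ((g * t * g⁻¹ : GLN N) : Mat N).IsDiag ∧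
        X.σ ⟨t, h⟩ = (⟨t, h⟩ : X.L)⁻¹}
      one_mem' := ⟨X.L.one_mem, by simp [Matrix.isDiag_one], by
        have : (⟨1, X.L.one_mem⟩ : X.L) = 1 := rfl
        rw [this, map_one, inv_one]⟩
      mul_mem' := by
        rintro s t ⟨hs, hs1, hs2⟩ ⟨ht, ht1, ht2⟩
        refine ⟨X.L.mul_mem hs ht, ?_, ?_⟩
        · have h1 : g * (s * t) * g⁻¹ = (g * s * g⁻¹) * (g * t * g⁻¹) := by group
          rw [h1, Units.val_mul, ← hs1.diagonal_diag, ← ht1.diagonal_diag, Matrix.diagonal_mul_diagonal]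
          exact Matrix.isDiag_diagonal _
        · have h1 : (⟨s * t, X.L.mul_mem hs ht⟩ : X.L) = ⟨s, hs⟩ * ⟨t, ht⟩ := rfl
          have h2 : (⟨s, hs⟩ * ⟨t, ht⟩ : X.L) = ⟨t, ht⟩ * ⟨s, hs⟩ := Subtype.ext (hcomm s t hs1 ht1)
          rw [h1, map_mul, hs2, ht2, h2, _root_.mul_inv_rev]
      inv_mem' := by
        rintro s ⟨hs, hs1, hs2⟩
        refine ⟨X.L.inv_mem hs, ?_, ?_⟩
        · have h1 : g * s⁻¹ * g⁻¹ = (g * s * g⁻¹)⁻¹ := by group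
          rw [h1, Matrix.coe_units_inv, ← hs1.diagonal_diag, Matrix.inv_diagonal]
          exact Matrix.isDiag_diagonal _
        · have h1 : (⟨s⁻¹, X.L.inv_mem hs⟩ : X.L) = (⟨s, hs⟩)⁻¹ := rfl
          rw [h1, map_inv, hs2] }
  refine ⟨A, ?_, fun t => Iff.rfl⟩
  obtain ⟨SL, hSL⟩ := X.L_levi.closed
  choose p k hpk using X.σ_algebraic
  let M : ℕ := ∑ i, ∑ j, k i j
  have hkM : ∀ i j, k i j ≤ M := fun i j =>
    (Finset.single_le_sum (f := fun j => k i j) (fun _ _ => Nat.zero_le _) (Finset.mem_univ j)).trans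
      (Finset.single_le_sum (f := fun i => ∑ j, k i j) (fun _ _ => Nat.zero_le _) (Finset.mem_univ i))
  let δ : MatPoly N := Matrix.det (Matrix.mvPolynomialX (Fin N) (Fin N) ℂ)
  -- The entries of σ(t)t - 1 multiplied by det(t)^M, with M large enough to clear all the
  -- denominators of the regular functions that define σ.
  let R : Fin N → Fin N → MatPoly N := fun i j =>
    (∑ m, p i m * δ ^ (M - k i m) * MvPolynomial.X (m, j)) - MvPolynomial.C ((1 : Mat N) i j) * δ ^ M
  have hR : ∀ (t : X.L) i j, evalAt ((t : GLN N) : Mat N) (R i j) =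
      (((X.σ t : GLN N) : Mat N) * ((t : GLN N) : Mat N) - 1) i j * Matrix.det ((t : GLN N) : Mat N) ^ M := by
    intro t i j
    have h1 : ∀ m, evalAt ((t : GLN N) : Mat N) (p i m * δ ^ (M - k i m) * MvPolynomial.X (m, j)) =
        ((X.σ t : GLN N) : Mat N) i m * ((t : GLN N) : Mat N) m j * Matrix.det ((t : GLN N) : Mat N) ^ M := by
      intro m
      have h2 := hpk i m t
      have h3 : evalAt ((t : GLN N) : Mat N) (p i m * δ ^ (M - k i m) * MvPolynomial.X (m, j)) =
          evalAt ((t : GLN N) : Mat N) (p i m) * (evalAt ((t : GLN N) : Mat N) δ) ^ (M - k i m) *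
            ((t : GLN N) : Mat N) m j := by simp [evalAt]
      rw [h3, evalAt_det, ← h2, mul_assoc _ (_ ^ _) (_ ^ _), ← pow_add, Nat.add_sub_cancel' (hkM i m)]
      simp only [MonoidHom.comp_apply, Subgroup.coe_subtype]
      ring
    have h4 : evalAt ((t : GLN N) : Mat N) (R i j) =
        (∑ m, evalAt ((t : GLN N) : Mat N) (p i m * δ ^ (M - k i m) * MvPolynomial.X (m, j))) -
          (1 : Mat N) i j * (evalAt ((t : GLN N) : Mat N) δ) ^ M := by simp [evalAt, R]
    rw [h4, evalAt_det, Matrix.sub_apply, sub_mul, Matrix.mul_apply, Finset.sum_mul]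
    congr 1
    exact Finset.sum_congr rfl fun m _ => h1 m
  refine ⟨SL ∪ ({q | ∃ i j, i ≠ j ∧ q = sandwich (g : Mat N) ((g⁻¹ : GLN N) : Mat N) (MvPolynomial.X (i, j))} ∪
    {q | ∃ i j, q = R i j}), fun t => ?_⟩
  constructor
  · rintro ⟨h, hd, hs⟩ q (hq | ⟨i, j, hij, rfl⟩ | ⟨i, j, rfl⟩)
    · exact (hSL t).1 h q hq
    · rw [evalAt_sandwich]
      have := hd hij
      simpa [evalAt] using this
    · rw [hR ⟨t, h⟩, hs, ← Units.val_mul, ← Subgroup.coe_mul, inv_mul_cancel]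
      simp
  · intro h
    have hL : t ∈ X.L := (hSL t).2 fun q hq => h q (Or.inl hq)
    refine ⟨hL, fun i j hij => ?_, ?_⟩
    · have := h _ (Or.inr (Or.inl ⟨i, j, hij, rfl⟩))
      rw [evalAt_sandwich] at this
      simpa [evalAt] using this
    · rw [eq_inv_iff_mul_eq_one]
      apply Subtype.ext
      apply Units.ext
      rw [Subgroup.coe_mul, Units.val_mul, ← sub_eq_zero]
      ext i j
      have h1 := h _ (Or.inr (Or.inr ⟨i, j, rfl⟩))
      rw [hR ⟨t, hL⟩] at h1
      refine (mul_eq_zero.1 h1).resolve_right (pow_ne_zero _ ?_)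
      exact ((Matrix.isUnit_iff_isUnit_det _).1 t.isUnit).ne_zero

theorem sg_eq_neg_of_forall {x : Mat N} (hx : x ∈ lie X.L) {A : Subgroup (GLN N)} (hA : IsZariskiClosed A)
    (hinv : ∀ t ∈ A, ∃ h : t ∈ X.L, X.σ ⟨t, h⟩ = (⟨t, h⟩ : X.L)⁻¹) (hxA : x ∈ lie A) : X.sg x = -x := by
  apply eq_of_exp
  intro s
  obtain ⟨h, h1⟩ := hinv _ (expGL_real_smul_mem hA hxA s)
  have h2 := congrArg (fun z : X.L => (z : GLN N)) h1
  rw [coe_σ_expGL (real_smul_mem hx s), sg_real_smul] at h2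
  rw [h2, Subgroup.coe_inv, smul_neg, expGL_neg]

theorem inverted_of_sg_eq_neg {x : Mat N} (hx : x ∈ lie X.L) (hs : X.sg x = -x) (h : expGL x ∈ X.L) :
    X.σ ⟨expGL x, h⟩ = (⟨expGL x, h⟩ : X.L)⁻¹ := by
  apply Subtype.ext
  rw [coe_σ_expGL hx, hs, expGL_neg]
  rfl

/-- Finite index puts some power of each exp(sx) in the fixed group, with exponent at most the index
d. Starting from s/M with M = d!, a further power reaches exp(sx) itself, so the whole one-parameter
group is fixed. -/
theorem sg_eq_of_mem_lie_H {x : Mat N} (hx : x ∈ lie X.L) (hH : x ∈ lie X.H) : X.sg x = x := by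
  set A := neutralComponent (fixedSubgroup X.L X.σ) with hA
  have h1 : ∀ s : ℝ, ∃ n : ℕ, 0 < n ∧ expGL ((n : ℝ) • s • x) ∈ fixedSubgroup X.L X.σ ∧
      n ∣ (A.relIndex (X.L ⊓ X.H)).factorial := by
    intro s
    have hs : expGL (s • x) ∈ X.L ⊓ X.H :=
      ⟨expGL_real_smul_mem X.L_levi.closed hx s, expGL_real_smul_mem X.H_closed hH s⟩
    obtain ⟨n, hn, hn', hmem⟩ := Subgroup.exists_pow_mem_of_relIndex_ne_zero X.finite_index hs
    refine ⟨n, hn, ?_, Nat.dvd_factorial hn hn'⟩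
    have h2 : expGL ((n : ℝ) • s • x) = expGL (s • x) ^ n := by
      apply Units.ext
      rw [Units.val_pow_eq_pow_val, coe_expGL, coe_expGL, ← Matrix.exp_nsmul]
      congr 1
      exact Nat.cast_smul_eq_nsmul ℝ n _
    rw [h2]
    obtain ⟨y, -, hy⟩ := hmem.1
    rw [← hA] at *
    have : expGL (s • x) ^ n = y := hy.symm
    rw [this]
    exact y.2
  set M := (A.relIndex (X.L ⊓ X.H)).factorial with hM
  have hM0 : (M : ℝ) ≠ 0 := by exact_mod_cast (Nat.factorial_pos _).ne'
  have hfix : ∀ s : ℝ, expGL (s • x) ∈ fixedSubgroup X.L X.σ := by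
    intro s
    obtain ⟨n, hn, hmem, d, hd⟩ := h1 (s / M)
    have h2 : expGL (s • x) = expGL ((n : ℝ) • (s / M) • x) ^ d := by
      apply Units.ext
      rw [Units.val_pow_eq_pow_val, coe_expGL, coe_expGL, ← Matrix.exp_nsmul]
      congr 1
      rw [← Nat.cast_smul_eq_nsmul ℝ d, smul_smul, smul_smul]
      congr 1
      have : (M : ℝ) = n * d := by rw [hd]; push_cast; ring
      field_simp
      rw [this]; ring
    rw [h2]
    exact Subgroup.pow_mem _ hmem d
  apply eq_of_exp
  intro s
  obtain ⟨y, hy, hy'⟩ := hfix s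
  have hy1 : X.σ y = y := hy
  have hy2 : y = ⟨expGL (s • x), expGL_real_smul_mem X.L_levi.closed hx s⟩ := Subtype.ext hy'
  have h3 := congrArg (fun z : X.L => (z : GLN N)) hy1
  rw [hy2, coe_σ_expGL (real_smul_mem hx s), sg_real_smul] at h3
  exact h3

theorem mem_lie_H_of_sg_eq {x : Mat N} (hx : x ∈ lie X.L) (hs : X.sg x = x) : x ∈ lie X.H :=
  X.fixed_mem_lie_H (x := ⟨x, hx⟩) (Subtype.ext (by rw [← sg_apply hx, hs]))

end HorosymmetricSpace

theorem eq_zero_of_eq_neg {V : Type*} [AddCommGroup V] [Module ℂ V] {x : V} (h : x = -x) : x = 0 := by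
  have h1 : (2 : ℂ) • x = 0 := by
    rw [two_smul]
    nth_rewrite 1 [h]
    exact neg_add_cancel x
  exact (smul_eq_zero.1 h1).resolve_left two_ne_zero

/-! ### The action of σ on roots and on the split torus -/

namespace Frame

open Matrix HorosymmetricSpace

variable {N : ℕ} {X : HorosymmetricSpace N} {F : Frame X}

theorem sg_dag {x : Mat N} (hx : x ∈ lie X.L) : X.sg (dag F.gram x) = dag F.gram (X.sg x) := by
  have h := F.C.dθ_dσ ⟨x, hx⟩
  rw [F.dθ_eq, ← sg_coe] at h
  have h1 : (F.C.dθ (X.toG ⟨x, hx⟩) : Mat N) = -dag F.gram x := F.dθ_eq _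
  have h2 : ((X.toG (X.dσ ⟨x, hx⟩) : lie X.G) : Mat N) = X.sg x := (sg_apply hx).symm
  rw [h2] at h
  simp only [h1, map_neg] at h
  exact (neg_injective h).symm

theorem sg_mem_T {h : Mat N} (hh : h ∈ lie F.S.T) : X.sg h ∈ lie F.S.T := by
  rw [sg_apply (F.lie_T_le_L hh)]
  exact F.S.dσ_mem ⟨h, hh⟩

theorem σRoot_apply (β : Module.Dual ℂ (lie F.S.T)) (h : lie F.S.T) :
    F.S.σRoot β h = β ⟨X.sg h, sg_mem_T h.2⟩ := by
  change β (F.S.dσT h) = _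
  congr 1
  apply Subtype.ext
  exact (sg_apply (F.lie_T_le_L h.2)).symm

theorem σRoot_σRoot (β : Module.Dual ℂ (lie F.S.T)) : F.S.σRoot (F.S.σRoot β) = β := by
  ext h
  rw [σRoot_apply, σRoot_apply]
  congr 1
  apply Subtype.ext
  exact sg_sg (F.lie_T_le_L h.2)

theorem σRoot_neg (β : Module.Dual ℂ (lie F.S.T)) : F.S.σRoot (-β) = -F.S.σRoot β := rfl

theorem sg_mem_rootSpace {β : Module.Dual ℂ (lie F.S.T)} {x : Mat N} (hx : x ∈ rootSpace X.G F.S.T β)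
    (hxL : x ∈ lie X.L) : X.sg x ∈ rootSpace X.G F.S.T (F.S.σRoot β) := by
  refine ⟨lie_mono X.L_le_G (sg_mem hxL), fun h => ?_⟩
  have hL := F.lie_T_le_L h.2
  have h1 := hx.2 ⟨X.sg h, sg_mem_T h.2⟩
  have h2 := congrArg X.sg h1
  rw [map_smul] at h2
  change X.sg ⁅X.sg (h : Mat N), x⁆ = _ at h2
  rw [sg_lie (sg_mem hL) hxL, sg_sg hL] at h2
  rw [h2, σRoot_apply]

theorem sg_ne_zero {x : Mat N} (hx : x ∈ lie X.L) (hx0 : x ≠ 0) : X.sg x ≠ 0 := fun h => hx0 (by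
  rw [← sg_sg hx, h, map_zero])

variable {β : Module.Dual ℂ (lie F.S.T)}

theorem e_mem_L (hβ : β ∈ rootsIn X.G F.S.T X.L) : (F.e β : Mat N) ∈ lie X.L :=
  hβ.2 _ (F.e_mem β hβ.1)

theorem sg_e_mem (hβ : β ∈ rootsIn X.G F.S.T X.L) :
    X.sg (F.e β : Mat N) ∈ rootSpace X.G F.S.T (F.S.σRoot β) :=
  sg_mem_rootSpace (F.e_mem β hβ.1) (e_mem_L hβ)

theorem σRoot_mem_roots (hβ : β ∈ rootsIn X.G F.S.T X.L) : F.S.σRoot β ∈ roots X.G F.S.T := by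
  refine ⟨fun h => hβ.1.1 ?_, fun h => ?_⟩
  · rw [← σRoot_σRoot β, h]; rfl
  · have h1 := sg_e_mem hβ
    rw [h, Submodule.mem_bot] at h1
    exact sg_ne_zero (e_mem_L hβ) (e_coe_ne_zero hβ.1) h1

theorem σRoot_mem_rootsIn (hβ : β ∈ rootsIn X.G F.S.T X.L) : F.S.σRoot β ∈ rootsIn X.G F.S.T X.L :=
  ⟨σRoot_mem_roots hβ, fun _ hx => mem_of_exists_mem (V := (lie X.L).toSubmodule) (σRoot_mem_roots hβ)
    (sg_e_mem hβ) (sg_mem (e_mem_L hβ)) (sg_ne_zero (e_mem_L hβ) (e_coe_ne_zero hβ.1)) hx⟩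

/-- For the direct implication, T_s is contained in the group generated by the inverted elements of
T. As T is diagonalizable, this lies in the algebraic group of inverted diagonal elements, whose
tangent vectors are anti-fixed. -/
theorem mem_lie_Ts {x : Mat N} : x ∈ lie F.S.Ts ↔ x ∈ lie F.S.T ∧ X.sg x = -x := by
  constructor
  · intro hx
    have hxT := lie_mono F.S.Ts_le hx
    refine ⟨hxT, ?_⟩
    obtain ⟨g, hg, -⟩ := F.S.torus.exists_lie_isDiag
    obtain ⟨A, hA, hmem⟩ := exists_isZariskiClosed_inverted (X := X) g
    refine sg_eq_neg_of_forall (F.lie_T_le_L hxT) hA (fun t ht => ?_) (lie_mono ?_ hx)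
    · obtain ⟨h, -, h2⟩ := (hmem t).1 ht
      exact ⟨h, h2⟩
    · rintro _ ⟨⟨t, ht⟩, -, rfl⟩
      refine (Subgroup.closure_le A).2 (fun s hs => ?_) ht
      obtain ⟨h, hT, hσ⟩ := hs
      exact (hmem s).2 ⟨h, hg s hT, hσ⟩
  · rintro ⟨hx, hs⟩
    refine F.S.antifixed_mem (x := ⟨x, F.lie_T_le_L hx⟩) hx (Subtype.ext ?_)
    rw [← sg_apply, hs]
    rfl

theorem dag_mem_Ts {x : Mat N} (hx : x ∈ lie F.S.Ts) : dag F.gram x ∈ lie F.S.Ts := by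
  rw [mem_lie_Ts] at hx ⊢
  refine ⟨F.dag_mem_T hx.1, ?_⟩
  rw [sg_dag (F.lie_T_le_L hx.1), hx.2, map_neg]

/-- On 𝔱_s the involution is -1, so β = β∘σ gives β(h) = -β(h). -/
theorem lie_mem_T_eq_zero_of_σRoot_eq (hσ : F.S.σRoot β = β) {h : Mat N} (hh : h ∈ lie F.S.Ts) {x : Mat N}
    (hx : x ∈ rootSpace X.G F.S.T β) : ⁅h, x⁆ = 0 := by
  rw [mem_lie_Ts] at hh
  have h1 := hx.2 ⟨h, hh.1⟩
  have h2 : β ⟨h, hh.1⟩ = -β ⟨h, hh.1⟩ := by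
    conv_lhs => rw [← hσ, σRoot_apply]
    rw [← map_neg]
    congr 1
    apply Subtype.ext
    exact hh.2
  have h3 : β ⟨h, hh.1⟩ = 0 := by
    have : (2 : ℂ) * β ⟨h, hh.1⟩ = 0 := by linear_combination h2
    exact (mul_eq_zero.1 this).resolve_left two_ne_zero
  rw [h3, zero_smul] at h1
  exact h1

/-- The involution is the identity on the root spaces of the fixed roots, by the maximality of the
split torus. -/
theorem sg_e_of_σRoot_eq (hβ : β ∈ rootsIn X.G F.S.T X.L) (hσ : F.S.σRoot β = β) :
    X.sg (F.e β : Mat N) = F.e β := by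
  have hL := e_mem_L hβ
  set e : Mat N := (F.e β).1 with he
  have heβ : e ∈ rootSpace X.G F.S.T β := F.e_mem β hβ.1
  have he0 : e ≠ 0 := e_coe_ne_zero hβ.1
  obtain ⟨c, hc⟩ := exists_eq_smul_e hβ.1 (x := X.sg e) (by have := sg_e_mem hβ; rwa [hσ] at this)
  change X.sg e = c • e at hc
  have hcc : c * c = 1 := by
    have h1 := sg_sg hL
    rw [hc, map_smul, hc, smul_smul] at h1
    have h2 : (c * c - 1) • e = 0 := by rw [sub_smul, h1, one_smul, sub_self]
    exact sub_eq_zero.1 ((smul_eq_zero.1 h2).resolve_right he0)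
  rcases mul_self_eq_one_iff.1 hcc with rfl | rfl
  · rw [hc, one_smul]
  exfalso
  rw [neg_smul, one_smul] at hc
  -- If σ were -1 on the root space, this self-adjoint, hence diagonalizable, element would be
  -- anti-fixed and commute with 𝔱_s. The hull of 𝔱_s + ℂx would then be a split torus of L of
  -- larger dimension.
  set x := e + dag F.gram e with hx
  have hxd : dag F.gram x = x := by rw [hx, map_add, dag_dag, add_comm]
  have hxL : x ∈ lie X.L := (lie X.L).add_mem hL (F.dag_mem_L hL)
  have hxs : X.sg x = -x := by rw [hx, map_add, sg_dag hL, hc, map_neg, neg_add]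
  have hσ' : F.S.σRoot (-β) = -β := by rw [σRoot_neg, hσ]
  have hxc : ∀ h ∈ lie F.S.Ts, ⁅h, x⁆ = 0 := by
    intro h hh
    rw [hx, lie_add, lie_mem_T_eq_zero_of_σRoot_eq hσ hh heβ,
      lie_mem_T_eq_zero_of_σRoot_eq hσ' hh (F.dag_mem_rootSpace heβ), add_zero]
  let D : Submodule ℂ (Mat N) := (lie F.S.Ts).toSubmodule ⊔ Submodule.span ℂ {x}
  have hD : ∀ z ∈ D, ∃ h ∈ lie F.S.Ts, ∃ c : ℂ, z = h + c • x := by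
    intro z hz
    obtain ⟨h, hh, w, hw, rfl⟩ := Submodule.mem_sup.1 hz
    obtain ⟨c, rfl⟩ := Submodule.mem_span_singleton.1 hw
    exact ⟨h, hh, c, rfl⟩
  have hTsL : lie F.S.Ts ≤ lie X.L := lie_mono (F.S.Ts_le.trans F.S.le_L)
  have hDL : ∀ z ∈ D, z ∈ lie X.L := by
    intro z hz
    obtain ⟨h, hh, c, rfl⟩ := hD z hz
    exact (lie X.L).add_mem (hTsL hh) ((lie X.L).smul_mem c hxL)
  have hDs : ∀ z ∈ D, X.sg z = -z := by
    intro z hz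
    obtain ⟨h, hh, c, rfl⟩ := hD z hz
    rw [map_add, map_smul, hxs, (mem_lie_Ts.1 hh).2, smul_neg, neg_add]
  obtain ⟨g, hg⟩ := exists_conj_isDiag (S := F.gram) (D := D) (by
    intro z hz
    obtain ⟨h, hh, c, rfl⟩ := hD z hz
    rw [map_add, LinearMap.map_smulₛₗ, hxd]
    exact Submodule.add_mem_sup (dag_mem_Ts hh) (Submodule.smul_mem _ _ (Submodule.mem_span_singleton_self x)))
    (by
      intro z hz z' hz'
      obtain ⟨h, hh, c, rfl⟩ := hD z hz
      obtain ⟨h', hh', c', rfl⟩ := hD z' hz'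
      rw [add_lie, lie_add, lie_add, smul_lie, smul_lie, lie_smul, lie_smul, lie_self,
        F.S.torus.lie_eq_zero (lie_mono F.S.Ts_le hh) (lie_mono F.S.Ts_le hh'), hxc h hh, ← lie_skew,
        hxc h' hh']
      simp)
  obtain ⟨A, hA, hDA, hmin⟩ := exists_torus_hull g hg
  obtain ⟨B, hB, hmem⟩ := exists_isZariskiClosed_inverted (X := X) g
  -- Minimality of the hull: the inverted diagonal elements of L form an algebraic group that
  -- contains the exponentials of D, so every element of the hull is inverted by σ.
  have hAB : A ≤ B := by
    refine hmin B hB fun z hz => (hmem _).2 ?_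
    have hzL : expGL z ∈ X.L := exp_mem X.L_levi.closed (hDL z hz)
    refine ⟨hzL, ?_, inverted_of_sg_eq_neg (hDL z hz) (hDs z hz) hzL⟩
    rw [eq_diagIn (hg z hz).diagonal_diag.symm, Units.val_mul, Units.val_mul, coe_expGL, exp_diagIn,
      conj_diagIn]
    exact Matrix.isDiag_diagonal _
  have hle := F.S.split A hA (fun t ht => ((hmem t).1 (hAB ht)).1) fun s hs =>
    ((hmem s).1 (hAB hs)).2.2
  have hxT : x ∉ lie F.S.Ts := by
    intro h
    have h1 := (mem_rootSpace_zero F).2 (mem_lie_Ts.1 h).1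
    have h2 := F.trace_mul_dag_eq_zero h1 heβ hβ.1.1.symm
    have h3 : trace (dag F.gram e * dag F.gram e) = 0 :=
      F.trace_mul_dag_eq_zero (F.dag_mem_rootSpace heβ) heβ (by
        intro h4
        exact hβ.1.1 (eq_zero_of_eq_neg h4.symm))
    rw [hx, add_mul, Matrix.trace_add, h3, add_zero] at h2
    exact he0 (trace_mul_dag_self_eq_zero F.gram h2)
  have hlt : (lie F.S.Ts).toSubmodule < (lie A).toSubmodule := by
    refine lt_of_le_of_ne (fun y hy => hDA y (Submodule.mem_sup_left hy)) fun h => hxT ?_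
    have : x ∈ (lie A).toSubmodule :=
      hDA x (Submodule.mem_sup_right (Submodule.mem_span_singleton_self x))
    rw [← h] at this
    exact this
  exact absurd hle (not_le.2 (Submodule.finrank_lt_finrank_of_lt hlt))

theorem neg_σRoot_mem_pos (hβ : β ∈ F.posRootsS) : -F.S.σRoot β ∈ F.pos := by
  rcases F.σ_pos β hβ.2 hβ.1.1 with h | h
  · exact absurd h hβ.1.2
  · exact h.1

/-- By the choice of the positive system, -σ(γ) is positive, so σ(γ) is not. This is what keeps the
vectors τ_β independent. -/
theorem σRoot_ne_of_mem_posRootsS (hβ : β ∈ F.posRootsS) {γ : Module.Dual ℂ (lie F.S.T)}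
    (hγ : γ ∈ F.posRootsS) : F.S.σRoot γ ≠ β := by
  intro h
  have h1 := neg_σRoot_mem_pos hγ
  rw [h] at h1
  rcases F.pos_system.trichotomy β hβ.1.1.1 with h2 | h2
  · exact h2.2 h1
  · exact h2.2 hβ.2

theorem tau_coe (hβ : β ∈ rootsIn X.G F.S.T X.L) :
    (F.tau β hβ : Mat N) = (F.e β : Mat N) - X.sg (F.e β : Mat N) := by
  rw [sg_apply (e_mem_L hβ)]
  rfl

theorem mem_aSplit {x : Mat N} : x ∈ F.aSplit ↔ x ∈ lie F.S.Ts ∧ dag F.gram x = x := by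
  constructor
  · rintro ⟨h, h'⟩
    refine ⟨h, ?_⟩
    have := congrArg (fun z : lie X.G => (z : Mat N)) h'
    rw [F.dθ_eq] at this
    exact neg_injective this
  · rintro ⟨h, h'⟩
    refine ⟨h, Subtype.ext ?_⟩
    rw [F.dθ_eq]
    change -dag F.gram x = -x
    rw [h']

theorem eq_hermitian_add (x : Mat N) : x = (1 / 2 : ℂ) • (x + dag F.gram x) +
    (-Complex.I / 2) • (Complex.I • (x - dag F.gram x)) := by
  rw [smul_smul, show -Complex.I / 2 * Complex.I = 1 / 2 by
    rw [div_mul_eq_mul_div, neg_mul, Complex.I_mul_I, neg_neg], ← smul_add, add_add_sub_cancel,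
    ← two_smul ℂ x, smul_smul]
  norm_num

/-! ### The frame is a basis of a complement of 𝔥 -/

section Basis

variable {r : ℕ} (l : Module.Basis (Fin r) ℝ F.aSplit)

theorem mem_span_of_mem_aSplit {x : Mat N} (hx : x ∈ F.aSplit) :
    x ∈ Submodule.span ℂ (Set.range fun j => (l j : Mat N)) := by
  have h := congrArg (fun z : F.aSplit => (z : Mat N)) (l.sum_repr ⟨x, hx⟩)
  simp only [Submodule.coe_sum, Submodule.coe_smul] at h
  rw [← h]
  refine Submodule.sum_mem _ fun j _ => ?_
  rw [← Complex.coe_smul]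
  exact Submodule.smul_mem _ _ (Submodule.subset_span ⟨j, rfl⟩)

theorem mem_span_of_mem_lie_Ts {x : Mat N} (hx : x ∈ lie F.S.Ts) :
    x ∈ Submodule.span ℂ (Set.range fun j => (l j : Mat N)) := by
  rw [eq_hermitian_add (F := F) x]
  refine Submodule.add_mem _ (Submodule.smul_mem _ _ (mem_span_of_mem_aSplit l ?_))
    (Submodule.smul_mem _ _ (mem_span_of_mem_aSplit l ?_))
  · rw [mem_aSplit]
    refine ⟨(lie F.S.Ts).add_mem hx (dag_mem_Ts hx), ?_⟩
    rw [map_add, dag_dag, add_comm]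
  · rw [mem_aSplit]
    refine ⟨(lie F.S.Ts).smul_mem _ ((lie F.S.Ts).sub_mem hx (dag_mem_Ts hx)), ?_⟩
    rw [LinearMap.map_smulₛₗ, map_sub, dag_dag, Complex.conj_I, neg_smul, ← smul_neg, neg_sub]

theorem dag_l (j : Fin r) : dag F.gram (l j : Mat N) = l j := (mem_aSplit.1 (l j).2).2

/-- The vectors l_j are self-adjoint, so applying the adjoint conjugates the coefficients of a
relation. The real and imaginary parts are then real relations. -/
theorem linearIndependent_l {z : Fin r → ℂ} (h : ∑ j, z j • (l j : Mat N) = 0) : z = 0 := by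
  have key : ∀ c : Fin r → ℝ, ∑ j, (c j : ℂ) • (l j : Mat N) = 0 → c = 0 := by
    intro c hc
    have h1 : ∑ j, c j • l j = 0 := by
      apply Subtype.ext
      simp only [Submodule.coe_sum, Submodule.coe_smul]
      rw [Submodule.coe_zero, ← hc]
      simp
    funext j
    exact Fintype.linearIndependent_iff.1 l.linearIndependent c h1 j
  have h' : ∑ j, starRingEnd ℂ (z j) • (l j : Mat N) = 0 := by
    have := congrArg (dag F.gram) h
    rw [map_sum, map_zero] at this
    rw [← this]
    exact Finset.sum_congr rfl fun j _ => by rw [LinearMap.map_smulₛₗ, dag_l]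
  have hre := key (fun j => (z j).re) (by
    have : ∀ j, ((z j).re : ℂ) • (l j : Mat N) =
        (1 / 2 : ℂ) • (z j • (l j : Mat N)) + (1 / 2 : ℂ) • (starRingEnd ℂ (z j) • (l j : Mat N)) := by
      intro j
      rw [smul_smul, smul_smul, ← add_smul, Complex.re_eq_add_conj]
      congr 1
      ring
    rw [Finset.sum_congr rfl fun j _ => this j, Finset.sum_add_distrib, ← Finset.smul_sum,
      ← Finset.smul_sum, h, h', smul_zero, add_zero])
  have him := key (fun j => (z j).im) (by
    have : ∀ j, ((z j).im : ℂ) • (l j : Mat N) =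
        (1 / (2 * Complex.I) : ℂ) • (z j • (l j : Mat N)) -
          (1 / (2 * Complex.I) : ℂ) • (starRingEnd ℂ (z j) • (l j : Mat N)) := by
      intro j
      rw [smul_smul, smul_smul, ← sub_smul, Complex.im_eq_sub_conj]
      congr 1
      ring
    rw [Finset.sum_congr rfl fun j _ => this j, Finset.sum_sub_distrib, ← Finset.smul_sum,
      ← Finset.smul_sum, h, h', smul_zero, sub_zero])
  funext j
  exact Complex.ext (congrFun hre j) (congrFun him j)

theorem lie_L_le : lie X.L ≤ lie X.G := lie_mono X.L_le_G

theorem lie_Pu_le_H : lie X.Pu ≤ lie X.H := lie_mono X.Pu_le_H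

/-- The frame vectors and the isotropy subalgebra span the Lie algebra. -/
theorem lie_G_le_span : (lie X.G).toSubmodule ≤
    Submodule.span ℂ (Set.range fun i => (F.frameVector l i : Mat N)) ⊔ (lie X.H).toSubmodule := by
  set W := Submodule.span ℂ (Set.range fun i => (F.frameVector l i : Mat N)) ⊔ (lie X.H).toSubmodule with hW
  have hf : ∀ i, (F.frameVector l i : Mat N) ∈ W := fun i =>
    Submodule.mem_sup_left (Submodule.subset_span ⟨i, rfl⟩)
  have hH : ∀ x ∈ lie X.H, x ∈ W := fun x hx => Submodule.mem_sup_right hx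
  have hτ : ∀ {γ : Module.Dual ℂ (lie F.S.T)} (hγ : γ ∈ F.posRootsS),
      (F.e γ : Mat N) - X.sg (F.e γ : Mat N) ∈ W := by
    intro γ hγ
    rw [← tau_coe hγ.1.1]
    exact hf (Sum.inr (Sum.inr ⟨γ, hγ⟩))
  have hμ : ∀ {γ : Module.Dual ℂ (lie F.S.T)} (hγ : γ ∈ rootsIn X.G F.S.T X.L),
      (F.e γ : Mat N) + X.sg (F.e γ : Mat N) ∈ W := by
    intro γ hγ
    refine hH _ (mem_lie_H_of_sg_eq ((lie X.L).add_mem (e_mem_L hγ) (sg_mem (e_mem_L hγ))) ?_)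
    rw [map_add, sg_sg (e_mem_L hγ), add_comm]
  have hhalf : ∀ x y : Mat N, x = (1 / 2 : ℂ) • (x + y) + (1 / 2 : ℂ) • (x - y) := by
    intro x y
    rw [← smul_add, add_add_sub_cancel, ← two_smul ℂ x, smul_smul]
    norm_num
  have hLroot : ∀ {γ : Module.Dual ℂ (lie F.S.T)} (hγ : γ ∈ F.posRootsS), (F.e γ : Mat N) ∈ W ∧
      X.sg (F.e γ : Mat N) ∈ W := by
    intro γ hγ
    have h1 : (F.e γ : Mat N) ∈ W := by
      rw [hhalf (F.e γ : Mat N) (X.sg (F.e γ : Mat N))]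
      exact W.add_mem (W.smul_mem _ (hμ hγ.1.1)) (W.smul_mem _ (hτ hγ))
    refine ⟨h1, ?_⟩
    have := W.sub_mem (hμ hγ.1.1) h1
    rwa [add_sub_cancel_left] at this
  refine F.S.torus.le_of_forall_weight (fun h hh x hx => (lie X.G).lie_mem (lie_mono F.S.le_G hh) hx) ?_
  intro γ x hx hxγ
  have hxγ' : x ∈ rootSpace X.G F.S.T γ := ⟨hx, hxγ⟩
  by_cases hx0 : x = 0
  · rw [hx0]; exact W.zero_mem
  by_cases hγ0 : γ = 0
  · rw [hγ0, mem_rootSpace_zero] at hxγ'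
    have hxL := F.lie_T_le_L hxγ'
    rw [hhalf x (X.sg x)]
    refine W.add_mem (W.smul_mem _ (hH _ (mem_lie_H_of_sg_eq ((lie X.L).add_mem hxL (sg_mem hxL)) ?_)))
      (W.smul_mem _ ?_)
    · rw [map_add, sg_sg hxL, add_comm]
    · have hTs : x - X.sg x ∈ lie F.S.Ts := by
        rw [mem_lie_Ts]
        refine ⟨(lie F.S.T).sub_mem hxγ' (sg_mem_T hxγ'), ?_⟩
        rw [map_sub, sg_sg hxL, neg_sub]
      refine Submodule.span_le.2 ?_ (mem_span_of_mem_lie_Ts l hTs)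
      rintro _ ⟨j, rfl⟩
      exact hf (Sum.inl j)
  have hγ : γ ∈ roots X.G F.S.T := ⟨hγ0, fun h => hx0 (by rwa [h, Submodule.mem_bot] at hxγ')⟩
  rcases mem_rootsQu_or hγ with h | h | h
  · obtain ⟨c, rfl⟩ := exists_eq_smul_e hγ hxγ'
    exact W.smul_mem _ (hf (Sum.inr (Sum.inl ⟨γ, h⟩)))
  · by_cases hσ : F.S.σRoot γ = γ
    · obtain ⟨c, rfl⟩ := exists_eq_smul_e hγ hxγ'
      exact W.smul_mem _ (hH _ (mem_lie_H_of_sg_eq (e_mem_L h) (sg_e_of_σRoot_eq h hσ)))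
    · rcases F.pos_system.trichotomy γ hγ with hp | hp
      -- For the positive roots of Φ_s, half the sum of e_γ + σ(e_γ) in 𝔥 and the frame vector τ_γ
      -- recovers e_γ.
      · obtain ⟨c, rfl⟩ := exists_eq_smul_e hγ hxγ'
        exact W.smul_mem _ (hLroot ⟨⟨h, hσ⟩, hp.1⟩).1
      · have hn : -γ ∈ rootsIn X.G F.S.T X.L :=
          ⟨neg_mem_roots hγ, fun y hy => mem_of_exists_mem (V := (lie X.L).toSubmodule) (neg_mem_roots hγ)
            (dag_e_mem hγ) (F.dag_mem_L (e_mem_L h)) (dag_ne_zero (e_coe_ne_zero hγ)) hy⟩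
        have hns : -γ ∈ F.posRootsS := ⟨⟨hn, fun h => hσ (neg_injective h)⟩, hp.1⟩
        -- A negative root γ of Φ_s is the image under σ of the positive root σ(γ), so σ(e_{σ(γ)})
        -- spans its root space and is reached through τ_{σ(γ)}.
        have hσγ : F.S.σRoot γ ∈ F.posRootsS := by
          refine ⟨⟨σRoot_mem_rootsIn h, fun h => hσ ?_⟩, ?_⟩
          · rw [σRoot_σRoot] at h; exact h.symm
          · have := neg_σRoot_mem_pos hns
            rwa [σRoot_neg, neg_neg] at this
        have h1 := sg_e_mem hσγ.1.1
        rw [σRoot_σRoot] at h1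
        exact mem_of_exists_mem hγ h1 (hLroot hσγ).2 (sg_ne_zero (e_mem_L hσγ.1.1)
          (e_coe_ne_zero hσγ.1.1.1)) hxγ'
  · exact hH _ (lie_Pu_le_H (h.2 x hxγ'))

theorem exists_add_of_mem_lie_H (F : Frame X) {x : Mat N} (hx : x ∈ lie X.H) :
    ∃ u ∈ lie X.Pu, ∃ y ∈ lie X.L, X.sg y = y ∧ x = u + y := by
  obtain ⟨u, hu, y, hy, rfl⟩ := X.L_levi.exists_lie_add X.P_parabolic.2.1 X.Pu_radical.1 F.exists_dag_L
    (lie_mono X.H_le_P hx)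
  refine ⟨u, hu, y, hy, sg_eq_of_mem_lie_H hy ?_, rfl⟩
  have := (lie X.H).sub_mem hx (lie_Pu_le_H hu)
  rwa [add_sub_cancel_left] at this

theorem trace_e_ne_zero {α : Module.Dual ℂ (lie F.S.T)} (hα : α ∈ roots X.G F.S.T) :
    trace ((F.e α : Mat N) * dag F.gram (F.e α : Mat N)) ≠ 0 := fun h =>
  e_coe_ne_zero hα (trace_mul_dag_self_eq_zero F.gram h)

theorem eq_zero_of_sum_e_eq_zero {z : F.rootsQu → ℂ} (h : ∑ α, z α • (F.e α : Mat N) = 0) : z = 0 := by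
  funext α
  have h1 := congrArg (fun m => trace (m * dag F.gram (F.e α : Mat N))) h
  simp only [Finset.sum_mul, Matrix.trace_sum, smul_mul_assoc, Matrix.trace_smul, zero_mul,
    Matrix.trace_zero] at h1
  rw [Finset.sum_eq_single α] at h1
  · exact (smul_eq_zero.1 h1).resolve_right (trace_e_ne_zero α.2.1)
  · intro γ _ hne
    rw [F.trace_mul_dag_eq_zero (F.e_mem γ γ.2.1) (F.e_mem α α.2.1) fun h => hne (Subtype.ext h), smul_zero]
  · simp

/-- The left side is the adjoint of an element of 𝔭^u, so the independence of 𝔭^u, 𝔩 and (𝔭^u)†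
applies. -/
theorem eq_zero_of_sum_e_add_mem_P {z : F.rootsQu → ℂ} {y : Mat N} (hy : y ∈ lie X.P)
    (h : ∑ α, z α • (F.e α : Mat N) = y) : z = 0 ∧ y = 0 := by
  obtain ⟨u, hu, w, hw, rfl⟩ := X.L_levi.exists_lie_add X.P_parabolic.2.1 X.Pu_radical.1 F.exists_dag_L hy
  have hv : dag F.gram (∑ α, z α • (F.e α : Mat N)) ∈ lie X.Pu := by
    rw [map_sum]
    refine Submodule.sum_mem (lie X.Pu).toSubmodule fun α _ => ?_
    rw [LinearMap.map_smulₛₗ]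
    exact (lie X.Pu).smul_mem _ (dag_e_mem_Pu α.2)
  obtain ⟨h1, h2, h3⟩ := X.L_levi.eq_zero_of_add_eq_zero (S := F.gram) X.P_parabolic.2.1 X.Pu_radical.1
    (fun _ => F.dag_mem_L) ((lie X.Pu).neg_mem hu) ((lie X.L).neg_mem hw) hv (by
      rw [dag_dag, h]; abel)
  rw [neg_eq_zero] at h1 h2
  rw [h1, h2, add_zero] at h
  exact ⟨eq_zero_of_sum_e_eq_zero h, by rw [h1, h2, add_zero]⟩

/-- Modulo 𝔭 only the e_α survive, so their coefficients vanish. The rest w of the sum is anti-fixed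
by σ, yet equals the fixed 𝔩-component of an element of 𝔥, so w = 0. Pairing w with e_β† isolates
the coefficient of τ_β, since neither γ ≠ β nor any σ(γ) has the weight β. -/
theorem frame_independent {z : F.Index r → ℂ}
    (h : ∑ i, z i • (F.frameVector l i : Mat N) ∈ lie X.H) : z = 0 := by
  obtain ⟨u, hu, y, hy, hys, he⟩ := F.exists_add_of_mem_lie_H h
  rw [Fintype.sum_sum_type, Fintype.sum_sum_type] at he
  set w : Mat N := ∑ j, z (Sum.inl j) • (F.frameVector l (Sum.inl j) : Mat N) +
    ∑ β, z (Sum.inr (Sum.inr β)) • (F.frameVector l (Sum.inr (Sum.inr β)) : Mat N) with hw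
  have hlj : ∀ j, (F.frameVector l (Sum.inl j) : Mat N) = l j := fun j => rfl
  have hτβ : ∀ β : F.posRootsS, (F.frameVector l (Sum.inr (Sum.inr β)) : Mat N) =
    (F.e β : Mat N) - X.sg (F.e β : Mat N) := fun β => tau_coe β.2.1.1
  have hlT : ∀ j, (l j : Mat N) ∈ lie F.S.Ts := fun j => (mem_aSplit.1 (l j).2).1
  have hwL : w ∈ lie X.L := by
    refine (lie X.L).add_mem (Submodule.sum_mem (lie X.L).toSubmodule fun j _ => ?_)
      (Submodule.sum_mem (lie X.L).toSubmodule fun β _ => ?_)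
    · exact (lie X.L).smul_mem _ (F.lie_T_le_L (mem_lie_Ts.1 (hlT j)).1)
    · rw [hτβ]
      exact (lie X.L).smul_mem _ ((lie X.L).sub_mem (e_mem_L β.2.1.1) (sg_mem (e_mem_L β.2.1.1)))
  have hws : X.sg w = -w := by
    rw [hw, map_add, map_sum, map_sum, neg_add, ← Finset.sum_neg_distrib, ← Finset.sum_neg_distrib]
    congr 1
    · refine Finset.sum_congr rfl fun j _ => ?_
      rw [map_smul, hlj, (mem_lie_Ts.1 (hlT j)).2, smul_neg]
    · refine Finset.sum_congr rfl fun β _ => ?_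
      rw [map_smul, hτβ, map_sub, sg_sg (e_mem_L β.2.1.1), ← smul_neg, neg_sub]
  obtain ⟨hα, h1⟩ := eq_zero_of_sum_e_add_mem_P (F := F) (z := fun α => z (Sum.inr (Sum.inl α)))
    (y := u + (y - w)) ((lie X.P).add_mem (lie_mono X.Pu_radical.1.1 hu)
      (lie_mono X.L_levi.le ((lie X.L).sub_mem hy hwL))) (by
      rw [← add_sub_assoc, ← he, hw]
      change ∑ α : F.rootsQu, z (Sum.inr (Sum.inl α)) • (F.frameVector l (Sum.inr (Sum.inl α)) : Mat N) = _
      abel)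
  have hyw : y = w := by
    have h2 := X.L_levi.eq_zero_of_add_eq_zero (S := F.gram) X.P_parabolic.2.1 X.Pu_radical.1
      (fun _ => F.dag_mem_L) hu ((lie X.L).sub_mem hy hwL) (lie X.Pu).zero_mem (by
        rw [map_zero, add_zero, h1])
    exact sub_eq_zero.1 h2.2.1
  have hw0 : w = 0 := by
    rw [hyw] at hys
    rw [hys] at hws
    exact eq_zero_of_eq_neg hws
  have hβ : ∀ β : F.posRootsS, z (Sum.inr (Sum.inr β)) = 0 := by
    intro β
    have h1 := congrArg (fun m => trace (m * dag F.gram (F.e β : Mat N))) hw0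
    simp only [hw, add_mul, Matrix.trace_add, Finset.sum_mul, Matrix.trace_sum, smul_mul_assoc,
      Matrix.trace_smul, zero_mul, Matrix.trace_zero] at h1
    have h2 : ∀ j, trace ((F.frameVector l (Sum.inl j) : Mat N) * dag F.gram (F.e β : Mat N)) = 0 :=
      fun j => F.trace_mul_dag_eq_zero ((mem_rootSpace_zero F).2 (mem_lie_Ts.1 (hlT j)).1)
        (F.e_mem β β.2.1.1.1) β.2.1.1.1.1.symm
    simp only [h2, smul_zero, Finset.sum_const_zero, zero_add] at h1
    rw [Finset.sum_eq_single β] at h1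
    · refine (smul_eq_zero.1 h1).resolve_right ?_
      rw [hτβ, sub_mul, Matrix.trace_sub, F.trace_mul_dag_eq_zero (sg_e_mem β.2.1.1)
        (F.e_mem β β.2.1.1.1) (σRoot_ne_of_mem_posRootsS β.2 β.2), sub_zero]
      exact trace_e_ne_zero β.2.1.1.1
    · intro γ _ hne
      rw [hτβ, sub_mul, Matrix.trace_sub, F.trace_mul_dag_eq_zero (sg_e_mem γ.2.1.1)
        (F.e_mem β β.2.1.1.1) (σRoot_ne_of_mem_posRootsS β.2 γ.2), sub_zero,
        F.trace_mul_dag_eq_zero (F.e_mem γ γ.2.1.1.1)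
        (F.e_mem β β.2.1.1.1) fun h => hne (Subtype.ext h), smul_zero]
    · simp
  have hj : (fun j => z (Sum.inl j)) = 0 := by
    apply linearIndependent_l l
    rw [hw] at hw0
    simp only [hβ, zero_smul, Finset.sum_const_zero, add_zero] at hw0
    exact hw0
  funext i
  rcases i with j | α | β
  · exact congrFun hj j
  · exact congrFun hα α
  · exact hβ β

end Basis
end Frame

/-! ### Dimension of G/H and norms of the reference metrics on exp(𝔞_s) -/

namespace Frame

open Matrix HorosymmetricSpace

variable {N : ℕ} {X : HorosymmetricSpace N} {F : Frame X} {r : ℕ}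

/-- The dimension of the homogeneous space is the number of the frame vectors. -/
theorem quotientDim_eq (l : Module.Basis (Fin r) ℝ F.aSplit) :
    quotientDim X.G X.H = Fintype.card (F.Index r) := by
  let Φ : (F.Index r → ℂ) →ₗ[ℂ] (lie X.G ⧸ (lie X.H).toSubmodule.comap (lie X.G).toSubmodule.subtype) :=
    Submodule.mkQ _ ∘ₗ Fintype.linearCombination ℂ (F.frameVector l)
  have hcoe : ∀ z : F.Index r → ℂ, ((Fintype.linearCombination ℂ (F.frameVector l) z : lie X.G) : Mat N) =
      ∑ i, z i • (F.frameVector l i : Mat N) := by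
    intro z
    rw [Fintype.linearCombination_apply]
    exact map_sum (lie X.G).toSubmodule.subtype _ _
  have hinj : Function.Injective Φ := by
    rw [← LinearMap.ker_eq_bot, LinearMap.ker_eq_bot']
    intro z hz
    rw [LinearMap.comp_apply, Submodule.mkQ_apply, Submodule.Quotient.mk_eq_zero] at hz
    apply frame_independent l
    rw [← hcoe]
    exact hz
  have hsurj : Function.Surjective Φ := by
    intro x
    induction x using Submodule.Quotient.induction_on with
    | _ x =>
      obtain ⟨w, hw, y, hy, hxy⟩ := Submodule.mem_sup.1 (lie_G_le_span l x.2)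
      obtain ⟨z, hz⟩ := (Submodule.mem_span_range_iff_exists_fun ℂ).1 hw
      refine ⟨z, ?_⟩
      rw [LinearMap.comp_apply, Submodule.mkQ_apply, Submodule.Quotient.eq]
      change ((Fintype.linearCombination ℂ (F.frameVector l) z : lie X.G) : Mat N) - x ∈ lie X.H
      rw [hcoe, hz, ← hxy, sub_add_cancel_left]
      exact (lie X.H).neg_mem hy
  have := (LinearEquiv.ofBijective Φ ⟨hinj, hsurj⟩).finrank_eq
  rw [Module.finrank_fintype_fun_eq_card] at this
  exact this.symm

theorem aSplit_mem_T (a : F.aSplit) : (a : Mat N) ∈ lie F.S.T := lie_mono F.S.Ts_le (mem_aSplit.1 a.2).1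

theorem aSplit_mem_L (a : F.aSplit) : (a : Mat N) ∈ lie X.L := F.lie_T_le_L (aSplit_mem_T a)

theorem dag_aSplit (a : F.aSplit) : dag F.gram (a : Mat N) = a := (mem_aSplit.1 a.2).2

theorem rootAt_im {α : Module.Dual ℂ (lie F.S.T)} (hα : α ∈ roots X.G F.S.T) (a : F.aSplit) :
    (((F.rootAt α a).re : ℝ) : ℂ) = F.rootAt α a := by
  have h := F.conj_root (F.e_mem α hα) (e_coe_ne_zero hα) ⟨a, aSplit_mem_T a⟩
  have h1 : F.dagT ⟨a, aSplit_mem_T a⟩ = ⟨a, aSplit_mem_T a⟩ := Subtype.ext (dag_aSplit a)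
  rw [h1] at h
  exact Complex.conj_eq_iff_re.1 h.symm

theorem lie_aSplit {α : Module.Dual ℂ (lie F.S.T)} {x : Mat N} (hx : x ∈ rootSpace X.G F.S.T α)
    (a : F.aSplit) : ⁅(a : Mat N), x⁆ = F.rootAt α a • x := hx.2 ⟨a, aSplit_mem_T a⟩

-- The identity hx = x(h + c) intertwines powers, hence exponentials, and exp(h + c) = e^c exp(h).
open scoped Matrix.Norms.Operator in
theorem exp_conj_of_lie_eq_smul {h x : Mat N} {c : ℂ} (hx : ⁅h, x⁆ = c • x) :
    NormedSpace.exp h * x * NormedSpace.exp (-h) = Complex.exp c • x := by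
  have h1 : h * x = x * (h + c • (1 : Mat N)) := by
    rw [mul_add, mul_smul_comm, mul_one, ← hx, Ring.lie_def]
    abel
  have h2 : SemiconjBy x (h + c • (1 : Mat N)) h := h1.symm
  have h3 : SemiconjBy x (NormedSpace.exp (h + c • (1 : Mat N))) (NormedSpace.exp h) := by
    rw [NormedSpace.exp_eq_tsum ℂ]
    have hs : ∀ m : Mat N, Summable fun n : ℕ => ((n.factorial : ℂ)⁻¹) • m ^ n :=
      fun m => NormedSpace.expSeries_summable' (𝕂 := ℂ) m
    rw [SemiconjBy]
    simp only
    rw [← (hs _).tsum_mul_left, ← (hs _).tsum_mul_right]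
    congr 1
    funext n
    rw [mul_smul_comm, smul_mul_assoc, (h2.pow_right n).eq]
  have h4 : NormedSpace.exp (h + c • (1 : Mat N)) = Complex.exp c • NormedSpace.exp h := by
    rw [Matrix.exp_add_of_commute _ _ ((Commute.one_right h).smul_right c)]
    have : NormedSpace.exp (c • (1 : Mat N)) = Complex.exp c • (1 : Mat N) := by
      rw [← Algebra.algebraMap_eq_smul_one, ← Algebra.algebraMap_eq_smul_one, Complex.exp_eq_exp_ℂ]
      exact (NormedSpace.algebraMap_exp_comm c).symm
    rw [this, mul_smul_comm, mul_one]
  have h5 : NormedSpace.exp h * NormedSpace.exp (-h) = 1 := by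
    rw [← Matrix.exp_add_of_commute _ _ (Commute.neg_right (Commute.refl h)), add_neg_cancel,
      NormedSpace.exp_zero]
  rw [← h3.eq, h4, mul_smul_comm, smul_mul_assoc, mul_assoc, h5, mul_one]

theorem point_mem_L (a : F.aSplit) : (F.point a : GLN N) ∈ X.L :=
  exp_mem X.L_levi.closed (aSplit_mem_L a)

/-- The classes of the e_α are a basis of 𝔤/𝔭, on which Ad(exp(a)) is diagonal with entries
e^{α(a)}. The canonical bundle takes the inverse determinant. -/
theorem canonicalCharacter_point (a : F.aSplit) :
    canonicalCharacter X.P_le_G ⟨F.point a, X.L_levi.le (point_mem_L a)⟩ =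
      (∏ α : F.rootsQu, Complex.exp (F.rootAt α a))⁻¹ := by
  let V := lie X.G ⧸ (lie X.P).toSubmodule.comap (lie X.G).toSubmodule.subtype
  let Φ : (F.rootsQu → ℂ) →ₗ[ℂ] V :=
    Submodule.mkQ _ ∘ₗ Fintype.linearCombination ℂ (fun α : F.rootsQu => F.e α)
  have hcoe : ∀ z : F.rootsQu → ℂ, ((Fintype.linearCombination ℂ (fun α : F.rootsQu => F.e α) z : lie X.G) : Mat N) =
      ∑ α, z α • (F.e α : Mat N) := by
    intro z
    rw [Fintype.linearCombination_apply]
    exact map_sum (lie X.G).toSubmodule.subtype _ _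
  have hinj : Function.Injective Φ := by
    rw [← LinearMap.ker_eq_bot, LinearMap.ker_eq_bot']
    intro z hz
    rw [LinearMap.comp_apply, Submodule.mkQ_apply, Submodule.Quotient.mk_eq_zero] at hz
    exact (eq_zero_of_sum_e_add_mem_P hz (hcoe z).symm).1
  have hspan : (lie X.G).toSubmodule ≤
      Submodule.span ℂ (Set.range fun α : F.rootsQu => (F.e α : Mat N)) ⊔ (lie X.P).toSubmodule := by
    refine F.S.torus.le_of_forall_weight (fun h hh x hx => (lie X.G).lie_mem (lie_mono F.S.le_G hh) hx) ?_
    intro γ x hx hxγ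
    have hxγ' : x ∈ rootSpace X.G F.S.T γ := ⟨hx, hxγ⟩
    by_cases hx0 : x = 0
    · rw [hx0]; exact Submodule.zero_mem _
    by_cases hγ0 : γ = 0
    · rw [hγ0, mem_rootSpace_zero] at hxγ'
      exact Submodule.mem_sup_right (lie_mono X.L_levi.le (F.lie_T_le_L hxγ'))
    have hγ : γ ∈ roots X.G F.S.T := ⟨hγ0, fun h => hx0 (by rwa [h, Submodule.mem_bot] at hxγ')⟩
    rcases mem_rootsQu_or hγ with h | h | h
    · obtain ⟨c, rfl⟩ := exists_eq_smul_e hγ hxγ'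
      exact Submodule.mem_sup_left (Submodule.smul_mem _ _ (Submodule.subset_span ⟨⟨γ, h⟩, rfl⟩))
    · exact Submodule.mem_sup_right (lie_mono X.L_levi.le (h.2 x hxγ'))
    · exact Submodule.mem_sup_right (lie_mono X.Pu_radical.1.1 (h.2 x hxγ'))
  have hsurj : Function.Surjective Φ := by
    intro x
    induction x using Submodule.Quotient.induction_on with
    | _ x =>
      obtain ⟨w, hw, y, hy, hxy⟩ := Submodule.mem_sup.1 (hspan x.2)
      obtain ⟨z, hz⟩ := (Submodule.mem_span_range_iff_exists_fun ℂ).1 hw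
      refine ⟨z, ?_⟩
      rw [LinearMap.comp_apply, Submodule.mkQ_apply, Submodule.Quotient.eq]
      change ((Fintype.linearCombination ℂ (fun α : F.rootsQu => F.e α) z : lie X.G) : Mat N) - x ∈ lie X.P
      rw [hcoe, hz, ← hxy, sub_add_cancel_left]
      exact (lie X.P).neg_mem hy
  let E : (F.rootsQu → ℂ) ≃ₗ[ℂ] V := LinearEquiv.ofBijective Φ ⟨hinj, hsurj⟩
  classical
  let d : F.rootsQu → ℂ := fun α => Complex.exp (F.rootAt α a)
  have hconj : isotropy X.P_le_G ⟨F.point a, X.L_levi.le (point_mem_L a)⟩ =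
      (E : (F.rootsQu → ℂ) →ₗ[ℂ] V) ∘ₗ Matrix.toLin' (diagonal d) ∘ₗ (E.symm : V →ₗ[ℂ] (F.rootsQu → ℂ)) := by
    rw [← LinearMap.comp_assoc, LinearEquiv.eq_comp_toLinearMap_symm]
    apply LinearMap.ext
    intro z
    rw [LinearMap.comp_apply, LinearMap.comp_apply]
    change Submodule.Quotient.mk (Ad (F.point a) (Fintype.linearCombination ℂ (fun α : F.rootsQu => F.e α) z)) =
      Submodule.Quotient.mk (Fintype.linearCombination ℂ (fun α : F.rootsQu => F.e α) (Matrix.toLin' (diagonal d) z))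
    congr 1
    apply Subtype.ext
    rw [hcoe]
    change NormedSpace.exp (a : Mat N) * _ * NormedSpace.exp (-(a : Mat N)) = _
    rw [hcoe, Finset.mul_sum, Finset.sum_mul]
    refine Finset.sum_congr rfl fun α _ => ?_
    rw [mul_smul_comm, smul_mul_assoc, exp_conj_of_lie_eq_smul (lie_aSplit (F.e_mem α α.2.1) a), smul_smul,
      Matrix.toLin'_apply, Matrix.mulVec_diagonal, mul_comm]
  rw [canonicalCharacter, hconj, LinearMap.det_conj, LinearMap.det_toLin', Matrix.det_diagonal]

/-- Since exp(a) lies in P, the point lies in the fiber at the base point of G/P, where the norm is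
known; only the character contributes. -/
theorem qP_norm_point (R : ReferenceMetrics F) (a : F.aSplit) :
    R.qP.norm (LineBundle.mk (F.point a) 1) = ∏ α : F.rootsQu, Real.exp (-(F.rootAt α a).re) := by
  have h1 : (LineBundle.mk (F.point a) 1 : LineBundle X.G X.P (canonicalCharacter X.P_le_G)) =
      LineBundle.mk 1 (canonicalCharacter X.P_le_G ⟨F.point a, X.L_levi.le (point_mem_L a)⟩ * 1) :=
    Quot.sound ⟨⟨F.point a, X.L_levi.le (point_mem_L a)⟩, by simp, rfl⟩
  rw [h1, R.qP.norm_smul, R.qP_one, mul_one, canonicalCharacter_point, norm_inv, norm_prod,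
    ← Finset.prod_inv_distrib]
  refine Finset.prod_congr rfl fun α _ => ?_
  rw [Complex.norm_exp, Real.exp_neg]

theorem qf_norm_point (R : ReferenceMetrics F) (a : F.aSplit) :
    R.qf.norm (LineBundle.mk (F.point a) 1) = 1 := R.qf_L ⟨F.point a, point_mem_L a⟩

end Frame

/-! ### Regular functions along unipotent one-parameter groups -/

section RegularFunctions

open Matrix HorosymmetricSpace

variable {N : ℕ}

theorem isNilpotent_of_lie_eq_smul {h x : Mat N} {c : ℂ} (hc : c ≠ 0) (hx : ⁅h, x⁆ = c • x) :
    IsNilpotent x := by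
  by_contra hn
  have hpow : ∀ k : ℕ, ⁅h, x ^ k⁆ = ((k : ℂ) * c) • x ^ k := by
    intro k
    induction k with
    | zero => simp [Ring.lie_def]
    | succ k ih =>
      have h1 : ⁅h, x ^ k * x⁆ = ⁅h, x ^ k⁆ * x + x ^ k * ⁅h, x⁆ := by
        simp only [Ring.lie_def, sub_mul, mul_sub, mul_assoc]
        abel
      rw [pow_succ, h1, ih, hx, smul_mul_assoc, mul_smul_comm, ← add_smul]
      congr 1
      push_cast
      ring
  let f : Module.End ℂ (Mat N) := LinearMap.mulLeft ℂ h - LinearMap.mulRight ℂ h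
  have hev : ∀ k : ℕ, f.HasEigenvalue ((k : ℂ) * c) := by
    intro k
    refine Module.End.hasEigenvalue_of_hasEigenvector (x := x ^ k)
      ⟨Module.End.mem_eigenspace_iff.2 (hpow k), fun h0 => hn ⟨k, h0⟩⟩
  have hfin : Set.Finite {μ : ℂ | f.HasEigenvalue μ} := Module.End.finite_hasEigenvalue f
  refine Set.infinite_univ (α := ℕ) ?_
  refine Set.Finite.subset (hfin.preimage (f := fun k : ℕ => (k : ℂ) * c) ?_) fun k _ => hev k
  intro k _ k' _ hkk
  exact_mod_cast mul_right_cancel₀ hc hkk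

theorem exp_smul_of_isNilpotent {y : Mat N} {M : ℕ} (hM : y ^ M = 0) (s : ℂ) :
    NormedSpace.exp (s • y) = ∑ n ∈ Finset.range M, ((n.factorial : ℂ)⁻¹ * s ^ n) • y ^ n := by
  have h := NormedSpace.exp_eq_tsum (𝔸 := Mat N) ℂ
  rw [h]
  change ∑' n : ℕ, ((n.factorial : ℂ)⁻¹) • (s • y) ^ n = _
  rw [tsum_eq_sum (s := Finset.range M)]
  · refine Finset.sum_congr rfl fun n _ => ?_
    rw [smul_pow, smul_smul]
  · intro n hn
    rw [Finset.mem_range, not_lt] at hn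
    rw [smul_pow, pow_eq_zero_of_le hn hM, smul_zero, smul_zero]

/-- A polynomial in the entries is a polynomial function along the exponential of a nilpotent
matrix. -/
theorem exists_polynomial_evalAt_exp {y : Mat N} (hy : IsNilpotent y) (p : MatPoly N) :
    ∃ q : Polynomial ℂ, ∀ s : ℂ, q.eval s = evalAt (NormedSpace.exp (s • y)) p := by
  obtain ⟨M, hM⟩ := hy
  let w : Fin N × Fin N → Polynomial ℂ := fun ij => ∑ n ∈ Finset.range M,
    Polynomial.C ((n.factorial : ℂ)⁻¹ * (y ^ n) ij.1 ij.2) * Polynomial.X ^ n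
  refine ⟨MvPolynomial.aeval w p, fun s => ?_⟩
  have h1 : (Polynomial.evalRingHom s).comp (MvPolynomial.aeval w).toRingHom =
      MvPolynomial.eval fun ij => NormedSpace.exp (s • y) ij.1 ij.2 := by
    apply MvPolynomial.ringHom_ext
    · intro c
      simp
    · intro ij
      have : (NormedSpace.exp (s • y)) ij.1 ij.2 = (w ij).eval s := by
        rw [exp_smul_of_isNilpotent hM, Matrix.sum_apply, Polynomial.eval_finsetSum]
        refine Finset.sum_congr rfl fun n _ => ?_
        simp
        ring
      simp [this]
  exact RingHom.congr_fun h1 p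

/-- A nowhere vanishing regular function is constant along unipotent one-parameter groups. -/
theorem IsRegular.exp_nilpotent {A : Subgroup (GLN N)} (hA : IsZariskiClosed A) {f : A → ℂ}
    (hf : IsRegular A f) (hf0 : ∀ a, f a ≠ 0) {y : lie A} (hy : IsNilpotent (y : Mat N)) (s : ℂ) :
    f (expIn hA (s • y)) = f 1 := by
  obtain ⟨p, k, hp⟩ := hf
  obtain ⟨q, hq⟩ := exists_polynomial_evalAt_exp hy p
  have hdet : ∀ s : ℂ, Matrix.det (NormedSpace.exp (s • (y : Mat N))) = 1 := by
    intro s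
    obtain ⟨q, hq⟩ := exists_polynomial_evalAt_exp hy
      (Matrix.det (Matrix.mvPolynomialX (Fin N) (Fin N) ℂ))
    simp only [evalAt_det] at hq
    have hd : q.degree = 0 := by
      by_contra hd
      obtain ⟨x, hx⟩ := IsAlgClosed.exists_root q hd
      exact ((Matrix.isUnit_iff_isUnit_det _).1 (expGL (x • (y : Mat N))).isUnit).ne_zero ((hq x).symm.trans hx)
    have h0 := hq 0
    rw [zero_smul, NormedSpace.exp_zero, Matrix.det_one] at h0
    rw [← hq, ← h0, Polynomial.eq_C_of_degree_eq_zero hd, Polynomial.eval_C, Polynomial.eval_C]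
  have hfq : ∀ s : ℂ, f (expIn hA (s • y)) = q.eval s := by
    intro s
    have h1 := hp (expIn hA (s • y))
    have h2 : ((expIn hA (s • y) : GLN N) : Mat N) = NormedSpace.exp (s • (y : Mat N)) := rfl
    rw [h2, hdet, one_pow, mul_one, ← hq] at h1
    exact h1
  -- Along a nilpotent direction the determinant is 1 and f is a polynomial in s; having no zero, it
  -- is constant.
  have hdeg : q.degree = 0 ∨ q.degree ≠ 0 := em _
  rcases hdeg with hd | hd
  · rw [hfq]
    have h3 : f 1 = q.eval 0 := by
      rw [← hfq, zero_smul]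
      congr 1
      apply Subtype.ext
      apply Units.ext
      simp [expIn, coe_expGL]
    rw [h3, Polynomial.eq_C_of_degree_eq_zero hd, Polynomial.eval_C, Polynomial.eval_C]
  · obtain ⟨x, hx⟩ := IsAlgClosed.exists_root q hd
    exact absurd ((hfq x).trans hx) (hf0 _)

/-- The differential of a polynomial at the identity, as a linear form. -/
def diffAtOneLinear (p : MatPoly N) : Mat N →ₗ[ℂ] ℂ where
  toFun y := diffAtOne y p
  map_add' y z := by simp [diffAtOne, mul_add, Finset.sum_add_distrib]
  map_smul' c y := by
    simp only [diffAtOne, Matrix.smul_apply, smul_eq_mul, RingHom.id_apply, Finset.mul_sum]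
    exact Finset.sum_congr rfl fun _ _ => by ring

/-- The differential of a regular function at the identity is linear. -/
theorem IsRegular.exists_hasDerivAt {A : Subgroup (GLN N)} (hA : IsZariskiClosed A) {f : A → ℂ}
    (hf : IsRegular A f) : ∃ D : Mat N →ₗ[ℂ] ℂ, ∀ y : lie A,
      HasDerivAt (fun s : ℂ => f (expIn hA (s • y))) (D y) 0 := by
  obtain ⟨p, k, hp⟩ := hf
  let δ : MatPoly N := Matrix.det (Matrix.mvPolynomialX (Fin N) (Fin N) ℂ)
  refine ⟨diffAtOneLinear p - (evalAt 1 p * k) • diffAtOneLinear δ, fun y => ?_⟩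
  have hne : ∀ s : ℂ, Matrix.det (NormedSpace.exp (s • (y : Mat N))) ≠ 0 := fun s =>
    ((Matrix.isUnit_iff_isUnit_det _).1 (expGL (s • (y : Mat N))).isUnit).ne_zero
  have h1 : (fun s : ℂ => f (expIn hA (s • y))) = fun s : ℂ =>
      evalAt (NormedSpace.exp (s • (y : Mat N))) p / Matrix.det (NormedSpace.exp (s • (y : Mat N))) ^ k := by
    funext s
    rw [eq_div_iff (pow_ne_zero _ (hne s))]
    exact hp (expIn hA (s • y))
  rw [h1]
  have h2 := hasDerivAt_evalAt_exp p (y : Mat N) 0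
  have h3 := hasDerivAt_evalAt_exp δ (y : Mat N) 0
  simp only [δ, evalAt_det] at h3
  replace h3 := h3.pow k
  have h4 := h2.div h3 (pow_ne_zero _ (hne 0))
  refine h4.congr_deriv ?_
  simp only [zero_smul, NormedSpace.exp_zero, evalAt_one_leftDer, Pi.pow_apply, Matrix.det_one, one_pow, mul_one,
    div_one, LinearMap.sub_apply, LinearMap.smul_apply, smul_eq_mul]
  change diffAtOne _ p - _ = diffAtOne _ p - _ * diffAtOne _ _
  ring

end RegularFunctions

/-! ### Characters of H and triviality on the symmetric fiber -/

section Characters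

variable {N : ℕ} {X : HorosymmetricSpace N}

/-- The fiber coordinate over gH, extended by zero to the other fibers, is constant on the classes
of the quotient and recovers z. -/
theorem LineBundle.mk_injective {G H : Subgroup (GLN N)} (χ : H →* ℂˣ) {g : G} {z w : ℂ}
    (h : (LineBundle.mk g z : LineBundle G H fun h => (χ h : ℂ)) = LineBundle.mk g w) : z = w := by
  classical
  let ψ : G × ℂ → ℂ := fun x =>
    if hx : (g : GLN N)⁻¹ * x.1 ∈ H then (χ ⟨_, hx⟩ : ℂ) * x.2 else 0
  have hψ : ∀ x y : G × ℂ, (∃ h : H, (x.1 : GLN N) = y.1 * h ∧ y.2 = (χ h : ℂ) * x.2) → ψ x = ψ y := by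
    rintro ⟨x, z⟩ ⟨y, w⟩ ⟨h, hxy, rfl⟩
    simp only at hxy
    by_cases hx : (g : GLN N)⁻¹ * x ∈ H
    · have hy : (g : GLN N)⁻¹ * y ∈ H := by
        have := H.mul_mem hx (H.inv_mem h.2)
        rwa [hxy, mul_assoc, mul_assoc, mul_inv_cancel, mul_one] at this
      simp only [ψ, hx, hy, dif_pos]
      rw [← mul_assoc, ← Units.val_mul, ← map_mul]
      congr 3
      apply Subtype.ext
      change (g : GLN N)⁻¹ * x = (g : GLN N)⁻¹ * y * h
      rw [hxy, mul_assoc]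
    · have hy : (g : GLN N)⁻¹ * y ∉ H := by
        intro hy
        apply hx
        rw [hxy, ← mul_assoc]
        exact H.mul_mem hy h.2
      simp only [ψ, hx, hy, dif_neg, not_false_eq_true]
  have h1 : Quot.lift ψ hψ (Quot.mk _ (g, z)) = Quot.lift ψ hψ (Quot.mk _ (g, w)) :=
    congrArg (Quot.lift ψ hψ) h
  have h2 : ∀ v, ψ (g, v) = v := by
    intro v
    have hg : (g : GLN N)⁻¹ * g ∈ H := by rw [inv_mul_cancel]; exact H.one_mem
    have h3 : (⟨(g : GLN N)⁻¹ * g, hg⟩ : H) = 1 := Subtype.ext (inv_mul_cancel _)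
    simp only [ψ]
    rw [dif_pos hg, h3, map_one, Units.val_one, one_mul]
  change ψ (g, z) = ψ (g, w) at h1
  rwa [h2, h2] at h1

/-- A character is a nowhere vanishing regular function, hence constant along exp(sy). Were dχ(y)
nonzero, s = 1/dχ(y) would give e = 1. -/
theorem AlgebraicCharacter.dχ_eq_zero_of_isNilpotent {A : Subgroup (GLN N)} {hA : IsZariskiClosed A}
    (χ : AlgebraicCharacter hA) {y : lie A} (hy : IsNilpotent (y : Mat N)) : χ.dχ y = 0 := by
  by_contra hne
  have h1 := χ.regular.exp_nilpotent hA (fun a => (χ.χ a).ne_zero) hy (1 / χ.dχ y)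
  rw [χ.χ_exp, map_smul, smul_eq_mul, one_div_mul_cancel hne, map_one, Units.val_one] at h1
  have h6 : Real.exp 1 = 1 := by
    rw [← Complex.ofReal_inj, Complex.ofReal_exp]
    simpa using h1
  have := Real.add_one_lt_exp one_ne_zero
  linarith

/-- A character that is trivial on the fiber vanishes on the sums of two nilpotent elements of the
Levi subalgebra. -/
theorem AlgebraicCharacter.dχ_eq_zero_of_add (χ : AlgebraicCharacter X.H_closed)
    (hχ : X.TrivialOnFiber fun h => (χ.χ h : ℂ)) {y z : Mat N} (hy : y ∈ lie X.L) (hz : z ∈ lie X.L)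
    (hyn : IsNilpotent y) (hzn : IsNilpotent z) (hyz : y + z ∈ lie X.H) : χ.dχ ⟨y + z, hyz⟩ = 0 := by
  obtain ⟨f, hf, hf0, hfeq⟩ := hχ
  have hL := X.L_levi.closed
  obtain ⟨D, hD⟩ := hf.exists_hasDerivAt hL
  have hnil : ∀ x : lie X.L, IsNilpotent (x : Mat N) → D x = 0 := by
    intro x hx
    have h1 := hD x
    have h2 : (fun s : ℂ => f (expIn hL (s • x))) = fun _ => f 1 := by
      funext s
      exact hf.exp_nilpotent hL hf0 hx s
    rw [h2] at h1
    exact h1.unique (hasDerivAt_const _ _)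
  let w : lie X.L := ⟨y + z, (lie X.L).add_mem hy hz⟩
  have hDw : D (w : Mat N) = 0 := by
    change D (y + z) = 0
    rw [map_add, hnil ⟨y, hy⟩ hyn, hnil ⟨z, hz⟩ hzn, add_zero]
  have hcov1 : ∀ (c : X.L) (hc : (c : GLN N) ∈ X.H), f 1 = (χ.χ ⟨c, hc⟩ : ℂ) * f c := by
    intro c hc
    have h1 := hfeq 1 c (by rwa [inv_one, one_mul])
    have h2 : (LineBundle.mk ⟨(c : GLN N), X.L_le_G c.2⟩ (f c) : LineBundle X.G X.H fun h => (χ.χ h : ℂ)) =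
        LineBundle.mk ⟨((1 : X.L) : GLN N), X.L_le_G (1 : X.L).2⟩ ((χ.χ ⟨c, hc⟩ : ℂ) * f c) :=
      Quot.sound ⟨⟨c, hc⟩, (one_mul _).symm, rfl⟩
    exact LineBundle.mk_injective χ.χ (h1.trans h2)
  -- The sum y + z need not be nilpotent, so χ alone says nothing. The trivializing section f
  -- satisfies f(1) = χ(c)f(c) on L ∩ H, and its differential at 1 is linear and kills y and z
  -- separately. Differentiating along exp(s(y+z)) leaves only the term with dχ.
  have hcov : ∀ s : ℂ, f 1 = Complex.exp (s * χ.dχ ⟨y + z, hyz⟩) * f (expIn hL (s • w)) := by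
    intro s
    have hc : (expIn hL (s • w) : GLN N) ∈ X.H := exp_mem X.H_closed ((lie X.H).smul_mem s hyz)
    have h1 : (⟨expIn hL (s • w), hc⟩ : X.H) = expIn X.H_closed (s • ⟨y + z, hyz⟩) := rfl
    rw [hcov1 _ hc, h1, χ.χ_exp, map_smul, smul_eq_mul]
  have h4 := (((hasDerivAt_id (0 : ℂ)).mul_const (χ.dχ ⟨y + z, hyz⟩)).cexp).mul (hD w)
  have h5 : ((fun s : ℂ => Complex.exp (id s * χ.dχ ⟨y + z, hyz⟩)) * fun s => f (expIn hL (s • w))) =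
      fun _ => f 1 := by
    funext s
    exact (hcov s).symm
  rw [h5] at h4
  have h6 := h4.unique (hasDerivAt_const _ _)
  rw [hDw] at h6
  have h7 : χ.dχ ⟨y + z, hyz⟩ * f (expIn hL ((0 : ℂ) • w)) = 0 := by simpa using h6
  exact (mul_eq_zero.1 h7).resolve_right (hf0 _)

end Characters

namespace Frame

open HorosymmetricSpace

variable {N : ℕ} {X : HorosymmetricSpace N} {F : Frame X} {γ : Module.Dual ℂ (lie F.S.T)}

theorem isNilpotent_of_mem_rootSpace {x : Mat N} (hγ : γ ≠ 0) (hx : x ∈ rootSpace X.G F.S.T γ) :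
    IsNilpotent x := by
  obtain ⟨h, hh⟩ := DFunLike.ne_iff.1 hγ
  exact isNilpotent_of_lie_eq_smul hh (hx.2 h)

end Frame

/-! ### Top powers of (1,1)-forms in the exterior algebra -/

section Exterior

open ExteriorAlgebra

variable {M : Type*} [AddCommGroup M] [Module ℂ M]

theorem ι_mul_ι_swap (x y : M) :
    ExteriorAlgebra.ι ℂ x * ExteriorAlgebra.ι ℂ y = -(ExteriorAlgebra.ι ℂ y * ExteriorAlgebra.ι ℂ x) :=
  eq_neg_of_add_eq_zero_left (ι_add_mul_swap x y)

theorem ι_mul_ιMulti_swap (w : M) {n : ℕ} (u : Fin n → M) :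
    ExteriorAlgebra.ι ℂ w * ιMulti ℂ n u = (-1 : ℂ) ^ n • (ιMulti ℂ n u * ExteriorAlgebra.ι ℂ w) := by
  induction n with
  | zero => simp
  | succ n ih =>
    rw [ιMulti_succ_apply, ← mul_assoc, ι_mul_ι_swap w, neg_mul, mul_assoc, ih, mul_smul_comm, mul_assoc,
      pow_succ, mul_neg_one, neg_smul]

theorem ι_mul_ιMulti_self {n : ℕ} (u : Fin n → M) (i : Fin n) :
    ExteriorAlgebra.ι ℂ (u i) * ιMulti ℂ n u = 0 := by
  rw [ιMulti_apply]
  exact ι_mul_prod_list u i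

theorem commute_ι_mul_ι (x y z w : M) :
    Commute (ExteriorAlgebra.ι ℂ x * ExteriorAlgebra.ι ℂ y) (ExteriorAlgebra.ι ℂ z * ExteriorAlgebra.ι ℂ w) := by
  have key : ∀ z, Commute (ExteriorAlgebra.ι ℂ x * ExteriorAlgebra.ι ℂ y) (ExteriorAlgebra.ι ℂ z) := by
    intro z
    rw [Commute, SemiconjBy, mul_assoc, ι_mul_ι_swap y z, mul_neg, ← mul_assoc, ι_mul_ι_swap x z, neg_mul,
      neg_neg, mul_assoc]
  exact (key z).mul_right (key w)

/-- The sign of the permutation that separates the two factors in a product of `n` pairs. -/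
def pairSign (n : ℕ) : ℂ := ∏ k ∈ Finset.range n, (-1 : ℂ) ^ k

/-- Products of pairs commute and have square zero. With x the first pair and s the sum of the
others, (x+s)^{n+1} = s^{n+1} + (n+1)xs^n and s^{n+1} = 0. Moving w_0 past the n remaining u's
produces the sign. -/
theorem sum_pairs_pow {n : ℕ} (u w : Fin n → M) :
    (∑ i, ExteriorAlgebra.ι ℂ (u i) * ExteriorAlgebra.ι ℂ (w i)) ^ n =
      ((n.factorial : ℂ) * pairSign n) • (ιMulti ℂ n u * ιMulti ℂ n w) := by
  induction n with
  | zero => simp [pairSign]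
  | succ n ih =>
    rw [Fin.sum_univ_succ]
    set x := ExteriorAlgebra.ι ℂ (u 0) * ExteriorAlgebra.ι ℂ (w 0) with hx
    set s := ∑ i : Fin n, ExteriorAlgebra.ι ℂ (u i.succ) * ExteriorAlgebra.ι ℂ (w i.succ) with hs
    have hcomm : Commute x s := Commute.sum_right _ _ _ fun i _ => commute_ι_mul_ι _ _ _ _
    have hx2 : x * x = 0 := by
      rw [hx, mul_assoc, ← mul_assoc (ExteriorAlgebra.ι ℂ (w 0)), ι_mul_ι_swap (w 0) (u 0), neg_mul, mul_neg,
        mul_assoc, ← mul_assoc, ι_sq_zero, zero_mul, neg_zero]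
    have hsn : s ^ n = ((n.factorial : ℂ) * pairSign n) •
        (ιMulti ℂ n (fun i => u i.succ) * ιMulti ℂ n (fun i => w i.succ)) :=
      ih (fun i => u i.succ) (fun i => w i.succ)
    have hs0 : s ^ (n + 1) = 0 := by
      rw [pow_succ', hsn, mul_smul_comm, hs, Finset.sum_mul, Finset.sum_eq_zero, smul_zero]
      intro i _
      rw [ι_mul_ι_swap, neg_mul, mul_assoc, ← mul_assoc (ExteriorAlgebra.ι ℂ (u i.succ)),
        ι_mul_ιMulti_self (fun i => u i.succ) i, zero_mul, mul_zero, neg_zero]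
    have hpow : ∀ m : ℕ, (x + s) ^ (m + 1) = s ^ (m + 1) + ((m : ℂ) + 1) • (x * s ^ m) := by
      intro m
      induction m with
      | zero => simp [add_comm]
      | succ m ihm =>
        have h1 : x * s ^ m * x = 0 := by
          rw [mul_assoc, ← (hcomm.pow_right m).eq, ← mul_assoc, hx2, zero_mul]
        rw [pow_succ, ihm, add_mul, mul_add, mul_add, smul_mul_assoc, smul_mul_assoc, h1, smul_zero, zero_add,
          ← pow_succ, mul_assoc, ← pow_succ, ← (hcomm.pow_right (m + 1)).eq, Nat.cast_succ, add_smul ((m : ℂ) + 1) 1, one_smul]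
        abel
    rw [hpow, hs0, zero_add, hsn, mul_smul_comm, smul_smul, hx, ιMulti_succ_apply, ιMulti_succ_apply]
    have h2 : ExteriorAlgebra.ι ℂ (u 0) * ExteriorAlgebra.ι ℂ (w 0) *
        (ιMulti ℂ n (fun i => u i.succ) * ιMulti ℂ n (fun i => w i.succ)) =
        (-1 : ℂ) ^ n • (ExteriorAlgebra.ι ℂ (u 0) * ιMulti ℂ n (fun i => u i.succ) *
          (ExteriorAlgebra.ι ℂ (w 0) * ιMulti ℂ n (fun i => w i.succ))) := by
      rw [mul_assoc, ← mul_assoc (ExteriorAlgebra.ι ℂ (w 0)), ι_mul_ιMulti_swap, smul_mul_assoc, mul_smul_comm]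
      simp only [mul_assoc]
    rw [h2, smul_smul]
    congr 1
    rw [pairSign, pairSign, Finset.prod_range_succ, Nat.factorial_succ]
    push_cast
    ring

/-- This matches the normalization of the volume form, because n² = n + 2(0 + 1 + ... + (n-1)). -/
theorem I_pow_mul_pairSign (n : ℕ) : Complex.I ^ n * pairSign n = Complex.I ^ (n ^ 2) := by
  induction n with
  | zero => simp [pairSign]
  | succ n ih =>
    have h1 : (n + 1) ^ 2 = n ^ 2 + 2 * n + 1 := by ring
    have h2 : Complex.I ^ ((n + 1) ^ 2) = Complex.I ^ (n ^ 2) * (Complex.I ^ 2) ^ n * Complex.I := by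
      rw [h1, pow_succ, pow_add, pow_mul]
    rw [h2, ← ih, Complex.I_sq, pairSign, pairSign, Finset.prod_range_succ, pow_succ]
    ring

/-- Both sides are alternating in the rows of A, so it suffices to compare them on the standard
basis. -/
theorem ιMulti_matrix {n : ℕ} (A : Matrix (Fin n) (Fin n) ℂ) (v : Fin n → M) :
    ιMulti ℂ n (fun i => ∑ j, A i j • v j) = A.det • ιMulti ℂ n v := by
  let f : (Fin n → ℂ) [⋀^Fin n]→ₗ[ℂ] ExteriorAlgebra ℂ M :=
    (ιMulti ℂ n).compLinearMap (Fintype.linearCombination ℂ v)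
  let g : (Fin n → ℂ) [⋀^Fin n]→ₗ[ℂ] ExteriorAlgebra ℂ M :=
    (LinearMap.toSpanSingleton ℂ _ (ιMulti ℂ n v)).compAlternatingMap Matrix.detRowAlternating
  have hfg : f = g := by
    refine Module.Basis.ext_alternating (Pi.basisFun ℂ (Fin n)) fun τ hτ => ?_
    obtain ⟨π, rfl⟩ : ∃ π : Equiv.Perm (Fin n), τ = π :=
      ⟨Equiv.ofBijective τ (Finite.injective_iff_bijective.1 hτ), rfl⟩
    change f ((fun j => Pi.basisFun ℂ (Fin n) j) ∘ π) = g ((fun j => Pi.basisFun ℂ (Fin n) j) ∘ π)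
    rw [AlternatingMap.map_perm, AlternatingMap.map_perm]
    congr 1
    have h1 : f (fun j => Pi.basisFun ℂ (Fin n) j) = ιMulti ℂ n v := by
      change ιMulti ℂ n (fun j => Fintype.linearCombination ℂ v (Pi.basisFun ℂ (Fin n) j)) = _
      congr 1
      funext j
      rw [Pi.basisFun_apply, Fintype.linearCombination_apply_single, one_smul]
    have h2 : g (fun j => Pi.basisFun ℂ (Fin n) j) = ιMulti ℂ n v := by
      change Matrix.det (Matrix.of fun j => Pi.basisFun ℂ (Fin n) j) • ιMulti ℂ n v = _
      have h3 : Matrix.of (fun j => Pi.basisFun ℂ (Fin n) j) = 1 := by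
        ext i j
        simp [Matrix.one_apply, Pi.single_apply, eq_comm]
      rw [h3, Matrix.det_one, one_smul]
    rw [h1, h2]
  exact congrArg (fun h : (Fin n → ℂ) [⋀^Fin n]→ₗ[ℂ] ExteriorAlgebra ℂ M => h A) hfg

theorem ιMulti_ne_zero {m : ℕ} (v : Fin m → M) (φ : M →ₗ[ℂ] (Fin m → ℂ))
    (hφ : ∀ k, φ (v k) = Pi.single k 1) : ιMulti ℂ m v ≠ 0 := by
  let g : M [⋀^Fin m]→ₗ[ℂ] ℂ := Matrix.detRowAlternating.compLinearMap φ
  have h1 := liftAlternating_apply_ιMulti (Function.update (fun i => (0 : M [⋀^Fin i]→ₗ[ℂ] ℂ)) m g) v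
  rw [Function.update_self] at h1
  have h2 : g v = 1 := by
    change Matrix.det (Matrix.of fun k => φ (v k)) = 1
    have h3 : Matrix.of (fun k => φ (v k)) = 1 := by
      ext i j
      rw [Matrix.of_apply, hφ]
      simp [Matrix.one_apply, Pi.single_apply, eq_comm]
    rw [h3, Matrix.det_one]
  intro h0
  rw [h0, map_zero, h2] at h1
  exact zero_ne_one h1

variable {ι : Type*} [DecidableEq ι]

theorem dz_single (i j : ι) (c : ℂ) : dz i (Pi.single j c) = if i = j then c else 0 := by
  simp [dz, Pi.single_apply]

theorem dzbar_single (i j : ι) (c : ℂ) :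
    dzbar i (Pi.single j c) = if i = j then starRingEnd ℂ c else 0 := by
  simp only [dzbar, LinearMap.comp_apply, LinearMap.proj_apply, Pi.single_apply]
  split_ifs <;> simp

variable [Fintype ι]

theorem standardVolume_ne_zero : standardVolume ι ≠ 0 := by
  rw [standardVolume, ιMulti_mul_ιMulti]
  set n := Fintype.card ι
  let ev : Fin n → ι := (Fintype.equivFin ι).symm
  -- Evaluation on the vectors ∂/∂z_k and ∂/∂z̄_k, the dual basis of dz_k and dz̄_k.
  let φ : Cotangent ι →ₗ[ℂ] (Fin (n + n) → ℂ) :=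
    { toFun := fun ξ => Fin.append
        (fun k => (ξ (Pi.single (ev k) 1) - Complex.I * ξ (Pi.single (ev k) Complex.I)) / 2)
        (fun k => (ξ (Pi.single (ev k) 1) + Complex.I * ξ (Pi.single (ev k) Complex.I)) / 2)
      map_add' := fun ξ η => by
        funext k
        refine Fin.addCases (fun k => ?_) (fun k => ?_) k
        · simp only [Fin.append_left, Pi.add_apply, LinearMap.add_apply]; ring
        · simp only [Fin.append_right, Pi.add_apply, LinearMap.add_apply]; ring
      map_smul' := fun c ξ => by
        funext k
        refine Fin.addCases (fun k => ?_) (fun k => ?_) k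
        · simp only [Fin.append_left, Pi.smul_apply, LinearMap.smul_apply, smul_eq_mul, RingHom.id_apply]; ring
        · simp only [Fin.append_right, Pi.smul_apply, LinearMap.smul_apply, smul_eq_mul, RingHom.id_apply]; ring }
  have hev : ∀ k k', ev k = ev k' ↔ k = k' := fun k k' => (Fintype.equivFin ι).symm.injective.eq_iff
  refine smul_ne_zero (pow_ne_zero _ Complex.I_ne_zero) (ιMulti_ne_zero _ φ fun k => ?_)
  have hφ : ∀ ξ k, φ ξ (Fin.castAdd n k) =
      (ξ (Pi.single (ev k) 1) - Complex.I * ξ (Pi.single (ev k) Complex.I)) / 2 := fun ξ k => by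
    simp only [φ, LinearMap.coe_mk, AddHom.coe_mk, Fin.append_left]
  have hφ' : ∀ ξ k, φ ξ (Fin.natAdd n k) =
      (ξ (Pi.single (ev k) 1) + Complex.I * ξ (Pi.single (ev k) Complex.I)) / 2 := fun ξ k => by
    simp only [φ, LinearMap.coe_mk, AddHom.coe_mk, Fin.append_right]
  have hne : ∀ (a b : Fin n), Fin.castAdd n a ≠ Fin.natAdd n b := by
    intro a b h
    have := congrArg Fin.val h
    simp at this
    omega
  refine Fin.addCases (fun k => ?_) (fun k => ?_) k
  · rw [Fin.append_left]
    funext j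
    refine Fin.addCases (fun j => ?_) (fun j => ?_) j
    · rw [hφ, dz_single, dz_single, Pi.single_apply]
      by_cases h : k = j
      · subst h
        simp [ev]
      · have h' : (Fintype.equivFin ι).symm k ≠ ev j := fun h' => h ((hev k j).1 h')
        rw [if_neg h', if_neg h', if_neg fun h' => h ((Fin.castAdd_injective n n h').symm)]
        simp
    · rw [hφ', dz_single, dz_single, Pi.single_apply, if_neg (hne _ _).symm]
      by_cases h : k = j
      · subst h
        simp [ev]
      · have h' : (Fintype.equivFin ι).symm k ≠ ev j := fun h' => h ((hev k j).1 h')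
        simp [h']
  · rw [Fin.append_right]
    funext j
    refine Fin.addCases (fun j => ?_) (fun j => ?_) j
    · rw [hφ, dzbar_single, dzbar_single, Pi.single_apply, if_neg (hne _ _)]
      by_cases h : k = j
      · subst h
        simp [ev]
      · have h' : (Fintype.equivFin ι).symm k ≠ ev j := fun h' => h ((hev k j).1 h')
        simp [h']
    · rw [hφ', dzbar_single, dzbar_single, Pi.single_apply]
      by_cases h : k = j
      · subst h
        simp [ev]
      · have h' : (Fintype.equivFin ι).symm k ≠ ev j := fun h' => h ((hev k j).1 h')
        rw [if_neg h', if_neg h', if_neg fun h' => h ((Fin.natAdd_injective n n h').symm)]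
        simp

/-- The top power of a `(1,1)`-form. -/
theorem ddbar_pow (f : (ι → ℂ) → ℂ) : ddbar f ^ Fintype.card ι =
    (((Fintype.card ι).factorial : ℂ) * (complexHessian f).det) • standardVolume ι := by
  let n := Fintype.card ι
  change ddbar f ^ n = ((n.factorial : ℂ) * _) • _
  let ev : Fin n ≃ ι := (Fintype.equivFin ι).symm
  let A : Matrix (Fin n) (Fin n) ℂ := Matrix.of fun i j => Complex.I * complexHessian f (ev i) (ev j)
  have h1 : ddbar f = ∑ i, ExteriorAlgebra.ι ℂ (dz (ev i)) *
      ExteriorAlgebra.ι ℂ (∑ j, A i j • dzbar (ev j)) := by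
    rw [ddbar, ← ev.sum_comp, Finset.smul_sum]
    refine Finset.sum_congr rfl fun i _ => ?_
    rw [← ev.sum_comp, map_sum, Finset.mul_sum, Finset.smul_sum]
    refine Finset.sum_congr rfl fun j _ => ?_
    rw [map_smul, mul_smul_comm, smul_smul]
    rfl
  have hdet : A.det = Complex.I ^ n * (complexHessian f).det := by
    have h2 : A = Complex.I • (complexHessian f).submatrix ev ev := by
      ext i j
      simp [A]
    rw [h2, Matrix.det_smul, Fintype.card_fin, Matrix.det_submatrix_equiv_self]
  have hvol : standardVolume ι = Complex.I ^ (n ^ 2) •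
      (ιMulti ℂ n (fun i => dz (ev i)) * ιMulti ℂ n (fun i => dzbar (ev i))) := rfl
  rw [h1, sum_pairs_pow, ιMulti_matrix, hdet, hvol, ← I_pow_mul_pairSign, smul_smul,
    mul_smul_comm, smul_smul]
  congr 1
  ring

end Exterior

/-! ### Second derivatives along products of exponentials -/

section SecondDerivative

variable {E : Type*} [NormedAddCommGroup E] [NormedSpace ℝ E]

theorem hasFDerivAt_fderiv {f : E → ℝ} {x : E}
    (hf : ContDiffAt ℝ ∞ f x) : HasFDerivAt (fderiv ℝ f) (fderiv ℝ (fderiv ℝ f) x) x := by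
  have h : ContDiffAt ℝ ∞ (fderiv ℝ f) x := hf.fderiv_right (by simp)
  exact (h.differentiableAt (by simp)).hasFDerivAt

theorem eventually_differentiableAt {f : E → ℝ} {x : E}
    (hf : ContDiffAt ℝ ∞ f x) : ∀ᶠ y in 𝓝 x, DifferentiableAt ℝ f y :=
  ((hf.of_le (m := 1) (by exact_mod_cast le_top)).eventually (by simp)).mono fun _ h => h.differentiableAt (by simp)

theorem fderiv_fderiv_symm {f : E → ℝ} {x : E}
    (hf : ContDiffAt ℝ ∞ f x) (v w : E) : fderiv ℝ (fderiv ℝ f) x v w = fderiv ℝ (fderiv ℝ f) x w v :=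
  hf.isSymmSndFDerivAt (by simpa using WithTop.coe_le_coe.2 (le_top : (2 : ℕ∞) ≤ ⊤)) v w

theorem hasDerivAt_fderiv_apply {f : E → ℝ}
    {γ c : ℝ → E} {γ' c' : E} {s : ℝ} (hf : ContDiffAt ℝ ∞ f (γ s)) (hγ : HasDerivAt γ γ' s) (hc : HasDerivAt c c' s) :
    HasDerivAt (fun t => fderiv ℝ f (γ t) (c t)) (fderiv ℝ (fderiv ℝ f) (γ s) γ' (c s) + fderiv ℝ f (γ s) c') s := by
  have h1 : HasDerivAt (fun t => fderiv ℝ f (γ t)) (fderiv ℝ (fderiv ℝ f) (γ s) γ') s :=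
    (hasFDerivAt_fderiv hf).comp_hasDerivAt s hγ
  exact h1.clm_apply hc

end SecondDerivative

section Jet

variable {𝔸 : Type*} [NormedRing 𝔸] [NormedAlgebra ℝ 𝔸]

/-- The second order derivative `∂²/∂s∂t Φ(exp(s v) exp(t w))` at the origin. -/
def mixedDeriv (Φ : 𝔸 → ℝ) : 𝔸 →ₗ[ℝ] 𝔸 →ₗ[ℝ] ℝ :=
  LinearMap.mk₂ ℝ (fun v w => fderiv ℝ (fderiv ℝ Φ) 1 v w + fderiv ℝ Φ 1 (v * w))
    (fun v v' w => by simp only [map_add, add_mul, add_apply]; ring)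
    (fun c v w => by simp only [map_smul, smul_mul_assoc, smul_apply, smul_add])
    (fun v w w' => by simp only [map_add, mul_add]; ring)
    (fun c v w => by simp only [map_smul, mul_smul_comm, smul_add])

theorem mixedDeriv_apply (Φ : 𝔸 → ℝ) (v w : 𝔸) :
    mixedDeriv Φ v w = fderiv ℝ (fderiv ℝ Φ) 1 v w + fderiv ℝ Φ 1 (v * w) := rfl

variable {Φ : 𝔸 → ℝ}

theorem mixedDeriv_sub_swap (hΦ : ContDiffAt ℝ ∞ Φ 1) (v w : 𝔸) :
    mixedDeriv Φ v w - mixedDeriv Φ w v = fderiv ℝ Φ 1 (v * w - w * v) := by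
  rw [mixedDeriv_apply, mixedDeriv_apply, fderiv_fderiv_symm hΦ v w, map_sub]
  ring

variable [CompleteSpace 𝔸]

theorem hasDerivAt_mul_exp {m : 𝔸} (h : DifferentiableAt ℝ Φ m) (w : 𝔸) :
    HasDerivAt (fun t : ℝ => Φ (m * NormedSpace.exp (t • w))) (fderiv ℝ Φ m (m * w)) 0 := by
  have h1 := (hasDerivAt_exp_smul_const w (0 : ℝ)).const_mul m
  have h2 : HasFDerivAt Φ (fderiv ℝ Φ m) (m * NormedSpace.exp ((0 : ℝ) • w)) := by
    simpa using h.hasFDerivAt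
  simpa [Function.comp_def] using h2.comp_hasDerivAt (0 : ℝ) h1

theorem hasDerivAt_exp_mul {m : 𝔸} (h : DifferentiableAt ℝ Φ m) (w : 𝔸) :
    HasDerivAt (fun t : ℝ => Φ (NormedSpace.exp (t • w) * m)) (fderiv ℝ Φ m (w * m)) 0 := by
  have h1 := (hasDerivAt_exp_smul_const w (0 : ℝ)).mul_const m
  have h2 : HasFDerivAt Φ (fderiv ℝ Φ m) (NormedSpace.exp ((0 : ℝ) • w) * m) := by
    simpa using h.hasFDerivAt
  simpa [Function.comp_def] using h2.comp_hasDerivAt (0 : ℝ) h1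

theorem tendsto_exp_smul (v : 𝔸) :
    Tendsto (fun s : ℝ => NormedSpace.exp (s • v)) (𝓝 0) (𝓝 (1 : 𝔸)) := by
  have := (hasDerivAt_exp_smul_const v (0 : ℝ)).continuousAt.tendsto
  simpa using this

theorem hasDerivAt_fderiv_exp (hΦ : ContDiffAt ℝ ∞ Φ 1) {c : ℝ → 𝔸} {c' : 𝔸} (v : 𝔸)
    (hc : HasDerivAt c c' 0) : HasDerivAt (fun s : ℝ => fderiv ℝ Φ (NormedSpace.exp (s • v)) (c s))
      (fderiv ℝ (fderiv ℝ Φ) 1 v (c 0) + fderiv ℝ Φ 1 c') 0 := by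
  have h0 : NormedSpace.exp ((0 : ℝ) • v) = 1 := by rw [zero_smul, NormedSpace.exp_zero]
  have h1 := hasDerivAt_exp_smul_const v (0 : ℝ)
  have h2 : ContDiffAt ℝ ∞ Φ (NormedSpace.exp ((0 : ℝ) • v)) := by rwa [h0]
  have h3 := hasDerivAt_fderiv_apply h2 h1 hc
  rwa [h0, one_mul] at h3

theorem hasDerivAt_fderiv_exp_mul (hΦ : ContDiffAt ℝ ∞ Φ 1) (v w : 𝔸) :
    HasDerivAt (fun s : ℝ => fderiv ℝ Φ (NormedSpace.exp (s • v)) (NormedSpace.exp (s • v) * w))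
      (mixedDeriv Φ v w) 0 := by
  have h := hasDerivAt_fderiv_exp hΦ v ((hasDerivAt_exp_smul_const v (0 : ℝ)).mul_const w)
  simpa [mixedDeriv_apply] using h

theorem hasDerivAt_fderiv_mul_exp (hΦ : ContDiffAt ℝ ∞ Φ 1) (v w : 𝔸) :
    HasDerivAt (fun s : ℝ => fderiv ℝ Φ (NormedSpace.exp (s • v)) (w * NormedSpace.exp (s • v)))
      (mixedDeriv Φ w v) 0 := by
  have h := hasDerivAt_fderiv_exp hΦ v ((hasDerivAt_exp_smul_const v (0 : ℝ)).const_mul w)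
  rw [mixedDeriv_apply, fderiv_fderiv_symm hΦ w v]
  simpa using h

/-- The inner derivative in t is the constant c at each point exp(sv), so its derivative in s
vanishes. The hypothesis only concerns the points m on this curve, since the equivariance of a
potential is known on the group and not on all matrices. -/
theorem mixedDeriv_eq_zero_right (hΦ : ContDiffAt ℝ ∞ Φ 1) {y : 𝔸} {c : ℝ} (v : 𝔸)
    (h : ∀ᶠ m in 𝓝 (1 : 𝔸), ∀ s : ℝ, m = NormedSpace.exp (s • v) →
      ∀ᶠ t : ℝ in 𝓝 0, Φ (m * NormedSpace.exp (t • y)) = Φ m + t * c) :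
    mixedDeriv Φ v y = 0 := by
  have h1 : ∀ᶠ s : ℝ in 𝓝 0,
      fderiv ℝ Φ (NormedSpace.exp (s • v)) (NormedSpace.exp (s • v) * y) = c := by
    filter_upwards [(tendsto_exp_smul v).eventually (h.and (eventually_differentiableAt hΦ))] with s hs
    have h2 := hasDerivAt_mul_exp hs.2 y
    have h3 : HasDerivAt (fun t : ℝ => Φ (NormedSpace.exp (s • v)) + t * c) c 0 := by
      simpa using ((hasDerivAt_id (0 : ℝ)).mul_const c).const_add (Φ (NormedSpace.exp (s • v)))
    exact h2.unique (h3.congr_of_eventuallyEq (hs.1 s rfl))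
  exact (hasDerivAt_fderiv_exp_mul hΦ v y).unique ((hasDerivAt_const 0 c).congr_of_eventuallyEq h1)

/-- The left-handed counterpart: the invariant direction stands first in the product of
exponentials, hence in the first argument. -/
theorem mixedDeriv_eq_zero_left (hΦ : ContDiffAt ℝ ∞ Φ 1) {k : 𝔸} (v : 𝔸)
    (h : ∀ᶠ m in 𝓝 (1 : 𝔸), ∀ s : ℝ, m = NormedSpace.exp (s • v) →
      ∀ᶠ t : ℝ in 𝓝 0, Φ (NormedSpace.exp (t • k) * m) = Φ m) :
    mixedDeriv Φ k v = 0 := by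
  have h1 : ∀ᶠ s : ℝ in 𝓝 0,
      fderiv ℝ Φ (NormedSpace.exp (s • v)) (k * NormedSpace.exp (s • v)) = 0 := by
    filter_upwards [(tendsto_exp_smul v).eventually (h.and (eventually_differentiableAt hΦ))] with s hs
    have h2 := hasDerivAt_exp_mul hs.2 k
    exact h2.unique ((hasDerivAt_const 0 _).congr_of_eventuallyEq (hs.1 s rfl))
  exact (hasDerivAt_fderiv_mul_exp hΦ v k).unique ((hasDerivAt_const 0 _).congr_of_eventuallyEq h1)

/-- The second derivative of `Φ ∘ exp` along a linear map. -/
theorem fderiv_fderiv_exp (hΦ : ContDiffAt ℝ ∞ Φ 1) {V : Type*} [NormedAddCommGroup V]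
    [NormedSpace ℝ V] (A : V →L[ℝ] 𝔸) {f : V → ℝ}
    (hf : ContDiffAt ℝ ∞ f 0) (hfΦ : ∀ᶠ z in 𝓝 (0 : V), f z = Φ (NormedSpace.exp (A z))) (z w : V) :
    fderiv ℝ (fderiv ℝ f) 0 z w = (mixedDeriv Φ (A z) (A w) + mixedDeriv Φ (A w) (A z)) / 2 := by
  -- On the diagonal the exponentials form a one-parameter group, where the two derivatives agree;
  -- the general case follows by polarization.
  have hdiag : ∀ z : V, fderiv ℝ (fderiv ℝ f) 0 z z = mixedDeriv Φ (A z) (A z) := by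
    intro z
    have hline : Tendsto (fun s : ℝ => s • z) (𝓝 0) (𝓝 0) := by
      have : Continuous fun s : ℝ => s • z := by fun_prop
      simpa using this.tendsto 0
    have hfd := eventually_differentiableAt hf
    have h1 : ∀ᶠ s : ℝ in 𝓝 0, fderiv ℝ f (s • z) z =
        fderiv ℝ Φ (NormedSpace.exp (s • A z)) (NormedSpace.exp (s • A z) * A z) := by
      filter_upwards [hline.eventually (hfd.and hfΦ.eventually_nhds),
        (tendsto_exp_smul (A z)).eventually (eventually_differentiableAt hΦ)] with s hs hs'
      have h2 : HasDerivAt (fun t : ℝ => f (t • z)) (fderiv ℝ f (s • z) z) s := by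
        have := hs.1.hasFDerivAt.comp_hasDerivAt s ((hasDerivAt_id s).smul_const z)
        simpa [Function.comp_def] using this
      have h3 : HasDerivAt (fun t : ℝ => Φ (NormedSpace.exp (t • A z)))
          (fderiv ℝ Φ (NormedSpace.exp (s • A z)) (NormedSpace.exp (s • A z) * A z)) s :=
        hs'.hasFDerivAt.comp_hasDerivAt s (hasDerivAt_exp_smul_const (A z) s)
      refine h2.unique (h3.congr_of_eventuallyEq ?_)
      have hcont : ContinuousAt (fun t : ℝ => t • z) s := by fun_prop
      filter_upwards [hcont.tendsto.eventually hs.2] with t ht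
      rw [ht, map_smul]
    have h4 : HasDerivAt (fun s : ℝ => fderiv ℝ f (s • z) z) (fderiv ℝ (fderiv ℝ f) 0 z z) 0 := by
      have h5 : ContDiffAt ℝ ∞ f ((0 : ℝ) • z) := by rwa [zero_smul]
      have h6 := hasDerivAt_fderiv_apply h5 ((hasDerivAt_id (0 : ℝ)).smul_const z)
        (hasDerivAt_const (0 : ℝ) z)
      simpa using h6
    exact h4.unique ((hasDerivAt_fderiv_exp_mul hΦ (A z) (A z)).congr_of_eventuallyEq h1)
  have hsymm := fderiv_fderiv_symm hf w z
  have h := hdiag (z + w)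
  simp only [map_add, add_apply, LinearMap.add_apply] at h
  rw [hdiag z, hdiag w, hsymm] at h
  linarith

end Jet

/-! ### The complex Hessian in exponential coordinates -/

section ComplexHessian

variable {ι : Type*} [Fintype ι] [DecidableEq ι]

theorem lineDeriv_ofReal {V : Type*} [NormedAddCommGroup V] [NormedSpace ℝ V] {f : V → ℝ} {x : V}
    (hf : DifferentiableAt ℝ f x) (v : V) :
    lineDeriv ℝ (fun z => (f z : ℂ)) x v = ((fderiv ℝ f x v : ℝ) : ℂ) := by
  have h := (Complex.ofRealCLM.hasFDerivAt.comp x hf.hasFDerivAt)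
  have h2 := h.hasLineDerivAt v
  simpa [Function.comp_def] using h2.lineDeriv

theorem complexHessian_ofReal {f : (ι → ℂ) → ℝ} (hf : ContDiffAt ℝ ∞ f 0) (i j : ι) :
    complexHessian (fun z => (f z : ℂ)) i j =
      ((fderiv ℝ (fderiv ℝ f) 0 (Pi.single i 1) (Pi.single j 1) +
        fderiv ℝ (fderiv ℝ f) 0 (Pi.single i Complex.I) (Pi.single j Complex.I) : ℝ) +
      Complex.I * (fderiv ℝ (fderiv ℝ f) 0 (Pi.single i 1) (Pi.single j Complex.I) -
        fderiv ℝ (fderiv ℝ f) 0 (Pi.single i Complex.I) (Pi.single j 1) : ℝ)) / 4 := by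
  have hfd := eventually_differentiableAt hf
  have hbar : wirtingerBar j (fun z => (f z : ℂ)) =ᶠ[𝓝 0] fun z =>
      (((fderiv ℝ f z (Pi.single j 1) : ℝ) : ℂ) +
        Complex.I * ((fderiv ℝ f z (Pi.single j Complex.I) : ℝ) : ℂ)) / 2 := by
    filter_upwards [hfd] with z hz
    rw [wirtingerBar, lineDeriv_ofReal hz, lineDeriv_ofReal hz]
  have hline : ∀ v w : ι → ℂ, HasDerivAt (fun t : ℝ => ((fderiv ℝ f (0 + t • v) w : ℝ) : ℂ))
      ((fderiv ℝ (fderiv ℝ f) 0 v w : ℝ) : ℂ) 0 := by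
    intro v w
    have h5 : ContDiffAt ℝ ∞ f (0 + (0 : ℝ) • v) := by rwa [zero_smul, zero_add]
    have h6 := hasDerivAt_fderiv_apply h5 (((hasDerivAt_id (0 : ℝ)).smul_const v).const_add 0)
      (hasDerivAt_const (0 : ℝ) w)
    have h7 : HasDerivAt (fun t : ℝ => fderiv ℝ f (0 + t • v) w) (fderiv ℝ (fderiv ℝ f) 0 v w) 0 := by
      simpa using h6
    exact h7.ofReal_comp
  have hld : ∀ v : ι → ℂ, lineDeriv ℝ (wirtingerBar j (fun z => (f z : ℂ))) 0 v =
      (((fderiv ℝ (fderiv ℝ f) 0 v (Pi.single j 1) : ℝ) : ℂ) +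
        Complex.I * ((fderiv ℝ (fderiv ℝ f) 0 v (Pi.single j Complex.I) : ℝ) : ℂ)) / 2 := by
    intro v
    rw [hbar.lineDeriv_eq]
    exact (((hline v (Pi.single j 1)).add ((hline v (Pi.single j Complex.I)).const_mul Complex.I)).div_const 2).deriv
  rw [complexHessian, Matrix.of_apply, wirtinger, hld, hld]
  push_cast
  linear_combination (1 / 4 : ℂ) *
    ((fderiv ℝ (fderiv ℝ f) 0 (Pi.single i Complex.I) (Pi.single j Complex.I) : ℝ) : ℂ) * (-Complex.I_sq)

theorem wirtinger_congr {f g : (ι → ℂ) → ℂ} {z : ι → ℂ} (h : f =ᶠ[𝓝 z] g) (i : ι) :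
    wirtinger i f z = wirtinger i g z := by
  rw [wirtinger, wirtinger, h.lineDeriv_eq, h.lineDeriv_eq]

theorem wirtingerBar_congr {f g : (ι → ℂ) → ℂ} {z : ι → ℂ} (h : f =ᶠ[𝓝 z] g) (i : ι) :
    wirtingerBar i f z = wirtingerBar i g z := by
  rw [wirtingerBar, wirtingerBar, h.lineDeriv_eq, h.lineDeriv_eq]

theorem complexHessian_congr {f g : (ι → ℂ) → ℂ} (h : f =ᶠ[𝓝 0] g) :
    complexHessian f = complexHessian g := by
  ext i j
  rw [complexHessian, complexHessian, Matrix.of_apply, Matrix.of_apply]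
  refine wirtinger_congr ?_ i
  filter_upwards [h.eventually_nhds] with z hz
  exact wirtingerBar_congr hz j

/-- The complex Hessian of `Φ ∘ exp` along a complex linear map. -/
theorem complexHessian_exp {𝔸 : Type*} [NormedRing 𝔸] [NormedAlgebra ℝ 𝔸] [Algebra ℂ 𝔸] [CompleteSpace 𝔸]
    {Φ : 𝔸 → ℝ} (hΦ : ContDiffAt ℝ ∞ Φ 1) (A : (ι → ℂ) →L[ℝ] 𝔸)
    (hI : ∀ k, A (Pi.single k Complex.I) = Complex.I • A (Pi.single k 1)) {f : (ι → ℂ) → ℂ}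
    (hf : ∀ᶠ z in 𝓝 (0 : ι → ℂ), f z = (Φ (NormedSpace.exp (A z)) : ℂ)) (i j : ι) :
    complexHessian f i j =
      ((mixedDeriv Φ (A (Pi.single i 1)) (A (Pi.single j 1)) +
        mixedDeriv Φ (Complex.I • A (Pi.single i 1)) (Complex.I • A (Pi.single j 1)) : ℝ) +
      Complex.I * (mixedDeriv Φ (A (Pi.single i 1)) (Complex.I • A (Pi.single j 1)) -
        mixedDeriv Φ (Complex.I • A (Pi.single i 1)) (A (Pi.single j 1)) : ℝ)) / 4 := by
  have hcd : ContDiffAt ℝ ∞ (fun z : ι → ℂ => Φ (NormedSpace.exp (A z))) 0 := by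
    have h1 : ContDiffAt ℝ ∞ (fun z : ι → ℂ => NormedSpace.exp (A z)) 0 :=
      (NormedSpace.exp_analytic (𝕂 := ℝ) (A 0)).contDiffAt.comp 0 A.contDiff.contDiffAt
    have h2 : ContDiffAt ℝ ∞ Φ (NormedSpace.exp (A 0)) := by
      rw [map_zero, NormedSpace.exp_zero]
      exact hΦ
    exact ContDiffAt.comp (0 : ι → ℂ) h2 h1
  have hH : complexHessian f i j = complexHessian (fun z => (Φ (NormedSpace.exp (A z)) : ℂ)) i j :=
    congrFun (congrFun (complexHessian_congr hf) i) j
  rw [hH, complexHessian_ofReal hcd]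
  simp only [fderiv_fderiv_exp hΦ A hcd (Eventually.of_forall fun _ => rfl), hI]
  set v := A (Pi.single i 1)
  set w := A (Pi.single j 1)
  -- The exponential chart only sees the symmetrized second derivatives. The commutator corrections
  -- cancel in the (1,1)-part because [iv,iw] = -[v,w] and [v,iw] = [iv,w].
  have h1 := mixedDeriv_sub_swap hΦ v w
  have h2 := mixedDeriv_sub_swap hΦ v (Complex.I • w)
  have h3 := mixedDeriv_sub_swap hΦ (Complex.I • v) w
  have h4 := mixedDeriv_sub_swap hΦ (Complex.I • v) (Complex.I • w)
  simp only [smul_mul_assoc, mul_smul_comm, smul_smul, Complex.I_mul_I, neg_smul, one_smul] at h2 h3 h4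
  have h5 : fderiv ℝ Φ 1 (-(v * w) - -(w * v)) = -fderiv ℝ Φ 1 (v * w - w * v) := by
    rw [← map_neg]
    congr 1
    abel
  rw [h5] at h4
  refine congrArg₂ (fun x y : ℝ => ((x : ℂ) + Complex.I * y) / 4) ?_ ?_
  · linarith
  · linarith

end ComplexHessian

/-! ### Smooth extension of a potential to a neighborhood in the space of matrices -/

section LocalExtension

open scoped Matrix.Norms.Operator

variable {N : ℕ}

/-- The quasipotential of a metric extends locally to a smooth function on the space of matrices. -/
theorem exists_local_extension {G : Subgroup (GLN N)} {hG : IsZariskiClosed G} {K H : Subgroup (GLN N)}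
    {χ : H → ℂ} (q : HermitianMetric hG K H χ) (g : G) :
    ∃ Φ : Mat N → ℝ, ContDiffAt ℝ ∞ Φ 1 ∧
      ∀ᶠ m in 𝓝 (1 : Mat N), ∀ k : G, ((k : GLN N) : Mat N) = m → q.quasipotential (g * k) = Φ m := by
  let b := Module.finBasis ℂ (lie G)
  obtain ⟨p, hp⟩ := (lie G).toSubmodule.subtype.exists_leftInverse_of_injective (by simp)
  let c : Mat N →ₗ[ℂ] (Fin (Module.finrank ℂ (lie G)) → ℂ) := b.equivFun.toLinearMap ∘ₗ p
  have hc : ∀ x : lie G, ∑ i, c (x : Mat N) i • b i = x := by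
    intro x
    have h1 : p (x : Mat N) = x := LinearMap.congr_fun hp x
    have h2 : c (x : Mat N) = b.equivFun x := by
      change b.equivFun (p (x : Mat N)) = _
      rw [h1]
    rw [h2]
    exact b.sum_equivFun x
  let c' : Mat N →L[ℝ] (Fin (Module.finrank ℂ (lie G)) → ℂ) :=
    LinearMap.toContinuousLinearMap (c.restrictScalars ℝ)
  refine ⟨fun m => -2 * Real.log (q.norm (LineBundle.mk
    (g * expIn hG (∑ i, c' (logMat m) i • b i)) 1)), ?_, ?_⟩
  · have h1 : ContDiffAt ℝ ∞ (fun m : Mat N => c' (logMat m)) 1 :=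
      c'.contDiff.contDiffAt.comp 1 contDiffAt_logMat
    have h2 := ((q.smooth g _ b).contDiffAt (x := c' (logMat 1))).comp (1 : Mat N) h1
    exact contDiffAt_const.mul (h2.log (q.norm_pos _ _ one_ne_zero).ne')
  · filter_upwards [eventually_logMat_mem hG] with m hm k hk
    obtain ⟨h1, h2⟩ := hm k k.2 hk
    have h3 : ∑ i, c' (logMat m) i • b i = ⟨logMat m, h1⟩ := hc ⟨logMat m, h1⟩
    have h4 : expIn hG (∑ i, c' (logMat m) i • b i) = k := by
      rw [h3]
      apply Subtype.ext
      apply Units.ext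
      change NormedSpace.exp (logMat m) = _
      rw [h2, hk]
    change _ = -2 * Real.log (q.norm (LineBundle.mk
      (g * expIn hG (∑ i, c' (logMat m) i • b i)) 1))
    rw [h4]
    rfl

end LocalExtension

/-! ### The second order jet of the quasipotential at exp(a) -/

section Jets

variable {N : ℕ} {X : HorosymmetricSpace N}

/-- The first and second derivatives at `exp(a)` of the quasipotential `φ` of a metric on the line bundle
attached to a character: `lin v` is the derivative of `φ(exp(a) exp(t v))`, and `quad v w` that of
`φ(exp(a) exp(s v) exp(t w))`. -/
structure PotentialJet (F : Frame X) (χ : AlgebraicCharacter X.H_closed)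
    (q : HermitianMetric X.G_closed F.C.K X.H fun h => (χ.χ h : ℂ)) (a : F.aSplit) where
  lin : Mat N →ₗ[ℝ] ℝ
  quad : Mat N →ₗ[ℝ] Mat N →ₗ[ℝ] ℝ
  quad_sub_swap : ∀ v w, quad v w - quad w v = lin ⁅v, w⁆
  lin_H : ∀ y : lie X.H, lin y = -2 * (χ.dχ y).re
  quad_H : ∀ v ∈ lie X.G, ∀ y ∈ lie X.H, quad v y = 0
  lin_K : ∀ k : lie X.G, F.C.dθ k = k →
    lin (NormedSpace.exp (-(a : Mat N)) * (k : Mat N) * NormedSpace.exp (a : Mat N)) = 0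
  quad_K : ∀ k : lie X.G, F.C.dθ k = k → ∀ v ∈ lie X.G,
    quad (NormedSpace.exp (-(a : Mat N)) * (k : Mat N) * NormedSpace.exp (a : Mat N)) v = 0
  lineDeriv_toric : ∀ x : F.aSplit, lineDeriv ℝ (F.toricPotential q) a x = lin x
  realHessian_toric : ∀ {r : ℕ} (l : Module.Basis (Fin r) ℝ F.aSplit) (j k : Fin r),
    F.realHessian l (F.toricPotential q) a j k = quad (l j : Mat N) (l k : Mat N)
  complexHessian_eq : ∀ {r : ℕ} (l : Module.Basis (Fin r) ℝ F.aSplit) [DecidableEq (F.Index r)]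
      (i j : F.Index r), complexHessian (F.localPotential l q (F.point a)) i j =
    ((quad (F.frameVector l i : Mat N) (F.frameVector l j : Mat N) +
      quad (Complex.I • (F.frameVector l i : Mat N)) (Complex.I • (F.frameVector l j : Mat N)) : ℝ) +
    Complex.I * (quad (F.frameVector l i : Mat N) (Complex.I • (F.frameVector l j : Mat N)) -
      quad (Complex.I • (F.frameVector l i : Mat N)) (F.frameVector l j : Mat N) : ℝ)) / 4

/-- The section s at g exp(y) is χ(exp(y)) times that at g, and |χ(exp(y))| = e^{Re dχ(y)}. -/
theorem HermitianMetric.quasipotential_mul_right {G : Subgroup (GLN N)} {hG : IsZariskiClosed G}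
    {K H : Subgroup (GLN N)} {hH : IsZariskiClosed H} (χ : AlgebraicCharacter hH)
    (q : HermitianMetric hG K H fun h => (χ.χ h : ℂ)) (g g' : G) (y : lie H)
    (h : (g' : GLN N) = g * expGL (y : Mat N)) :
    q.quasipotential g' = q.quasipotential g - 2 * (χ.dχ y).re := by
  have h1 : (LineBundle.mk g' 1 : LineBundle G H fun h => (χ.χ h : ℂ)) =
      LineBundle.mk g ((χ.χ (expIn hH y) : ℂ) * 1) :=
    Quot.sound ⟨expIn hH y, h, rfl⟩
  rw [quasipotential, quasipotential, h1, q.norm_smul, χ.χ_exp, Complex.norm_exp,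
    Real.log_mul (Real.exp_pos _).ne' (q.norm_pos _ _ one_ne_zero).ne', Real.log_exp]
  ring

theorem CartanInvolution.expGL_mem_K (C : CartanInvolution X) {k : lie X.G} (hk : C.dθ k = k) (t : ℝ) :
    expGL (t • (k : Mat N)) ∈ C.K := by
  refine ⟨expIn X.G_closed ((t : ℂ) • k), ?_, CartanInvolution.expIn_smul X.G_closed t k⟩
  change C.θ _ = _
  rw [C.θ_exp, C.dθ_smul, hk]
  rfl

end Jets

section JetExistence

open scoped Matrix.Norms.Operator

variable {N : ℕ} {X : HorosymmetricSpace N}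

theorem Frame.point_add {F : Frame X} (a x : F.aSplit) :
    F.point (a + x) = F.point a * expIn X.G_closed (F.asToG x) := by
  apply Subtype.ext
  apply Units.ext
  have h : Commute (a : Mat N) (x : Mat N) :=
    sub_eq_zero.1 (IsTorus.lie_eq_zero F.S.torus (aSplit_mem_T a) (aSplit_mem_T x))
  exact Matrix.exp_add_of_commute _ _ h

theorem expGL_conj_smul (g : GLN N) (k : Mat N) (t : ℝ) :
    expGL (t • (((g⁻¹ : GLN N) : Mat N) * k * (g : Mat N))) = g⁻¹ * expGL (t • k) * g := by
  have := conj_expGL (g⁻¹) (t • k)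
  rw [inv_inv] at this
  rw [this]
  congr 1
  rw [mul_smul_comm, smul_mul_assoc]

variable {F : Frame X} {χ : AlgebraicCharacter X.H_closed}

/-- The jet is that of a smooth local extension of k ↦ φ(exp(a)k). Right equivariance under H gives
the properties in the directions of 𝔥, and left invariance under K those in the directions of
Ad(exp(-a))𝔨. The derivatives of u appear because exp(a+x) = exp(a)exp(x) on the commutative 𝔞_s. -/
theorem nonempty_potentialJet (q : HermitianMetric X.G_closed F.C.K X.H fun h => (χ.χ h : ℂ)) (a : F.aSplit) :
    Nonempty (PotentialJet F χ q a) := by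
  obtain ⟨Φ, hΦ, hev⟩ := exists_local_extension q (F.point a)
  have hexpG : ∀ (s : ℝ) {v : Mat N}, v ∈ lie X.G → expGL (s • v) ∈ X.G := by
    intro s v hv
    have h := (lie X.G).smul_mem (s : ℂ) hv
    rw [Complex.coe_smul] at h
    exact exp_mem X.G_closed h
  have hH : ∀ v ∈ lie X.G, ∀ y : lie X.H, ∀ᶠ m in 𝓝 (1 : Mat N), ∀ s : ℝ, m = NormedSpace.exp (s • v) →
      ∀ᶠ t : ℝ in 𝓝 0, Φ (m * NormedSpace.exp (t • (y : Mat N))) = Φ m + t * (-2 * (χ.dχ y).re) := by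
    intro v hv y
    filter_upwards [hev.eventually_nhds] with m hm s hs
    have ht : Tendsto (fun t : ℝ => m * NormedSpace.exp (t • (y : Mat N))) (𝓝 0) (𝓝 m) := by
      have := (tendsto_exp_smul (y : Mat N)).const_mul m
      rwa [mul_one] at this
    filter_upwards [ht.eventually hm] with t hmt
    let k : X.G := ⟨expGL (s • v), hexpG s hv⟩
    let k' : X.G := ⟨expGL (t • (y : Mat N)), hexpG t (lie_mono X.H_le_G y.2)⟩
    rw [← hmt (k * k') (by rw [hs]; rfl), ← hm.self_of_nhds k hs.symm,
      HermitianMetric.quasipotential_mul_right χ q (F.point a * k) (F.point a * (k * k')) ((t : ℂ) • y)]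
    · rw [map_smul, smul_eq_mul, Complex.re_ofReal_mul]
      ring
    · change (F.point a : GLN N) * (expGL (s • v) * expGL (t • (y : Mat N))) =
        (F.point a : GLN N) * expGL (s • v) * expGL ((t : ℂ) • (y : Mat N))
      rw [mul_assoc, Complex.coe_smul]
  have hK : ∀ v ∈ lie X.G, ∀ k : lie X.G, F.C.dθ k = k →
      ∀ᶠ m in 𝓝 (1 : Mat N), ∀ s : ℝ, m = NormedSpace.exp (s • v) →
      ∀ᶠ t : ℝ in 𝓝 0, Φ (NormedSpace.exp (t • (NormedSpace.exp (-(a : Mat N)) * (k : Mat N) *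
        NormedSpace.exp (a : Mat N))) * m) = Φ m := by
    intro v hv k hk
    filter_upwards [hev.eventually_nhds] with m hm s hs
    have ht : Tendsto (fun t : ℝ => NormedSpace.exp (t • (NormedSpace.exp (-(a : Mat N)) * (k : Mat N) *
        NormedSpace.exp (a : Mat N))) * m) (𝓝 0) (𝓝 m) := by
      have := (tendsto_exp_smul (NormedSpace.exp (-(a : Mat N)) * (k : Mat N) *
        NormedSpace.exp (a : Mat N))).mul_const m
      rwa [one_mul] at this
    filter_upwards [ht.eventually hm] with t hmt
    let x : X.G := ⟨expGL (s • v), hexpG s hv⟩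
    let kt : X.G := ⟨expGL (t • (k : Mat N)), hexpG t k.2⟩
    have h1 : (((F.point a)⁻¹ * kt * F.point a : X.G) : GLN N) =
        expGL (t • (NormedSpace.exp (-(a : Mat N)) * (k : Mat N) * NormedSpace.exp (a : Mat N))) :=
      (expGL_conj_smul (F.point a : GLN N) (k : Mat N) t).symm
    have h2 : (((((F.point a)⁻¹ * kt * F.point a) * x : X.G) : GLN N) : Mat N) =
        NormedSpace.exp (t • (NormedSpace.exp (-(a : Mat N)) * (k : Mat N) *
          NormedSpace.exp (a : Mat N))) * m := by
      rw [Subgroup.coe_mul, h1, hs]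
      rfl
    -- Left multiplication by k on φ becomes, in the chart at exp(a), left multiplication by
    -- exp(-a)k exp(a).
    have h3 : F.point a * (((F.point a)⁻¹ * kt * F.point a) * x) = kt * (F.point a * x) := by group
    rw [← hmt _ h2, ← hm.self_of_nhds x hs.symm, h3, HermitianMetric.quasipotential,
      HermitianMetric.quasipotential, q.invariant _ _ _ (F.C.expGL_mem_K hk t)]
  have htoric : ∀ v w : F.aSplit, ∀ᶠ s : ℝ in 𝓝 0, lineDeriv ℝ (F.toricPotential q) (a + s • v) w =
      fderiv ℝ Φ (NormedSpace.exp (s • (v : Mat N))) (NormedSpace.exp (s • (v : Mat N)) * (w : Mat N)) := by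
    intro v w
    filter_upwards [(tendsto_exp_smul (v : Mat N)).eventually
      (hev.eventually_nhds.and (eventually_differentiableAt hΦ))] with s hs
    have ht : Tendsto (fun t : ℝ => NormedSpace.exp (s • (v : Mat N)) * NormedSpace.exp (t • (w : Mat N)))
        (𝓝 0) (𝓝 (NormedSpace.exp (s • (v : Mat N)))) := by
      have := (tendsto_exp_smul (w : Mat N)).const_mul (NormedSpace.exp (s • (v : Mat N)))
      rwa [mul_one] at this
    refine ((hasDerivAt_mul_exp hs.2 (w : Mat N)).congr_of_eventuallyEq ?_).deriv
    filter_upwards [ht.eventually hs.1] with t hst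
    rw [Frame.toricPotential, Frame.point_add, Frame.point_add, mul_assoc]
    exact hst _ rfl
  refine ⟨⟨(fderiv ℝ Φ 1 : Mat N →ₗ[ℝ] ℝ), mixedDeriv Φ, mixedDeriv_sub_swap hΦ, fun y => ?_,
    fun v hv y hy => mixedDeriv_eq_zero_right hΦ v (hH v hv ⟨y, hy⟩), fun k hk => ?_,
    fun k hk v hv => mixedDeriv_eq_zero_left hΦ v (hK v hv k hk), fun x => ?_, fun l j k => ?_,
    fun l _ i j => ?_⟩⟩
  · have h1 := (hH 0 (zero_mem _) y).self_of_nhds 0 (by simp)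
    have h2 := hasDerivAt_mul_exp (eventually_differentiableAt hΦ).self_of_nhds (y : Mat N)
    have h3 := (((hasDerivAt_id (0 : ℝ)).mul_const (-2 * (χ.dχ y).re)).const_add (Φ 1)).congr_of_eventuallyEq h1
    have h4 := h2.unique h3
    rw [one_mul, one_mul] at h4
    exact h4
  · have h1 := (hK 0 (zero_mem _) k hk).self_of_nhds 0 (by simp)
    have h2 := hasDerivAt_exp_mul (eventually_differentiableAt hΦ).self_of_nhds
      (NormedSpace.exp (-(a : Mat N)) * (k : Mat N) * NormedSpace.exp (a : Mat N))
    have h4 := h2.unique ((hasDerivAt_const (0 : ℝ) (Φ 1)).congr_of_eventuallyEq h1)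
    rw [mul_one] at h4
    exact h4
  · have h1 := (htoric 0 x).self_of_nhds
    simp only [zero_smul, add_zero, ZeroMemClass.coe_zero, NormedSpace.exp_zero, one_mul] at h1
    exact h1
  · exact ((hasDerivAt_fderiv_exp_mul hΦ (l j : Mat N) (l k : Mat N)).congr_of_eventuallyEq
      (htoric (l j) (l k))).deriv
  · let A : (F.Index _ → ℂ) →ₗ[ℂ] Mat N :=
      Fintype.linearCombination ℂ (fun i => (F.frameVector l i : Mat N))
    have hA1 : ∀ k, A (Pi.single k 1) = F.frameVector l k := fun k => by
      rw [Fintype.linearCombination_apply_single, one_smul]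
    have hA : ∀ z, (A z : Mat N) = ((∑ i, z i • F.frameVector l i : lie X.G) : Mat N) := by
      intro z
      rw [Fintype.linearCombination_apply]
      exact (map_sum (lie X.G).toSubmodule.subtype (fun i => z i • F.frameVector l i) Finset.univ).symm
    have h := complexHessian_exp hΦ (LinearMap.toContinuousLinearMap (A.restrictScalars ℝ)) (fun k => by
      change A _ = Complex.I • A _
      rw [hA1, Fintype.linearCombination_apply_single]) (f := F.localPotential l q (F.point a)) (by
      have hcont : Continuous fun z => NormedSpace.exp (A z) :=
        contDiff_exp_mat.continuous.comp (LinearMap.continuous_of_finiteDimensional A)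
      have ht : Tendsto (fun z => NormedSpace.exp (A z)) (𝓝 0) (𝓝 1) := by
        have := hcont.tendsto 0
        rwa [map_zero, NormedSpace.exp_zero] at this
      filter_upwards [ht.eventually hev] with z hz
      have h1 := hz (expIn X.G_closed (∑ i, z i • F.frameVector l i)) (by
        change NormedSpace.exp _ = _
        rw [hA])
      change _ = ((Φ (NormedSpace.exp (A z)) : ℝ) : ℂ)
      rw [← h1, Frame.localPotential, HermitianMetric.quasipotential, Real.log_pow]
      push_cast
      rw [neg_mul]
      rfl) i j
    rw [h]
    simp only [LinearMap.coe_toContinuousLinearMap', LinearMap.coe_restrictScalars, hA1]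

end JetExistence

theorem complex_smul_eq {N : ℕ} (c : ℂ) (v : Mat N) : c • v = c.re • v + c.im • (Complex.I • v) := by
  rw [← Complex.coe_smul, ← Complex.coe_smul, smul_smul, ← add_smul, Complex.re_add_im]

/-! ### The consequences of H-equivariance and K-invariance for the jet -/

namespace PotentialJet

variable {N : ℕ} {X : HorosymmetricSpace N} {F : Frame X} {χ : AlgebraicCharacter X.H_closed}
  {q : HermitianMetric X.G_closed F.C.K X.H fun h => (χ.χ h : ℂ)} {a : F.aSplit} (J : PotentialJet F χ q a)

/-- The `(1,0)`-part of the first derivative. -/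
def lam : Mat N →ₗ[ℂ] ℂ where
  toFun v := ((J.lin v : ℂ) - Complex.I * (J.lin (Complex.I • v) : ℂ)) / 2
  map_add' v w := by
    simp only [smul_add, map_add, Complex.ofReal_add]
    ring
  map_smul' c v := by
    have h1 : J.lin (c • v) = c.re * J.lin v + c.im * J.lin (Complex.I • v) := by
      rw [complex_smul_eq c v, map_add, map_smul, map_smul]
      rfl
    have h2 : J.lin (Complex.I • c • v) = c.re * J.lin (Complex.I • v) - c.im * J.lin v := by
      have h3 : Complex.I • c • v = c.re • (Complex.I • v) - c.im • v := by
        rw [smul_comm, complex_smul_eq c (Complex.I • v), smul_smul Complex.I, Complex.I_mul_I, neg_smul,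
          one_smul, smul_neg, sub_eq_add_neg]
      rw [h3, map_sub, map_smul J.lin c.re, map_smul J.lin c.im]
      rfl
    rw [h1, h2, RingHom.id_apply, smul_eq_mul]
    push_cast
    linear_combination ((J.lin v : ℂ) - Complex.I * (J.lin (Complex.I • v) : ℂ)) / 2 * Complex.re_add_im c +
      ((c.im : ℂ) * (J.lin (Complex.I • v) : ℂ) / 2) * Complex.I_sq

theorem lam_apply (v : Mat N) :
    J.lam v = ((J.lin v : ℂ) - Complex.I * (J.lin (Complex.I • v) : ℂ)) / 2 := rfl

/-- The hermitian form of the curvature, in terms of the second derivatives. -/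
def hess (v w : Mat N) : ℂ :=
  ((J.quad v w + J.quad (Complex.I • v) (Complex.I • w) : ℝ) +
    Complex.I * (J.quad v (Complex.I • w) - J.quad (Complex.I • v) w : ℝ)) / 4

/-- The complex bilinear part of the second derivative. -/
def bil (v w : Mat N) : ℂ :=
  ((J.quad v w - J.quad (Complex.I • v) (Complex.I • w) : ℝ) -
    Complex.I * (J.quad (Complex.I • v) w + J.quad v (Complex.I • w) : ℝ)) / 4

theorem hess_add (v w w' : Mat N) : J.hess v (w + w') = J.hess v w + J.hess v w' := by
  simp only [hess, smul_add, map_add, Complex.ofReal_add, Complex.ofReal_sub]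
  ring

theorem hess_sub (v w w' : Mat N) : J.hess v (w - w') = J.hess v w - J.hess v w' := by
  simp only [hess, smul_sub, map_sub, Complex.ofReal_add, Complex.ofReal_sub]
  ring

theorem bil_add (v v' w : Mat N) : J.bil (v + v') w = J.bil v w + J.bil v' w := by
  simp only [bil, smul_add, map_add, LinearMap.add_apply, Complex.ofReal_add, Complex.ofReal_sub]
  ring

theorem bil_sub_swap (v w : Mat N) : J.bil v w - J.bil w v = J.lam ⁅v, w⁆ := by
  have h1 := J.quad_sub_swap v w
  have h2 := J.quad_sub_swap (Complex.I • v) (Complex.I • w)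
  have h3 := J.quad_sub_swap (Complex.I • v) w
  have h4 := J.quad_sub_swap v (Complex.I • w)
  simp only [smul_lie, lie_smul, smul_smul, Complex.I_mul_I, neg_smul, one_smul, map_neg] at h2 h3 h4
  rw [lam_apply, ← h1, ← h3]
  have h5 : J.quad (Complex.I • v) (Complex.I • w) = J.quad (Complex.I • w) (Complex.I • v) -
      (J.quad v w - J.quad w v) := by linarith
  have h6 : J.quad v (Complex.I • w) = J.quad (Complex.I • w) v +
      (J.quad (Complex.I • v) w - J.quad w (Complex.I • v)) := by linarith
  rw [bil, bil, h5, h6]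
  push_cast
  ring

/-- The order of differentiation is irrelevant in the (1,1)-part, where the bracket terms cancel as
in the exponential chart. -/
theorem hess_swap (v w : Mat N) : J.hess v w =
    ((J.quad w v + J.quad (Complex.I • w) (Complex.I • v) : ℝ) +
      Complex.I * (J.quad (Complex.I • w) v - J.quad w (Complex.I • v) : ℝ)) / 4 := by
  have h1 := J.quad_sub_swap v w
  have h2 := J.quad_sub_swap (Complex.I • v) (Complex.I • w)
  have h3 := J.quad_sub_swap (Complex.I • v) w
  have h4 := J.quad_sub_swap v (Complex.I • w)
  simp only [smul_lie, lie_smul, smul_smul, Complex.I_mul_I, neg_smul, one_smul, map_neg] at h2 h3 h4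
  rw [hess]
  refine congrArg₂ (fun x y : ℝ => ((x : ℂ) + Complex.I * y) / 4) ?_ ?_
  · linarith
  · linarith

theorem lam_H (y : lie X.H) : J.lam y = -χ.dχ y := by
  have h1 := J.lin_H y
  have h2 : J.lin (Complex.I • (y : Mat N)) = 2 * (χ.dχ y).im := by
    have := J.lin_H (Complex.I • y)
    rw [map_smul, smul_eq_mul, Complex.I_mul_re] at this
    rw [mul_neg, neg_mul, neg_neg] at this
    exact this
  rw [lam_apply, h1, h2]
  push_cast
  linear_combination -Complex.re_add_im (χ.dχ y)

theorem hess_H {v y : Mat N} (hv : v ∈ lie X.G) (hy : y ∈ lie X.H) : J.hess v y = 0 := by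
  have hv' := (lie X.G).smul_mem Complex.I hv
  have hy' := (lie X.H).smul_mem Complex.I hy
  simp [hess, J.quad_H _ hv _ hy, J.quad_H _ hv' _ hy', J.quad_H _ hv _ hy', J.quad_H _ hv' _ hy]

/-- The second derivative vanishes with y in the second argument; exchanging the arguments leaves
the bracket term. -/
theorem bil_H {v y : Mat N} (hv : v ∈ lie X.G) (hy : y ∈ lie X.H) : J.bil y v = J.lam ⁅y, v⁆ := by
  have hv' := (lie X.G).smul_mem Complex.I hv
  have hy' := (lie X.H).smul_mem Complex.I hy
  have h : J.bil v y = 0 := by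
    simp [bil, J.quad_H _ hv _ hy, J.quad_H _ hv' _ hy', J.quad_H _ hv _ hy', J.quad_H _ hv' _ hy]
  rw [← bil_sub_swap, h, sub_zero]

theorem exp_neg_conj {x : Mat N} {ρ : ℝ} (hx : ⁅(a : Mat N), x⁆ = (ρ : ℂ) • x) :
    NormedSpace.exp (-(a : Mat N)) * x * NormedSpace.exp (a : Mat N) = Real.exp (-ρ) • x := by
  have h : ⁅-(a : Mat N), x⁆ = ((-ρ : ℝ) : ℂ) • x := by
    rw [neg_lie, hx, Complex.ofReal_neg, neg_smul]
  have h2 := Frame.exp_conj_of_lie_eq_smul h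
  rwa [neg_neg, ← Complex.ofReal_exp, Complex.coe_smul] at h2

theorem lie_dag_eq {x : Mat N} {ρ : ℝ} (hx : ⁅(a : Mat N), x⁆ = (ρ : ℂ) • x) :
    ⁅(a : Mat N), dag F.gram x⁆ = ((-ρ : ℝ) : ℂ) • dag F.gram x := by
  rw [F.lie_dag, Frame.dag_aSplit, hx, map_smulₛₗ, Complex.conj_ofReal, Complex.ofReal_neg, neg_smul]

/-- The invariance under the maximal compact subgroup, in the direction of an eigenvector of `ad a`. -/
theorem compact_direction {x : Mat N} (hxG : x ∈ lie X.G) {ρ : ℝ} (hx : ⁅(a : Mat N), x⁆ = (ρ : ℂ) • x) :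
    J.lin x = Real.exp (2 * ρ) * J.lin (dag F.gram x) ∧
      ∀ v ∈ lie X.G, J.quad x v = Real.exp (2 * ρ) * J.quad (dag F.gram x) v := by
  -- The element x - x† is fixed by θ, and Ad(exp(-a)) turns it into e^{-ρ}x - e^{ρ}x†.
  have hk : F.C.dθ (⟨x, hxG⟩ - ⟨dag F.gram x, F.dag_mem_G hxG⟩) =
      ⟨x, hxG⟩ - ⟨dag F.gram x, F.dag_mem_G hxG⟩ := by
    apply Subtype.ext
    rw [F.dθ_eq]
    change -dag F.gram (x - dag F.gram x) = x - dag F.gram x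
    rw [map_sub, dag_dag, neg_sub]
  have hc : NormedSpace.exp (-(a : Mat N)) *
      ((⟨x, hxG⟩ - ⟨dag F.gram x, F.dag_mem_G hxG⟩ : lie X.G) : Mat N) * NormedSpace.exp (a : Mat N) =
      Real.exp (-ρ) • x - Real.exp ρ • dag F.gram x := by
    have h2 := exp_neg_conj (lie_dag_eq hx)
    rw [neg_neg] at h2
    rw [← exp_neg_conj hx, ← h2, ← sub_mul, ← mul_sub]
    rfl
  have hexp : Real.exp (2 * ρ) = Real.exp ρ * Real.exp ρ := by rw [← Real.exp_add]; ring_nf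
  have hone : Real.exp ρ * Real.exp (-ρ) = 1 := by rw [← Real.exp_add, add_neg_cancel, Real.exp_zero]
  refine ⟨?_, fun v hv => ?_⟩
  · have h := J.lin_K _ hk
    rw [hc, map_sub, map_smul, map_smul, smul_eq_mul, smul_eq_mul] at h
    rw [hexp]
    linear_combination Real.exp ρ * h - J.lin x * hone
  · have h := J.quad_K _ hk v hv
    rw [hc, map_sub, map_smul, map_smul, LinearMap.sub_apply, LinearMap.smul_apply, LinearMap.smul_apply,
      smul_eq_mul, smul_eq_mul] at h
    rw [hexp]
    linear_combination Real.exp ρ * h - J.quad x v * hone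

theorem lie_I_smul {x : Mat N} {ρ : ℝ} (hx : ⁅(a : Mat N), x⁆ = (ρ : ℂ) • x) :
    ⁅(a : Mat N), Complex.I • x⁆ = (ρ : ℂ) • (Complex.I • x) := by
  rw [lie_smul, hx, smul_comm]

theorem dag_I_smul (x : Mat N) : dag F.gram (Complex.I • x) = -(Complex.I • dag F.gram x) := by
  rw [map_smulₛₗ, Complex.conj_I, neg_smul]

/-- The real relation is used for x and for ix. As (ix)† = -ix†, the complex structure is reversed
and a conjugate appears. -/
theorem lam_eq_conj {x : Mat N} (hxG : x ∈ lie X.G) {ρ : ℝ} (hx : ⁅(a : Mat N), x⁆ = (ρ : ℂ) • x) :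
    J.lam x = Real.exp (2 * ρ) * starRingEnd ℂ (J.lam (dag F.gram x)) := by
  have h1 := (J.compact_direction hxG hx).1
  have h2 := (J.compact_direction ((lie X.G).smul_mem Complex.I hxG) (lie_I_smul hx)).1
  rw [dag_I_smul, map_neg] at h2
  rw [lam_apply, lam_apply, h1, h2]
  simp only [map_div₀, map_sub, map_mul, Complex.conj_ofReal, Complex.conj_I, map_ofNat]
  push_cast
  ring

/-- The same reversal of the complex structure exchanges the hermitian and the bilinear parts of the
second derivative. It brings x† into the first argument, where equivariance under 𝔥 can be used. -/
theorem hess_eq_bil {x v : Mat N} (hxG : x ∈ lie X.G) (hv : v ∈ lie X.G) {ρ : ℝ}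
    (hx : ⁅(a : Mat N), x⁆ = (ρ : ℂ) • x) :
    J.hess v x = Real.exp (2 * ρ) * J.bil (dag F.gram x) v := by
  have h1 := (J.compact_direction hxG hx).2
  have h2 := (J.compact_direction ((lie X.G).smul_mem Complex.I hxG) (lie_I_smul hx)).2
  have hv' := (lie X.G).smul_mem Complex.I hv
  rw [hess_swap, h1 v hv, h1 _ hv', h2 v hv, h2 _ hv', dag_I_smul, map_neg, LinearMap.neg_apply,
    LinearMap.neg_apply, bil]
  push_cast
  ring

/-- The form `lam` on `𝔞_s` is half the differential of the toric potential. -/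
theorem lam_aSplit (x : F.aSplit) : J.lam x = (J.lin x : ℂ) / 2 := by
  have hxG : (x : Mat N) ∈ lie X.G := Frame.lie_L_le (Frame.aSplit_mem_L x)
  have h0 : ⁅(a : Mat N), Complex.I • (x : Mat N)⁆ = ((0 : ℝ) : ℂ) • (Complex.I • (x : Mat N)) := by
    rw [lie_smul, IsTorus.lie_eq_zero F.S.torus (Frame.aSplit_mem_T a) (Frame.aSplit_mem_T x), smul_zero,
      Complex.ofReal_zero, zero_smul]
  have h := (J.compact_direction ((lie X.G).smul_mem Complex.I hxG) h0).1
  rw [dag_I_smul, Frame.dag_aSplit, map_neg, mul_zero, Real.exp_zero, one_mul] at h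
  have h1 : J.lin (Complex.I • (x : Mat N)) = 0 := by linarith
  rw [lam_apply, h1, Complex.ofReal_zero, mul_zero, sub_zero]

/-- For x in 𝔞_s the vector ix lies in 𝔨 and commutes with a, so all second derivatives involving
such a direction vanish and only the real one remains. -/
theorem hess_aSplit (x y : F.aSplit) : J.hess x y = (J.quad x y : ℂ) / 4 := by
  have hG : ∀ x : F.aSplit, (x : Mat N) ∈ lie X.G := fun x => Frame.lie_L_le (Frame.aSplit_mem_L x)
  have hI : ∀ x : F.aSplit, ∀ v ∈ lie X.G, J.quad (Complex.I • (x : Mat N)) v = 0 := by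
    intro x v hv
    have h0 : ⁅(a : Mat N), Complex.I • (x : Mat N)⁆ = ((0 : ℝ) : ℂ) • (Complex.I • (x : Mat N)) := by
      rw [lie_smul, IsTorus.lie_eq_zero F.S.torus (Frame.aSplit_mem_T a) (Frame.aSplit_mem_T x), smul_zero,
        Complex.ofReal_zero, zero_smul]
    have h := (J.compact_direction ((lie X.G).smul_mem Complex.I (hG x)) h0).2 v hv
    rw [dag_I_smul, Frame.dag_aSplit, map_neg, LinearMap.neg_apply, mul_zero, Real.exp_zero, one_mul] at h
    linarith
  have hxy : J.quad x (Complex.I • (y : Mat N)) = 0 := by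
    have h := J.quad_sub_swap (x : Mat N) (Complex.I • (y : Mat N))
    rwa [hI y _ (hG x), lie_smul, IsTorus.lie_eq_zero F.S.torus (Frame.aSplit_mem_T x) (Frame.aSplit_mem_T y),
      smul_zero, map_zero, sub_zero] at h
  rw [hess, hI x _ (hG y), hI x _ ((lie X.G).smul_mem Complex.I (hG y)), hxy]
  simp

end PotentialJet

namespace Frame

variable {N : ℕ} {X : HorosymmetricSpace N} {F : Frame X}

theorem rootAt_σRoot (β : Module.Dual ℂ (lie F.S.T)) (a : F.aSplit) :
    F.rootAt (F.S.σRoot β) a = -F.rootAt β a := by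
  have h := (mem_lie_Ts.1 (mem_aSplit.1 a.2).1).2
  rw [rootAt, σRoot_apply, rootAt, ← map_neg]
  congr 1
  exact Subtype.ext h

theorem mu_mem_H {x : Mat N} (hx : x ∈ lie X.L) : x + X.sg x ∈ lie X.H :=
  HorosymmetricSpace.mem_lie_H_of_sg_eq ((lie X.L).add_mem hx (HorosymmetricSpace.sg_mem hx))
    (by rw [map_add, HorosymmetricSpace.sg_sg hx, add_comm])

theorem lie_aSplit_re {β : Module.Dual ℂ (lie F.S.T)} (hβ : β ∈ roots X.G F.S.T) {x : Mat N}
    (hx : x ∈ rootSpace X.G F.S.T β) (a : F.aSplit) :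
    ⁅(a : Mat N), x⁆ = (((F.rootAt β a).re : ℝ) : ℂ) • x := by
  rw [rootAt_im hβ, lie_aSplit hx]

end Frame

namespace PotentialJet

open Horosymmetric.Frame

variable {N : ℕ} {X : HorosymmetricSpace N} {F : Frame X} {χ : AlgebraicCharacter X.H_closed}
  {q : HermitianMetric X.G_closed F.C.K X.H fun h => (χ.χ h : ℂ)} {a : F.aSplit} (J : PotentialJet F χ q a)

theorem lam_eq_zero_of_isNilpotent {x : Mat N} (hx : x ∈ lie X.H) (hn : IsNilpotent x) : J.lam x = 0 := by
  rw [J.lam_H ⟨x, hx⟩, χ.dχ_eq_zero_of_isNilpotent hn, neg_zero]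

variable {β γ : Module.Dual ℂ (lie F.S.T)}

theorem lam_dag_e_eq_zero (hα : β ∈ F.rootsQu) : J.lam (dag F.gram (F.e β : Mat N)) = 0 :=
  J.lam_eq_zero_of_isNilpotent (lie_Pu_le_H (dag_e_mem_Pu hα))
    (isNilpotent_of_mem_rootSpace (neg_ne_zero.2 hα.1.1) (dag_e_mem hα.1))

/-- The sum x + σ(x) lies in 𝔥 and is a sum of two nilpotent elements of 𝔩, which χ kills because
the bundle is trivial on the fiber. -/
theorem lam_sg (hχ : X.TrivialOnFiber fun h => (χ.χ h : ℂ)) (hγ : γ ≠ 0) {x : Mat N}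
    (hx : x ∈ rootSpace X.G F.S.T γ) (hxL : x ∈ lie X.L) : J.lam (X.sg x) = -J.lam x := by
  have hσ : F.S.σRoot γ ≠ 0 := by
    intro h
    apply hγ
    rw [← σRoot_σRoot γ, h]
    rfl
  have h := J.lam_H ⟨x + X.sg x, mu_mem_H hxL⟩
  rw [χ.dχ_eq_zero_of_add hχ hxL (HorosymmetricSpace.sg_mem hxL) (isNilpotent_of_mem_rootSpace hγ hx)
    (isNilpotent_of_mem_rootSpace hσ (sg_mem_rootSpace hx hxL)), neg_zero] at h
  exact eq_neg_of_add_eq_zero_right ((map_add J.lam _ _).symm.trans h)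

theorem exp_sub_exp_neg_ne_zero {ρ : ℝ} (hρ : ρ ≠ 0) : ((Real.exp (2 * ρ) : ℂ) - (Real.exp (2 * -ρ) : ℂ)) ≠ 0 := by
  rw [← Complex.ofReal_sub, Complex.ofReal_ne_zero, sub_ne_zero]
  intro h
  have := Real.exp_injective h
  apply hρ
  linarith

/-- Roots of Q^u reduce to 𝔭^u by passing to the adjoint, and roots of P^u or σ-fixed roots of L
give nilpotent elements of 𝔥. For the other roots of L, comparing the relations for e and σ(e),
whose eigenvalues are opposite, gives (e^{2ρ} - e^{-2ρ}) times the conjugate of λ(e†) equal to 0,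
and ρ ≠ 0. -/
theorem lam_e_eq_zero (hχ : X.TrivialOnFiber fun h => (χ.χ h : ℂ)) (ha : ∀ β ∈ F.rootsS, F.rootAt β a ≠ 0)
    (hγ : γ ∈ roots X.G F.S.T) : J.lam (F.e γ : Mat N) = 0 := by
  have heG := (F.e γ).2
  have hcase := mem_rootsQu_or hγ
  rcases hcase with h | h | h
  · rw [J.lam_eq_conj heG (lie_aSplit_re hγ (F.e_mem γ hγ) a), J.lam_dag_e_eq_zero h, map_zero, mul_zero]
  · by_cases hσ : F.S.σRoot γ = γ
    · exact J.lam_eq_zero_of_isNilpotent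
        (HorosymmetricSpace.mem_lie_H_of_sg_eq (e_mem_L h) (sg_e_of_σRoot_eq h hσ))
        (isNilpotent_of_mem_rootSpace hγ.1 (F.e_mem γ hγ))
    · have hρ : (F.rootAt γ a).re ≠ 0 := by
        rw [← Complex.ofReal_ne_zero, rootAt_im hγ]
        exact ha γ ⟨h, hσ⟩
      have h1 := J.lam_eq_conj heG (lie_aSplit_re hγ (F.e_mem γ hγ) a)
      have h2 := J.lam_eq_conj (lie_L_le (HorosymmetricSpace.sg_mem (e_mem_L h)))
        (lie_aSplit_re (σRoot_mem_roots h) (sg_e_mem h) a)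
      rw [rootAt_σRoot, ← sg_dag (e_mem_L h), J.lam_sg hχ hγ.1 (F.e_mem γ hγ) (e_mem_L h),
        J.lam_sg hχ (neg_ne_zero.2 hγ.1) (dag_e_mem hγ) (F.dag_mem_L (e_mem_L h)), map_neg, Complex.neg_re] at h2
      have h3 : ((Real.exp (2 * (F.rootAt γ a).re) : ℂ) - (Real.exp (2 * -(F.rootAt γ a).re) : ℂ)) *
          starRingEnd ℂ (J.lam (dag F.gram (F.e γ : Mat N))) = 0 := by
        linear_combination -h1 - h2
      rw [h1, (mul_eq_zero.1 h3).resolve_left (exp_sub_exp_neg_ne_zero hρ), mul_zero]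
  · exact J.lam_eq_zero_of_isNilpotent (lie_Pu_le_H (h.2 _ (F.e_mem γ hγ)))
      (isNilpotent_of_mem_rootSpace hγ.1 (F.e_mem γ hγ))

theorem lam_eq_zero (hχ : X.TrivialOnFiber fun h => (χ.χ h : ℂ)) (ha : ∀ β ∈ F.rootsS, F.rootAt β a ≠ 0)
    (hγ : γ ≠ 0) {x : Mat N} (hx : x ∈ rootSpace X.G F.S.T γ) : J.lam x = 0 := by
  by_cases h : γ ∈ roots X.G F.S.T
  · obtain ⟨c, rfl⟩ := exists_eq_smul_e h hx
    rw [map_smul, J.lam_e_eq_zero hχ ha h, smul_zero]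
  · have hbot : rootSpace X.G F.S.T γ = ⊥ := by
      by_contra h'
      exact h ⟨hγ, h'⟩
    rw [hbot, Submodule.mem_bot] at hx
    rw [hx, map_zero]

theorem hess_e (hα : β ∈ F.rootsQu) {v : Mat N} (hv : v ∈ lie X.G) :
    J.hess v (F.e β : Mat N) =
      Real.exp (2 * (F.rootAt β a).re) * J.lam ⁅dag F.gram (F.e β : Mat N), v⁆ := by
  rw [J.hess_eq_bil (F.e β).2 hv (lie_aSplit_re hα.1 (F.e_mem β hα.1) a),
    J.bil_H hv (lie_Pu_le_H (dag_e_mem_Pu hα))]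

theorem hess_tau (hβ : β ∈ F.posRootsS) (ha : ∀ β ∈ F.rootsS, F.rootAt β a ≠ 0) {v : Mat N}
    (hv : v ∈ lie X.G) : J.hess v ((F.e β : Mat N) - X.sg (F.e β : Mat N)) =
      -J.lam ⁅dag F.gram ((F.e β : Mat N) + X.sg (F.e β : Mat N)), v⁆ /
        (Real.sinh (2 * (F.rootAt β a).re) : ℂ) := by
  have hL := hβ.1.1
  have hR := hL.1
  have hρ : (F.rootAt β a).re ≠ 0 := by
    rw [← Complex.ofReal_ne_zero, rootAt_im hR]
    exact ha β hβ.1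
  have h1 := J.hess_eq_bil (F.e β).2 hv (lie_aSplit_re hR (F.e_mem β hR) a)
  have h2 := J.hess_eq_bil (lie_L_le (HorosymmetricSpace.sg_mem (e_mem_L hL))) hv
    (lie_aSplit_re (σRoot_mem_roots hL) (sg_e_mem hL) a)
  rw [rootAt_σRoot, Complex.neg_re] at h2
  have h3 := J.hess_H hv (mu_mem_H (e_mem_L hL))
  have hd : dag F.gram ((F.e β : Mat N) + X.sg (F.e β : Mat N)) ∈ lie X.H := by
    rw [map_add, ← sg_dag (e_mem_L hL)]
    exact mu_mem_H (F.dag_mem_L (e_mem_L hL))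
  have h4 := J.bil_H hv hd
  rw [map_add, bil_add] at h4
  rw [hess_add, h1, h2] at h3
  have hs : (Real.sinh (2 * (F.rootAt β a).re) : ℂ) =
      ((Real.exp (2 * (F.rootAt β a).re) : ℂ) - (Real.exp (2 * -(F.rootAt β a).re) : ℂ)) / 2 := by
    rw [Real.sinh_eq, mul_neg]
    push_cast
    rfl
  have hone : (Real.exp (2 * (F.rootAt β a).re) : ℂ) * (Real.exp (2 * -(F.rootAt β a).re) : ℂ) = 1 := by
    rw [← Complex.ofReal_mul, ← Real.exp_add, mul_neg, add_neg_cancel, Real.exp_zero, Complex.ofReal_one]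
  have hne := exp_sub_exp_neg_ne_zero hρ
  rw [map_add, ← h4, hess_sub, h1, h2, hs, eq_div_iff (div_ne_zero hne two_ne_zero)]
  set E := (Real.exp (2 * (F.rootAt β a).re) : ℂ)
  set E' := (Real.exp (2 * -(F.rootAt β a).re) : ℂ)
  set B := J.bil (dag F.gram (F.e β : Mat N)) v
  set B' := J.bil (dag F.gram (X.sg (F.e β : Mat N))) v
  -- Two linear equations, EB + E'B' = 0 and B + B' = λ([(e_β+σ(e_β))†,v]), with EE' = 1, determine
  -- EB - E'B' = -(B + B')/((E - E')/2).
  linear_combination (E + E') / 2 * h3 - (B + B') * hone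

end PotentialJet

/-! ### The determinant of the complex Hessian in the frame -/

theorem det_eq_of_blocks {m n R : Type*} [Fintype m] [Fintype n] [DecidableEq m]
    [inst : DecidableEq (m ⊕ n)] [CommRing R] (M : Matrix (m ⊕ n) (m ⊕ n) R)
    (h₁₂ : ∀ i j, M (Sum.inl i) (Sum.inr j) = 0)
    (h₂₂ : ∀ i j, i ≠ j → M (Sum.inr i) (Sum.inr j) = 0) :
    M.det = (M.toBlocks₁₁).det * ∏ j, M (Sum.inr j) (Sum.inr j) := by
  classical
  have h : inst = instDecidableEqSum := Subsingleton.elim _ _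
  subst h
  have h1 : M.toBlocks₁₂ = 0 := by
    ext i j
    exact h₁₂ i j
  have h2 : M.toBlocks₂₂ = Matrix.diagonal fun j => M (Sum.inr j) (Sum.inr j) := by
    ext i j
    by_cases hij : i = j
    · subst hij
      rw [Matrix.diagonal_apply_eq]
      rfl
    · rw [Matrix.diagonal_apply_ne _ hij]
      exact h₂₂ i j hij
  conv_lhs => rw [← Matrix.fromBlocks_toBlocks M, h1, h2, Matrix.det_fromBlocks_zero₁₂, Matrix.det_diagonal]

namespace Frame

variable {N : ℕ} {X : HorosymmetricSpace N} {F : Frame X} {β : Module.Dual ℂ (lie F.S.T)}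

theorem pCoroot_add_hCoroot (hβ : β ∈ roots X.G F.S.T) :
    (F.pCoroot β hβ : Mat N) + (F.hCoroot β : Mat N) = F.coroot β := by
  change ((X.pPart (F.S.toL (F.coroot β)) + X.hPart (F.S.toL (F.coroot β)) : lie X.L) : Mat N) =
    ((F.S.toL (F.coroot β) : lie X.L) : Mat N)
  congr 1
  simp only [HorosymmetricSpace.pPart, HorosymmetricSpace.hPart, LinearMap.smul_apply, LinearMap.sub_apply,
    LinearMap.add_apply, LinearMap.id_apply]
  module

theorem two_smul_pCoroot (hβ : β ∈ roots X.G F.S.T) :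
    (2 : ℂ) • (F.pCoroot β hβ : Mat N) = (F.coroot β : Mat N) - X.sg (F.coroot β : Mat N) := by
  rw [HorosymmetricSpace.sg_apply (F.lie_T_le_L (F.coroot β).2)]
  change (2 : ℂ) • (((1 / 2 : ℂ) • ((F.coroot β : Mat N) -
    (X.dσ (F.S.toL (F.coroot β)) : Mat N))) : Mat N) = _
  rw [smul_smul, mul_one_div_cancel two_ne_zero, one_smul]
  rfl

end Frame

namespace PotentialJet

open Horosymmetric.Frame

variable {N : ℕ} {X : HorosymmetricSpace N} {F : Frame X} {χ : AlgebraicCharacter X.H_closed}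
  {q : HermitianMetric X.G_closed F.C.K X.H fun h => (χ.χ h : ℂ)} {a : F.aSplit} (J : PotentialJet F χ q a)
  {β γ δ : Module.Dual ℂ (lie F.S.T)}

theorem lam_pCoroot (hβ : β ∈ roots X.G F.S.T) :
    J.lam (F.pCoroot β hβ : Mat N) = (F.diffAtCoroot (F.toricPotential q) a β hβ : ℂ) / 2 := by
  rw [J.lam_aSplit, ← J.lineDeriv_toric]
  rfl

theorem lam_coroot (hβ : β ∈ roots X.G F.S.T) :
    J.lam (F.coroot β : Mat N) =
      (F.diffAtCoroot (F.toricPotential q) a β hβ : ℂ) / 2 - F.charAtCoroot χ β := by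
  rw [← pCoroot_add_hCoroot hβ, map_add, J.lam_pCoroot hβ, J.lam_H, sub_eq_add_neg]
  rfl

theorem lam_lie_dag_eq_zero (hχ : X.TrivialOnFiber fun h => (χ.χ h : ℂ))
    (ha : ∀ β ∈ F.rootsS, F.rootAt β a ≠ 0) {x y : Mat N} (hx : x ∈ rootSpace X.G F.S.T γ)
    (hy : y ∈ rootSpace X.G F.S.T δ) (h : δ ≠ γ) : J.lam ⁅dag F.gram x, y⁆ = 0 := by
  refine J.lam_eq_zero hχ ha ?_ (lie_mem_rootSpace (F.dag_mem_rootSpace hx) hy)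
  rw [neg_add_eq_sub]
  exact sub_ne_zero.2 h

/-- Since [e†,e] = -α^∨ for e = e_α, the entry is -e^{2α(a)}λ(α^∨); the denominator 2 comes from λ
being half of d_au on 𝔞_s. -/
theorem hess_e_self (hα : β ∈ F.rootsQu) :
    J.hess (F.e β : Mat N) (F.e β : Mat N) = Real.exp (2 * (F.rootAt β a).re) *
      (2 * F.charAtCoroot χ β - (F.diffAtCoroot (F.toricPotential q) a β hα.1 : ℂ)) / 2 := by
  rw [J.hess_e hα (F.e β).2, ← lie_skew, ← coroot_eq hα.1, map_neg, J.lam_coroot hα.1]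
  ring

theorem hess_tau_self (hχ : X.TrivialOnFiber fun h => (χ.χ h : ℂ))
    (ha : ∀ β ∈ F.rootsS, F.rootAt β a ≠ 0) (hβ : β ∈ F.posRootsS) :
    J.hess ((F.e β : Mat N) - X.sg (F.e β : Mat N)) ((F.e β : Mat N) - X.sg (F.e β : Mat N)) =
      (F.diffAtCoroot (F.toricPotential q) a β hβ.1.1.1 : ℂ) / (Real.sinh (2 * (F.rootAt β a).re) : ℂ) := by
  have hL := hβ.1.1
  have hR := hL.1
  have hx := F.e_mem β hR
  have hs := sg_e_mem hL
  have hv : (F.e β : Mat N) - X.sg (F.e β : Mat N) ∈ lie X.G := (lie X.G).sub_mem hx.1 hs.1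
  have h1 : J.lam ⁅dag F.gram (X.sg (F.e β : Mat N)), X.sg (F.e β : Mat N)⁆ =
      -J.lam (X.sg (F.coroot β : Mat N)) := by
    rw [← sg_dag (e_mem_L hL), ← HorosymmetricSpace.sg_lie (F.dag_mem_L (e_mem_L hL)) (e_mem_L hL),
      ← lie_skew, ← coroot_eq hR, map_neg, map_neg]
  have h2 : J.lam ⁅dag F.gram (F.e β : Mat N), (F.e β : Mat N)⁆ = -J.lam (F.coroot β : Mat N) := by
    rw [← lie_skew, ← coroot_eq hR, map_neg]
  -- The two surviving brackets combine to α^∨ - σ(α^∨) for α = β, which is 2𝓟(β^∨). The character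
  -- disappears, and the factor 2 cancels the half in λ.
  have h3 := congrArg J.lam (two_smul_pCoroot hR)
  rw [map_smul, J.lam_pCoroot hR, map_sub, smul_eq_mul] at h3
  rw [J.hess_tau hβ ha hv, map_add, add_lie, lie_sub, lie_sub, map_add, map_sub, map_sub, h1, h2,
    J.lam_lie_dag_eq_zero hχ ha hx hs hβ.1.2, J.lam_lie_dag_eq_zero hχ ha hs hx hβ.1.2.symm]
  congr 1
  linear_combination -h3

theorem lam_lie_dag_mu_eq_zero (hχ : X.TrivialOnFiber fun h => (χ.χ h : ℂ))
    (ha : ∀ β ∈ F.rootsS, F.rootAt β a ≠ 0) (hβ : β ∈ rootsIn X.G F.S.T X.L) {y : Mat N}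
    (hy : y ∈ rootSpace X.G F.S.T δ) (h : δ ≠ β) (h' : δ ≠ F.S.σRoot β) :
    J.lam ⁅dag F.gram ((F.e β : Mat N) + X.sg (F.e β : Mat N)), y⁆ = 0 := by
  rw [map_add, add_lie, map_add, J.lam_lie_dag_eq_zero hχ ha (F.e_mem β hβ.1) hy h,
    J.lam_lie_dag_eq_zero hχ ha (sg_e_mem hβ) hy h', add_zero]

variable {r : ℕ} (l : Module.Basis (Fin r) ℝ F.aSplit)

theorem mem_rootSpace_zero_of_aSplit (x : F.aSplit) : (x : Mat N) ∈ rootSpace X.G F.S.T 0 :=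
  F.mem_rootSpace_zero.2 (aSplit_mem_T x)

theorem ne_of_mem_Qu_of_mem_L (hα : γ ∈ F.rootsQu) (hβ : β ∈ rootsIn X.G F.S.T X.L) : γ ≠ β := by
  rintro rfl
  exact notMem_rootsQu_of_mem_L hβ hα

theorem det_complexHessian (hχ : X.TrivialOnFiber fun h => (χ.χ h : ℂ)) (ha : ∀ β ∈ F.rootsS, F.rootAt β a ≠ 0)
    [DecidableEq (F.Index r)] :
    (complexHessian (F.localPotential l q (F.point a))).det =
      (((F.realHessian l (F.toricPotential q) a).det : ℝ) : ℂ) / 4 ^ r *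
      ((∏ α : F.rootsQu, Real.exp (2 * (F.rootAt α a).re) *
        (2 * F.charAtCoroot χ α - (F.diffAtCoroot (F.toricPotential q) a α α.2.1 : ℂ)) / 2) *
      ∏ β : F.posRootsS, (F.diffAtCoroot (F.toricPotential q) a β β.2.1.1.1 : ℂ) /
        (Real.sinh (2 * (F.rootAt β a).re) : ℂ)) := by
  obtain ⟨J⟩ := nonempty_potentialJet q a
  have hM : ∀ i j, complexHessian (F.localPotential l q (F.point a)) i j =
      J.hess (F.frameVector l i : Mat N) (F.frameVector l j : Mat N) := J.complexHessian_eq l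
  have hτ : ∀ β : F.posRootsS, (F.frameVector l (Sum.inr (Sum.inr β)) : Mat N) =
      (F.e β : Mat N) - X.sg (F.e β : Mat N) := fun β => tau_coe β.2.1.1
  have he : ∀ α : F.rootsQu, (F.frameVector l (Sum.inr (Sum.inl α)) : Mat N) = F.e α := fun _ => rfl
  have hσ : ∀ β : F.posRootsS, F.S.σRoot β ∈ rootsIn X.G F.S.T X.L := fun β => σRoot_mem_rootsIn β.2.1.1
  -- The bracket of e_α† with any other frame vector is a sum of vectors of nonzero weight, on which
  -- λ vanishes.
  have hz : ∀ (α : F.rootsQu) i, i ≠ Sum.inr (Sum.inl α) →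
      J.hess (F.frameVector l i : Mat N) (F.e α : Mat N) = 0 := by
    intro α i hi
    rw [J.hess_e α.2 (F.frameVector l i).2]
    have hα := F.e_mem α α.2.1
    suffices h : J.lam ⁅dag F.gram (F.e α : Mat N), (F.frameVector l i : Mat N)⁆ = 0 by rw [h, mul_zero]
    match i with
    | Sum.inl j =>
      exact J.lam_lie_dag_eq_zero hχ ha hα (mem_rootSpace_zero_of_aSplit (l j)) α.2.1.1.symm
    | Sum.inr (Sum.inl α') =>
      refine J.lam_lie_dag_eq_zero hχ ha hα (F.e_mem α' α'.2.1) fun h => hi ?_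
      rw [Subtype.ext h]
    | Sum.inr (Sum.inr β) =>
      rw [hτ, lie_sub, map_sub, J.lam_lie_dag_eq_zero hχ ha hα (F.e_mem β β.2.1.1.1)
        (ne_of_mem_Qu_of_mem_L α.2 β.2.1.1).symm, J.lam_lie_dag_eq_zero hχ ha hα (sg_e_mem β.2.1.1)
        (ne_of_mem_Qu_of_mem_L α.2 (hσ β)).symm, sub_zero]
  have hz' : ∀ (β : F.posRootsS) i, i ≠ Sum.inr (Sum.inr β) →
      J.hess (F.frameVector l i : Mat N) ((F.e β : Mat N) - X.sg (F.e β : Mat N)) = 0 := by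
    intro β i hi
    rw [J.hess_tau β.2 ha (F.frameVector l i).2]
    suffices h : J.lam ⁅dag F.gram ((F.e β : Mat N) + X.sg (F.e β : Mat N)), (F.frameVector l i : Mat N)⁆ = 0 by
      rw [h, neg_zero, zero_div]
    have hL := β.2.1.1
    match i with
    | Sum.inl j =>
      exact J.lam_lie_dag_mu_eq_zero hχ ha hL (mem_rootSpace_zero_of_aSplit (l j)) hL.1.1.symm
        (hσ β).1.1.symm
    | Sum.inr (Sum.inl α) =>
      exact J.lam_lie_dag_mu_eq_zero hχ ha hL (F.e_mem α α.2.1) (ne_of_mem_Qu_of_mem_L α.2 hL)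
        (ne_of_mem_Qu_of_mem_L α.2 (hσ β))
    | Sum.inr (Sum.inr γ) =>
      have hne : (γ : Module.Dual ℂ (lie F.S.T)) ≠ β := fun h => hi (by rw [Subtype.ext h])
      rw [hτ, lie_sub, map_sub, J.lam_lie_dag_mu_eq_zero hχ ha hL (F.e_mem γ γ.2.1.1.1) hne
        (σRoot_ne_of_mem_posRootsS γ.2 β.2).symm, J.lam_lie_dag_mu_eq_zero hχ ha hL (sg_e_mem γ.2.1.1)
        (σRoot_ne_of_mem_posRootsS β.2 γ.2) fun h => hne ?_, sub_zero]
      rw [← σRoot_σRoot (γ : Module.Dual ℂ (lie F.S.T)), h, σRoot_σRoot]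
  rw [det_eq_of_blocks]
  · have hA : (complexHessian (F.localPotential l q (F.point a))).toBlocks₁₁ =
        (4 : ℂ)⁻¹ • (F.realHessian l (F.toricPotential q) a).map Complex.ofRealHom := by
      ext j k
      rw [Matrix.smul_apply, Matrix.map_apply, J.realHessian_toric, smul_eq_mul, inv_mul_eq_div]
      exact (hM _ _).trans (J.hess_aSplit (l j) (l k))
    rw [hA, Matrix.det_smul, Fintype.card_fin, ← RingHom.mapMatrix_apply, ← RingHom.map_det, inv_pow,
      inv_mul_eq_div, Fintype.prod_sum_type]
    congr 2
    · refine Finset.prod_congr rfl fun α _ => ?_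
      rw [hM, he, J.hess_e_self α.2]
    · refine Finset.prod_congr rfl fun β _ => ?_
      rw [hM, hτ, J.hess_tau_self hχ ha β.2]
  · rintro j (α | β)
    · rw [hM, he, hz _ _ Sum.inl_ne_inr]
    · rw [hM, hτ, hz' _ _ Sum.inl_ne_inr]
  · rintro i (α | β) hne
    · rw [hM, he, hz _ _ fun h => hne (Sum.inr_injective h)]
    · rw [hM, hτ, hz' _ _ fun h => hne (Sum.inr_injective h)]

/-- The quotient is the diagonal entry of the Hessian at τ_β, obtained by testing non-negativity on
a coordinate vector. -/
theorem diffAtCoroot_div_nonneg (hχ : X.TrivialOnFiber fun h => (χ.χ h : ℂ))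
    (ha : ∀ β ∈ F.rootsS, F.rootAt β a ≠ 0) (hpos : F.CurvatureNonneg l q (F.point a)) (β : F.posRootsS) :
    0 ≤ F.diffAtCoroot (F.toricPotential q) a β β.2.1.1.1 / Real.sinh (2 * (F.rootAt β a).re) := by
  classical
  obtain ⟨J⟩ := nonempty_potentialJet q a
  have h := hpos (Pi.single (Sum.inr (Sum.inr β)) 1)
  rw [Finset.sum_eq_single (Sum.inr (Sum.inr β)) (fun i _ hi => Finset.sum_eq_zero fun j _ => by
      rw [Pi.single_eq_of_ne hi, mul_zero, zero_mul]) (by simp),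
    Finset.sum_eq_single (Sum.inr (Sum.inr β)) (fun j _ hj => by
      rw [Pi.single_eq_of_ne hj, map_zero, mul_zero]) (by simp),
    Pi.single_eq_same, map_one, mul_one, mul_one, J.complexHessian_eq] at h
  have h1 := J.hess_tau_self hχ ha β.2
  rw [← tau_coe β.2.1.1] at h1
  rw [← Complex.ofReal_div] at h1
  change 0 ≤ (J.hess (F.tau β β.2.1.1 : Mat N) (F.tau β β.2.1.1 : Mat N)).re at h
  rwa [h1, Complex.ofReal_re] at h

end PotentialJet

/-! ### Comparison with the reference volume form -/

namespace Frame

variable {N r : ℕ} {X : HorosymmetricSpace N} {F : Frame X}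

/-- The relative metric contributes 1 because exp(a) is in L, and the squared inverse norm for q_P
is ∏ e^{2α(a)}, exactly the factors in the determinant. -/
theorem referenceVolume_point (R : ReferenceMetrics F) (a : F.aSplit) :
    F.referenceVolume (r := r) R (F.point a) =
      (∏ α : F.rootsQu, (Real.exp (2 * (F.rootAt α a).re) : ℂ)) • standardVolume (F.Index r) := by
  rw [referenceVolume, qf_norm_point, qP_norm_point, one_mul, ← Finset.prod_pow, ← Finset.prod_inv_distrib,
    Complex.ofReal_prod]
  congr 1
  refine Finset.prod_congr rfl fun α _ => ?_
  rw [← Real.exp_nat_mul, ← Real.exp_neg]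
  congr 2
  push_cast
  ring

theorem referenceVolume_ne_zero (R : ReferenceMetrics F) (a : F.aSplit) :
    F.referenceVolume (r := r) R (F.point a) ≠ 0 := by
  classical
  rw [referenceVolume_point]
  exact smul_ne_zero (Finset.prod_ne_zero_iff.2 fun α _ => Complex.ofReal_ne_zero.2 (Real.exp_pos _).ne')
    standardVolume_ne_zero

/-- The function sinh(2ρ) has the sign of ρ, which converts it to the absolute value in J_H; at ρ =
0 both sides are zero. -/
theorem div_sinh_eq (d ρ : ℝ) : d / Real.sinh (2 * ρ) = Real.sign ρ * d / |Real.sinh (2 * ρ)| := by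
  rcases lt_trichotomy ρ 0 with h | h | h
  · have h' : Real.sinh (2 * ρ) < 0 := Real.sinh_neg_iff.2 (by linarith)
    rw [Real.sign_of_neg h, abs_of_neg h', neg_one_mul, neg_div_neg_eq]
  · subst h
    simp
  · have h' : 0 < Real.sinh (2 * ρ) := Real.sinh_pos_iff.2 (by linarith)
    rw [Real.sign_of_pos h, abs_of_pos h', one_mul]

variable (l : Module.Basis (Fin r) ℝ F.aSplit) (R : ReferenceMetrics F) {χ : AlgebraicCharacter X.H_closed}
  (q : HermitianMetric X.G_closed F.C.K X.H fun h => (χ.χ h : ℂ))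
  (a : F.aSplit)

/-- The top power of the curvature form, in terms of the reference volume form. -/
theorem curvatureForm_pow (hχ : X.TrivialOnFiber fun h => (χ.χ h : ℂ))
    (ha : ∀ β ∈ F.rootsS, F.rootAt β a ≠ 0) :
    F.curvatureForm l q (F.point a) ^ quotientDim X.G X.H =
      (((quotientDim X.G X.H).factorial : ℂ) / 2 ^ (2 * r + Fintype.card F.rootsQu) *
        (((F.realHessian l (F.toricPotential q) a).det / F.J a : ℝ) : ℂ) *
        (∏ α : F.rootsQu, (2 * F.charAtCoroot χ α -
          (F.diffAtCoroot (F.toricPotential q) a α α.2.1 : ℂ))) *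
        ∏ β : F.posRootsS, ((Real.sign (F.rootAt β a).re *
          F.diffAtCoroot (F.toricPotential q) a β β.2.1.1.1 : ℝ) : ℂ)) •
        F.referenceVolume (r := r) R (F.point a) := by
  classical
  have hβ : ∏ β : F.posRootsS, (F.diffAtCoroot (F.toricPotential q) a β β.2.1.1.1 : ℂ) /
      (Real.sinh (2 * (F.rootAt β a).re) : ℂ) =
      (∏ β : F.posRootsS, ((Real.sign (F.rootAt β a).re *
        F.diffAtCoroot (F.toricPotential q) a β β.2.1.1.1 : ℝ) : ℂ)) / (F.J a : ℂ) := by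
    rw [J, Complex.ofReal_prod, ← Finset.prod_div_distrib]
    refine Finset.prod_congr rfl fun β _ => ?_
    rw [← Complex.ofReal_div, ← Complex.ofReal_div, div_sinh_eq]
  -- The powers of 2 in the formula: 4^r from the block of 𝔞_s and one factor 2 for each root of
  -- Q^u.
  have h4 : (2 : ℂ) ^ (2 * r + Fintype.card F.rootsQu) = 4 ^ r * 2 ^ Fintype.card F.rootsQu := by
    rw [pow_add, pow_mul]
    norm_num
  rw [referenceVolume_point, smul_smul, quotientDim_eq l, curvatureForm, ddbar_pow,
    PotentialJet.det_complexHessian l hχ ha, hβ, Finset.prod_div_distrib, Finset.prod_mul_distrib,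
    Finset.prod_const, Finset.card_univ, h4, Complex.ofReal_div]
  congr 1
  ring

/-- If the curvature is non-negative, the signs of the roots are those of the derivatives along the
coroots. -/
theorem sign_mul_diffAtCoroot (hχ : X.TrivialOnFiber fun h => (χ.χ h : ℂ))
    (ha : ∀ β ∈ F.rootsS, F.rootAt β a ≠ 0) (hpos : F.CurvatureNonneg l q (F.point a)) (β : F.posRootsS) :
    Real.sign (F.rootAt β a).re * F.diffAtCoroot (F.toricPotential q) a β β.2.1.1.1 =
      |F.diffAtCoroot (F.toricPotential q) a β β.2.1.1.1| := by
  have h := PotentialJet.diffAtCoroot_div_nonneg l hχ ha hpos β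
  have hρ : (F.rootAt β a).re ≠ 0 := by
    rw [← Complex.ofReal_ne_zero, rootAt_im β.2.1.1.1]
    exact ha β β.2.1
  rcases hρ.lt_or_gt with h' | h'
  · have hs : Real.sinh (2 * (F.rootAt β a).re) < 0 := Real.sinh_neg_iff.2 (by linarith)
    rw [Real.sign_of_neg h', abs_of_nonpos, neg_one_mul]
    by_contra hd
    exact absurd h (div_neg_of_pos_of_neg (not_le.1 hd) hs).not_ge
  · have hs : 0 < Real.sinh (2 * (F.rootAt β a).re) := Real.sinh_pos_iff.2 (by linarith)
    rw [Real.sign_of_pos h', one_mul, abs_of_nonneg]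
    by_contra hd
    exact absurd h (div_neg_of_neg_of_pos (not_le.1 hd) hs).not_ge

end Frame

end Horosymmetric

end

/-- Since dV_H does not vanish at the point, the scalar in front of it is uniquely determined, which
gives a meaning to the quotient ω^n/dV_H. -/
theorem mainTheorem7 {N r : ℕ} (X : HorosymmetricSpace N) (F : Frame X)
    (l : Module.Basis (Fin r) ℝ F.aSplit) (R : ReferenceMetrics F)
    (χ : AlgebraicCharacter X.H_closed)
    (hχ : X.TrivialOnFiber fun h => (χ.χ h : ℂ))
    (q : HermitianMetric X.G_closed F.C.K X.H fun h => (χ.χ h : ℂ))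
    (a : F.aSplit) (ha : ∀ β ∈ F.rootsS, F.rootAt β a ≠ 0) :
    F.referenceVolume (r := r) R (F.point a) ≠ 0 ∧
    F.curvatureForm l q (F.point a) ^ quotientDim X.G X.H =
      (((quotientDim X.G X.H).factorial : ℂ) / 2 ^ (2 * r + Fintype.card F.rootsQu) *
        (((F.realHessian l (F.toricPotential q) a).det / F.J a : ℝ) : ℂ) *
        (∏ α : F.rootsQu, (2 * F.charAtCoroot χ α -
          (F.diffAtCoroot (F.toricPotential q) a α α.2.1 : ℂ))) *
        ∏ β : F.posRootsS, ((Real.sign (F.rootAt β a).re *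
          F.diffAtCoroot (F.toricPotential q) a β β.2.1.1.1 : ℝ) : ℂ)) •
        F.referenceVolume (r := r) R (F.point a) ∧
    (F.CurvatureNonneg l q (F.point a) →
      F.curvatureForm l q (F.point a) ^ quotientDim X.G X.H =
        (((quotientDim X.G X.H).factorial : ℂ) / 2 ^ (2 * r + Fintype.card F.rootsQu) *
          (((F.realHessian l (F.toricPotential q) a).det / F.J a : ℝ) : ℂ) *
          (∏ α : F.rootsQu, (2 * F.charAtCoroot χ α -
            (F.diffAtCoroot (F.toricPotential q) a α α.2.1 : ℂ))) *
          ∏ β : F.posRootsS, ((|F.diffAtCoroot (F.toricPotential q) a β β.2.1.1.1| : ℝ) : ℂ)) •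
          F.referenceVolume (r := r) R (F.point a)) := by
  have h := Frame.curvatureForm_pow l R q a hχ ha
  refine ⟨Frame.referenceVolume_ne_zero R a, h, fun hpos => h.trans ?_⟩
  simp only [Frame.sign_mul_diffAtCoroot l q a hχ ha hpos]
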